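/- **Notation.** Let $\beta=\frac{\sqrt{13}-1}{4}$, $D_x=x\partial_x$, $D_y=x\partial_y$, $D^\ell=D_y^{\ell_y}D_x^{\ell_x}$ and $|\ell|=\ell_x+\ell_y$ for $\ell=(\ell_x,\ell_y)\in\mathbb N_0^2$, $\tilde q(\zeta)=(\zeta+\frac12)(\zeta+\beta-\frac12)(\zeta-1)(\zeta-\beta-1)$, and let $I=[0,T)$ with $T\in(0,\infty]$. All derivatives are weak derivatives. For functions of $(x,y)\in(0,\infty)\times\mathbb R$ put $$\|v\|_{\kappa,\alpha}^2=\sum_{|\ell|\le\kappa}\int_{\mathbb R}\int_0^\infty x^{-2\alpha}(D^\ell v)^2x^{-2}\,dx\,dy ,$$ and for functions of $(t,x,y)$ $$|||w|||_{\kappa,\alpha}^2=\sup_{t\in I}\|w\|_{\kappa,\alpha}^2+\int_I\big(\|\partial_tw\|_{\kappa-2,\alpha-\frac12}^2+\|w\|_{\kappa+2,\alpha+\frac12}^2\big)dt ,$$ where $\sup$ is the essential supremum. For $k,\tilde k,\check k,\breve k\in\mathbb N$, $\delta>0$ and $Q:=(D_x-3)(D_x-2)\tilde q(D_x)D_x$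 let $$\begin{aligned}\|v^{(0)}\|_{\rm init}^2={}&\|v^{(0)}\|_{k,-1-\delta}^2+\|D_xv^{(0)}\|_{\tilde k,-\delta}^2+\|\tilde q(D_x)D_xv^{(0)}\|_{\tilde k,\delta}^2+\|\tilde q(D_x)D_xv^{(0)}\|_{\check k,-\delta+1}^2\\&+\|Qv^{(0)}\|_{\check k,\delta+1}^2+\|D_y\tilde q(D_x)D_xv^{(0)}\|_{\breve k,-\delta+2}^2,\end{aligned}$$ $$\begin{aligned}|||v|||_{\rm sol}^2={}&|||v|||_{k,-\delta-1}^2+|||D_yv|||_{\tilde k-1,-\delta}^2+|||D_xv|||_{\tilde k,-\delta}^2+|||D_yD_xv|||_{\tilde k-1,\delta}^2+|||\tilde q(D_x)D_xv|||_{\tilde k,\delta}^2\\&+|||D_y^2v|||_{\check k-2,-\delta+1}^2+|||D_yD_xv|||_{\check k-1,-\delta+1}^2+|||\tilde q(D_x)D_xv|||_{\check k,-\delta+1}^2+|||D_y^2D_xv|||_{\check k-2,\delta+1}^2\\&+|||D_y\tilde q(D_x)D_xv|||_{\check k-1,\delta+1}^2+|||Qv|||_{\check k,\delta+1}^2+|||D_y^3v|||_{\breve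 k-2,-\delta+2}^2\\&+|||D_y^2D_xv|||_{\breve k-1,-\delta+2}^2+|||D_y\tilde q(D_x)D_xv|||_{\breve k,-\delta+2}^2,\end{aligned}$$ $$\begin{aligned}|||f|||_{\rm rhs}^2=\int_I\Big(&\|f\|_{k-2,-\delta-\frac12}^2+\|(D_x-1)f\|_{\tilde k-2,-\delta+\frac12}^2+\|\tilde q(D_x-1)(D_x-1)f\|_{\tilde k-2,\delta+\frac12}^2\\&+\|\tilde q(D_x-1)(D_x-1)f\|_{\check k-2,-\delta+\frac32}^2+\|(D_x-4)(D_x-3)\tilde q(D_x-1)(D_x-1)f\|_{\check k-2,\delta+\frac32}^2\\&+\|D_y\tilde q(D_x-1)(D_x-1)f\|_{\breve k-2,-\delta+\frac52}^2\Big)dt .\end{aligned}$$ **Expansions.** We say that $w\sim\sum_\gamma w_\gamma(y)x^\gamma$ up to $o(x^\rho)$ with orders $(L,L_y)$ if for all $\ell$ with $|\ell|\le L$, $\ell_y\le L_y$ the weak derivative $D^\ell w$ is a locally integrable function, the weak derivative $\partial_y^{\ell_y}w_\gamma$ is a locally integrable function whenever $\gamma+\ell_y<\rho$, and for almost every $y$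 (almost every $(t,y)\in I\times\mathbb R$ if $w$ and $w_\gamma$ also depend on $t$) $$D^\ell w=\sum_{\gamma\,:\,\gamma+\ell_y<\rho}\gamma^{\ell_x}x^{\gamma+\ell_y}\,\partial_y^{\ell_y}w_\gamma+R_\ell,\qquad R_\ell=o(x^\rho)\quad\text{as }x\searrow0 .$$ Here $0^0=1$; so the sum is $D^\ell\big(\sum_\gamma w_\gamma x^\gamma\big)$ without those terms that are formally of order higher than $x^\rho$. The relation $R_\ell=o(x^\rho)$ holds in quadratic mean, i.e. $\frac1r\int_0^rR_\ell^2\,dx=o(r^{2\rho})$ as $r\searrow0$, and if $|\ell|<L$ it also holds pointwise (for $x$ outside a null set). **Lemma.** Let $\tilde k\ge3$, $\check k\ge4$ and $\delta\in(0,\frac1{10})$. There is a constant $C<\infty$ depending only on $\tilde k,\check k,\delta$ such that the following holds for all $\breve k\ge4$, all $k\ge\max\{\tilde k+4,\check k+6,\breve k+5\}$ and all $T\in(0,\infty]$. (i) If $v^{(0)}:(0,\infty)\times\mathbb R\to\mathbb R$ is locally integrable and $\|v^{(0)}\|_{\rm init}<\infty$, then there are $v^{(0)}_0,v^{(0)}_1:\mathbb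 R\to\mathbb R$ with $v^{(0)}\sim v_0^{(0)}+v_1^{(0)}x$ up to $o(x^{\frac32+\delta})$ with orders $(\check k+7,\check k)$, and for all $\ell$ with $|\ell|\le\min\{\tilde k-2,\check k-2\}$, each of $$\|D^\ell v^{(0)}_x\|_{BC^0((0,\infty)\times\mathbb R)},\quad\|D^\ell v^{(0)}_y\|_{BC^0((0,\infty)\times\mathbb R)},\quad|v_0^{(0)}|_{BC^1(\mathbb R)},\quad|v_1^{(0)}|_{BC^0(\mathbb R)}$$ is at most $C\|v^{(0)}\|_{\rm init}$. (ii) If $v:(0,T)\times(0,\infty)\times\mathbb R\to\mathbb R$ is locally integrable and $|||v|||_{\rm sol}<\infty$, then there are $v_0,v_1,v_{1+\beta},v_2$, functions of $(t,y)$, with $v\sim v_0+v_1x+v_{1+\beta}x^{1+\beta}+v_2x^2$ up to $o(x^{2+\delta})$ with orders $(\check k+9,\check k+2)$, and for all $\ell$ with $|\ell|\le\min\{\tilde k-2,\check k-2\}$, each of $$\|D^\ell v_x\|_{BC^0(I\times(0,\infty)\times\mathbb R)},\ \|D^\ell v_y\|_{BC^0(I\times(0,\infty)\times\mathbb R)},\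 \|v_0\|_{BC^0(I;BC^1(\mathbb R))},\ \|v_1\|_{BC^0(I\times\mathbb R)},$$ $$\|v_1\|_{L^2(I;H^1(\mathbb R))},\ \|(v_0)_y\|_{L^2(I;H^1(\mathbb R))},\ \|v_1\|_{BC^0(I;H^1(\mathbb R))},\ \|(v_0)_y\|_{BC^0(I;H^1(\mathbb R))},$$ $$\|v_{1+\beta}\|_{L^2(I;BC^0(\mathbb R))},\ \|v_{1+\beta}\|_{L^2(I;H^1(\mathbb R))},\ \|v_2\|_{L^2(I\times\mathbb R)}$$ is at most $C|||v|||_{\rm sol}$. (iii) If $f:(0,T)\times(0,\infty)\times\mathbb R\to\mathbb R$ is locally integrable and $|||f|||_{\rm rhs}<\infty$, then there are $f_1,f_2$, functions of $(t,y)$, with $f\sim f_1x+f_2x^2$ up to $o(x^{2+\delta})$ with orders $(\check k+5,\check k-2)$, and $\|f_1\|_{L^2(I\times\mathbb R)}\le C|||f|||_{\rm rhs}$, $\|f_2\|_{L^2(I\times\mathbb R)}\le C|||f|||_{\rm rhs}$. A bound on a $BC^0$-norm includes that the function has a (bounded) continuous representative on the set named, and likewise for the $BC^1$-, $BC^0(I;\cdot)$-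 and $L^2(I;\cdot)$-norms. -/

import Mathlib

open MeasureTheory Set Filter Topology Asymptotics
open scoped ENNReal NNReal ContDiff Polynomial BoundedContinuousFunction

namespace ThinFilm

noncomputable section

/-- The irrational exponent `β = (√13 - 1) / 4 ∈ (1/2, 1)`. -/
def β : ℝ := (√13 - 1) / 4

/-- `q̃(ζ) = (ζ + 1/2) (ζ + β - 1/2) (ζ - 1) (ζ - β - 1)`. -/
def qt : ℝ[X] :=
  (Polynomial.X + Polynomial.C (1 / 2)) * (Polynomial.X + Polynomial.C (β - 1 / 2)) *
    (Polynomial.X - Polynomial.C 1) * (Polynomial.X - Polynomial.C (β + 1))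

/-! ### Weak derivatives built from `D_x = x ∂_x` and `D_y = x ∂_y` -/

/-- An open domain `dom`, the coordinate function `x` (positive on `dom`), and the directions
in which `∂_x` and `∂_y` differentiate. -/
structure HalfSpace (E : Type) where
  dom : Set E
  x : E → ℝ
  ex : E
  ey : E

/-- `(0,∞) × ℝ` with points `(x, y)`. -/
def plane : HalfSpace (ℝ × ℝ) := ⟨{p | 0 < p.1}, fun p => p.1, (1, 0), (0, 1)⟩

/-- The time interval `I = [0, T)`, where `T ∈ (0, ∞]`. -/
def timeI (T : ℝ≥0∞) : Set ℝ := {t | 0 ≤ t ∧ ENNReal.ofReal t < T}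

/-- `(0, T) × (0,∞) × ℝ` with points `(t, x, y)`. -/
def spaceTime (T : ℝ≥0∞) : HalfSpace (ℝ × ℝ × ℝ) :=
  ⟨{p | 0 < p.1 ∧ ENNReal.ofReal p.1 < T ∧ 0 < p.2.1}, fun p => p.2.1, (0, 1, 0), (0, 0, 1)⟩

section Weak

variable {E : Type} [NormedAddCommGroup E] [NormedSpace ℝ E]

/-- Transpose of `∂_e`: `φ ↦ -∂_e φ`. -/
def pdT (e : E) (φ : E → ℝ) : E → ℝ := fun p => -(fderiv ℝ φ p e)

/-- Transpose of `D_x = x ∂_x`: `φ ↦ -∂_x (x φ)`. -/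
def dxT (H : HalfSpace E) (φ : E → ℝ) : E → ℝ := pdT H.ex (fun p => H.x p * φ p)

/-- Transpose of `D_y = x ∂_y`: `φ ↦ -∂_y (x φ)`. -/
def dyT (H : HalfSpace E) (φ : E → ℝ) : E → ℝ := pdT H.ey (fun p => H.x p * φ p)

/-- Transpose of `P(D_x)` for a polynomial `P`. -/
def polyT (H : HalfSpace E) (P : ℝ[X]) (φ : E → ℝ) : E → ℝ :=
  fun p => ∑ n ∈ P.support, P.coeff n * ((dxT H)^[n] φ) p

/-- Transpose of `D^ℓ = D_y^b D_x^a`, where `ℓ = (a, b) = (ℓ_x, ℓ_y)`. -/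
def powT (H : HalfSpace E) (a b : ℕ) (φ : E → ℝ) : E → ℝ := (dxT H)^[a] ((dyT H)^[b] φ)

/-- Transpose of `D^ℓ D_y^m P(D_x)`, where `ℓ = (a, b)`. -/
def opT (H : HalfSpace E) (m : ℕ) (P : ℝ[X]) (a b : ℕ) (φ : E → ℝ) : E → ℝ :=
  polyT H P ((dyT H)^[m] (powT H a b φ))

variable [MeasureSpace E]

/-- With `AT` the transpose of a differential operator `A`: the distribution `A v` on the domain
of `H` is the locally integrable function `g`. -/
def IsWeak (H : HalfSpace E) (AT : (E → ℝ) → (E → ℝ)) (v g : E → ℝ) : Prop :=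
  LocallyIntegrableOn v H.dom ∧ LocallyIntegrableOn g H.dom ∧
    ∀ φ : E → ℝ, ContDiff ℝ ∞ φ → HasCompactSupport φ → tsupport φ ⊆ H.dom →
      ∫ p, v p * AT φ p = ∫ p, g p * φ p

end Weak

/-- Multi-indices `ℓ = (ℓ_x, ℓ_y)` with `|ℓ| ≤ κ`. -/
def multiIdx (κ : ℕ) : Finset (ℕ × ℕ) :=
  (Finset.range (κ + 1) ×ˢ Finset.range (κ + 1)).filter fun l => l.1 + l.2 ≤ κ

/-- `∫_ℝ ∫_0^∞ x^{-2α} g² x^{-2} dx dy`. -/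
def weightSq (α : ℝ) (g : ℝ × ℝ → ℝ) : ℝ≥0∞ :=
  ∫⁻ p in {p : ℝ × ℝ | 0 < p.1}, ENNReal.ofReal (p.1 ^ (-2 * α - 2)) * ‖g p‖ₑ ^ 2

/-- `‖D_y^m P(D_x) v‖_{κ,α}²` for `v = v(x, y)`. The infimum runs over all families of
functions `g ℓ` that represent `D^ℓ D_y^m P(D_x) v`; any two such families agree almost everywhere,
and the value is `∞` if one of these distributions is not a locally integrable function. -/
def normSq (m : ℕ) (P : ℝ[X]) (κ : ℕ) (α : ℝ) (v : ℝ × ℝ → ℝ) : ℝ≥0∞ :=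
  ⨅ (g : ℕ × ℕ → ℝ × ℝ → ℝ)
    (_ : ∀ l ∈ multiIdx κ, IsWeak plane (opT plane m P l.1 l.2) v (g l)),
    ∑ l ∈ multiIdx κ, weightSq α (g l)

/-- `∫_I ‖D_y^m P(D_x) v‖_{κ,α}² dt` for `v = v(t, x, y)`. -/
def intNormSq (T : ℝ≥0∞) (m : ℕ) (P : ℝ[X]) (κ : ℕ) (α : ℝ) (v : ℝ × ℝ × ℝ → ℝ) : ℝ≥0∞ :=
  ⨅ (g : ℕ × ℕ → ℝ × ℝ × ℝ → ℝ)
    (_ : ∀ l ∈ multiIdx κ,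
      IsWeak (spaceTime T) (opT (spaceTime T) m P l.1 l.2) v (g l)),
    ∫⁻ t in timeI T, ∑ l ∈ multiIdx κ, weightSq α (fun p => g l (t, p))

/-- `∫_I ‖∂_t D_y^m P(D_x) v‖_{κ,α}² dt` for `v = v(t, x, y)`. -/
def intNormDtSq (T : ℝ≥0∞) (m : ℕ) (P : ℝ[X]) (κ : ℕ) (α : ℝ) (v : ℝ × ℝ × ℝ → ℝ) : ℝ≥0∞ :=
  ⨅ (g : ℕ × ℕ → ℝ × ℝ × ℝ → ℝ)
    (_ : ∀ l ∈ multiIdx κ, IsWeak (spaceTime T)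
      (fun φ => pdT (1, 0, 0) (opT (spaceTime T) m P l.1 l.2 φ)) v (g l)),
    ∫⁻ t in timeI T, ∑ l ∈ multiIdx κ, weightSq α (fun p => g l (t, p))

/-- `sup_{t ∈ I} ‖D_y^m P(D_x) v‖_{κ,α}²` for `v = v(t, x, y)`. -/
def supNormSq (T : ℝ≥0∞) (m : ℕ) (P : ℝ[X]) (κ : ℕ) (α : ℝ) (v : ℝ × ℝ × ℝ → ℝ) : ℝ≥0∞ :=
  ⨅ (g : ℕ × ℕ → ℝ × ℝ × ℝ → ℝ)
    (_ : ∀ l ∈ multiIdx κ,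
      IsWeak (spaceTime T) (opT (spaceTime T) m P l.1 l.2) v (g l)),
    essSup (fun t => ∑ l ∈ multiIdx κ, weightSq α (fun p => g l (t, p)))
      (volume.restrict (timeI T))

/-- `|||w|||_{κ,α,I}²` for `w = D_y^m P(D_x) v`. -/
def triSq (T : ℝ≥0∞) (m : ℕ) (P : ℝ[X]) (κ : ℕ) (α : ℝ) (v : ℝ × ℝ × ℝ → ℝ) : ℝ≥0∞ :=
  supNormSq T m P κ α v + intNormDtSq T m P (κ - 2) (α - 1 / 2) v +
    intNormSq T m P (κ + 2) (α + 1 / 2) v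

/-! ### The norms for initial data, solutions and right-hand sides

The integers `k, kt, kc, kb` are the four differentiability parameters
`k, k̃, ǩ, k̆`. -/

open Polynomial in
/-- `(ζ - 3) (ζ - 2) q̃(ζ) ζ`. -/
def symb : ℝ[X] := (X - C 3) * (X - C 2) * qt * X

open Polynomial in
/-- `‖v⁽⁰⁾‖_init`. -/
def initNorm (k kt kc kb : ℕ) (δ : ℝ) (v : ℝ × ℝ → ℝ) : ℝ≥0∞ :=
  (normSq 0 1 k (-1 - δ) v + normSq 0 X kt (-δ) v + normSq 0 (qt * X) kt δ v +
    normSq 0 (qt * X) kc (-δ + 1) v + normSq 0 symb kc (δ + 1) v +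
    normSq 1 (qt * X) kb (-δ + 2) v) ^ (1 / 2 : ℝ)

open Polynomial in
/-- `|||v|||_sol` on the time interval `I = [0, T)`. -/
def solNorm (T : ℝ≥0∞) (k kt kc kb : ℕ) (δ : ℝ) (v : ℝ × ℝ × ℝ → ℝ) : ℝ≥0∞ :=
  (triSq T 0 1 k (-δ - 1) v + triSq T 1 1 (kt - 1) (-δ) v + triSq T 0 X kt (-δ) v +
    triSq T 1 X (kt - 1) δ v + triSq T 0 (qt * X) kt δ v +
    triSq T 2 1 (kc - 2) (-δ + 1) v + triSq T 1 X (kc - 1) (-δ + 1) v +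
    triSq T 0 (qt * X) kc (-δ + 1) v + triSq T 2 X (kc - 2) (δ + 1) v +
    triSq T 1 (qt * X) (kc - 1) (δ + 1) v + triSq T 0 symb kc (δ + 1) v +
    triSq T 3 1 (kb - 2) (-δ + 2) v + triSq T 2 X (kb - 1) (-δ + 2) v +
    triSq T 1 (qt * X) kb (-δ + 2) v) ^ (1 / 2 : ℝ)

open Polynomial in
/-- `|||f|||_rhs` on the time interval `I = [0, T)`. Note that `(qt * X).comp (X - C 1)` is
`q̃(ζ - 1) (ζ - 1)`, and `symb.comp (X - C 1)` is `(ζ - 4) (ζ - 3) q̃(ζ - 1) (ζ - 1)`. -/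
def rhsNorm (T : ℝ≥0∞) (k kt kc kb : ℕ) (δ : ℝ) (f : ℝ × ℝ × ℝ → ℝ) : ℝ≥0∞ :=
  (intNormSq T 0 1 (k - 2) (-δ - 1 / 2) f +
    intNormSq T 0 (X - C 1) (kt - 2) (-δ + 1 / 2) f +
    intNormSq T 0 ((qt * X).comp (X - C 1)) (kt - 2) (δ + 1 / 2) f +
    intNormSq T 0 ((qt * X).comp (X - C 1)) (kc - 2) (-δ + 3 / 2) f +
    intNormSq T 0 (symb.comp (X - C 1)) (kc - 2) (δ + 3 / 2) f +
    intNormSq T 1 ((qt * X).comp (X - C 1)) (kb - 2) (-δ + 5 / 2) f) ^ (1 / 2 : ℝ)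

/-! ### Expansions as `x ↘ 0` -/

/-- The locally integrable function `h` is the `m`-th weak derivative of `g` on `ℝ`. -/
def IsWeakDeriv (m : ℕ) (g h : ℝ → ℝ) : Prop :=
  LocallyIntegrable g ∧ LocallyIntegrable h ∧
    ∀ φ : ℝ → ℝ, ContDiff ℝ ∞ φ → HasCompactSupport φ →
      ∫ y, g y * iteratedDeriv m φ y = (-1) ^ m * ∫ y, h y * φ y

/-- The term `D_y^b D_x^a (c(y) x^γ) = γ^a x^{γ+b} ∂_y^b c(y)` of an expansion up to `o(x^ρ)`;
`d` is the value of `∂_y^b c(y)`. The term is dropped if it is of higher order than `x^ρ`. -/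
def expTerm (γ ρ : ℝ) (a b : ℕ) (d x : ℝ) : ℝ :=
  if γ + b < ρ then γ ^ a * x ^ (γ + b) * d else 0

/-- `R(x) = o(x^ρ)` as `x ↘ 0`, outside a set of `x` of measure zero. -/
def AeLittleO (ρ : ℝ) (R : ℝ → ℝ) : Prop :=
  R =o[𝓝[>] 0 ⊓ ae volume] fun x => x ^ ρ

/-- `R = o(x^ρ)` as `x ↘ 0` in quadratic mean: `r⁻¹ ∫_0^r R² dx = o(r^{2ρ})` as `r ↘ 0`. -/
def MeanLittleO (ρ : ℝ) (R : ℝ → ℝ) : Prop :=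
  Tendsto (fun r : ℝ => (∫⁻ x in Ioo 0 r, ‖R x‖ₑ ^ 2) / ENNReal.ofReal (r ^ (2 * ρ + 1)))
    (𝓝[>] 0) (𝓝 0)

/-- `D^ℓ v = D^ℓ (∑ i, c i(y) x^{γ i}) + o(x^ρ)` as `x ↘ 0` for almost every `y`, for all
`ℓ = (a, b)` with `a + b ≤ L` and `b ≤ Ly`: the weak derivative `g = D^ℓ v` exists,
the derivatives `h i = ∂_y^b (c i)` that occur exist weakly, and the remainder is `o(x^ρ)` in
quadratic mean, and pointwise if `a + b < L`. -/
def HasExpansion {n : ℕ} (v : ℝ × ℝ → ℝ) (γ : Fin n → ℝ) (c : Fin n → ℝ → ℝ) (ρ : ℝ)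
    (L Ly : ℕ) : Prop :=
  ∀ a b : ℕ, a + b ≤ L → b ≤ Ly →
    ∃ (g : ℝ × ℝ → ℝ) (h : Fin n → ℝ → ℝ),
      IsWeak plane (powT plane a b) v g ∧
      (∀ i, γ i + b < ρ → IsWeakDeriv b (c i) (h i)) ∧
      (∀ᵐ y : ℝ, MeanLittleO ρ fun x => g (x, y) - ∑ i, expTerm (γ i) ρ a b (h i y) x) ∧
      (a + b < L →
        ∀ᵐ y : ℝ, AeLittleO ρ fun x => g (x, y) - ∑ i, expTerm (γ i) ρ a b (h i y) x)

/-- The analogue of `HasExpansion` for functions of `(t, x, y)`, with coefficients `c i (t, y)`,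
for almost every `(t, y) ∈ I × ℝ`. -/
def HasExpansionT {n : ℕ} (T : ℝ≥0∞) (v : ℝ × ℝ × ℝ → ℝ) (γ : Fin n → ℝ)
    (c : Fin n → ℝ → ℝ → ℝ) (ρ : ℝ) (L Ly : ℕ) : Prop :=
  ∀ a b : ℕ, a + b ≤ L → b ≤ Ly →
    ∃ (g : ℝ × ℝ × ℝ → ℝ) (h : Fin n → ℝ → ℝ → ℝ),
      IsWeak (spaceTime T) (powT (spaceTime T) a b) v g ∧
      (∀ i, γ i + b < ρ →
        ∀ᵐ t ∂(volume.restrict (timeI T)), IsWeakDeriv b (c i t) (h i t)) ∧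
      (∀ᵐ s : ℝ × ℝ ∂(volume.restrict (timeI T ×ˢ univ)), MeanLittleO ρ fun x =>
        g (s.1, x, s.2) - ∑ i, expTerm (γ i) ρ a b (h i s.1 s.2) x) ∧
      (a + b < L →
        ∀ᵐ s : ℝ × ℝ ∂(volume.restrict (timeI T ×ˢ univ)), AeLittleO ρ fun x =>
          g (s.1, x, s.2) - ∑ i, expTerm (γ i) ρ a b (h i s.1 s.2) x)

/-! ### Function spaces for the coefficients -/

/-- `G` is continuous on `S` and bounded by `M` there, i.e. `‖G‖_{BC⁰(S)} ≤ M`. -/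
def BCBound {E : Type} [TopologicalSpace E] (S : Set E) (G : E → ℝ) (M : ℝ≥0∞) : Prop :=
  ContinuousOn G S ∧ ∀ p ∈ S, ‖G p‖ₑ ≤ M

/-- `BC¹(ℝ)`: pairs `(u, u')` of bounded continuous functions with `u' = du/dy`,
with norm `max (sup |u|) (sup |u'|)`. -/
def BC1 : Submodule ℝ ((ℝ →ᵇ ℝ) × (ℝ →ᵇ ℝ)) where
  carrier := {p | ∀ y, HasDerivAt p.1 (p.2 y) y}
  zero_mem' := fun y => hasDerivAt_const y 0
  add_mem' := fun hp hq y => (hp y).add (hq y)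
  smul_mem' := fun c _ hp y => (hp y).const_smul c

theorem integrable_mul_test (u : Lp ℝ 2 (volume : Measure ℝ)) {φ : ℝ → ℝ} (hφ : Continuous φ)
    (hc : HasCompactSupport φ) : Integrable (fun y => u y * φ y) :=
  MemLp.integrable_mul (p := 2) (q := 2) (Lp.memLp u) (hφ.memLp_of_hasCompactSupport hc)

/-- `H¹(ℝ)`: pairs `(u, u')` of `L²` functions with `u'` the weak derivative of `u`,
with norm `(‖u‖² + ‖u'‖²)^{1/2}`. -/
def H1 : Submodule ℝ
    (WithLp 2 (Lp ℝ 2 (volume : Measure ℝ) × Lp ℝ 2 (volume : Measure ℝ))) where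
  carrier := {p | ∀ φ : ℝ → ℝ, ContDiff ℝ ∞ φ → HasCompactSupport φ →
    ∫ y, p.fst y * deriv φ y = -∫ y, p.snd y * φ y}
  zero_mem' := by
    intro φ _ _
    have h0 : ∀ ψ : ℝ → ℝ,
        ∫ y, (0 : Lp ℝ 2 (volume : Measure ℝ)) y * ψ y = 0 := by
      intro ψ
      rw [← integral_zero ℝ ℝ (μ := volume)]
      refine integral_congr_ae ?_
      filter_upwards [Lp.coeFn_zero ℝ 2 (volume : Measure ℝ)] with y hy
      rw [hy, Pi.zero_apply, zero_mul]
    rw [WithLp.zero_fst, WithLp.zero_snd, h0, h0, neg_zero]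
  add_mem' := by
    intro p q hp hq φ hφ hc
    have hs : ∀ (u w : Lp ℝ 2 (volume : Measure ℝ)) {ψ : ℝ → ℝ}, Continuous ψ →
        HasCompactSupport ψ →
        ∫ y, (u + w) y * ψ y = (∫ y, u y * ψ y) + ∫ y, w y * ψ y := by
      intro u w ψ h1 h2
      rw [← integral_add (integrable_mul_test u h1 h2) (integrable_mul_test w h1 h2)]
      refine integral_congr_ae ?_
      filter_upwards [Lp.coeFn_add u w] with y hy
      rw [hy, Pi.add_apply, add_mul]
    have hd : Continuous (deriv φ) := hφ.continuous_deriv (by simp)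
    rw [WithLp.add_fst, WithLp.add_snd, hs _ _ hd hc.deriv, hs _ _ hφ.continuous hc,
      hp φ hφ hc, hq φ hφ hc]
    ring
  smul_mem' := by
    intro c p hp φ hφ hc
    have hs : ∀ (u : Lp ℝ 2 (volume : Measure ℝ)) (ψ : ℝ → ℝ),
        ∫ y, (c • u) y * ψ y = c * ∫ y, u y * ψ y := by
      intro u ψ
      rw [← integral_const_mul]
      refine integral_congr_ae ?_
      filter_upwards [Lp.coeFn_smul c u] with y hy
      rw [hy, Pi.smul_apply, smul_eq_mul, mul_assoc]
    rw [WithLp.smul_fst, WithLp.smul_snd, hs, hs, hp φ hφ hc]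
    ring

/-- The function `u : ℝ → ℝ` is the element `B` of `BC⁰(ℝ)`. -/
def RepBC0 (B : ℝ →ᵇ ℝ) (u : ℝ → ℝ) : Prop := ∀ y, B y = u y

/-- The function `u : ℝ → ℝ` is the element `B` of `BC¹(ℝ)`. -/
def RepBC1 (B : BC1) (u : ℝ → ℝ) : Prop := ∀ y, B.1.1 y = u y

/-- The function `u : ℝ → ℝ` represents the element `B` of `H¹(ℝ)`. -/
def RepH1 (B : H1) (u : ℝ → ℝ) : Prop := B.1.fst =ᵐ[volume] u

section Bochner

variable {F : Type} [NormedAddCommGroup F]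

/-- `‖c‖_{BC⁰(I; F)} ≤ M` for `c = c(t, y)`, where `F` is a space of functions of `y` and `rep`
says which functions an element of `F` stands for. -/
def BCInto (rep : F → (ℝ → ℝ) → Prop) (T : ℝ≥0∞) (c : ℝ → ℝ → ℝ) (M : ℝ≥0∞) : Prop :=
  ∃ B : ℝ → F, (∀ t ∈ timeI T, rep (B t) (c t)) ∧ ContinuousOn B (timeI T) ∧
    ∀ t ∈ timeI T, ‖B t‖ₑ ≤ M

/-- `‖c‖_{L²(I; F)} ≤ M` for `c = c(t, y)`. -/
def L2Into (rep : F → (ℝ → ℝ) → Prop) (T : ℝ≥0∞) (c : ℝ → ℝ → ℝ) (M : ℝ≥0∞) : Prop :=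
  ∃ B : ℝ → F, (∀ᵐ t ∂(volume.restrict (timeI T)), rep (B t) (c t)) ∧
    AEStronglyMeasurable B (volume.restrict (timeI T)) ∧
    eLpNorm B 2 (volume.restrict (timeI T)) ≤ M

end Bochner

/-- `‖c‖_{L²(I × ℝ)} ≤ M` for `c = c(t, y)`. -/
def L2Bound (T : ℝ≥0∞) (c : ℝ → ℝ → ℝ) (M : ℝ≥0∞) : Prop :=
  AEStronglyMeasurable (fun s : ℝ × ℝ => c s.1 s.2) (volume.restrict (timeI T ×ˢ univ)) ∧
    eLpNorm (fun s : ℝ × ℝ => c s.1 s.2) 2 (volume.restrict (timeI T ×ˢ univ)) ≤ M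

end

end ThinFilm

open ThinFilm

/-!
Since `D_y^b p(D_x) = p(D_x - b) D_y^b`, and since weak derivatives are taken by transposing on
test functions (`opEnd`), the whole question can be moved to almost every line parallel to the
`x`-axis (`ae_slice_of_tensor`, `ae_xd`), where it is governed by Hardy's inequality (`hardy`): if
`(D_x - γ) u` is in `L²(x^{-2ρ-1} dx)` and `γ ≠ ρ`, then `u = c x^γ + R` with `R` in this space
(`XD.exists_const`, `XD.exists_coef`).

**Expansions.** The polynomial `(ζ-3)(ζ-2) q̃(ζ) ζ` has the seven simple roots `0, 1, 2, 3, 1+β,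
-1/2, 1/2-β` (`roots`). Lagrange interpolation (`exists_decomp`) writes `v` as a combination of the
functions `filt Γ γ (D_x) v`, in each of which all roots but `γ` have been divided out, so that
`D_x - γ` maps each of them to the same function `full Γ (D_x) v`, which is controlled at the
highest weight. Each root thus contributes one term `c x^γ` (`exists_expansion`); the remainder is
`o(x^ρ)` in mean by `meanLittleO_of_wN` and, where one more derivative is available, pointwise by
`XD.aeLittleO`. The two negative roots do not occur, because `D_x v` is controlled at a weight above
them and `D_x` does not annihilate their powers (`cf_eq_zero`, `ExpData.cf_bad`).

**Coefficients.** A coefficient is the limit as `r ↘ 0` of averages at scale `r` (`coef`,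
`cfT`). It is therefore measurable in the remaining variables, square integrable with a
bound by the norms (`exists_lintegral_cfT_sq_le`), and its weak `y`-derivatives are the
coefficients of the `y`-derivatives of `v` (`Jets.weakD_cfT`). For continuity in `t` the averages
are Hölder continuous in `t` with a constant that blows up like a power of `r`, by the bound on
`∂_t v`, while they converge at the rate of another power of `r`; choosing `r` in terms of the time
increment gives Hölder continuity of the coefficients (`exists_holder_cfT`), hence continuous
curves in `H¹(ℝ)` (`exists_h1Curve`, `exists_curves`), and `BC⁰`-bounds by the embedding of
`H¹(ℝ)`.

**Gradients.** `D^ℓ v_x` and `D^ℓ v_y` are of the form `w = x⁻¹ D_y^b p(D_x) v`, and the expansion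
of `x D_x w` has no terms of lower order than `x^{8/5}` (`Vanishes`). It is therefore controlled at
the weights `ρ = 3/2 ± δ`. The embedding into bounded functions of `(x, y)` costs a factor `x^{1/2}`,
so `|D_x w| ≲ x^{±δ}`, which is integrable against `dx/x` at both ends (`exists_bcBound`,
`exists_gradient_bounds`). Hölder continuity in time gives continuity up to `t = 0`
(`exists_continuousOn_domI`).

**Reductions.** Initial data are treated as functions on `[0, 1)` that are constant in time
(`WeakOp.comp_snd`, `WeakOp.ae_comp_snd`, `HasExpansionT.ae_hasExpansion`), and the right-hand side
by the same expansion with all roots shifted by `1` (`roots₁`).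
-/

namespace ThinFilm

noncomputable section

/-! ### Test functions and the ring generated by the transposed operators -/

section TestFunctions

variable {E : Type} [NormedAddCommGroup E] [NormedSpace ℝ E]

/-- `φ ∈ C_c^∞(U)`. -/
structure IsTest (U : Set E) (φ : E → ℝ) : Prop where
  smooth : ContDiff ℝ ∞ φ
  compact : HasCompactSupport φ
  subset : tsupport φ ⊆ U

theorem IsTest.of_support {U : Set E} {φ ψ : E → ℝ} (h : IsTest U φ) (hψ : ContDiff ℝ ∞ ψ)
    (hs : Function.support ψ ⊆ tsupport φ) : IsTest U ψ where
  smooth := hψ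
  compact := h.compact.mono' hs
  subset := (closure_minimal hs (isClosed_tsupport φ)).trans h.subset

theorem IsTest.mul_of_contDiffAt {U : Set E} {φ a : E → ℝ} (h : IsTest U φ)
    (ha : ∀ p ∈ U, ContDiffAt ℝ ∞ a p) : IsTest U (fun p => a p * φ p) := by
  refine h.of_support ?_ ?_
  · rw [contDiff_iff_contDiffAt]
    intro p
    by_cases hp : p ∈ tsupport φ
    · exact (ha p (h.subset hp)).mul h.smooth.contDiffAt
    · refine (contDiffAt_const (c := (0 : ℝ))).congr_of_eventuallyEq ?_
      filter_upwards [(isClosed_tsupport φ).isOpen_compl.mem_nhds hp] with q hq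
      rw [image_eq_zero_of_notMem_tsupport hq, mul_zero]
  · intro p hp
    refine subset_tsupport φ ?_
    rw [Function.mem_support] at hp ⊢
    exact right_ne_zero_of_mul hp

theorem IsTest.pdT {U : Set E} {φ : E → ℝ} (h : IsTest U φ) (e : E) : IsTest U (pdT e φ) := by
  refine h.of_support ?_ ?_
  · exact ((h.smooth.fderiv_right (m := ∞) (by simp)).clm_apply contDiff_const).neg
  · intro p hp
    refine support_fderiv_subset ℝ (f := φ) ?_
    rw [Function.mem_support] at hp ⊢
    intro h0
    exact hp (by simp [ThinFilm.pdT, h0])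

theorem IsTest.add {U : Set E} {φ ψ : E → ℝ} (h : IsTest U φ) (h' : IsTest U ψ) :
    IsTest U (φ + ψ) where
  smooth := h.smooth.add h'.smooth
  compact := h.compact.add h'.compact
  subset := (tsupport_add φ ψ).trans (union_subset h.subset h'.subset)

/-- `C_c^∞(U)` as a space of functions. -/
def testSpace (U : Set E) : Submodule ℝ (E → ℝ) where
  carrier := {φ | IsTest U φ}
  zero_mem' := ⟨contDiff_const, HasCompactSupport.zero, by simp [tsupport]⟩
  add_mem' := fun h h' => h.add h'
  smul_mem' := fun c φ h => h.mul_of_contDiffAt (a := fun _ => c) fun _ _ => contDiffAt_const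

/-- `φ ↦ -∂_e φ` on `C_c^∞(U)`. -/
def pdEnd (U : Set E) (e : E) : Module.End ℝ (testSpace U) where
  toFun φ := ⟨pdT e φ.1, φ.2.pdT e⟩
  map_add' φ ψ := by
    ext p
    have h1 := (φ.2.smooth.differentiable (by simp)) p
    have h2 := (ψ.2.smooth.differentiable (by simp)) p
    simp only [pdT, Submodule.coe_add, Pi.add_apply]
    rw [fderiv_add h1 h2]
    simp [add_comm]
  map_smul' c φ := by
    ext p
    have h1 := (φ.2.smooth.differentiable (by simp)) p
    simp only [pdT, Submodule.coe_smul, Pi.smul_apply]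
    rw [fderiv_const_smul h1]
    simp

/-- Multiplication by a function which is smooth on `U`. -/
def mulEnd (U : Set E) (a : E → ℝ) (ha : ∀ p ∈ U, ContDiffAt ℝ ∞ a p) :
    Module.End ℝ (testSpace U) where
  toFun φ := ⟨fun p => a p * φ.1 p, φ.2.mul_of_contDiffAt ha⟩
  map_add' φ ψ := by ext p; simp [mul_add]
  map_smul' c φ := by ext p; simp [mul_left_comm]

theorem pdEnd_comm (U : Set E) (e f : E) : pdEnd U e * pdEnd U f = pdEnd U f * pdEnd U e := by
  ext φ p
  have hφ := φ.2.smooth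
  have key : ∀ e f : E, pdT e (pdT f φ.1) p = fderiv ℝ (fderiv ℝ φ.1) p e f := by
    intro e f
    have hd : DifferentiableAt ℝ (fderiv ℝ φ.1) p :=
      ((hφ.fderiv_right (m := ∞) (by simp)).differentiable (by simp)) p
    change -(fderiv ℝ (fun q => -((fderiv ℝ φ.1 q) f)) p e) = _
    rw [fderiv_fun_neg, fderiv_clm_apply hd (differentiableAt_const f)]
    simp
  have hsymm : IsSymmSndFDerivAt ℝ φ.1 p :=
    (hφ.contDiffAt).isSymmSndFDerivAt (by
      rw [minSmoothness_of_isRCLikeNormedField]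
      exact WithTop.coe_le_coe.2 le_top)
  change pdT e (pdT f φ.1) p = pdT f (pdT e φ.1) p
  rw [key, key, hsymm.eq]

/-- A half space whose domain is open and whose coordinate `x` is linear, with `∂_x x = 1` and
`∂_y x = 0`. -/
class HalfSpace.IsLinear (H : HalfSpace E) : Prop where
  isOpen : IsOpen H.dom
  pos : ∀ p ∈ H.dom, 0 < H.x p
  lin : ∃ l : E →L[ℝ] ℝ, H.x = ⇑l ∧ l H.ex = 1 ∧ l H.ey = 0

variable (H : HalfSpace E) [hH : H.IsLinear]

theorem HalfSpace.contDiff_x : ContDiff ℝ ∞ H.x := by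
  obtain ⟨l, hl, -⟩ := hH.lin
  rw [hl]
  exact l.contDiff

/-- Multiplication by `x`. -/
def xEnd : Module.End ℝ (testSpace H.dom) := mulEnd H.dom H.x fun _ _ => H.contDiff_x.contDiffAt

/-- Division by `x`. -/
def xInvEnd : Module.End ℝ (testSpace H.dom) :=
  mulEnd H.dom (fun p => (H.x p)⁻¹) fun p hp => H.contDiff_x.contDiffAt.inv (hH.pos p hp).ne'

/-- The transpose of `D_x`. -/
def dxEnd : Module.End ℝ (testSpace H.dom) := pdEnd H.dom H.ex * xEnd H

/-- The transpose of `D_y`. -/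
def dyEnd : Module.End ℝ (testSpace H.dom) := pdEnd H.dom H.ey * xEnd H

theorem xEnd_mul_xInvEnd : xEnd H * xInvEnd H = 1 := by
  ext φ p
  change H.x p * ((H.x p)⁻¹ * φ.1 p) = φ.1 p
  by_cases hp : p ∈ H.dom
  · rw [mul_inv_cancel_left₀ (hH.pos p hp).ne']
  · rw [image_eq_zero_of_notMem_tsupport fun h => hp (φ.2.subset h)]
    simp

theorem pdEnd_mul_xEnd (e : E) (c : ℝ) (hc : fderiv ℝ H.x 0 e = c) :
    pdEnd H.dom e * xEnd H + c • 1 = xEnd H * pdEnd H.dom e := by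
  ext φ p
  obtain ⟨l, hl, -⟩ := hH.lin
  have hφ := (φ.2.smooth.differentiable (by simp)) p
  have hx : DifferentiableAt ℝ H.x p := (H.contDiff_x.differentiable (by simp)) p
  have h1 : fderiv ℝ H.x p e = c := by
    rw [← hc, hl]
    simp
  change -(fderiv ℝ (fun p => H.x p * φ.1 p) p e) + c * φ.1 p = H.x p * (-(fderiv ℝ φ.1 p e))
  rw [fderiv_fun_mul hx hφ]
  simp [h1]
  ring

theorem pdEnd_ex_mul_xEnd :
    xEnd H * pdEnd H.dom H.ex = pdEnd H.dom H.ex * xEnd H + 1 := by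
  obtain ⟨l, hl, h1, -⟩ := hH.lin
  rw [← pdEnd_mul_xEnd H H.ex 1 (by rw [hl]; simpa using h1), one_smul]

theorem pdEnd_ey_mul_xEnd : pdEnd H.dom H.ey * xEnd H = xEnd H * pdEnd H.dom H.ey := by
  obtain ⟨l, hl, -, h1⟩ := hH.lin
  rw [← pdEnd_mul_xEnd H H.ey 0 (by rw [hl]; simpa using h1), zero_smul, add_zero]

theorem dyEnd_mul_dxEnd : dyEnd H * dxEnd H = (dxEnd H + 1) * dyEnd H := by
  have hR := pdEnd_ey_mul_xEnd H
  have hP := pdEnd_ex_mul_xEnd H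
  have hC := pdEnd_comm H.dom H.ex H.ey
  unfold dyEnd dxEnd
  set P := pdEnd H.dom H.ex
  set R := pdEnd H.dom H.ey
  set M := xEnd H
  have h1 : R * M * (P * M) = R * (M * P) * M := by simp only [mul_assoc]
  have h2 : M * P = P * M + 1 := hP
  have h3 : P * M * (R * M) = R * (P * M) * M := by
    calc P * M * (R * M) = P * (M * R) * M := by simp only [mul_assoc]
      _ = (P * R) * M * M := by rw [← hR]; simp only [mul_assoc]
      _ = R * (P * M) * M := by rw [hC]; simp only [mul_assoc]
  rw [h1, h2, add_mul, h3, mul_add, add_mul, one_mul, mul_one]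

open Polynomial in
/-- `D_y^b D_x^a = (D_x - b)^a D_y^b`, transposed and for polynomials in `D_x`. -/
theorem dyEnd_pow_mul_aeval (b : ℕ) (p : ℝ[X]) :
    dyEnd H ^ b * aeval (dxEnd H) p = aeval (dxEnd H) (p.comp (X + C (b : ℝ))) * dyEnd H ^ b := by
  have h1 : ∀ b : ℕ, dyEnd H ^ b * dxEnd H = (dxEnd H + algebraMap ℝ _ (b : ℝ)) * dyEnd H ^ b := by
    intro b
    induction b with
    | zero => simp
    | succ b ih =>
      rw [pow_succ', mul_assoc, ih, ← mul_assoc, mul_add, dyEnd_mul_dxEnd,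
        ← Algebra.commutes, ← add_mul, mul_assoc]
      congr 1
      simp
      abel
  induction p using Polynomial.induction_on' with
  | add p q hp hq => simp only [map_add, mul_add, hp, hq, add_comp, add_mul]
  | monomial n a =>
    induction n with
    | zero => simp [Algebra.commutes]
    | succ n ih =>
      have : (monomial (n + 1) a : ℝ[X]) = monomial n a * X := by simp [monomial_mul_X]
      rw [this, map_mul, ← mul_assoc, ih, mul_assoc, aeval_X, h1, ← mul_assoc, mul_comp, map_mul]
      simp

/-! ### Weak derivatives -/

theorem coe_dxEnd_pow (a : ℕ) (φ : testSpace H.dom) :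
    ((dxEnd H ^ a) φ : E → ℝ) = (dxT H)^[a] φ := by
  induction a with
  | zero => rfl
  | succ a ih => rw [pow_succ', Function.iterate_succ_apply', ← ih]; rfl

theorem coe_dyEnd_pow (a : ℕ) (φ : testSpace H.dom) :
    ((dyEnd H ^ a) φ : E → ℝ) = (dyT H)^[a] φ := by
  induction a with
  | zero => rfl
  | succ a ih => rw [pow_succ', Function.iterate_succ_apply', ← ih]; rfl

theorem coe_aeval_dxEnd (p : ℝ[X]) (φ : testSpace H.dom) :
    ((Polynomial.aeval (dxEnd H) p) φ : E → ℝ) = polyT H p φ := by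
  ext q
  rw [Polynomial.aeval_def, Polynomial.eval₂_eq_sum, Polynomial.sum, LinearMap.sum_apply, polyT,
    AddSubmonoidClass.coe_finsetSum, Finset.sum_apply]
  refine Finset.sum_congr rfl fun n _ => ?_
  rw [← coe_dxEnd_pow]
  rfl

/-- The transpose of `D_y^b p(D_x)`. -/
def opEnd (p : ℝ[X]) (b : ℕ) : Module.End ℝ (testSpace H.dom) :=
  Polynomial.aeval (dxEnd H) p * dyEnd H ^ b

open Polynomial in
theorem coe_opT (m : ℕ) (P : ℝ[X]) (a b : ℕ) (φ : testSpace H.dom) :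
    opT H m P a b φ.1 = (opEnd H (P * (X + C (m : ℝ)) ^ a) (b + m) φ).1 := by
  have h : opEnd H (P * (X + C (m : ℝ)) ^ a) (b + m) =
      aeval (dxEnd H) P * (dyEnd H ^ m * (dxEnd H ^ a * dyEnd H ^ b)) := by
    have := dyEnd_pow_mul_aeval H m (X ^ a)
    rw [map_pow, aeval_X, X_pow_comp] at this
    rw [opEnd, map_mul, ← mul_assoc (dyEnd H ^ m), this, add_comm b m, pow_add]
    simp only [mul_assoc]
  rw [h, opT, powT]
  simp only [Module.End.mul_apply]
  rw [coe_aeval_dxEnd, coe_dyEnd_pow, coe_dxEnd_pow, coe_dyEnd_pow]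

theorem coe_powT (a b : ℕ) (φ : testSpace H.dom) :
    powT H a b φ.1 = (opEnd H (Polynomial.X ^ a) b φ).1 := by
  rw [opEnd, map_pow, Polynomial.aeval_X, powT, Module.End.mul_apply, coe_dxEnd_pow,
    coe_dyEnd_pow]

theorem opEnd_mul_dyEnd (p : ℝ[X]) (b : ℕ) : opEnd H p b * dyEnd H = opEnd H p (b + 1) := by
  rw [opEnd, opEnd, mul_assoc, pow_succ]

open Polynomial in
theorem opEnd_mul_dxEnd (p : ℝ[X]) (b : ℕ) :
    opEnd H p b * dxEnd H = opEnd H (p * (X + C (b : ℝ))) b := by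
  have := dyEnd_pow_mul_aeval H b X
  rw [aeval_X, X_comp] at this
  rw [opEnd, opEnd, mul_assoc, this, map_mul, mul_assoc]

open Polynomial in
/-- `D^l ∂_x = x⁻¹ D_y^b (D_x - 1)^a D_x`, transposed. -/
theorem coe_pdT_ex_powT (a b : ℕ) (φ : testSpace H.dom) :
    pdT H.ex (powT H a b φ.1) = ((opEnd H (X * (X - 1) ^ a) b * xInvEnd H) φ).1 := by
  have h1 : dyEnd H * xEnd H = xEnd H * dyEnd H := by
    unfold dyEnd
    rw [← mul_assoc, ← pdEnd_ey_mul_xEnd]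
  set m : Module.End ℝ (testSpace H.dom) := algebraMap ℝ _ (-1) with hm
  have h0 : 1 + m = 0 := by rw [hm, ← map_one (algebraMap ℝ _), ← map_add]; simp
  have h2 : dxEnd H * xEnd H = xEnd H * (dxEnd H + m) := by
    have h3 := pdEnd_ex_mul_xEnd H
    unfold dxEnd
    have h7 : xEnd H + m * xEnd H = 0 := by
      rw [← zero_mul (xEnd H), ← h0, add_mul, one_mul]
    rw [mul_add, ← mul_assoc, h3, add_mul, one_mul, hm, ← Algebra.commutes, ← hm, add_assoc, h7,
      add_zero]
  have h3 : dyEnd H ^ b * xEnd H = xEnd H * dyEnd H ^ b := (Commute.pow_left h1 b)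
  have h4 : dxEnd H ^ a * xEnd H = xEnd H * (dxEnd H + m) ^ a := by
    induction a with
    | zero => simp
    | succ a ih => rw [pow_succ, mul_assoc, h2, ← mul_assoc, ih, mul_assoc, ← pow_succ]
  have h5 : pdEnd H.dom H.ex * opEnd H (X ^ a) b = opEnd H (X * (X - 1) ^ a) b * xInvEnd H := by
    have : opEnd H (X ^ a) b = opEnd H (X ^ a) b * xEnd H * xInvEnd H := by
      rw [mul_assoc, xEnd_mul_xInvEnd, mul_one]
    rw [this, ← mul_assoc]
    congr 1
    have h6 : (X - 1 : ℝ[X]) = X + C (-1) := by rw [C_neg, C_1, sub_eq_add_neg]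
    rw [opEnd, opEnd, map_mul, map_pow, h6, map_pow, map_add, aeval_X, aeval_C, mul_assoc, h3,
      ← hm, ← mul_assoc, mul_assoc _ (dxEnd H ^ a), ← mul_assoc (dxEnd H ^ a), h4]
    simp only [dxEnd, mul_assoc]
  rw [← h5, coe_powT]
  rfl

open Polynomial in
/-- `D^l ∂_y = x⁻¹ D_y^(b+1) D_x^a`, transposed. -/
theorem coe_pdT_ey_powT (a b : ℕ) (φ : testSpace H.dom) :
    pdT H.ey (powT H a b φ.1) = ((opEnd H (X ^ a) (b + 1) * xInvEnd H) φ).1 := by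
  have h1 : pdEnd H.dom H.ey * dyEnd H = dyEnd H * pdEnd H.dom H.ey := by
    unfold dyEnd
    rw [mul_assoc, pdEnd_ey_mul_xEnd]
  have h2 : pdEnd H.dom H.ey * dxEnd H = dxEnd H * pdEnd H.dom H.ey := by
    unfold dxEnd
    rw [← mul_assoc, pdEnd_comm, mul_assoc, pdEnd_ey_mul_xEnd, mul_assoc]
  have h3 : pdEnd H.dom H.ey * opEnd H (X ^ a) b = opEnd H (X ^ a) b * pdEnd H.dom H.ey := by
    rw [opEnd, map_pow, aeval_X]
    exact (Commute.pow_right h2 a).mul_right (Commute.pow_right h1 b)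
  have h4 : pdEnd H.dom H.ey = dyEnd H * xInvEnd H := by
    rw [dyEnd, mul_assoc, xEnd_mul_xInvEnd, mul_one]
  rw [coe_powT, ← opEnd_mul_dyEnd, mul_assoc, ← h4, ← h3]
  rfl

variable [MeasureSpace E]

/-- `WeakOp U A v g`: the operator with transpose `A` maps the distribution `v` to `g`, where both
are locally integrable functions on `U`. -/
def WeakOp (U : Set E) (A : Module.End ℝ (testSpace U)) (v g : E → ℝ) : Prop :=
  LocallyIntegrableOn v U ∧ LocallyIntegrableOn g U ∧
    ∀ φ : testSpace U, ∫ p, v p * (A φ).1 p = ∫ p, g p * φ.1 p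

omit hH in
theorem isWeak_iff {AT : (E → ℝ) → (E → ℝ)} {A : Module.End ℝ (testSpace H.dom)}
    (h : ∀ φ : testSpace H.dom, AT φ.1 = (A φ).1) (v g : E → ℝ) :
    IsWeak H AT v g ↔ WeakOp H.dom A v g := by
  refine and_congr_right fun _ => and_congr_right fun _ => ⟨fun h1 φ => ?_, fun h1 φ a b c => ?_⟩
  · rw [← h]
    exact h1 φ.1 φ.2.smooth φ.2.compact φ.2.subset
  · have := h1 ⟨φ, a, b, c⟩
    rwa [← h] at this

namespace WeakOp

variable {U : Set E} {A B : Module.End ℝ (testSpace U)} {v v' g g' h : E → ℝ}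

theorem comp (h1 : WeakOp U A v g) (h2 : WeakOp U B g h) : WeakOp U (A * B) v h :=
  ⟨h1.1, h2.2.1, fun φ => (h1.2.2 (B φ)).trans (h2.2.2 φ)⟩

theorem of_comp (h1 : WeakOp U A v g) (h2 : WeakOp U (A * B) v h) : WeakOp U B g h :=
  ⟨h1.2.1, h2.2.1, fun φ => (h1.2.2 (B φ)).symm.trans (h2.2.2 φ)⟩

end WeakOp

end TestFunctions

/-! ### Representatives of weak derivatives -/

section Jets

/-- The linear map `p ↦ p(u)`, `X^n ↦ u n`. -/
def ev {M : Type} [AddCommGroup M] [Module ℝ M] (u : ℕ → M) : ℝ[X] →ₗ[ℝ] M :=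
  Polynomial.lsum fun n => LinearMap.toSpanSingleton ℝ M (u n)

theorem ev_eq_sum {M : Type} [AddCommGroup M] [Module ℝ M] (u : ℕ → M) (p : ℝ[X]) {N : ℕ}
    (h : p.natDegree < N) : ev u p = ∑ n ∈ Finset.range N, p.coeff n • u n := by
  rw [ev, Polynomial.lsum_apply, Polynomial.sum_over_range' p (by simp) N h]
  rfl

theorem ev_X_pow {M : Type} [AddCommGroup M] [Module ℝ M] (u : ℕ → M) (n : ℕ) :
    ev u (Polynomial.X ^ n) = u n := by
  rw [ev, Polynomial.lsum_apply, Polynomial.X_pow_eq_monomial, Polynomial.sum_monomial_index] <;>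
    simp

theorem ev_apply {α : Type} (u : ℕ → α → ℝ) (p : ℝ[X]) (x : α) :
    ev u p x = ev (fun n => u n x) p := by
  rw [ev_eq_sum u p (Nat.lt_succ_self _), ev_eq_sum _ p (Nat.lt_succ_self _), Finset.sum_apply]
  rfl

theorem measurable_ev {α : Type} [MeasurableSpace α] {u : ℕ → α → ℝ} (h : ∀ n, Measurable (u n))
    (p : ℝ[X]) : Measurable (ev u p) := by
  have : ev u p = fun x => ∑ n ∈ Finset.range (p.natDegree + 1), p.coeff n * u n x := by
    ext x
    rw [ev_eq_sum u p (Nat.lt_succ_self _), Finset.sum_apply]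
    rfl
  rw [this]
  exact Finset.measurable_sum _ fun n _ => (h n).const_mul (p.coeff n)

variable {E : Type} [NormedAddCommGroup E] [NormedSpace ℝ E] [MeasureSpace E]

theorem IsTest.integrable_mul [BorelSpace E] {U : Set E} {v φ : E → ℝ}
    (hv : LocallyIntegrableOn v U) (hφ : IsTest U φ) : Integrable (fun p => v p * φ p) := by
  have hK : IsCompact (tsupport φ) := hφ.compact
  have h1 : IntegrableOn v (tsupport φ) := hv.integrableOn_compact_subset hφ.subset hK
  have h2 := h1.mul_continuousOn hφ.smooth.continuous.continuousOn hK
  rwa [integrableOn_iff_integrable_of_support_subset] at h2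
  intro p hp
  exact subset_tsupport φ (right_ne_zero_of_mul hp)

namespace WeakOp

variable {U : Set E} {A B : Module.End ℝ (testSpace U)} {v v' g g' h : E → ℝ}

theorem sum [BorelSpace E] {ι : Type} (s : Finset ι) (c : ι → ℝ)
    {A : ι → Module.End ℝ (testSpace U)} {g : ι → E → ℝ} (hv : LocallyIntegrableOn v U)
    (h : ∀ i ∈ s, WeakOp U (A i) v (g i)) :
    WeakOp U (∑ i ∈ s, c i • A i) v (∑ i ∈ s, c i • g i) := by
  classical
  induction s using Finset.induction_on with
  | empty => exact ⟨hv, (locallyIntegrable_zero (μ := volume)).locallyIntegrableOn U, by simp⟩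
  | insert i s hi ih =>
    have h1 := ih fun j hj => h j (Finset.mem_insert_of_mem hj)
    have h2 := h i (Finset.mem_insert_self i s)
    have h3 : LocallyIntegrableOn (c i • g i) U := h2.2.1.smul (c i)
    rw [Finset.sum_insert hi, Finset.sum_insert hi]
    refine ⟨hv, h3.add h1.2.1, fun φ => ?_⟩
    have e1 : ∀ p, v p * ((c i • A i + ∑ j ∈ s, c j • A j) φ).1 p =
        c i * (v p * (A i φ).1 p) + v p * ((∑ j ∈ s, c j • A j) φ).1 p := by
      intro p
      rw [LinearMap.add_apply, Submodule.coe_add, Pi.add_apply, LinearMap.smul_apply,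
        Submodule.coe_smul, Pi.smul_apply, smul_eq_mul]
      ring
    have e2 : ∀ p, (c i • g i + ∑ j ∈ s, c j • g j) p * φ.1 p =
        c i * (g i p * φ.1 p) + (∑ j ∈ s, c j • g j) p * φ.1 p := by
      intro p
      rw [Pi.add_apply, Pi.smul_apply, smul_eq_mul]
      ring
    simp_rw [e1, e2]
    rw [integral_add (((A i φ).2.integrable_mul hv).const_mul _) (IsTest.integrable_mul hv
      ((∑ j ∈ s, c j • A j) φ).2), integral_add ((φ.2.integrable_mul h2.2.1).const_mul _)
      (φ.2.integrable_mul h1.2.1), integral_const_mul, integral_const_mul, h1.2.2, h2.2.2]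

theorem congr_ae [OpensMeasurableSpace E] (hU : IsOpen U) (h : WeakOp U A v g)
    (hg : ∀ᵐ p ∂volume.restrict U, g p = g' p) : WeakOp U A v g' := by
  refine ⟨h.1, ?_, fun φ => ?_⟩
  · intro x hx
    obtain ⟨t, ht, hi⟩ := h.2.1 x hx
    refine ⟨t ∩ U, inter_mem ht self_mem_nhdsWithin, ?_⟩
    refine (hi.mono_set inter_subset_left).congr ?_
    exact ae_restrict_of_ae_restrict_of_subset inter_subset_right hg
  · rw [h.2.2 φ]
    refine integral_congr_ae ?_
    filter_upwards [(ae_restrict_iff' hU.measurableSet).1 hg] with p hp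
    by_cases hpU : p ∈ U
    · rw [hp hpU]
    · rw [image_eq_zero_of_notMem_tsupport fun h => hpU (φ.2.subset h), mul_zero, mul_zero]

theorem ae_eq [BorelSpace E] [FiniteDimensional ℝ E] (hU : IsOpen U) (h : WeakOp U A v g)
    (h' : WeakOp U A v g') : ∀ᵐ p ∂volume.restrict U, g p = g' p := by
  rw [ae_restrict_iff' hU.measurableSet]
  have := hU.ae_eq_zero_of_integral_contDiff_smul_eq_zero (f := g - g') (μ := volume)
    (h.2.1.sub h'.2.1) fun φ h1 h2 h3 => by
      have h4 := (h.2.2 ⟨φ, h1, h2, h3⟩).symm.trans (h'.2.2 ⟨φ, h1, h2, h3⟩)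
      simp only [Pi.sub_apply, smul_eq_mul, mul_sub]
      rw [integral_sub]
      · simpa [mul_comm, sub_eq_zero] using h4
      · simpa only [mul_comm] using IsTest.integrable_mul h.2.1 ⟨h1, h2, h3⟩
      · simpa only [mul_comm] using IsTest.integrable_mul h'.2.1 ⟨h1, h2, h3⟩
  filter_upwards [this] with p hp hpU
  exact sub_eq_zero.1 (hp hpU)

/-- A weak derivative has a representative which is measurable everywhere. -/
theorem exists_measurable [OpensMeasurableSpace E] [SecondCountableTopology E] (hU : IsOpen U)
    (h : WeakOp U A v g) : ∃ g' : E → ℝ, Measurable g' ∧ WeakOp U A v g' := by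
  have hm : AEStronglyMeasurable g (volume.restrict U) := h.2.1.aestronglyMeasurable
  exact ⟨hm.mk g, hm.stronglyMeasurable_mk.measurable, h.congr_ae hU hm.ae_eq_mk⟩

end WeakOp

variable (H : HalfSpace E) [hH : H.IsLinear]

theorem WeakOp.ev [BorelSpace E] {v : E → ℝ} {g : ℕ → E → ℝ} {b N : ℕ}
    (h : ∀ n ≤ N, WeakOp H.dom (opEnd H (Polynomial.X ^ n) b) v (g n)) {p : ℝ[X]}
    (hp : p.natDegree ≤ N) : WeakOp H.dom (opEnd H p b) v (ev g p) := by
  have hp' : p.natDegree < N + 1 := Nat.lt_succ_of_le hp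
  have h1 : opEnd H p b =
      ∑ n ∈ Finset.range (N + 1), p.coeff n • opEnd H (Polynomial.X ^ n) b := by
    conv_lhs => rw [opEnd, p.as_sum_range' (N + 1) hp', map_sum, Finset.sum_mul]
    refine Finset.sum_congr rfl fun n _ => ?_
    rw [opEnd, ← smul_mul_assoc, ← map_smul, Polynomial.smul_X_eq_monomial]
  rw [h1, ev_eq_sum g p hp']
  exact WeakOp.sum _ _ (h 0 (Nat.zero_le N)).1 fun n hn =>
    h n (Nat.lt_succ_iff.1 (Finset.mem_range.1 hn))

end Jets

/-! ### The two domains -/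

instance : plane.IsLinear where
  isOpen := isOpen_lt continuous_const continuous_fst
  pos := fun _ hp => hp
  lin := ⟨ContinuousLinearMap.fst ℝ ℝ ℝ, rfl, rfl, rfl⟩

theorem isOpen_ofReal_lt (T : ℝ≥0∞) : IsOpen {t : ℝ | ENNReal.ofReal t < T} :=
  isOpen_lt ENNReal.continuous_ofReal continuous_const

instance (T : ℝ≥0∞) : (spaceTime T).IsLinear where
  isOpen := (isOpen_lt continuous_const continuous_fst).inter
    (((isOpen_ofReal_lt T).preimage continuous_fst).inter
      (isOpen_lt continuous_const continuous_snd.fst))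
  pos := fun _ hp => hp.2.2
  lin := ⟨(ContinuousLinearMap.fst ℝ ℝ ℝ).comp (ContinuousLinearMap.snd ℝ ℝ (ℝ × ℝ)), rfl, rfl,
    rfl⟩

theorem measurableSet_timeI (T : ℝ≥0∞) : MeasurableSet (timeI T) :=
  (measurableSet_le measurable_const measurable_id).inter (isOpen_ofReal_lt T).measurableSet

/-- The open time interval `(0, T)`. -/
def timeO (T : ℝ≥0∞) : Set ℝ := {t | 0 < t ∧ ENNReal.ofReal t < T}

theorem isOpen_timeO (T : ℝ≥0∞) : IsOpen (timeO T) :=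
  (isOpen_lt continuous_const continuous_id).inter (isOpen_ofReal_lt T)

theorem timeO_subset (T : ℝ≥0∞) : timeO T ⊆ timeI T := fun _ ht => ⟨ht.1.le, ht.2⟩

theorem restrict_timeO (T : ℝ≥0∞) :
    (volume : Measure ℝ).restrict (timeI T) = volume.restrict (timeO T) := by
  refine Measure.restrict_congr_set ?_
  have h : ∀ᵐ t : ℝ, t ≠ 0 := by simp [ae_iff, measure_singleton]
  filter_upwards [h] with t ht
  simp only [eq_iff_iff]
  exact ⟨fun h => ⟨lt_of_le_of_ne h.1 (Ne.symm ht), h.2⟩, fun h => timeO_subset T h⟩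

theorem spaceTime_dom (T : ℝ≥0∞) : (spaceTime T).dom = timeO T ×ˢ plane.dom := by
  ext p
  simp only [spaceTime, timeO, plane, mem_ofPred_eq, mem_prod, and_assoc]

theorem ae_slice {T : ℝ≥0∞} {P : ℝ × ℝ × ℝ → Prop}
    (h : ∀ᵐ p ∂volume.restrict (spaceTime T).dom, P p) :
    ∀ᵐ t ∂volume.restrict (timeI T), ∀ᵐ q ∂volume.restrict plane.dom, P (t, q) := by
  rw [spaceTime_dom, Measure.volume_eq_prod, ← Measure.prod_restrict] at h
  rw [restrict_timeO]
  exact Measure.ae_ae_of_ae_prod h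

theorem weightSq_congr {α : ℝ} {g g' : ℝ × ℝ → ℝ}
    (h : ∀ᵐ q ∂volume.restrict plane.dom, g q = g' q) : weightSq α g = weightSq α g' := by
  refine lintegral_congr_ae ?_
  filter_upwards [h] with q hq
  rw [hq]

/-! ### Extracting bounds from the norms -/

theorem mem_multiIdx {κ : ℕ} {l : ℕ × ℕ} : l ∈ multiIdx κ ↔ l.1 + l.2 ≤ κ := by
  simp only [multiIdx, Finset.mem_filter, Finset.mem_product, Finset.mem_range]
  omega

open Polynomial in
/-- The symbol of `D^ℓ D_y^m P(D_x)`, as a polynomial to be followed by `D_y^(ℓ_y + m)`. -/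
def opPoly (m : ℕ) (P : ℝ[X]) (a : ℕ) : ℝ[X] := P * (X + C (m : ℝ)) ^ a

section Extract

variable {T : ℝ≥0∞} {m : ℕ} {P : ℝ[X]} {κ : ℕ} {α : ℝ}

theorem exists_of_intNormSq_lt_top {v : ℝ × ℝ × ℝ → ℝ} (h : intNormSq T m P κ α v < ⊤) {a b : ℕ}
    (hl : a + b ≤ κ) :
    ∃ g, WeakOp (spaceTime T).dom (opEnd (spaceTime T) (opPoly m P a) (b + m)) v g := by
  rw [intNormSq, iInf_lt_iff] at h
  obtain ⟨g, hg⟩ := h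
  rw [iInf_lt_iff] at hg
  obtain ⟨hg, -⟩ := hg
  exact ⟨g (a, b), (isWeak_iff _ (coe_opT _ m P a b) v _).1 (hg _ (mem_multiIdx.2 hl))⟩

/-- The transpose of `∂_t`. -/
def dtEnd (T : ℝ≥0∞) : Module.End ℝ (testSpace (spaceTime T).dom) := pdEnd _ (1, 0, 0)

theorem dtEnd_mul_opEnd (p : ℝ[X]) (b : ℕ) :
    dtEnd T * opEnd (spaceTime T) p b = opEnd (spaceTime T) p b * dtEnd T := by
  have h0 : dtEnd T * xEnd (spaceTime T) = xEnd (spaceTime T) * dtEnd T := by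
    have h := pdEnd_mul_xEnd (spaceTime T) (1, 0, 0) 0 (by
      have : (spaceTime T).x =
        ⇑((ContinuousLinearMap.fst ℝ ℝ ℝ).comp (ContinuousLinearMap.snd ℝ ℝ (ℝ × ℝ))) := rfl
      rw [this, ContinuousLinearMap.fderiv]
      rfl)
    rwa [zero_smul, add_zero] at h
  have h1 : Commute (dtEnd T) (dxEnd (spaceTime T)) := (Commute.mul_right (pdEnd_comm _ _ _) h0)
  have h2 : Commute (dtEnd T) (dyEnd (spaceTime T)) := (Commute.mul_right (pdEnd_comm _ _ _) h0)
  refine Commute.mul_right ?_ (h2.pow_right b)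
  induction p using Polynomial.induction_on' with
  | add p q hp hq => rw [map_add]; exact hp.add_right hq
  | monomial n a =>
    rw [Polynomial.aeval_monomial]
    exact Commute.mul_right (Algebra.commutes a (dtEnd T)).symm (h1.pow_right n)

theorem coe_pdT_opT (m : ℕ) (P : ℝ[X]) (a b : ℕ) (φ : testSpace (spaceTime T).dom) :
    pdT (1, 0, 0) (opT (spaceTime T) m P a b φ.1) =
      ((dtEnd T * opEnd (spaceTime T) (opPoly m P a) (b + m)) φ).1 := by
  rw [coe_opT]
  rfl

theorem exists_of_intNormDtSq_lt_top {v : ℝ × ℝ × ℝ → ℝ} (h : intNormDtSq T m P κ α v < ⊤)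
    {a b : ℕ} (hl : a + b ≤ κ) :
    ∃ g, WeakOp (spaceTime T).dom
      (dtEnd T * opEnd (spaceTime T) (opPoly m P a) (b + m)) v g := by
  rw [intNormDtSq, iInf_lt_iff] at h
  obtain ⟨g, hg⟩ := h
  rw [iInf_lt_iff] at hg
  obtain ⟨hg, -⟩ := hg
  exact ⟨g (a, b), (isWeak_iff _ (coe_pdT_opT m P a b) v _).1 (hg _ (mem_multiIdx.2 hl))⟩

theorem lintegral_weightSq_le_intNormSq {v : ℝ × ℝ × ℝ → ℝ} {a b : ℕ} (hl : a + b ≤ κ)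
    {w : ℝ × ℝ × ℝ → ℝ}
    (hw : WeakOp (spaceTime T).dom (opEnd (spaceTime T) (opPoly m P a) (b + m)) v w) :
    ∫⁻ t in timeI T, weightSq α (fun q => w (t, q)) ≤ intNormSq T m P κ α v := by
  refine le_iInf₂ fun g hg => lintegral_mono_ae ?_
  have h1 := (isWeak_iff _ (coe_opT _ m P a b) v _).1 (hg (a, b) (mem_multiIdx.2 hl))
  filter_upwards [ae_slice (hw.ae_eq HalfSpace.IsLinear.isOpen h1)] with t ht
  rw [weightSq_congr ht]
  exact Finset.single_le_sum (f := fun l => weightSq α (fun q => g l (t, q)))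
    (fun _ _ => zero_le) (mem_multiIdx.2 hl)

theorem lintegral_weightSq_le_intNormDtSq {v : ℝ × ℝ × ℝ → ℝ} {a b : ℕ} (hl : a + b ≤ κ)
    {w : ℝ × ℝ × ℝ → ℝ}
    (hw : WeakOp (spaceTime T).dom
      (dtEnd T * opEnd (spaceTime T) (opPoly m P a) (b + m)) v w) :
    ∫⁻ t in timeI T, weightSq α (fun q => w (t, q)) ≤ intNormDtSq T m P κ α v := by
  refine le_iInf₂ fun g hg => lintegral_mono_ae ?_
  have h1 := (isWeak_iff _ (coe_pdT_opT m P a b) v _).1 (hg (a, b) (mem_multiIdx.2 hl))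
  filter_upwards [ae_slice (hw.ae_eq HalfSpace.IsLinear.isOpen h1)] with t ht
  rw [weightSq_congr ht]
  exact Finset.single_le_sum (f := fun l => weightSq α (fun q => g l (t, q)))
    (fun _ _ => zero_le) (mem_multiIdx.2 hl)

theorem ae_weightSq_le_supNormSq {v : ℝ × ℝ × ℝ → ℝ} {a b : ℕ} (hl : a + b ≤ κ)
    {w : ℝ × ℝ × ℝ → ℝ}
    (hw : WeakOp (spaceTime T).dom (opEnd (spaceTime T) (opPoly m P a) (b + m)) v w) :
    ∀ᵐ t ∂volume.restrict (timeI T), weightSq α (fun q => w (t, q)) ≤ supNormSq T m P κ α v := by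
  have h2 : essSup (fun t => weightSq α (fun q => w (t, q))) (volume.restrict (timeI T)) ≤
      supNormSq T m P κ α v := by
    refine le_iInf₂ fun g hg => essSup_mono_ae ?_
    have h1 := (isWeak_iff _ (coe_opT _ m P a b) v _).1 (hg (a, b) (mem_multiIdx.2 hl))
    filter_upwards [ae_slice (hw.ae_eq HalfSpace.IsLinear.isOpen h1)] with t ht
    rw [weightSq_congr ht]
    exact Finset.single_le_sum (f := fun l => weightSq α (fun q => g l (t, q)))
      (fun _ _ => zero_le) (mem_multiIdx.2 hl)
  filter_upwards [ENNReal.ae_le_essSup fun t => weightSq α (fun q => w (t, q))] with t ht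
  exact ht.trans h2

end Extract

/-! ### Weighted integrals and Hardy's inequality -/

section Hardy

/-- The Cauchy-Schwarz inequality for lower integrals. -/
theorem lintegral_mul_sq_le {α : Type} [MeasurableSpace α] {μ : Measure α} {f g : α → ℝ≥0∞}
    (hf : AEMeasurable f μ) (hg : AEMeasurable g μ) :
    (∫⁻ a, f a * g a ∂μ) ^ 2 ≤ (∫⁻ a, f a ^ 2 ∂μ) * ∫⁻ a, g a ^ 2 ∂μ := by
  have h := ENNReal.lintegral_mul_le_Lp_mul_Lq μ Real.HolderConjugate.two_two hf hg
  simp only [Pi.mul_apply, ENNReal.rpow_ofNat] at h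
  calc (∫⁻ a, f a * g a ∂μ) ^ 2
      ≤ ((∫⁻ a, f a ^ 2 ∂μ) ^ (1 / 2 : ℝ) * (∫⁻ a, g a ^ 2 ∂μ) ^ (1 / 2 : ℝ)) ^ 2 := by gcongr
    _ = _ := by
      rw [mul_pow, ← ENNReal.rpow_ofNat, ← ENNReal.rpow_mul, ← ENNReal.rpow_ofNat,
        ← ENNReal.rpow_mul]
      norm_num

theorem enorm_add_sq_le (a b : ℝ) : ‖a + b‖ₑ ^ 2 ≤ 2 * ‖a‖ₑ ^ 2 + 2 * ‖b‖ₑ ^ 2 := by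
  have h : (a + b) ^ 2 ≤ 2 * a ^ 2 + 2 * b ^ 2 := by nlinarith [sq_nonneg (a - b)]
  have e : ∀ c : ℝ, ‖c‖ₑ ^ 2 = ENNReal.ofReal (c ^ 2) := fun c => by
    rw [Real.enorm_eq_ofReal_abs, ← ENNReal.ofReal_pow (abs_nonneg c), sq_abs]
  have e2 : (2 : ℝ≥0∞) = ENNReal.ofReal 2 := by simp
  rw [e, e, e, e2, ← ENNReal.ofReal_mul zero_le_two, ← ENNReal.ofReal_mul zero_le_two,
    ← ENNReal.ofReal_add (by positivity) (by positivity)]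
  exact ENNReal.ofReal_le_ofReal h

theorem enorm_sq (c : ℝ) : ‖c‖ₑ ^ 2 = ENNReal.ofReal (c ^ 2) := by
  rw [Real.enorm_eq_ofReal_abs, ← ENNReal.ofReal_pow (abs_nonneg c), sq_abs]

theorem measurable_ofReal_rpow (a : ℝ) : Measurable fun x : ℝ => ENNReal.ofReal (x ^ a) :=
  (measurable_id.pow_const a).ennreal_ofReal

theorem ofReal_rpow_mul {x : ℝ} (hx : 0 < x) (a b : ℝ) :
    ENNReal.ofReal (x ^ a) * ENNReal.ofReal (x ^ b) = ENNReal.ofReal (x ^ (a + b)) := by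
  rw [← ENNReal.ofReal_mul (by positivity), Real.rpow_add hx]

theorem ofReal_rpow_sq {x : ℝ} (hx : 0 < x) (a : ℝ) :
    ENNReal.ofReal (x ^ a) ^ 2 = ENNReal.ofReal (x ^ (2 * a)) := by
  rw [pow_two, ofReal_rpow_mul hx, two_mul]

/-- `∫_S x^(-2ρ-1) u² dx`. -/
def wN (S : Set ℝ) (ρ : ℝ) (u : ℝ → ℝ) : ℝ≥0∞ :=
  ∫⁻ x in S, ENNReal.ofReal (x ^ (-2 * ρ - 1)) * ‖u x‖ₑ ^ 2

theorem wN_mono {S S' : Set ℝ} (h : S ⊆ S') (ρ : ℝ) (u : ℝ → ℝ) : wN S ρ u ≤ wN S' ρ u :=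
  lintegral_mono_set h

theorem wN_congr {S : Set ℝ} {ρ : ℝ} {u u' : ℝ → ℝ} (h : ∀ᵐ x ∂volume.restrict S, u x = u' x) :
    wN S ρ u = wN S ρ u' := by
  refine lintegral_congr_ae ?_
  filter_upwards [h] with x hx
  rw [hx]

theorem wN_add_le {S : Set ℝ} {ρ : ℝ} {u u' : ℝ → ℝ}
    (h : AEMeasurable u (volume.restrict S)) :
    wN S ρ (fun x => u x + u' x) ≤ 2 * wN S ρ u + 2 * wN S ρ u' := by
  calc wN S ρ (fun x => u x + u' x)
      ≤ ∫⁻ x in S, (2 * (ENNReal.ofReal (x ^ (-2 * ρ - 1)) * ‖u x‖ₑ ^ 2) +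
          2 * (ENNReal.ofReal (x ^ (-2 * ρ - 1)) * ‖u' x‖ₑ ^ 2)) := by
        refine lintegral_mono fun x => ?_
        calc ENNReal.ofReal (x ^ (-2 * ρ - 1)) * ‖u x + u' x‖ₑ ^ 2
            ≤ ENNReal.ofReal (x ^ (-2 * ρ - 1)) * (2 * ‖u x‖ₑ ^ 2 + 2 * ‖u' x‖ₑ ^ 2) := by
              gcongr
              exact enorm_add_sq_le _ _
          _ = _ := by ring
    _ = _ := by
        rw [lintegral_add_left', lintegral_const_mul' _ _ (by simp),
          lintegral_const_mul' _ _ (by simp)]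
        · rfl
        · exact (((measurable_ofReal_rpow _).aemeasurable).mul
            ((h.enorm).pow_const 2)).const_mul 2

theorem wN_const_mul {S : Set ℝ} {ρ : ℝ} (c : ℝ) (u : ℝ → ℝ) :
    wN S ρ (fun x => c * u x) = ‖c‖ₑ ^ 2 * wN S ρ u := by
  rw [wN, wN, ← lintegral_const_mul' _ _ (by simp)]
  congr 1
  ext x
  rw [enorm_mul, mul_pow]
  ring

theorem wN_rpow_mul {S : Set ℝ} (hS : MeasurableSet S) (hS0 : S ⊆ Ioi 0) (ρ γ : ℝ) (u : ℝ → ℝ) :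
    wN S ρ (fun x => x ^ γ * u x) = wN S (ρ - γ) u := by
  refine setLIntegral_congr_fun hS fun x hx => ?_
  have h0 : (0 : ℝ) < x := hS0 hx
  simp only [enorm_mul, mul_pow]
  rw [enorm_sq (x ^ γ), ← mul_assoc, ← ENNReal.ofReal_mul (by positivity), ← Real.rpow_natCast,
    ← Real.rpow_mul h0.le, ← Real.rpow_add h0]
  congr 3
  push_cast
  ring

theorem lintegral_Ioo_rpow {σ x : ℝ} (hσ : 0 < σ) (hx : 0 < x) :
    ∫⁻ s in Ioo 0 x, ENNReal.ofReal (s ^ (σ - 1)) = ENNReal.ofReal (x ^ σ / |σ|) := by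
  rw [← ofReal_integral_eq_lintegral_ofReal]
  · rw [← integral_Ioc_eq_integral_Ioo, ← intervalIntegral.integral_of_le hx.le,
      integral_rpow (Or.inl (by linarith)), abs_of_pos hσ]
    simp [hσ.ne']
  · exact ((intervalIntegral.intervalIntegrable_rpow' (by linarith)).1).mono_set Ioo_subset_Ioc_self
  · filter_upwards [ae_restrict_mem measurableSet_Ioo] with s hs
    exact Real.rpow_nonneg hs.1.le _

theorem lintegral_Ioi_rpow {σ x : ℝ} (hσ : σ < 0) (hx : 0 < x) :
    ∫⁻ s in Ioi x, ENNReal.ofReal (s ^ (σ - 1)) = ENNReal.ofReal (x ^ σ / |σ|) := by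
  rw [← ofReal_integral_eq_lintegral_ofReal]
  · rw [integral_Ioi_rpow_of_lt (by linarith) hx, abs_of_neg hσ]
    congr 1
    simp only [sub_add_cancel]
    rw [neg_div, div_neg]
  · exact integrableOn_Ioi_rpow_of_lt (by linarith) hx
  · filter_upwards [ae_restrict_mem measurableSet_Ioi] with s hs
    exact Real.rpow_nonneg (hx.trans hs).le _

/-- The part of `(0, ∞)` from which `x ^ σ` can be integrated up to `x`: it is `(0, x)` for
`σ > 0` and `(x, ∞)` for `σ < 0`. -/
def side (σ x : ℝ) : Set ℝ := if 0 < σ then Ioo 0 x else Ioi x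

theorem measurableSet_side (σ x : ℝ) : MeasurableSet (side σ x) := by
  unfold side
  split_ifs
  exacts [measurableSet_Ioo, measurableSet_Ioi]

theorem side_subset {σ x : ℝ} (hx : 0 < x) : side σ x ⊆ Ioi 0 := by
  unfold side
  split_ifs
  exacts [fun s hs => hs.1, fun s hs => hx.trans hs]

theorem lintegral_side_rpow {σ x : ℝ} (hσ : σ ≠ 0) (hx : 0 < x) :
    ∫⁻ s in side σ x, ENNReal.ofReal (s ^ (σ - 1)) = ENNReal.ofReal (x ^ σ / |σ|) := by
  unfold side
  split_ifs with h
  · exact lintegral_Ioo_rpow h hx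
  · exact lintegral_Ioi_rpow (lt_of_le_of_ne (not_lt.1 h) hσ) hx

theorem mem_side_neg {σ x s : ℝ} (hσ : σ ≠ 0) (hx : 0 < x) (hs : 0 < s) :
    s ∈ side σ x ↔ x ∈ side (-σ) s := by
  unfold side
  rcases lt_or_gt_of_ne hσ with h | h
  · simp [h, not_lt.2 h.le, hx]
  · simp [h, not_lt.2 h.le, hs]

theorem sq_lintegral_side_le {σ x : ℝ} (hσ : σ ≠ 0) (hx : 0 < x) {f : ℝ → ℝ≥0∞}
    (hf : AEMeasurable f (volume.restrict (Ioi 0))) :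
    (∫⁻ s in side σ x, f s * ENNReal.ofReal (s ^ (-1 : ℝ))) ^ 2 ≤
      ENNReal.ofReal (x ^ σ / |σ|) *
        ∫⁻ s in side σ x, f s ^ 2 * ENNReal.ofReal (s ^ (-σ - 1)) := by
  have hm : ∀ᵐ s ∂volume.restrict (side σ x), 0 < s := by
    filter_upwards [ae_restrict_mem (measurableSet_side σ x)] with s hs
    exact side_subset hx hs
  have h1 := lintegral_mul_sq_le (μ := volume.restrict (side σ x))
    (f := fun s => ENNReal.ofReal (s ^ ((σ - 1) / 2)))
    (g := fun s => f s * ENNReal.ofReal (s ^ ((-σ - 1) / 2)))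
    (measurable_ofReal_rpow _).aemeasurable
    ((hf.mono_measure (Measure.restrict_mono (side_subset hx) le_rfl)).mul
      (measurable_ofReal_rpow _).aemeasurable)
  have e1 : ∫⁻ s in side σ x, f s * ENNReal.ofReal (s ^ (-1 : ℝ)) =
      ∫⁻ s in side σ x, ENNReal.ofReal (s ^ ((σ - 1) / 2)) *
        (f s * ENNReal.ofReal (s ^ ((-σ - 1) / 2))) := by
    refine lintegral_congr_ae ?_
    filter_upwards [hm] with s hs
    rw [mul_left_comm, ofReal_rpow_mul hs]
    congr 4
    ring
  have e2 : ∫⁻ s in side σ x, ENNReal.ofReal (s ^ ((σ - 1) / 2)) ^ 2 =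
      ENNReal.ofReal (x ^ σ / |σ|) := by
    rw [← lintegral_side_rpow hσ hx]
    refine lintegral_congr_ae ?_
    filter_upwards [hm] with s hs
    rw [ofReal_rpow_sq hs]
    congr 2
    ring
  have e3 : ∫⁻ s in side σ x, (f s * ENNReal.ofReal (s ^ ((-σ - 1) / 2))) ^ 2 =
      ∫⁻ s in side σ x, f s ^ 2 * ENNReal.ofReal (s ^ (-σ - 1)) := by
    refine lintegral_congr_ae ?_
    filter_upwards [hm] with s hs
    rw [mul_pow, ofReal_rpow_sq hs]
    congr 3
    ring
  rw [e1, ← e3, ← e2]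
  exact h1

/-- Hardy's inequality. -/
theorem hardy {σ : ℝ} (hσ : σ ≠ 0) {f : ℝ → ℝ≥0∞}
    (hf : AEMeasurable f (volume.restrict (Ioi 0))) :
    ∫⁻ x in Ioi 0, ENNReal.ofReal (x ^ (-2 * σ - 1)) *
        (∫⁻ s in side σ x, f s * ENNReal.ofReal (s ^ (-1 : ℝ))) ^ 2 ≤
      ENNReal.ofReal ((σ ^ 2)⁻¹) *
        ∫⁻ s in Ioi 0, ENNReal.ofReal (s ^ (-2 * σ - 1)) * f s ^ 2 := by
  have hA : MeasurableSet {q : ℝ × ℝ | q.2 ∈ side σ q.1} := by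
    unfold side
    split_ifs
    · exact (measurableSet_lt measurable_const measurable_snd).inter
        (measurableSet_lt measurable_snd measurable_fst)
    · exact measurableSet_lt measurable_fst measurable_snd
  -- the integrand after the Cauchy-Schwarz inequality
  let F : ℝ → ℝ → ℝ≥0∞ := fun x s => {q : ℝ × ℝ | q.2 ∈ side σ q.1}.indicator (fun q =>
    ENNReal.ofReal (q.1 ^ (-σ - 1)) * (f q.2 ^ 2 * ENNReal.ofReal (q.2 ^ (-σ - 1)))) (x, s)
  have hF : AEMeasurable (Function.uncurry F)
      ((volume.restrict (Ioi 0)).prod (volume.restrict (Ioi 0))) := by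
    refine AEMeasurable.indicator ?_ hA
    refine ((measurable_ofReal_rpow _).comp measurable_fst).aemeasurable.mul ?_
    have h2 : AEMeasurable (fun q : ℝ × ℝ => f q.2)
      ((volume.restrict (Ioi 0)).prod (volume.restrict (Ioi 0))) := hf.comp_snd
    exact (h2.pow_const 2).mul ((measurable_ofReal_rpow _).comp measurable_snd).aemeasurable
  have hσ' : ENNReal.ofReal (|σ|⁻¹) ≠ ⊤ := ENNReal.ofReal_ne_top
  calc _ ≤ ∫⁻ x in Ioi 0, ENNReal.ofReal (|σ|⁻¹) * ∫⁻ s in Ioi 0, F x s := by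
        refine lintegral_mono_ae ?_
        filter_upwards [ae_restrict_mem measurableSet_Ioi] with x hx
        have hx' : (0 : ℝ) < x := hx
        have e1 : ∫⁻ s in Ioi 0, F x s = ENNReal.ofReal (x ^ (-σ - 1)) *
            ∫⁻ s in side σ x, f s ^ 2 * ENNReal.ofReal (s ^ (-σ - 1)) := by
          rw [← lintegral_const_mul' _ _ ENNReal.ofReal_ne_top]
          have : (fun s => F x s) = (side σ x).indicator fun s => ENNReal.ofReal (x ^ (-σ - 1)) *
              (f s ^ 2 * ENNReal.ofReal (s ^ (-σ - 1))) := by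
            ext s
            simp only [F, indicator, mem_ofPred_eq]
          rw [this, lintegral_indicator (measurableSet_side σ x),
            Measure.restrict_restrict (measurableSet_side σ x),
            inter_eq_self_of_subset_left (side_subset hx')]
        rw [e1]
        calc _ ≤ ENNReal.ofReal (x ^ (-2 * σ - 1)) * (ENNReal.ofReal (x ^ σ / |σ|) *
              ∫⁻ s in side σ x, f s ^ 2 * ENNReal.ofReal (s ^ (-σ - 1))) := by
              gcongr
              exact sq_lintegral_side_le hσ hx' hf
          _ = _ := by
              rw [← mul_assoc, ← mul_assoc, ← ENNReal.ofReal_mul (by positivity),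
                ← ENNReal.ofReal_mul (by positivity)]
              congr 2
              rw [mul_div_assoc', ← Real.rpow_add hx', div_eq_inv_mul]
              congr 2
              ring
    _ = ENNReal.ofReal (|σ|⁻¹) * ∫⁻ s in Ioi 0, ∫⁻ x in Ioi 0, F x s := by
        rw [lintegral_const_mul' _ _ hσ', lintegral_lintegral_swap hF]
    _ = ENNReal.ofReal (|σ|⁻¹) * ∫⁻ s in Ioi 0, ENNReal.ofReal (|σ|⁻¹) *
          (ENNReal.ofReal (s ^ (-2 * σ - 1)) * f s ^ 2) := by
        congr 1
        refine setLIntegral_congr_fun measurableSet_Ioi fun s hs => ?_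
        have hs' : (0 : ℝ) < s := hs
        have : ∀ x ∈ Ioi (0 : ℝ), F x s = (side (-σ) s).indicator (fun x =>
            ENNReal.ofReal (x ^ (-σ - 1))) x * (f s ^ 2 * ENNReal.ofReal (s ^ (-σ - 1))) := by
          intro x hx
          have := mem_side_neg (x := x) hσ hx hs'
          by_cases h : s ∈ side σ x
          · simp [F, indicator, h, this.1 h]
          · simp [F, indicator, h, mt this.2 h]
        rw [setLIntegral_congr_fun measurableSet_Ioi this, lintegral_mul_const _
          ((measurable_ofReal_rpow _).indicator (measurableSet_side _ _)),
          lintegral_indicator (measurableSet_side _ _),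
            Measure.restrict_restrict (measurableSet_side _ _),
            inter_eq_self_of_subset_left (side_subset hs'),
            lintegral_side_rpow (neg_ne_zero.2 hσ) hs']
        rw [mul_comm (f s ^ 2), ← mul_assoc, ← mul_assoc, ← ENNReal.ofReal_mul (by positivity),
          ← ENNReal.ofReal_mul (by positivity), abs_neg]
        congr 2
        rw [div_eq_inv_mul, mul_assoc, ← Real.rpow_add hs']
        congr 2
        ring
    _ = _ := by
        rw [lintegral_const_mul' _ _ hσ', ← mul_assoc, ← ENNReal.ofReal_mul (by positivity)]
        congr 2
        rw [← mul_inv, ← sq, sq_abs]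

theorem sq_lintegral_side_le_wN {σ x : ℝ} (hσ : σ ≠ 0) (hx : 0 < x) {h : ℝ → ℝ}
    (hf : AEMeasurable h (volume.restrict (Ioi 0))) :
    (∫⁻ s in side σ x, ‖h s‖ₑ * ENNReal.ofReal (s ^ (-1 : ℝ))) ^ 2 ≤
      ENNReal.ofReal (x ^ (2 * σ) / |σ|) * wN (side σ x) σ h := by
  refine (sq_lintegral_side_le hσ hx hf.enorm).trans ?_
  have h1 : ∫⁻ s in side σ x, ‖h s‖ₑ ^ 2 * ENNReal.ofReal (s ^ (-σ - 1)) ≤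
      ENNReal.ofReal (x ^ σ) * wN (side σ x) σ h := by
    rw [wN, ← lintegral_const_mul' _ _ ENNReal.ofReal_ne_top]
    refine setLIntegral_mono_ae' (measurableSet_side σ x) (Eventually.of_forall fun s hs => ?_)
    have hs0 : (0 : ℝ) < s := side_subset hx hs
    rw [mul_comm, ← mul_assoc, ← ENNReal.ofReal_mul (by positivity)]
    gcongr
    have h2 : s ^ σ ≤ x ^ σ := by
      unfold side at hs
      split_ifs at hs with hσ'
      · exact Real.rpow_le_rpow hs0.le hs.2.le hσ'.le
      · exact Real.rpow_le_rpow_of_nonpos hx (le_of_lt hs) (not_lt.1 hσ')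
    calc s ^ (-σ - 1) = s ^ σ * s ^ (-2 * σ - 1) := by
          rw [← Real.rpow_add hs0]
          congr 1
          ring
      _ ≤ _ := by gcongr
  calc _ ≤ ENNReal.ofReal (x ^ σ / |σ|) * (ENNReal.ofReal (x ^ σ) * wN (side σ x) σ h) := by gcongr
    _ = _ := by
      rw [← mul_assoc, ← ENNReal.ofReal_mul (by positivity)]
      congr 2
      rw [two_mul, Real.rpow_add hx]
      ring

end Hardy

/-! ### The operator `D_x` on functions of `x` alone -/

section OneDim

/-- `w` is a primitive of `f` on `(0, ∞)`. -/
def Prim (w f : ℝ → ℝ) : Prop :=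
  ∀ x₁ x₂ : ℝ, 0 < x₁ → 0 < x₂ → IntervalIntegrable f volume x₁ x₂ ∧
    w x₂ - w x₁ = ∫ s in x₁..x₂, f s

/-- `D_x u = g` for a function `u` on `(0, ∞)` which is locally absolutely continuous after a
modification on a null set. -/
def XD (u g : ℝ → ℝ) : Prop :=
  ∃ w : ℝ → ℝ, (∀ᵐ x ∂volume.restrict (Ioi 0), u x = w x) ∧ Prim w fun s => g s / s

theorem uIcc_subset_Ioi {a b : ℝ} (ha : 0 < a) (hb : 0 < b) : uIcc a b ⊆ Ioi 0 :=
  fun _ hx => (lt_min ha hb).trans_le hx.1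

theorem Prim.continuousOn {w f : ℝ → ℝ} (h : Prim w f) : ContinuousOn w (Ioi 0) := by
  intro x hx
  have hx' : (0 : ℝ) < x := hx
  have h0 : (0 : ℝ) < x / 2 := by linarith
  have h1 : ContinuousOn (fun y => w (x / 2) + ∫ s in (x / 2)..y, f s) (uIcc (x / 2) (2 * x)) :=
    continuousOn_const.add (intervalIntegral.continuousOn_primitive_interval'
      (h (x / 2) (2 * x) h0 (by linarith)).1 left_mem_uIcc)
  have hm : uIcc (x / 2) (2 * x) ∈ 𝓝 x := by
    rw [uIcc_of_le (by linarith)]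
    exact Icc_mem_nhds (by linarith) (by linarith)
  have h2 := h1.continuousAt hm
  refine (h2.congr ?_).continuousWithinAt
  filter_upwards [lt_mem_nhds hx'] with y hy
  rw [← (h (x / 2) y h0 hy).2]
  ring

theorem Prim.mul {w f k k' : ℝ → ℝ} (h : Prim w f) (hk : ContDiffOn ℝ 1 k (Ioi 0))
    (hk' : ∀ x ∈ Ioi (0 : ℝ), HasDerivAt k (k' x) x) :
    Prim (fun x => k x * w x) fun x => k' x * w x + k x * f x := by
  intro a b ha hb
  have hab := uIcc_subset_Ioi ha hb
  obtain ⟨hi, -⟩ := h a b ha hb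
  have hw : ∀ x ∈ uIcc a b, w x = w a + ∫ s in a..x, f s := fun x hx => by
    rw [← (h a x ha (hab hx)).2]
    ring
  set W : ℝ → ℝ := fun x => w a + ∫ s in a..x, f s with hW
  have hWac : AbsolutelyContinuousOnInterval W a b := by
    have h1 : AbsolutelyContinuousOnInterval (fun _ : ℝ => w a) a b :=
      (LipschitzWith.const (w a)).lipschitzOnWith.absolutelyContinuousOnInterval
    exact h1.add (hi.absolutelyContinuousOnInterval_intervalIntegral left_mem_uIcc)
  have hkac : AbsolutelyContinuousOnInterval k a b :=
    (hk.mono hab).absolutelyContinuousOnInterval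
  have hderiv : ∀ᵐ x, x ∈ uIcc a b → deriv W x = f x := by
    filter_upwards [hi.ae_hasDerivAt_integral] with x hx hxm
    exact ((hx hxm a left_mem_uIcc).const_add (w a)).deriv
  have key := hkac.integral_deriv_mul_eq_sub hWac
  have hcont : ContinuousOn k' (uIcc a b) := by
    have h1 : ContinuousOn (deriv k) (Ioi 0) := hk.continuousOn_deriv_of_isOpen isOpen_Ioi le_rfl
    exact (h1.mono hab).congr fun x hx => ((hk' x (hab hx)).deriv).symm
  have hcw := h.continuousOn.mono hab
  refine ⟨(hcont.mul hcw).intervalIntegrable.add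
    (hi.continuousOn_mul (hk.continuousOn.mono hab)), ?_⟩
  have hWa : W a = w a := (hw a left_mem_uIcc).symm
  have hWb : W b = w b := (hw b right_mem_uIcc).symm
  rw [hWa, hWb] at key
  refine key.symm.trans (intervalIntegral.integral_congr_ae ?_)
  filter_upwards [hderiv] with x hx hxm
  have hxm' : x ∈ uIcc a b := uIoc_subset_uIcc hxm
  rw [hx hxm', (hk' x (hab hxm')).deriv, show W x = w x from (hw x hxm').symm]

namespace XD

variable {u g u' g' : ℝ → ℝ}

theorem aemeasurable (h : XD u g) : AEMeasurable u (volume.restrict (Ioi 0)) := by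
  obtain ⟨w, hw, hp⟩ := h
  exact (hp.continuousOn.aemeasurable measurableSet_Ioi).congr (hw.mono fun _ h => h.symm)

theorem congr_right (h : XD u g) (hg : ∀ᵐ x ∂volume.restrict (Ioi 0), g x = g' x) : XD u g' := by
  obtain ⟨w, hw, hp⟩ := h
  refine ⟨w, hw, fun a b ha hb => ?_⟩
  have h1 : ∀ᵐ x ∂volume.restrict (uIoc a b), g x / x = g' x / x := by
    filter_upwards [ae_restrict_of_ae_restrict_of_subset
      (uIoc_subset_uIcc.trans (uIcc_subset_Ioi ha hb)) hg] with x hx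
    rw [hx]
  refine ⟨(hp a b ha hb).1.congr_ae h1, ?_⟩
  rw [(hp a b ha hb).2]
  exact intervalIntegral.integral_congr_ae_restrict h1

theorem aemeasurable_right (h : XD u g) : AEMeasurable g (volume.restrict (Ioi 0)) := by
  obtain ⟨w, -, hp⟩ := h
  have h1 : ∀ n : ℕ, AEMeasurable g (volume.restrict (Ioc ((n : ℝ) + 2)⁻¹ (n + 2))) := by
    intro n
    have h0 : (0 : ℝ) < (n : ℝ) + 2 := by positivity
    have h2 :=
      ((hp ((n : ℝ) + 2)⁻¹ (n + 2) (by positivity) h0).1.1).aestronglyMeasurable.aemeasurable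
    refine (h2.mul (measurable_id (α := ℝ)).aemeasurable).congr ?_
    filter_upwards [ae_restrict_mem measurableSet_Ioc] with x hx
    have : x ≠ 0 := ((by positivity : (0 : ℝ) < ((n : ℝ) + 2)⁻¹).trans hx.1).ne'
    simp [this]
  have h2 : Ioi (0 : ℝ) = ⋃ n : ℕ, Ioc ((n : ℝ) + 2)⁻¹ (n + 2) := by
    ext x
    simp only [mem_Ioi, mem_iUnion, mem_Ioc]
    constructor
    · intro hx
      obtain ⟨n, hn⟩ := exists_nat_gt (max x x⁻¹)
      have h3 := (max_lt_iff.1 hn)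
      refine ⟨n, ?_, by linarith⟩
      rw [inv_lt_comm₀ (by positivity) hx]
      linarith
    · rintro ⟨n, hn, -⟩
      exact (by positivity : (0 : ℝ) < ((n : ℝ) + 2)⁻¹).trans hn
  rw [h2, aemeasurable_iUnion_iff]
  exact h1

theorem add (h : XD u g) (h' : XD u' g') : XD (fun x => u x + u' x) fun x => g x + g' x := by
  obtain ⟨w, hw, hp⟩ := h
  obtain ⟨w', hw', hp'⟩ := h'
  refine ⟨fun x => w x + w' x, ?_, fun a b ha hb => ?_⟩
  · filter_upwards [hw, hw'] with x h1 h2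
    rw [h1, h2]
  · have h1 := hp a b ha hb
    have h2 := hp' a b ha hb
    simp only [add_div]
    refine ⟨h1.1.add h2.1, ?_⟩
    rw [intervalIntegral.integral_add h1.1 h2.1, ← h1.2, ← h2.2]
    ring

theorem rpow_mul (h : XD u g) (γ : ℝ) :
    XD (fun x => x ^ γ * u x) fun x => x ^ γ * (g x + γ * u x) := by
  obtain ⟨w, hw, hp⟩ := h
  have h1 : XD (fun x => x ^ γ * u x) fun x => x ^ γ * (g x + γ * w x) := by
    refine ⟨fun x => x ^ γ * w x, ?_, ?_⟩
    · filter_upwards [hw] with x h1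
      rw [h1]
    · have h2 := hp.mul (k := fun x => x ^ γ) (k' := fun x => γ * x ^ (γ - 1))
        (fun x hx => (Real.contDiffAt_rpow_const_of_ne (ne_of_gt hx)).contDiffWithinAt)
        fun x hx => Real.hasDerivAt_rpow_const (Or.inl (ne_of_gt hx))
      intro a b ha hb
      obtain ⟨h3, h4⟩ := h2 a b ha hb
      have e : ∀ x ∈ uIoc a b, γ * x ^ (γ - 1) * w x + x ^ γ * (g x / x) =
          x ^ γ * (g x + γ * w x) / x := by
        intro x hx
        have hx0 : (0 : ℝ) < x := uIcc_subset_Ioi ha hb (uIoc_subset_uIcc hx)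
        rw [Real.rpow_sub_one hx0.ne']
        ring
      refine ⟨h3.congr e, h4.trans ?_⟩
      refine intervalIntegral.integral_congr_ae (Eventually.of_forall fun x hx => e x hx)
  refine h1.congr_right ?_
  filter_upwards [hw] with x hx
  rw [hx]

theorem const_mul (h : XD u g) (c : ℝ) : XD (fun x => c * u x) fun x => c * g x := by
  obtain ⟨w, hw, hp⟩ := h
  refine ⟨fun x => c * w x, ?_, fun a b ha hb => ?_⟩
  · filter_upwards [hw] with x h1
    rw [h1]
  · have h1 := hp a b ha hb
    simp only [mul_div_assoc]
    refine ⟨h1.1.const_mul c, ?_⟩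
    rw [intervalIntegral.integral_const_mul, ← h1.2]
    ring

theorem one : XD (fun _ => 1) fun _ => 0 :=
  ⟨fun _ => 1, Eventually.of_forall fun _ => rfl, fun a b _ _ => by simp⟩

theorem rpow (γ : ℝ) : XD (fun x => x ^ γ) fun x => γ * x ^ γ := by
  have := XD.one.rpow_mul γ
  simpa [mul_comm] using this

end XD

theorem enorm_intervalIntegral_le_side {σ x : ℝ} {h : ℝ → ℝ} (hx : 0 < x) {a b : ℝ}
    (hab : Ioc a b ⊆ insert x (side σ x)) (hle : a ≤ b) :
    ‖∫ s in a..b, h s / s‖ₑ ≤ ∫⁻ s in side σ x, ‖h s‖ₑ * ENNReal.ofReal (s ^ (-1 : ℝ)) := by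
  rw [intervalIntegral.integral_of_le hle]
  refine (enorm_integral_le_lintegral_enorm _).trans ?_
  have h1 : ∫⁻ s in side σ x, ‖h s / s‖ₑ =
      ∫⁻ s in side σ x, ‖h s‖ₑ * ENNReal.ofReal (s ^ (-1 : ℝ)) := by
    refine setLIntegral_congr_fun (measurableSet_side σ x) fun s hs => ?_
    have hs0 : (0 : ℝ) < s := side_subset hx hs
    rw [div_eq_mul_inv, enorm_mul, Real.rpow_neg_one,
      Real.enorm_of_nonneg (inv_pos.2 hs0).le]
  rw [← h1]
  have h2 : side σ x =ᵐ[volume] (insert x (side σ x) : Set ℝ) := (insert_ae_eq_self x _).symm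
  rw [setLIntegral_congr h2]
  exact lintegral_mono_set hab

/-- If `D_x u = h` with `h ∈ L²(x^(-2σ-1) dx)`, then `u - c` satisfies Hardy's inequality for
some constant `c`, which is the limit of `u` at `0` or at `∞`. -/
theorem XD.exists_const {u h : ℝ → ℝ} (hu : XD u h) {σ : ℝ} (hσ : σ ≠ 0)
    (hN : wN (Ioi 0) σ h ≠ ⊤) :
    ∃ c : ℝ, wN (Ioi 0) σ (fun x => u x - c) ≤
      ENNReal.ofReal ((σ ^ 2)⁻¹) * wN (Ioi 0) σ h := by
  have hm := hu.aemeasurable_right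
  obtain ⟨w, hw, hp⟩ := hu
  -- the total variation of `w` on the side of `x` from which we integrate
  set V : ℝ → ℝ≥0∞ := fun x => ∫⁻ s in side σ x, ‖h s‖ₑ * ENNReal.ofReal (s ^ (-1 : ℝ)) with hV
  have hV2 : ∀ x, 0 < x → V x ^ 2 ≤ ENNReal.ofReal (x ^ (2 * σ) / |σ|) * wN (Ioi 0) σ h := by
    intro x hx
    refine (sq_lintegral_side_le_wN hσ hx hm).trans ?_
    gcongr
    exact wN_mono (side_subset hx) _ _
  have hVfin : ∀ x, 0 < x → V x ≠ ⊤ := by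
    intro x hx h0
    have := hV2 x hx
    rw [h0] at this
    exact absurd (top_le_iff.1 (by simpa using this))
      (ENNReal.mul_ne_top ENNReal.ofReal_ne_top hN)
  have hint : ∀ x, 0 < x → IntegrableOn (fun s => h s / s) (side σ x) := by
    intro x hx
    refine ⟨?_, ?_⟩
    · exact ((hm.mono_measure (Measure.restrict_mono (side_subset hx) le_rfl)).div
        measurable_id.aemeasurable).aestronglyMeasurable
    · rw [hasFiniteIntegral_iff_enorm]
      refine lt_of_le_of_lt (le_of_eq ?_) (lt_top_iff_ne_top.2 (hVfin x hx))
      refine setLIntegral_congr_fun (measurableSet_side σ x) fun s hs => ?_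
      have hs0 : (0 : ℝ) < s := side_subset hx hs
      rw [div_eq_mul_inv, enorm_mul, Real.rpow_neg_one,
        Real.enorm_of_nonneg (inv_pos.2 hs0).le]
  have key : ∃ c : ℝ, ∀ x, 0 < x → ‖w x - c‖ₑ ≤ V x := by
    by_cases hs : 0 < σ
    · have hint1 : ∀ x, 0 < x → IntervalIntegrable (fun s => h s / s) volume 0 x := by
        intro x hx
        rw [intervalIntegrable_iff_integrableOn_Ioo_of_le hx.le]
        simpa [side, hs] using hint x hx
      refine ⟨w 1 - ∫ s in (0 : ℝ)..1, h s / s, fun x hx => ?_⟩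
      have e : w x - (w 1 - ∫ s in (0 : ℝ)..1, h s / s) = ∫ s in (0 : ℝ)..x, h s / s := by
        rw [← intervalIntegral.integral_add_adjacent_intervals (hint1 1 one_pos)
          (hp 1 x one_pos hx).1, ← (hp 1 x one_pos hx).2]
        ring
      rw [e]
      refine enorm_intervalIntegral_le_side hx (fun s hs' => ?_) hx.le
      rcases eq_or_lt_of_le hs'.2 with h1 | h1
      · exact Or.inl h1
      · exact Or.inr (by simpa [side, hs] using ⟨hs'.1, h1⟩)
    · have hint1 : ∀ x, 0 < x → IntegrableOn (fun s => h s / s) (Ioi x) := by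
        intro x hx
        simpa [side, hs] using hint x hx
      refine ⟨w 1 + ∫ s in Ioi (1 : ℝ), h s / s, fun x hx => ?_⟩
      have e : w x - (w 1 + ∫ s in Ioi (1 : ℝ), h s / s) = -∫ s in Ioi x, h s / s := by
        have h1 := intervalIntegral.integral_Ioi_sub_Ioi' (hint1 x hx) (hint1 1 one_pos)
        have h2 := (hp x 1 hx one_pos).2
        linarith
      rw [e, enorm_neg]
      refine (enorm_integral_le_lintegral_enorm _).trans (le_of_eq ?_)
      have : Ioi x = side σ x := by simp [side, hs]
      rw [this]
      refine setLIntegral_congr_fun (measurableSet_side σ x) fun s hs => ?_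
      have hs0 : (0 : ℝ) < s := side_subset hx hs
      rw [div_eq_mul_inv, enorm_mul, Real.rpow_neg_one,
        Real.enorm_of_nonneg (inv_pos.2 hs0).le]
  obtain ⟨c, hc⟩ := key
  refine ⟨c, ?_⟩
  calc wN (Ioi 0) σ (fun x => u x - c)
      ≤ ∫⁻ x in Ioi 0, ENNReal.ofReal (x ^ (-2 * σ - 1)) * V x ^ 2 := by
        refine lintegral_mono_ae ?_
        filter_upwards [hw, ae_restrict_mem measurableSet_Ioi] with x h1 h2
        gcongr
        rw [h1]
        exact hc x h2
    _ ≤ _ := hardy hσ hm.enorm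

theorem wN_one_Ioi {σ : ℝ} (hσ : σ ≤ 0) : wN (Ioi 1) σ (fun _ => 1) = ⊤ := by
  have h1 : ∀ n : ℕ, ENNReal.ofReal (∫ s in (1 : ℝ)..(n + 1), s ^ (-1 : ℝ)) ≤
      wN (Ioi 1) σ (fun _ => 1) := by
    intro n
    have hn : (1 : ℝ) ≤ n + 1 := by
      have : (0 : ℝ) ≤ n := n.cast_nonneg
      linarith
    rw [intervalIntegral.integral_of_le hn, ofReal_integral_eq_lintegral_ofReal]
    · refine (lintegral_mono_ae ?_).trans (lintegral_mono_set Ioc_subset_Ioi_self)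
      filter_upwards [ae_restrict_mem measurableSet_Ioc] with s hs
      simp only [enorm_one, one_pow, mul_one]
      exact ENNReal.ofReal_le_ofReal (Real.rpow_le_rpow_of_exponent_le hs.1.le (by linarith))
    · have h0 : ContinuousOn (fun s : ℝ => s ^ (-1 : ℝ)) (Icc 1 (n + 1)) := by
        refine ContinuousOn.rpow_const continuousOn_id fun s hs => Or.inl ?_
        exact (zero_lt_one.trans_le hs.1).ne'
      exact h0.integrableOn_Icc.mono_set Ioc_subset_Icc_self
    · filter_upwards [ae_restrict_mem measurableSet_Ioc] with s hs
      exact Real.rpow_nonneg (zero_lt_one.trans hs.1).le _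
  have h2 : Tendsto (fun n : ℕ => ENNReal.ofReal (∫ s in (1 : ℝ)..(n + 1), s ^ (-1 : ℝ))) atTop
      (𝓝 ⊤) := by
    have e : ∀ n : ℕ, ∫ s in (1 : ℝ)..(n + 1), s ^ (-1 : ℝ) = Real.log (n + 1) := by
      intro n
      simp only [Real.rpow_neg_one]
      rw [integral_inv_of_pos one_pos (by positivity), div_one]
    simp_rw [e]
    refine ENNReal.tendsto_ofReal_nhds_top.2 (Real.tendsto_log_atTop.comp ?_)
    exact tendsto_atTop_add_const_right _ _ tendsto_natCast_atTop_atTop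
  exact top_le_iff.1 (le_of_tendsto' h2 h1)

theorem XD.conj {u g : ℝ → ℝ} (h : XD u g) (γ : ℝ) :
    XD (fun x => x ^ (-γ) * u x) fun x => x ^ (-γ) * (g x - γ * u x) := by
  have := h.rpow_mul (-γ)
  simpa [sub_eq_add_neg] using this

/-- A function with `(D_x - γ) u ∈ L²(x^(-2ρ-1) dx)` differs from a multiple of `x^γ` by a
function in this space. -/
theorem XD.exists_coef {u g : ℝ → ℝ} (h : XD u g) {γ ρ : ℝ} (hγ : γ ≠ ρ)
    (hN : wN (Ioi 0) ρ (fun x => g x - γ * u x) ≠ ⊤) :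
    ∃ c : ℝ, wN (Ioi 0) ρ (fun x => u x - c * x ^ γ) ≤
      ENNReal.ofReal (((ρ - γ) ^ 2)⁻¹) * wN (Ioi 0) ρ (fun x => g x - γ * u x) := by
  have e : wN (Ioi 0) (ρ - γ) (fun x => x ^ (-γ) * (g x - γ * u x)) =
      wN (Ioi 0) ρ (fun x => g x - γ * u x) := by
    rw [wN_rpow_mul measurableSet_Ioi subset_rfl]
    congr 1
    ring
  obtain ⟨c, hc⟩ := (h.conj γ).exists_const (σ := ρ - γ) (sub_ne_zero.2 hγ.symm) (by rwa [e])
  refine ⟨c, ?_⟩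
  rw [e] at hc
  refine le_trans (le_of_eq ?_) hc
  rw [← wN_rpow_mul measurableSet_Ioi subset_rfl]
  refine wN_congr ?_
  filter_upwards [ae_restrict_mem measurableSet_Ioi] with x hx
  have h0 : (0 : ℝ) < x := hx
  rw [mul_sub, ← mul_assoc, ← Real.rpow_add h0]
  simp
  ring

theorem wN_le_of_le {ρ ρ' : ℝ} (h : ρ' ≤ ρ) (u : ℝ → ℝ) : wN (Ioi 1) ρ u ≤ wN (Ioi 1) ρ' u := by
  refine setLIntegral_mono_ae' measurableSet_Ioi (Eventually.of_forall fun x hx => ?_)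
  gcongr ENNReal.ofReal ?_ * _
  exact Real.rpow_le_rpow_of_exponent_le (show (1 : ℝ) < x from hx).le (by linarith)

theorem wN_le_of_le' {ρ ρ' : ℝ} (h : ρ ≤ ρ') (u : ℝ → ℝ) :
    wN (Ioo 0 1) ρ u ≤ wN (Ioo 0 1) ρ' u := by
  refine setLIntegral_mono_ae' measurableSet_Ioo (Eventually.of_forall fun x hx => ?_)
  gcongr ENNReal.ofReal ?_ * _
  exact Real.rpow_le_rpow_of_exponent_ge hx.1 hx.2.le (by linarith)

/-- If `γ > ρ` and `u` does not grow too fast at infinity, then no multiple of `x^γ` is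
present in `u`. -/
theorem XD.wN_le {u g : ℝ → ℝ} (h : XD u g) {γ ρ ρ₀ : ℝ} (hγ : ρ < γ) (hρ : ρ₀ ≤ ρ)
    (h0 : wN (Ioi 0) ρ₀ u ≠ ⊤) (hN : wN (Ioi 0) ρ (fun x => g x - γ * u x) ≠ ⊤) :
    wN (Ioi 0) ρ u ≤
      ENNReal.ofReal (((ρ - γ) ^ 2)⁻¹) * wN (Ioi 0) ρ (fun x => g x - γ * u x) := by
  obtain ⟨c, hc⟩ := h.exists_coef hγ.ne' hN
  have hc0 : c = 0 := by
    by_contra hc0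
    have h1 : wN (Ioi 1) ρ (fun x => c * x ^ γ) ≤
        2 * wN (Ioi 1) ρ u + 2 * wN (Ioi 1) ρ (fun x => u x - c * x ^ γ) := by
      have := wN_add_le (S := Ioi 1) (ρ := ρ) (u := u) (u' := fun x => -1 * (u x - c * x ^ γ))
        (h.aemeasurable.mono_measure (Measure.restrict_mono (Ioi_subset_Ioi zero_le_one) le_rfl))
      rw [wN_const_mul] at this
      simpa using this
    have h2 : wN (Ioi 1) ρ (fun x => c * x ^ γ) ≠ ⊤ := by
      refine ne_top_of_le_ne_top ?_ h1
      refine ENNReal.add_ne_top.2 ⟨ENNReal.mul_ne_top (by simp) ?_,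
        ENNReal.mul_ne_top (by simp) ?_⟩
      · exact ne_top_of_le_ne_top h0
          ((wN_le_of_le hρ u).trans (wN_mono (Ioi_subset_Ioi zero_le_one) _ _))
      · exact ne_top_of_le_ne_top (ENNReal.mul_ne_top ENNReal.ofReal_ne_top hN)
          ((wN_mono (Ioi_subset_Ioi zero_le_one) _ _).trans hc)
    rw [wN_const_mul] at h2
    have h3 : wN (Ioi 1) ρ (fun x => x ^ γ) = ⊤ := by
      have := wN_rpow_mul (S := Ioi 1) measurableSet_Ioi (Ioi_subset_Ioi zero_le_one) ρ γ
        (fun _ => 1)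
      rw [wN_one_Ioi (by linarith)] at this
      simpa using this
    rw [h3, ENNReal.mul_top (by simpa using hc0)] at h2
    exact h2 rfl
  simpa [hc0] using hc

end OneDim

/-! ### Averages and the coefficient of a power -/

section Averages

theorem rpow_le_of_mem_Icc {l x : ℝ} (hl : 0 < l) (hx : x ∈ Icc l (2 * l)) (a : ℝ) :
    x ^ a ≤ 2 ^ |a| * l ^ a := by
  have hx0 : 0 < x := hl.trans_le hx.1
  have h1 : 1 ≤ x / l := by rw [le_div_iff₀ hl]; linarith [hx.1]
  have h2 : x / l ≤ 2 := by rw [div_le_iff₀ hl]; exact hx.2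
  have h3 : x ^ a = (x / l) ^ a * l ^ a := by
    rw [Real.div_rpow hx0.le hl.le]
    field_simp
  rw [h3]
  gcongr
  calc (x / l) ^ a ≤ (x / l) ^ |a| := Real.rpow_le_rpow_of_exponent_le h1 (le_abs_self a)
    _ ≤ 2 ^ |a| := by gcongr

/-- A smooth function with integral one which is supported in `(1, 2)`. -/
def bump : ℝ → ℝ :=
  (⟨1 / 8, 1 / 4, by norm_num, by norm_num⟩ : ContDiffBump (3 / 2 : ℝ)).normed volume

theorem contDiff_bump : ContDiff ℝ ∞ bump := ContDiffBump.contDiff_normed _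

theorem bump_nonneg (x : ℝ) : 0 ≤ bump x := ContDiffBump.nonneg_normed _ x

theorem integral_bump : ∫ x, bump x = 1 := ContDiffBump.integral_normed _

theorem tsupport_bump : tsupport bump = Icc (5 / 4) (7 / 4) := by
  rw [bump, ContDiffBump.tsupport_normed_eq, Real.closedBall_eq_Icc]
  norm_num

theorem isTest_bump : IsTest (Ioi 0) bump where
  smooth := contDiff_bump
  compact := by
    rw [HasCompactSupport, tsupport_bump]
    exact isCompact_Icc
  subset := by
    rw [tsupport_bump]
    exact fun x hx => (by norm_num : (0 : ℝ) < 5 / 4).trans_le hx.1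

theorem exists_bump_le : ∃ B : ℝ, 0 ≤ B ∧ ∀ x, bump x ≤ B := by
  obtain ⟨B, hB⟩ := isTest_bump.compact.exists_bound_of_continuous contDiff_bump.continuous
  exact ⟨B, (norm_nonneg _).trans (hB 0), fun x => (le_abs_self _).trans (hB x)⟩

/-- The kernel `l⁻¹ φ(x / l) x^(-γ)`. -/
def avKer (γ l x : ℝ) : ℝ := l⁻¹ * bump (x / l) * x ^ (-γ)

/-- A weighted average of `x^(-γ) u` over `(l, 2 l)`. -/
def av (γ l : ℝ) (u : ℝ → ℝ) : ℝ := ∫ x, avKer γ l x * u x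

theorem avKer_eq_zero {γ l x : ℝ} (hl : 0 < l) (hx : x ∉ Ioo l (2 * l)) : avKer γ l x = 0 := by
  have : bump (x / l) = 0 := by
    refine image_eq_zero_of_notMem_tsupport fun h => hx ?_
    rw [tsupport_bump, mem_Icc, le_div_iff₀ hl, div_le_iff₀ hl] at h
    exact ⟨by linarith [h.1], by linarith [h.2]⟩
  rw [avKer, this, mul_zero, zero_mul]

theorem isTest_avKer (γ : ℝ) {l : ℝ} (hl : 0 < l) : IsTest (Ioi 0) (avKer γ l) := by
  have h1 : IsTest (Ioi 0) fun x => bump (x / l) := by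
    have e : (fun x => bump (x / l)) = bump ∘ (Homeomorph.mulRight₀ l⁻¹ (inv_pos.2 hl).ne') := by
      ext x
      simp [div_eq_mul_inv]
    refine ⟨contDiff_bump.comp (contDiff_id.div_const l), ?_, ?_⟩
    · rw [e]
      exact isTest_bump.compact.comp_homeomorph _
    · intro x hx
      rw [e, tsupport_comp_eq_preimage] at hx
      have h2 := isTest_bump.subset hx
      have h3 : 0 < x * l⁻¹ := h2
      exact (pos_iff_pos_of_mul_pos h3).2 (inv_pos.2 hl)
  have h2 := h1.mul_of_contDiffAt (a := fun x => l⁻¹ * x ^ (-γ)) fun x hx =>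
    contDiffAt_const.mul (Real.contDiffAt_rpow_const_of_ne (ne_of_gt hx))
  convert h2 using 1
  ext x
  rw [avKer]
  ring

theorem integral_avKer_rpow (γ : ℝ) {l : ℝ} (hl : 0 < l) : av γ l (fun x => x ^ γ) = 1 := by
  have h1 : ∀ x, avKer γ l x * x ^ γ = l⁻¹ * bump (x / l) := by
    intro x
    by_cases hx : x ∈ Ioo l (2 * l)
    · have h0 : 0 < x := hl.trans hx.1
      rw [avKer, mul_assoc, ← Real.rpow_add h0]
      simp
    · rw [avKer_eq_zero hl hx, zero_mul]
      refine (mul_eq_zero_of_right _ ?_).symm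
      refine image_eq_zero_of_notMem_tsupport fun h => hx ?_
      rw [tsupport_bump, mem_Icc, le_div_iff₀ hl, div_le_iff₀ hl] at h
      exact ⟨by linarith [h.1], by linarith [h.2]⟩
  rw [av]
  simp_rw [h1]
  rw [integral_const_mul, Measure.integral_comp_div (fun x => bump x), integral_bump, abs_of_pos hl]
  simp [hl.ne']

theorem exists_av_sq_le (γ ρ : ℝ) : ∃ K : ℝ≥0, ∀ l : ℝ, 0 < l → ∀ u : ℝ → ℝ,
    AEMeasurable u (volume.restrict (Ioi 0)) →
    ‖av γ l u‖ₑ ^ 2 ≤ K * ENNReal.ofReal (l ^ (2 * (ρ - γ))) * wN (Ioi 0) ρ u := by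
  obtain ⟨B, hB0, hB⟩ := exists_bump_le
  set a : ℝ := 2 * ρ + 1 - 2 * γ with ha
  refine ⟨Real.toNNReal (B ^ 2 * 2 ^ |a|), fun l hl u hu => ?_⟩
  set S := Ioo l (2 * l) with hS
  have hSpos : ∀ x ∈ S, 0 < x := fun x hx => hl.trans hx.1
  have hu' : AEMeasurable u (volume.restrict S) :=
    hu.mono_measure (Measure.restrict_mono hSpos le_rfl)
  have h1 : ‖av γ l u‖ₑ ≤ ∫⁻ x in S, (ENNReal.ofReal (x ^ (ρ + 1 / 2)) * ‖avKer γ l x‖ₑ) *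
      (ENNReal.ofReal (x ^ (-ρ - 1 / 2)) * ‖u x‖ₑ) := by
    rw [av]
    refine (enorm_integral_le_lintegral_enorm _).trans ?_
    rw [← setLIntegral_eq_of_support_subset (s := S)]
    · refine le_of_eq (setLIntegral_congr_fun measurableSet_Ioo fun x hx => ?_)
      have e : ENNReal.ofReal (x ^ (ρ + 1 / 2)) * ENNReal.ofReal (x ^ (-ρ - 1 / 2)) = 1 := by
        rw [ofReal_rpow_mul (hSpos x hx)]
        simp
      rw [enorm_mul, mul_mul_mul_comm, e, one_mul]
    · intro x hx
      by_contra h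
      exact hx (by simp [avKer_eq_zero hl h])
  have hk : Measurable (avKer γ l) := (isTest_avKer γ hl).smooth.continuous.measurable
  have h2 := lintegral_mul_sq_le (μ := volume.restrict S)
    (f := fun x => ENNReal.ofReal (x ^ (ρ + 1 / 2)) * ‖avKer γ l x‖ₑ)
    (g := fun x => ENNReal.ofReal (x ^ (-ρ - 1 / 2)) * ‖u x‖ₑ)
    ((measurable_ofReal_rpow _).mul hk.enorm).aemeasurable
    ((measurable_ofReal_rpow _).aemeasurable.mul hu'.enorm)
  have h3 : ∫⁻ x in S, (ENNReal.ofReal (x ^ (-ρ - 1 / 2)) * ‖u x‖ₑ) ^ 2 = wN S ρ u := by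
    refine setLIntegral_congr_fun measurableSet_Ioo fun x hx => ?_
    rw [mul_pow, ofReal_rpow_sq (hSpos x hx)]
    congr 3
    ring
  have h4 : ∫⁻ x in S, (ENNReal.ofReal (x ^ (ρ + 1 / 2)) * ‖avKer γ l x‖ₑ) ^ 2 ≤
      ENNReal.ofReal (B ^ 2 * 2 ^ |a|) * ENNReal.ofReal (l ^ (2 * (ρ - γ))) := by
    calc _ ≤ ∫⁻ _ in S, ENNReal.ofReal (B ^ 2 * 2 ^ |a| * l ^ (2 * (ρ - γ) - 1)) := by
          refine setLIntegral_mono_ae' measurableSet_Ioo (Eventually.of_forall fun x hx => ?_)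
          have hx0 := hSpos x hx
          rw [mul_pow, ofReal_rpow_sq hx0, enorm_sq, ← ENNReal.ofReal_mul (by positivity)]
          refine ENNReal.ofReal_le_ofReal ?_
          have e1 : (avKer γ l x) ^ 2 ≤ l⁻¹ ^ 2 * B ^ 2 * x ^ (-2 * γ) := by
            rw [avKer, mul_pow, mul_pow, ← Real.rpow_mul_natCast hx0.le]
            have := pow_le_pow_left₀ (bump_nonneg (x / l)) (hB (x / l)) 2
            have e2 : -γ * (2 : ℕ) = -2 * γ := by push_cast; ring
            rw [e2]
            gcongr
          calc x ^ (2 * (ρ + 1 / 2)) * avKer γ l x ^ 2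
              ≤ x ^ (2 * (ρ + 1 / 2)) * (l⁻¹ ^ 2 * B ^ 2 * x ^ (-2 * γ)) := by gcongr
            _ = l⁻¹ ^ 2 * B ^ 2 * x ^ a := by
                rw [mul_left_comm, ← Real.rpow_add hx0]
                congr 2
                rw [ha]
                ring
            _ ≤ l⁻¹ ^ 2 * B ^ 2 * (2 ^ |a| * l ^ a) := by
                gcongr
                exact rpow_le_of_mem_Icc hl (Ioo_subset_Icc_self hx) a
            _ = B ^ 2 * 2 ^ |a| * (l ^ a * l ^ (-2 : ℝ)) := by
                rw [Real.rpow_neg hl.le, inv_pow, Real.rpow_two]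
                ring
            _ = _ := by
                rw [← Real.rpow_add hl]
                congr 2
                rw [ha]
                ring
      _ = _ := by
          rw [setLIntegral_const, Real.volume_Ioo, ← ENNReal.ofReal_mul (by positivity),
            ← ENNReal.ofReal_mul (by positivity)]
          congr 1
          rw [Real.rpow_sub_one hl.ne']
          field_simp
          ring
  calc ‖av γ l u‖ₑ ^ 2 ≤ _ := by gcongr
    _ ≤ _ := h2
    _ ≤ _ := by
        rw [h3]
        refine mul_le_mul' h4 (wN_mono (fun x hx => hSpos x hx) _ _)

theorem XD.locallyIntegrableOn {u g : ℝ → ℝ} (h : XD u g) : LocallyIntegrableOn u (Ioi 0) := by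
  obtain ⟨w, hw, hp⟩ := h
  have h1 : LocallyIntegrableOn w (Ioi 0) := hp.continuousOn.locallyIntegrableOn measurableSet_Ioi
  rw [locallyIntegrableOn_iff isOpen_Ioi.isLocallyClosed] at h1 ⊢
  intro k hk hkc
  refine (h1 k hk hkc).congr ?_
  filter_upwards [ae_restrict_of_ae_restrict_of_subset hk hw] with x hx using hx.symm

theorem av_sub_const_mul {u : ℝ → ℝ} (h : LocallyIntegrableOn u (Ioi 0)) (γ c : ℝ) {l : ℝ}
    (hl : 0 < l) : av γ l (fun x => u x - c * x ^ γ) = av γ l u - c := by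
  have h1 : Integrable fun x => avKer γ l x * u x := by
    simpa only [mul_comm] using (isTest_avKer γ hl).integrable_mul h
  have h2 : Integrable fun x => avKer γ l x * x ^ γ := by
    simpa only [mul_comm] using (isTest_avKer γ hl).integrable_mul (XD.rpow γ).locallyIntegrableOn
  have h3 : ∫ x, avKer γ l x * x ^ γ = 1 := integral_avKer_rpow γ hl
  have h4 : av γ l u - c = (∫ x, avKer γ l x * u x) - c * ∫ x, avKer γ l x * x ^ γ := by
    rw [h3, mul_one, av]
  rw [h4, av, ← integral_const_mul, ← integral_sub h1 (h2.const_mul c)]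
  refine integral_congr_ae (Eventually.of_forall fun x => ?_)
  simp only
  ring

/-- The coefficient of `x^γ` in the behaviour of `u` as `x ↘ 0`. -/
def coef (γ : ℝ) (u : ℝ → ℝ) : ℝ := limUnder atTop fun n : ℕ => av γ ((n : ℝ) + 1)⁻¹ u

theorem tendsto_inv_rpow {a : ℝ} (ha : 0 < a) :
    Tendsto (fun n : ℕ => ((n : ℝ) + 1)⁻¹ ^ a) atTop (𝓝 0) := by
  have h1 : Tendsto (fun n : ℕ => (n : ℝ) + 1) atTop atTop :=
    tendsto_atTop_add_const_right _ _ tendsto_natCast_atTop_atTop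
  have h2 := h1.inv_tendsto_atTop.rpow_const (p := a) (Or.inr ha.le)
  simpa [Real.zero_rpow ha.ne'] using h2

theorem tendsto_of_enorm_sq_le {a : ℕ → ℝ} {c : ℝ} {b : ℕ → ℝ≥0∞} (hb : Tendsto b atTop (𝓝 0))
    (h : ∀ n, ‖a n - c‖ₑ ^ 2 ≤ b n) : Tendsto a atTop (𝓝 c) := by
  rw [tendsto_iff_edist_tendsto_0]
  have h1 : Tendsto (fun n => b n ^ (1 / 2 : ℝ)) atTop (𝓝 0) := by
    have := hb.ennrpow_const (1 / 2)
    simpa using this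
  refine tendsto_of_tendsto_of_tendsto_of_le_of_le tendsto_const_nhds h1 (fun _ => zero_le)
    fun n => ?_
  rw [edist_eq_enorm_sub]
  calc ‖a n - c‖ₑ = (‖a n - c‖ₑ ^ 2) ^ (1 / 2 : ℝ) := by
        rw [← ENNReal.rpow_natCast, ← ENNReal.rpow_mul]
        simp
    _ ≤ _ := by gcongr; exact h n

theorem coef_eq {u : ℝ → ℝ} (hu : LocallyIntegrableOn u (Ioi 0)) {γ ρ c : ℝ} (hγ : γ < ρ)
    (h : wN (Ioi 0) ρ (fun x => u x - c * x ^ γ) ≠ ⊤) :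
    Tendsto (fun n : ℕ => av γ ((n : ℝ) + 1)⁻¹ u) atTop (𝓝 c) ∧ coef γ u = c := by
  obtain ⟨K, hK⟩ := exists_av_sq_le γ ρ
  have hm : AEMeasurable (fun x => u x - c * x ^ γ) (volume.restrict (Ioi 0)) :=
    hu.aestronglyMeasurable.aemeasurable.sub ((measurable_id.pow_const γ).const_mul c).aemeasurable
  suffices h1 : Tendsto (fun n : ℕ => av γ ((n : ℝ) + 1)⁻¹ u) atTop (𝓝 c) from ⟨h1, h1.limUnder_eq⟩
  refine tendsto_of_enorm_sq_le (b := fun n : ℕ => K * ENNReal.ofReal (((n : ℝ) + 1)⁻¹ ^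
    (2 * (ρ - γ))) * wN (Ioi 0) ρ (fun x => u x - c * x ^ γ)) ?_ fun n => ?_
  · have h2 := ENNReal.tendsto_ofReal (tendsto_inv_rpow (a := 2 * (ρ - γ)) (by linarith))
    rw [ENNReal.ofReal_zero] at h2
    have h3 := ENNReal.Tendsto.mul_const (ENNReal.Tendsto.const_mul h2
      (Or.inr (ENNReal.coe_ne_top (r := K)))) (b := wN (Ioi 0) ρ (fun x => u x - c * x ^ γ))
      (Or.inr h)
    simpa using h3
  · have hn : (0 : ℝ) < ((n : ℝ) + 1)⁻¹ := by positivity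
    rw [← av_sub_const_mul hu γ c hn]
    exact hK _ hn _ hm

/-- The trace estimate: `(D_x - γ) u` controls the remainder of `u` after the term `x^γ` and,
together with any weighted norm of `u`, also its coefficient. -/
theorem exists_trace (γ ρ₀ ρ : ℝ) (hγ : γ < ρ) : ∃ K : ℝ≥0, ∀ u g : ℝ → ℝ, XD u g →
    wN (Ioi 0) ρ (fun x => g x - γ * u x) ≠ ⊤ →
    (wN (Ioi 0) ρ (fun x => u x - coef γ u * x ^ γ) ≤
      K * wN (Ioi 0) ρ (fun x => g x - γ * u x)) ∧
    (‖coef γ u‖ₑ ^ 2 ≤ K * (wN (Ioi 0) ρ₀ u + wN (Ioi 0) ρ (fun x => g x - γ * u x))) ∧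
    (∀ l, 0 < l → ‖av γ l u - coef γ u‖ₑ ^ 2 ≤
      K * ENNReal.ofReal (l ^ (2 * (ρ - γ))) * wN (Ioi 0) ρ (fun x => g x - γ * u x)) ∧
    Tendsto (fun n : ℕ => av γ ((n : ℝ) + 1)⁻¹ u) atTop (𝓝 (coef γ u)) := by
  obtain ⟨K1, hK1⟩ := exists_av_sq_le γ ρ
  obtain ⟨K0, hK0⟩ := exists_av_sq_le γ ρ₀
  set k : ℝ≥0 := Real.toNNReal (((ρ - γ) ^ 2)⁻¹) with hk
  refine ⟨k + K1 * k + 2 * K0 + 2 * (K1 * k), fun u g h hN => ?_⟩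
  obtain ⟨c, hc⟩ := h.exists_coef hγ.ne hN
  set N := wN (Ioi 0) ρ (fun x => g x - γ * u x) with hNdef
  have hcfin := ne_top_of_le_ne_top (ENNReal.mul_ne_top ENNReal.ofReal_ne_top hN) hc
  obtain ⟨hlim, hcoef⟩ := coef_eq h.locallyIntegrableOn hγ hcfin
  rw [hcoef]
  have hc' : wN (Ioi 0) ρ (fun x => u x - c * x ^ γ) ≤ k * N := hc
  have hm : AEMeasurable (fun x => u x - c * x ^ γ) (volume.restrict (Ioi 0)) :=
    h.aemeasurable.sub ((measurable_id.pow_const γ).const_mul c).aemeasurable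
  have hav : ∀ l, 0 < l → ‖av γ l u - c‖ₑ ^ 2 ≤
      (K1 * k : ℝ≥0) * ENNReal.ofReal (l ^ (2 * (ρ - γ))) * N := by
    intro l hl
    rw [← av_sub_const_mul h.locallyIntegrableOn γ c hl]
    refine (hK1 l hl _ hm).trans ?_
    calc _ ≤ K1 * ENNReal.ofReal (l ^ (2 * (ρ - γ))) * (k * N) := by gcongr
      _ = _ := by push_cast; ring
  have hle : ∀ {a b : ℝ≥0}, a ≤ b → ∀ X : ℝ≥0∞, (a : ℝ≥0∞) * X ≤ b * X := fun hab X => by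
    gcongr
  refine ⟨hc'.trans (hle ?_ _), ?_, fun l hl => (hav l hl).trans ?_, hlim⟩
  · rw [add_assoc, add_assoc]
    exact le_self_add
  · have h1 := hav 1 one_pos
    have h0 := hK0 1 one_pos u h.aemeasurable
    simp only [Real.one_rpow, ENNReal.ofReal_one, mul_one] at h0 h1
    have e : c = av γ 1 u + -(av γ 1 u - c) := by ring
    calc ‖c‖ₑ ^ 2 ≤ 2 * ‖av γ 1 u‖ₑ ^ 2 + 2 * ‖-(av γ 1 u - c)‖ₑ ^ 2 := by
          conv_lhs => rw [e]
          exact enorm_add_sq_le _ _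
      _ ≤ 2 * (K0 * wN (Ioi 0) ρ₀ u) + 2 * ((K1 * k : ℝ≥0) * N) := by
          rw [enorm_neg]
          gcongr
      _ = (2 * K0 : ℝ≥0) * wN (Ioi 0) ρ₀ u + (2 * (K1 * k) : ℝ≥0) * N := by push_cast; ring
      _ ≤ _ := by
          rw [mul_add]
          refine add_le_add (hle ?_ _) (hle ?_ _)
          · rw [add_assoc, add_comm _ (2 * (K1 * k)), ← add_assoc]
            exact le_add_self
          · exact le_add_self
  · rw [mul_assoc, mul_assoc]
    refine hle ?_ _
    rw [add_assoc, add_assoc, add_left_comm]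
    exact le_self_add

/-! ### Pointwise bounds -/

theorem exists_pointwise (ρ : ℝ) : ∃ K : ℝ≥0, ∀ w g : ℝ → ℝ, Prim w (fun s => g s / s) →
    AEMeasurable g (volume.restrict (Ioi 0)) → ∀ x, 0 < x →
    ‖w x‖ₑ ^ 2 ≤ K * ENNReal.ofReal (x ^ (2 * ρ)) *
      (wN (Ioo x (2 * x)) ρ w + wN (Ioo x (2 * x)) ρ g) := by
  refine ⟨Real.toNNReal (2 * 2 ^ |2 * ρ + 1|) + Real.toNNReal (2 * 2 ^ |2 * ρ - 1|),
    fun w g hp hg x hx => ?_⟩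
  set S := Ioo x (2 * x) with hS
  have hSpos : ∀ s ∈ S, 0 < s := fun s hs => hx.trans hs.1
  have hw : AEMeasurable w (volume.restrict S) :=
    (hp.continuousOn.mono hSpos).aemeasurable measurableSet_Ioo
  have hg' : AEMeasurable g (volume.restrict S) :=
    hg.mono_measure (Measure.restrict_mono hSpos le_rfl)
  set V : ℝ≥0∞ := ∫⁻ s in S, ‖g s / s‖ₑ with hV
  have hV2 : V ^ 2 ≤ ENNReal.ofReal (2 ^ |2 * ρ - 1| * x ^ (2 * ρ)) * wN S ρ g := by
    have e : V = ∫⁻ s in S, ENNReal.ofReal (s ^ (ρ - 1 / 2)) *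
        (ENNReal.ofReal (s ^ (-ρ - 1 / 2)) * ‖g s‖ₑ) := by
      refine setLIntegral_congr_fun measurableSet_Ioo fun s hs => ?_
      have hs0 := hSpos s hs
      rw [div_eq_mul_inv, enorm_mul, ← mul_assoc, ofReal_rpow_mul hs0, mul_comm,
        Real.enorm_of_nonneg (inv_pos.2 hs0).le, ← Real.rpow_neg_one]
      congr 3
      ring
    rw [e]
    refine (lintegral_mul_sq_le (measurable_ofReal_rpow _).aemeasurable
      ((measurable_ofReal_rpow _).aemeasurable.mul hg'.enorm)).trans ?_
    refine mul_le_mul' ?_ (le_of_eq ?_)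
    · calc _ ≤ ∫⁻ _ in S, ENNReal.ofReal (2 ^ |2 * ρ - 1| * x ^ (2 * ρ - 1)) := by
            refine setLIntegral_mono_ae' measurableSet_Ioo (Eventually.of_forall fun s hs => ?_)
            rw [ofReal_rpow_sq (hSpos s hs)]
            refine ENNReal.ofReal_le_ofReal ?_
            have := rpow_le_of_mem_Icc hx (Ioo_subset_Icc_self hs) (2 * ρ - 1)
            convert this using 2
            ring
        _ = _ := by
            rw [setLIntegral_const, Real.volume_Ioo, ← ENNReal.ofReal_mul (by positivity)]
            congr 1
            rw [Real.rpow_sub_one hx.ne']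
            field_simp
            ring
    · refine setLIntegral_congr_fun measurableSet_Ioo fun s hs => ?_
      rw [Pi.mul_apply, mul_pow, ofReal_rpow_sq (hSpos s hs)]
      congr 3
      ring
  have hpt : ∀ s ∈ S, ‖w x‖ₑ ^ 2 ≤ 2 * ‖w s‖ₑ ^ 2 + 2 * V ^ 2 := by
    intro s hs
    have h1 : ‖w s - w x‖ₑ ≤ V := by
      rw [(hp x s hx (hSpos s hs)).2, intervalIntegral.integral_of_le hs.1.le]
      refine (enorm_integral_le_lintegral_enorm _).trans (lintegral_mono_set fun y hy => ?_)
      exact ⟨hy.1, hy.2.trans_lt hs.2⟩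
    calc ‖w x‖ₑ ^ 2 = ‖w s + -(w s - w x)‖ₑ ^ 2 := by congr 2; ring
      _ ≤ 2 * ‖w s‖ₑ ^ 2 + 2 * ‖-(w s - w x)‖ₑ ^ 2 := enorm_add_sq_le _ _
      _ ≤ _ := by rw [enorm_neg]; gcongr
  have hvol : volume S = ENNReal.ofReal x := by
    rw [hS, Real.volume_Ioo]
    congr 1
    ring
  have hx0 : ENNReal.ofReal x ≠ 0 := by simpa using hx
  rw [← ENNReal.mul_le_mul_iff_right hx0 ENNReal.ofReal_ne_top]
  calc ENNReal.ofReal x * ‖w x‖ₑ ^ 2 = ∫⁻ _ in S, ‖w x‖ₑ ^ 2 := by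
        rw [setLIntegral_const, hvol, mul_comm]
    _ ≤ ∫⁻ s in S, (2 * ‖w s‖ₑ ^ 2 + 2 * V ^ 2) :=
        setLIntegral_mono_ae' measurableSet_Ioo (Eventually.of_forall hpt)
    _ = 2 * (∫⁻ s in S, ‖w s‖ₑ ^ 2) + 2 * V ^ 2 * ENNReal.ofReal x := by
        rw [lintegral_add_right _ measurable_const, lintegral_const_mul' _ _ (by simp),
          setLIntegral_const, hvol]
    _ ≤ 2 * (ENNReal.ofReal (2 ^ |2 * ρ + 1| * x ^ (2 * ρ + 1)) * wN S ρ w) +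
        2 * (ENNReal.ofReal (2 ^ |2 * ρ - 1| * x ^ (2 * ρ)) * wN S ρ g) * ENNReal.ofReal x := by
        gcongr
        rw [wN, ← lintegral_const_mul' _ _ ENNReal.ofReal_ne_top]
        refine setLIntegral_mono_ae' measurableSet_Ioo (Eventually.of_forall fun s hs => ?_)
        have hs0 := hSpos s hs
        rw [← mul_assoc, ← ENNReal.ofReal_mul (by positivity)]
        have h1 : 1 ≤ 2 ^ |2 * ρ + 1| * x ^ (2 * ρ + 1) * s ^ (-2 * ρ - 1) := by
          have := rpow_le_of_mem_Icc hx (Ioo_subset_Icc_self hs) (2 * ρ + 1)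
          calc (1 : ℝ) = s ^ (2 * ρ + 1) * s ^ (-2 * ρ - 1) := by
                rw [← Real.rpow_add hs0]
                simp
            _ ≤ _ := by gcongr
        calc ‖w s‖ₑ ^ 2 = ENNReal.ofReal 1 * ‖w s‖ₑ ^ 2 := by simp
          _ ≤ _ := by gcongr
    _ = ENNReal.ofReal x * (ENNReal.ofReal (2 * 2 ^ |2 * ρ + 1|) * ENNReal.ofReal (x ^ (2 * ρ)) *
          wN S ρ w + ENNReal.ofReal (2 * 2 ^ |2 * ρ - 1|) * ENNReal.ofReal (x ^ (2 * ρ)) *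
          wN S ρ g) := by
        have e2 : (2 : ℝ≥0∞) = ENNReal.ofReal 2 := by simp
        rw [Real.rpow_add_one hx.ne', e2, ENNReal.ofReal_mul (by positivity),
          ENNReal.ofReal_mul (by positivity), ENNReal.ofReal_mul (by positivity),
          ENNReal.ofReal_mul (by positivity), ENNReal.ofReal_mul (by positivity)]
        ring
    _ ≤ _ := by
        gcongr
        rw [mul_add]
        refine add_le_add ?_ ?_
        · gcongr
          exact ENNReal.coe_le_coe.2 le_self_add
        · gcongr
          exact ENNReal.coe_le_coe.2 le_add_self

theorem tendsto_wN_Ioo {ρ : ℝ} {u : ℝ → ℝ} (h : wN (Ioo 0 1) ρ u ≠ ⊤) :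
    Tendsto (fun r => wN (Ioo 0 r) ρ u) (𝓝[>] 0) (𝓝 0) := by
  have h1 : Tendsto (fun r : ℝ => (volume.restrict (Ioo (0 : ℝ) 1)) (Ioo 0 r)) (𝓝[>] 0) (𝓝 0) := by
    have h2 : Tendsto (fun r : ℝ => ENNReal.ofReal r) (𝓝[>] 0) (𝓝 0) := by
      have := (ENNReal.continuous_ofReal.tendsto (0 : ℝ)).mono_left
        (nhdsWithin_le_nhds (s := Ioi (0 : ℝ)))
      simpa using this
    refine tendsto_of_tendsto_of_tendsto_of_le_of_le tendsto_const_nhds h2 (fun _ => zero_le)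
      fun r => ?_
    refine (Measure.restrict_apply_le _ _).trans ?_
    simp
  have h3 := tendsto_setLIntegral_zero h h1
  refine h3.congr' ?_
  filter_upwards [Ioo_mem_nhdsGT (zero_lt_one' ℝ)] with r hr
  rw [Measure.restrict_restrict measurableSet_Ioo,
    inter_eq_self_of_subset_left (Ioo_subset_Ioo_right hr.2.le)]
  rfl

theorem meanLittleO_of_wN {ρ : ℝ} (hρ : -1 < 2 * ρ) {u : ℝ → ℝ} (h : wN (Ioo 0 1) ρ u ≠ ⊤) :
    MeanLittleO ρ u := by
  refine tendsto_of_tendsto_of_tendsto_of_le_of_le' tendsto_const_nhds (tendsto_wN_Ioo h)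
    (Eventually.of_forall fun _ => zero_le) ?_
  filter_upwards [self_mem_nhdsWithin] with r hr
  have hr0 : (0 : ℝ) < r := hr
  refine ENNReal.div_le_of_le_mul ?_
  rw [mul_comm, wN, ← lintegral_const_mul' _ _ ENNReal.ofReal_ne_top]
  refine setLIntegral_mono_ae' measurableSet_Ioo (Eventually.of_forall fun s hs => ?_)
  rw [← mul_assoc, ← ENNReal.ofReal_mul (by positivity)]
  have h1 : 1 ≤ r ^ (2 * ρ + 1) * s ^ (-2 * ρ - 1) := by
    calc (1 : ℝ) = s ^ (2 * ρ + 1) * s ^ (-2 * ρ - 1) := by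
          rw [← Real.rpow_add hs.1]
          simp
      _ ≤ _ := by
          have := hs.1.le
          gcongr
          · linarith
          · exact hs.2.le
  calc ‖u s‖ₑ ^ 2 = ENNReal.ofReal 1 * ‖u s‖ₑ ^ 2 := by simp
    _ ≤ _ := by gcongr

theorem XD.aeLittleO {u g : ℝ → ℝ} (h : XD u g) {ρ : ℝ} (h0 : wN (Ioo 0 1) ρ u ≠ ⊤)
    (h1 : wN (Ioo 0 1) ρ g ≠ ⊤) : AeLittleO ρ u := by
  have hg := h.aemeasurable_right
  obtain ⟨w, hw, hp⟩ := h
  obtain ⟨K, hK⟩ := exists_pointwise ρ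
  have h0' : wN (Ioo 0 1) ρ w ≠ ⊤ := by
    rwa [← wN_congr (ae_restrict_of_ae_restrict_of_subset (fun x hx => hx.1) hw)]
  have h2 : Tendsto (fun r => wN (Ioo 0 (2 * r)) ρ w + wN (Ioo 0 (2 * r)) ρ g) (𝓝[>] 0) (𝓝 0) := by
    have h3 : Tendsto (fun r : ℝ => 2 * r) (𝓝[>] 0) (𝓝[>] 0) := by
      refine tendsto_nhdsWithin_iff.2 ⟨?_, ?_⟩
      · have : Tendsto (fun r : ℝ => 2 * r) (𝓝 0) (𝓝 (2 * 0)) := tendsto_id.const_mul 2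
        rw [mul_zero] at this
        exact this.mono_left nhdsWithin_le_nhds
      · filter_upwards [self_mem_nhdsWithin] with r hr
        exact mul_pos two_pos (show (0 : ℝ) < r from hr)
    simpa using ((tendsto_wN_Ioo h0').comp h3).add ((tendsto_wN_Ioo h1).comp h3)
  have h4 : w =o[𝓝[>] 0] fun x => x ^ ρ := by
    rw [isLittleO_iff]
    intro c hc
    have h5 : Tendsto (fun r => K * (wN (Ioo 0 (2 * r)) ρ w + wN (Ioo 0 (2 * r)) ρ g)) (𝓝[>] 0)
        (𝓝 0) := by
      have := ENNReal.Tendsto.const_mul h2 (Or.inr (ENNReal.coe_ne_top (r := K)))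
      simpa using this
    have h6 : (0 : ℝ≥0∞) < ENNReal.ofReal (c ^ 2) := by
      simpa using pow_pos hc 2
    filter_upwards [h5.eventually_lt_const h6, self_mem_nhdsWithin] with r h7 hr
    have hr0 : (0 : ℝ) < r := hr
    have h8 : ‖w r‖ₑ ^ 2 ≤ ENNReal.ofReal (c ^ 2 * r ^ (2 * ρ)) := by
      refine (hK w g hp hg r hr0).trans ?_
      have hsub : Ioo r (2 * r) ⊆ Ioo 0 (2 * r) := Ioo_subset_Ioo_left hr0.le
      calc _ ≤ K * ENNReal.ofReal (r ^ (2 * ρ)) *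
            (wN (Ioo 0 (2 * r)) ρ w + wN (Ioo 0 (2 * r)) ρ g) := by
              gcongr
              · exact wN_mono hsub _ _
              · exact wN_mono hsub _ _
        _ = K * (wN (Ioo 0 (2 * r)) ρ w + wN (Ioo 0 (2 * r)) ρ g) *
            ENNReal.ofReal (r ^ (2 * ρ)) := by ring
        _ ≤ ENNReal.ofReal (c ^ 2) * ENNReal.ofReal (r ^ (2 * ρ)) := by gcongr
        _ = _ := by rw [ENNReal.ofReal_mul (by positivity)]
    rw [enorm_sq, ENNReal.ofReal_le_ofReal_iff (by positivity)] at h8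
    rw [Real.norm_eq_abs, Real.norm_eq_abs, abs_of_pos (Real.rpow_pos_of_pos hr0 ρ)]
    refine abs_le_of_sq_le_sq ?_ (by positivity)
    rw [mul_pow, ← Real.rpow_mul_natCast hr0.le]
    rw [Nat.cast_ofNat, mul_comm ρ]
    exact h8
  refine (h4.mono inf_le_left).congr' ?_ EventuallyEq.rfl
  have h9 : ∀ᵐ x : ℝ, x ∈ Ioi (0 : ℝ) → u x = w x := (ae_restrict_iff' measurableSet_Ioi).1 hw
  have h10 : ∀ᶠ x in 𝓝[>] (0 : ℝ) ⊓ ae volume, x ∈ Ioi (0 : ℝ) := by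
    exact (inf_le_left : 𝓝[>] (0 : ℝ) ⊓ ae volume ≤ _) self_mem_nhdsWithin
  have h11 : ∀ᶠ x in 𝓝[>] (0 : ℝ) ⊓ ae volume, x ∈ Ioi (0 : ℝ) → u x = w x :=
    (inf_le_right : 𝓝[>] (0 : ℝ) ⊓ ae volume ≤ _) h9
  filter_upwards [h10, h11] with x h12 h13
  exact (h13 h12).symm

end Averages

/-! ### Weak derivatives on an interval -/

section Interval

variable {J : Set ℝ}

theorem exists_rat_Ioo (hJ : IsOpen J) {K : Set ℝ} (hK : IsCompact K) (hKJ : K ⊆ J) {s : ℝ}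
    (hs : s ∈ J) :
    ∃ a b : ℚ, (a : ℝ) ∈ J ∧ (b : ℝ) ∈ J ∧ K ⊆ Ioo (a : ℝ) b ∧ s ∈ Ioo (a : ℝ) b := by
  set K' := insert s K
  have hK' : IsCompact K' := hK.insert s
  have hne : K'.Nonempty := ⟨s, mem_insert s K⟩
  have hsub : K' ⊆ J := insert_subset hs hKJ
  have h1 : ∃ a : ℚ, (a : ℝ) ∈ J ∧ (a : ℝ) < sInf K' := by
    obtain ⟨l, hl, hlJ⟩ := exists_Ioc_subset_of_mem_nhds (hJ.mem_nhds (hsub (hK'.sInf_mem hne)))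
      (exists_lt _)
    obtain ⟨a, ha1, ha2⟩ := exists_rat_btwn hl
    exact ⟨a, hlJ ⟨ha1, ha2.le⟩, ha2⟩
  have h2 : ∃ b : ℚ, (b : ℝ) ∈ J ∧ sSup K' < b := by
    obtain ⟨l, hl, hlJ⟩ := exists_Ico_subset_of_mem_nhds (hJ.mem_nhds (hsub (hK'.sSup_mem hne)))
      (exists_gt _)
    obtain ⟨a, ha1, ha2⟩ := exists_rat_btwn hl
    exact ⟨a, hlJ ⟨ha1.le, ha2⟩, ha1⟩
  obtain ⟨a, ha, ha'⟩ := h1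
  obtain ⟨b, hb, hb'⟩ := h2
  have h3 : K' ⊆ Ioo (a : ℝ) b := fun x hx =>
    ⟨ha'.trans_le (csInf_le hK'.bddBelow hx), (le_csSup hK'.bddAbove hx).trans_lt hb'⟩
  exact ⟨a, b, ha, hb, (subset_insert s K).trans h3, h3 (mem_insert s K)⟩

/-- A test function with integral zero has a test function as primitive. -/
theorem IsTest.primitive (hJ : IsOpen J) (hc : J.OrdConnected) {ψ : ℝ → ℝ} (h : IsTest J ψ)
    (h0 : ∫ s, ψ s = 0) :
    IsTest J (fun σ => ∫ s in Iic σ, ψ s) ∧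
      ∀ σ, HasDerivAt (fun σ => ∫ s in Iic σ, ψ s) (ψ σ) σ := by
  have hi : Integrable ψ := h.smooth.continuous.integrable_of_hasCompactSupport h.compact
  have hd : ∀ σ, HasDerivAt (fun σ => ∫ s in Iic σ, ψ s) (ψ σ) σ := by
    intro σ
    have e : ∀ r, (∫ s in Iic r, ψ s) = (∫ s in Iic 0, ψ s) + ∫ s in (0 : ℝ)..r, ψ s := by
      intro r
      rw [← intervalIntegral.integral_Iic_sub_Iic hi.integrableOn hi.integrableOn]
      ring
    rw [funext e]
    exact (h.smooth.continuous.integral_hasStrictDerivAt 0 σ).hasDerivAt.const_add _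
  refine ⟨?_, hd⟩
  have hs : ContDiff ℝ ∞ (fun σ => ∫ s in Iic σ, ψ s) := by
    rw [contDiff_infty_iff_deriv]
    refine ⟨fun σ => (hd σ).differentiableAt, ?_⟩
    rw [funext fun σ => (hd σ).deriv]
    exact h.smooth
  rcases J.eq_empty_or_nonempty with hJe | ⟨s0, hs0⟩
  · have : ψ = 0 := by
      ext x
      exact image_eq_zero_of_notMem_tsupport fun hx => by simpa [hJe] using h.subset hx
    subst this
    have h0 : IsTest J (0 : ℝ → ℝ) := (testSpace J).zero_mem
    convert h0 using 1
    ext σ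
    simp
  obtain ⟨a, b, ha, hb, hab, -⟩ := exists_rat_Ioo hJ h.compact h.subset hs0
  have hsupp : Function.support (fun σ => ∫ s in Iic σ, ψ s) ⊆ Icc (a : ℝ) b := by
    intro σ hσ
    by_contra hn
    rw [mem_Icc, not_and_or, not_le, not_le] at hn
    refine hσ ?_
    have hz : ∀ s, s ∉ Ioo (a : ℝ) b → ψ s = 0 := fun s hs =>
      image_eq_zero_of_notMem_tsupport fun hx => hs (hab hx)
    rcases hn with hn | hn
    · refine setIntegral_eq_zero_of_forall_eq_zero fun s hs => hz s fun hx => ?_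
      exact absurd (hx.1.trans_le hs) (not_lt.2 hn.le)
    · simp only
      rw [← h0, setIntegral_eq_integral_of_forall_compl_eq_zero]
      intro s hs
      refine hz s fun hx => hs ?_
      exact (hx.2.trans hn).le
  have hcl := closure_minimal hsupp isClosed_Icc
  exact ⟨hs, HasCompactSupport.intro isCompact_Icc fun x hx => by
    by_contra hn
    exact hx (hsupp hn), hcl.trans (hc.out ha hb)⟩

theorem exists_isTest_integral_one (hJ : IsOpen J) {s : ℝ} (hs : s ∈ J) :
    ∃ η, IsTest J η ∧ ∫ r, η r = 1 := by
  obtain ⟨ε, hε, hεJ⟩ := Metric.isOpen_iff.1 hJ s hs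
  let f : ContDiffBump s := ⟨ε / 4, ε / 2, by positivity, by linarith⟩
  refine ⟨f.normed volume, ⟨f.contDiff_normed, f.hasCompactSupport_normed, ?_⟩, f.integral_normed⟩
  rw [f.tsupport_normed_eq]
  exact (Metric.closedBall_subset_ball (by change ε / 2 < ε; linarith)).trans hεJ

/-- `w` is a primitive of `f` on the interval `J`. -/
def PrimOn (J : Set ℝ) (w f : ℝ → ℝ) : Prop :=
  ∀ a ∈ J, ∀ b ∈ J, IntervalIntegrable f volume a b ∧ w b - w a = ∫ s in a..b, f s

/-- `g` is the weak derivative of `u` on `J`. -/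
def WeakD (J : Set ℝ) (u g : ℝ → ℝ) : Prop :=
  LocallyIntegrableOn u J ∧ LocallyIntegrableOn g J ∧
    ∀ χ, IsTest J χ → ∫ s, u s * deriv χ s = -∫ s, g s * χ s

theorem integral_primitive_mul_deriv (hJ : IsOpen J) (hc : J.OrdConnected) {g : ℝ → ℝ}
    (hg : LocallyIntegrableOn g J) {s : ℝ} (hs : s ∈ J) {χ : ℝ → ℝ} (hχ : IsTest J χ) :
    ∫ r, (∫ q in s..r, g q) * deriv χ r = -∫ r, g r * χ r := by
  obtain ⟨a, b, ha, hb, hab, hsab⟩ := exists_rat_Ioo hJ hχ.compact hχ.subset hs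
  have hle : (a : ℝ) ≤ b := (hsab.1.trans hsab.2).le
  have hi : IntervalIntegrable g volume a b :=
    (hg.integrableOn_compact_subset (hc.uIcc_subset ha hb) isCompact_uIcc).intervalIntegrable
  have hsm : s ∈ uIcc (a : ℝ) b := by
    rw [uIcc_of_le hle]
    exact Ioo_subset_Icc_self hsab
  have h1 := hi.absolutelyContinuousOnInterval_intervalIntegral hsm
  have h2 : AbsolutelyContinuousOnInterval χ a b :=
    (hχ.smooth.of_le (by simp)).contDiffOn.absolutelyContinuousOnInterval
  have h3 := h1.integral_mul_deriv_eq_deriv_mul h2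
  have hz : ∀ r, r ∉ Ioo (a : ℝ) b → χ r = 0 := fun r hr =>
    image_eq_zero_of_notMem_tsupport fun hx => hr (hab hx)
  rw [hz a (by simp), hz b (by simp)] at h3
  have h4 : ∫ r in (a : ℝ)..b, deriv (fun x => ∫ q in s..x, g q) r * χ r =
      ∫ r in (a : ℝ)..b, g r * χ r := by
    refine intervalIntegral.integral_congr_ae ?_
    filter_upwards [hi.ae_hasDerivAt_integral] with r hr hrm
    rw [(hr (uIoc_subset_uIcc hrm) s hsm).deriv]
  have h5 : ∫ r in (a : ℝ)..b, g r * χ r = ∫ r, g r * χ r := by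
    refine intervalIntegral.integral_eq_integral_of_support_subset fun r hr => ?_
    by_contra hn
    exact right_ne_zero_of_mul hr (hz r fun hx => hn ⟨hx.1, hx.2.le⟩)
  have h6 : ∫ r in (a : ℝ)..b, (∫ q in s..r, g q) * deriv χ r =
      ∫ r, (∫ q in s..r, g q) * deriv χ r := by
    refine intervalIntegral.integral_eq_integral_of_support_subset fun r hr => ?_
    have hr' : r ∈ tsupport χ := support_deriv_subset (f := χ) (right_ne_zero_of_mul hr)
    exact ⟨(hab hr').1, (hab hr').2.le⟩
  rw [h4, h5, h6] at h3
  simpa using h3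

/-- A function with an integrable weak derivative is absolutely continuous. -/
theorem WeakD.exists_primitive (hJ : IsOpen J) (hc : J.OrdConnected) {u g : ℝ → ℝ}
    (h : WeakD J u g) : ∃ w, (∀ᵐ s ∂volume.restrict J, u s = w s) ∧ PrimOn J w g := by
  rcases J.eq_empty_or_nonempty with hJe | ⟨s, hs⟩
  · exact ⟨u, Eventually.of_forall fun _ => rfl, fun a ha => by simp [hJe] at ha⟩
  obtain ⟨hu, hg, hw⟩ := h
  have hi : ∀ a ∈ J, ∀ b ∈ J, IntervalIntegrable g volume a b := fun a ha b hb =>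
    (hg.integrableOn_compact_subset (hc.uIcc_subset ha hb) isCompact_uIcc).intervalIntegrable
  obtain ⟨η, hη, hη1⟩ := exists_isTest_integral_one hJ hs
  set G : ℝ → ℝ := fun r => ∫ q in s..r, g q with hG
  have hGc : ContinuousOn G J := by
    intro r hr
    obtain ⟨a, b, ha, hb, -, hab⟩ := exists_rat_Ioo hJ (isCompact_singleton (x := s))
      (by simpa using hs) hr
    obtain ⟨a', b', ha', hb', hs', hab'⟩ := exists_rat_Ioo hJ (isCompact_singleton (x := s))
      (by simpa using hs) hr
    have hsab : s ∈ Ioo (a' : ℝ) b' := hs' rfl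
    have h1 : ContinuousOn G (uIcc (a' : ℝ) b') :=
      intervalIntegral.continuousOn_primitive_interval' (hi a' ha' b' hb')
        (Icc_subset_uIcc (Ioo_subset_Icc_self hsab))
    refine (h1.continuousAt ?_).continuousWithinAt
    exact mem_of_superset (Icc_mem_nhds hab'.1 hab'.2) Icc_subset_uIcc
  have hGl : LocallyIntegrableOn G J := hGc.locallyIntegrableOn hJ.measurableSet
  have hd : LocallyIntegrableOn (u - G) J := hu.sub hGl
  have hmul : ∀ {f : ℝ → ℝ}, LocallyIntegrableOn f J → ∀ {φ : ℝ → ℝ}, IsTest J φ →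
      Integrable fun r => f r * φ r := fun hf _ hφ => hφ.integrable_mul hf
  set c := ∫ r, (u - G) r * η r with hcdef
  have hder : ∀ θ, IsTest J θ → ∫ r, (u - G) r * deriv θ r = 0 := by
    intro θ hθ
    have hθ' : IsTest J (deriv θ) := by
      have h2 := (hθ.pdT 1).mul_of_contDiffAt (a := fun _ => -1) fun _ _ => contDiffAt_const
      convert h2 using 1
      ext r
      simp [pdT]
    have h1 := integral_primitive_mul_deriv hJ hc hg hs hθ
    simp only [Pi.sub_apply, sub_mul]
    rw [integral_sub (hmul hu hθ') (hmul hGl hθ'), hw θ hθ, h1]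
    simp
  have key : ∀ᵐ r, r ∈ J → ((u - G) - (fun _ => c : ℝ → ℝ)) r = 0 := by
    refine hJ.ae_eq_zero_of_integral_contDiff_smul_eq_zero (μ := volume)
      (hd.sub ((continuousOn_const (s := J)).locallyIntegrableOn hJ.measurableSet))
      fun φ h1 h2 h3 => ?_
    have hφ : IsTest J φ := ⟨h1, h2, h3⟩
    set m := ∫ r, φ r with hm
    have hφi : Integrable φ := hφ.smooth.continuous.integrable_of_hasCompactSupport hφ.compact
    have hηi : Integrable η := hη.smooth.continuous.integrable_of_hasCompactSupport hη.compact
    have hψ : IsTest J (φ + (-m) • η) := (testSpace J).add_mem hφ ((testSpace J).smul_mem _ hη)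
    have hψ0 : ∫ r, (φ + (-m) • η) r = 0 := by
      simp only [Pi.add_apply, Pi.smul_apply, smul_eq_mul]
      rw [integral_add hφi (hηi.const_mul _), integral_const_mul, hη1]
      ring
    obtain ⟨hθ, hθd⟩ := hψ.primitive hJ hc hψ0
    have h4 := hder _ hθ
    rw [funext fun σ => (hθd σ).deriv] at h4
    have e1 : ∀ r, (u - G) r * (φ + (-m) • η) r = (u - G) r * φ r + (-m) * ((u - G) r * η r) := by
      intro r
      simp only [Pi.add_apply, Pi.smul_apply, smul_eq_mul]
      ring
    simp_rw [e1] at h4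
    rw [integral_add (hmul hd hφ) ((hmul hd hη).const_mul _), integral_const_mul, ← hcdef] at h4
    have e2 : ∀ r, φ r • ((u - G) - (fun _ => c : ℝ → ℝ)) r = (u - G) r * φ r - c * φ r := by
      intro r
      simp only [Pi.sub_apply, smul_eq_mul]
      ring
    simp_rw [e2]
    rw [integral_sub (hmul hd hφ) (hφi.const_mul c), integral_const_mul, ← hm]
    linarith
  refine ⟨fun r => G r + c, ?_, fun a ha b hb => ⟨hi a ha b hb, ?_⟩⟩
  · rw [ae_restrict_iff' hJ.measurableSet]
    filter_upwards [key] with r hr hrJ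
    have := hr hrJ
    simp only [Pi.sub_apply] at this
    linarith
  · rw [← intervalIntegral.integral_interval_sub_left (hi s hs b hb) (hi s hs a ha)]
    exact add_sub_add_right_eq_sub _ _ _

end Interval

/-! ### Weak derivatives on almost every slice -/

section Slices

set_option linter.unusedSectionVars false

theorem continuous_integral_mul {X : Type} [TopologicalSpace X] [CompactSpace X]
    [MeasurableSpace X] [BorelSpace X] {μ : Measure X} {f : X → ℝ} (hf : Integrable f μ) :
    Continuous fun p : C(X, ℝ) => ∫ x, f x * p x ∂μ := by
  have hi : ∀ p : C(X, ℝ), Integrable (fun x => f x * p x) μ := fun p =>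
    hf.mul_bdd (c := ‖p‖) p.continuous.aestronglyMeasurable
      (Eventually.of_forall fun x => p.norm_coe_le_norm x)
  refine LipschitzWith.continuous (K := (∫ x, ‖f x‖ ∂μ).toNNReal)
    (LipschitzWith.of_dist_le_mul fun p q => ?_)
  rw [Real.dist_eq, ← integral_sub (hi p) (hi q), Real.coe_toNNReal _
    (integral_nonneg fun _ => norm_nonneg _), ← integral_mul_const, ← Real.norm_eq_abs]
  refine norm_integral_le_of_norm_le (hf.norm.mul_const _) (Eventually.of_forall fun x => ?_)
  rw [← mul_sub, norm_mul, dist_eq_norm]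
  gcongr
  exact (p - q).norm_coe_le_norm x

variable {Z : Type} [NormedAddCommGroup Z] [NormedSpace ℝ Z] [FiniteDimensional ℝ Z]
  [MeasureSpace Z] [BorelSpace Z] [IsLocallyFiniteMeasure (volume : Measure Z)]
  [SigmaFinite (volume : Measure Z)]
  {J : Set ℝ} {W : Set Z}

theorem IsTest.tensor {E F : Type} [NormedAddCommGroup E] [NormedSpace ℝ E]
    [NormedAddCommGroup F] [NormedSpace ℝ F] {U : Set E} {V : Set F} {χ : E → ℝ} {ψ : F → ℝ}
    (hχ : IsTest U χ) (hψ : IsTest V ψ) : IsTest (U ×ˢ V) fun p => χ p.1 * ψ p.2 := by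
  have hs : Function.support (fun p : E × F => χ p.1 * ψ p.2) ⊆ tsupport χ ×ˢ tsupport ψ := by
    intro p hp
    exact ⟨subset_tsupport _ (left_ne_zero_of_mul hp), subset_tsupport _ (right_ne_zero_of_mul hp)⟩
  have hcl : tsupport (fun p : E × F => χ p.1 * ψ p.2) ⊆ tsupport χ ×ˢ tsupport ψ :=
    closure_minimal hs ((isClosed_tsupport χ).prod (isClosed_tsupport ψ))
  exact ⟨(hχ.smooth.comp contDiff_fst).mul (hψ.smooth.comp contDiff_snd),
    (hχ.compact.isCompact.prod hψ.compact.isCompact).of_isClosed_subset (isClosed_tsupport _) hcl,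
    hcl.trans (prod_mono hχ.subset hψ.subset)⟩

theorem IsTest.deriv {χ : ℝ → ℝ} (h : IsTest J χ) : IsTest J (deriv χ) := by
  have h2 := (h.pdT 1).mul_of_contDiffAt (a := fun _ => -1) fun _ _ => contDiffAt_const
  convert h2 using 1
  ext r
  simp [ThinFilm.pdT]

theorem ae_restrict_of_local {P : Z → Prop} (hW : IsOpen W)
    (h : ∀ N, IsCompact N → N ⊆ W → ∀ᵐ z ∂volume.restrict N, P z) :
    ∀ᵐ z ∂(volume : Measure Z), z ∈ W → P z := by
  have := FiniteDimensional.proper_real Z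
  rw [ae_iff]
  refine measure_null_of_locally_null _ fun z hz => ?_
  have hzW : z ∈ W := by
    by_contra hn
    exact hz fun h => absurd h hn
  obtain ⟨N, hN, hzN, hNW⟩ := exists_compact_subset hW hzW
  refine ⟨N ∩ {a | ¬(a ∈ W → P a)}, inter_mem (mem_nhdsWithin_of_mem_nhds
    (mem_interior_iff_mem_nhds.1 hzN)) self_mem_nhdsWithin, ?_⟩
  have h1 := ae_iff.1 (h N hN hNW)
  refine le_antisymm ?_ zero_le
  calc volume (N ∩ {a | ¬(a ∈ W → P a)}) ≤ volume ({a | ¬P a} ∩ N) :=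
        measure_mono fun a ha => ⟨fun hP => ha.2 fun _ => hP, ha.1⟩
    _ ≤ (volume.restrict N) {a | ¬P a} := Measure.le_restrict_apply _ _
    _ = 0 := h1

theorem integrable_slice (hW : IsOpen W) {f : ℝ × Z → ℝ}
    (hf : LocallyIntegrableOn f (J ×ˢ W)) {K : Set ℝ} (hK : IsCompact K) (hKJ : K ⊆ J) :
    ∀ᵐ z, z ∈ W → IntegrableOn (fun s => f (s, z)) K := by
  refine ae_restrict_of_local hW fun N hN hNW => ?_
  have h1 : IntegrableOn f (K ×ˢ N) :=
    hf.integrableOn_compact_subset (prod_mono hKJ hNW) (hK.prod hN)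
  rw [IntegrableOn, Measure.volume_eq_prod, ← Measure.prod_restrict] at h1
  exact h1.prod_left_ae

theorem locallyIntegrableOn_integral_mul (hW : IsOpen W) {f : ℝ × Z → ℝ}
    (hf : LocallyIntegrableOn f (J ×ˢ W)) {θ : ℝ → ℝ} (hθ : IsTest J θ) :
    LocallyIntegrableOn (fun z => ∫ s, f (s, z) * θ s) W := by
  have := FiniteDimensional.proper_real Z
  rw [locallyIntegrableOn_iff hW.isLocallyClosed]
  intro N hNW hN
  have e : ∀ z, ∫ s, f (s, z) * θ s = ∫ s in tsupport θ, f (s, z) * θ s := fun z =>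
    (setIntegral_eq_integral_of_forall_compl_eq_zero fun s hs => by
      rw [image_eq_zero_of_notMem_tsupport hs, mul_zero]).symm
  simp_rw [e]
  have hk : IsCompact (tsupport θ ×ˢ N) := hθ.compact.isCompact.prod hN
  have h3 : IntegrableOn f (tsupport θ ×ˢ N) :=
    hf.integrableOn_compact_subset (prod_mono hθ.subset hNW) hk
  have h4 : IntegrableOn (fun p : ℝ × Z => f p * θ p.1) (tsupport θ ×ˢ N) :=
    h3.mul_continuousOn (hθ.smooth.continuous.comp continuous_fst).continuousOn hk
  rw [IntegrableOn, Measure.volume_eq_prod, ← Measure.prod_restrict] at h4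
  exact h4.integral_prod_right

omit [FiniteDimensional ℝ Z] [IsLocallyFiniteMeasure (volume : Measure Z)] in
theorem integral_mul_tensor {f : ℝ × Z → ℝ} (hf : LocallyIntegrableOn f (J ×ˢ W)) {θ : ℝ → ℝ}
    {ψ : Z → ℝ} (hθ : IsTest J θ) (hψ : IsTest W ψ) :
    ∫ p, f p * (θ p.1 * ψ p.2) = ∫ z, (∫ s, f (s, z) * θ s) * ψ z := by
  have h5 := (hθ.tensor hψ).integrable_mul hf
  rw [Measure.volume_eq_prod] at h5 ⊢
  rw [integral_prod_symm _ h5]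
  congr 1
  ext z
  rw [← integral_mul_const]
  simp only [mul_assoc]

/-- If tensor products of test functions cannot see `f₁ ∂_s + f₂`, then almost every slice in the
direction of `s` has this property, since the space of test functions is separable. -/
theorem ae_slice_of_tensor (hJ : IsOpen J) (hc : J.OrdConnected) (hW : IsOpen W) {f₁ f₂ : ℝ × Z → ℝ}
    (h1 : LocallyIntegrableOn f₁ (J ×ˢ W)) (h2 : LocallyIntegrableOn f₂ (J ×ˢ W))
    (h : ∀ χ ψ, IsTest J χ → IsTest W ψ →
      (∫ p, f₁ p * (deriv χ p.1 * ψ p.2)) + ∫ p, f₂ p * (χ p.1 * ψ p.2) = 0) :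
    ∀ᵐ z : Z, z ∈ W →
      LocallyIntegrableOn (fun s => f₁ (s, z)) J ∧ LocallyIntegrableOn (fun s => f₂ (s, z)) J ∧
      ∀ χ, IsTest J χ → (∫ s, f₁ (s, z) * deriv χ s) + ∫ s, f₂ (s, z) * χ s = 0 := by
  rcases J.eq_empty_or_nonempty with hJe | ⟨s0, hs0⟩
  · subst hJe
    refine Eventually.of_forall fun z _ => ⟨by simp [LocallyIntegrableOn],
      by simp [LocallyIntegrableOn], fun χ hχ => ?_⟩
    have : χ = 0 := by
      ext x
      exact image_eq_zero_of_notMem_tsupport fun hx => by simpa using hχ.subset hx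
    simp [this]
  -- a single test function
  have hone : ∀ χ, IsTest J χ → ∀ᵐ z, z ∈ W →
      (∫ s, f₁ (s, z) * deriv χ s) + ∫ s, f₂ (s, z) * χ s = 0 := by
    intro χ hχ
    have hl1 := locallyIntegrableOn_integral_mul hW h1 hχ.deriv
    have hl2 := locallyIntegrableOn_integral_mul hW h2 hχ
    refine hW.ae_eq_zero_of_integral_contDiff_smul_eq_zero (μ := volume) (hl1.add hl2)
      fun ψ g1 g2 g3 => ?_
    have hψ : IsTest W ψ := ⟨g1, g2, g3⟩
    rw [← h χ ψ hχ hψ]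
    rw [integral_mul_tensor h1 hχ.deriv hψ, integral_mul_tensor h2 hχ hψ,
      ← integral_add (hψ.integrable_mul hl1) (hψ.integrable_mul hl2)]
    congr 1
    ext z
    simp only [smul_eq_mul]
    ring
  -- all test functions with support in a fixed interval
  have hall : ∀ a b : ℚ, (a : ℝ) ∈ J → (b : ℝ) ∈ J → ∀ᵐ z, z ∈ W →
      ∀ χ, IsTest J χ → tsupport χ ⊆ Icc (a : ℝ) b →
        (∫ s, f₁ (s, z) * deriv χ s) + ∫ s, f₂ (s, z) * χ s = 0 := by
    intro a b ha hb
    set K := Icc (a : ℝ) b with hK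
    have hKJ : K ⊆ J := hc.out ha hb
    let X := {χ : ℝ → ℝ // IsTest J χ ∧ tsupport χ ⊆ K}
    let ι : X → C(K, ℝ) × C(K, ℝ) := fun χ =>
      (⟨fun s => χ.1 s, χ.2.1.smooth.continuous.comp continuous_subtype_val⟩,
        ⟨fun s => deriv χ.1 s, χ.2.1.deriv.smooth.continuous.comp continuous_subtype_val⟩)
    have : Nonempty (range ι) :=
      ⟨⟨_, ⟨⟨0, (testSpace J).zero_mem, by simp [tsupport]⟩, rfl⟩⟩⟩
    have hd := TopologicalSpace.denseRange_denseSeq (range ι)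
    choose d hdι using fun n : ℕ => (TopologicalSpace.denseSeq (range ι) n).2
    have hall : ∀ᵐ z, ∀ n : ℕ, z ∈ W →
        (∫ s, f₁ (s, z) * deriv (d n).1 s) + ∫ s, f₂ (s, z) * (d n).1 s = 0 :=
      ae_all_iff.2 fun n => hone _ (d n).2.1
    filter_upwards [hall, integrable_slice hW h1 isCompact_Icc hKJ,
      integrable_slice hW h2 isCompact_Icc hKJ] with z hz hi1 hi2 hzW χ hχ hχK
    set ν : Measure K := Measure.comap Subtype.val volume
    have hi : ∀ f : ℝ → ℝ, IntegrableOn f K → Integrable (fun s : K => f s) ν := fun f hf =>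
      ((integrableOn_iff_comap_subtypeVal measurableSet_Icc).1 hf)
    let F : C(K, ℝ) × C(K, ℝ) → ℝ := fun q =>
      (∫ s : K, f₁ (s, z) * q.2 s ∂ν) + ∫ s : K, f₂ (s, z) * q.1 s ∂ν
    have hF : Continuous F :=
      ((continuous_integral_mul (hi _ (hi1 hzW))).comp continuous_snd).add
        ((continuous_integral_mul (hi _ (hi2 hzW))).comp continuous_fst)
    have hFι : ∀ χ : X, F (ι χ) = (∫ s, f₁ (s, z) * deriv χ.1 s) + ∫ s, f₂ (s, z) * χ.1 s := by
      intro χ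
      have e1 : ∫ s : K, f₁ (s, z) * deriv χ.1 s ∂ν = ∫ s, f₁ (s, z) * deriv χ.1 s := by
        rw [integral_subtype_comap measurableSet_Icc (fun s => f₁ (s, z) * deriv χ.1 s)]
        refine setIntegral_eq_integral_of_forall_compl_eq_zero fun s hs => ?_
        have h3 : s ∉ tsupport (deriv χ.1) := fun h =>
          hs (χ.2.2 (closure_minimal support_deriv_subset (isClosed_tsupport _) h))
        rw [image_eq_zero_of_notMem_tsupport h3, mul_zero]
      have e2 : ∫ s : K, f₂ (s, z) * χ.1 s ∂ν = ∫ s, f₂ (s, z) * χ.1 s := by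
        rw [integral_subtype_comap measurableSet_Icc (fun s => f₂ (s, z) * χ.1 s)]
        refine setIntegral_eq_integral_of_forall_compl_eq_zero fun s hs => ?_
        rw [image_eq_zero_of_notMem_tsupport fun h => hs (χ.2.2 h), mul_zero]
      exact congr_arg₂ (· + ·) e1 e2
    have hzero : ∀ q : range ι, F q = 0 := by
      have hcl : IsClosed {q : range ι | F q = 0} :=
        isClosed_eq (hF.comp continuous_subtype_val) continuous_const
      have hr : range (TopologicalSpace.denseSeq (range ι)) ⊆ {q : range ι | F q = 0} := by
        rintro _ ⟨n, rfl⟩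
        change F _ = 0
        rw [← hdι n, hFι]
        exact hz n hzW
      intro q
      exact hcl.closure_subset_iff.2 hr (hd q)
    have := hzero ⟨ι ⟨χ, hχ, hχK⟩, mem_range_self _⟩
    rwa [hFι] at this
  have hcount : ∀ᵐ z, ∀ a b : ℚ, (a : ℝ) ∈ J → (b : ℝ) ∈ J → z ∈ W →
      (∀ χ, IsTest J χ → tsupport χ ⊆ Icc (a : ℝ) b →
        (∫ s, f₁ (s, z) * deriv χ s) + ∫ s, f₂ (s, z) * χ s = 0) ∧
      IntegrableOn (fun s => f₁ (s, z)) (Icc (a : ℝ) b) ∧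
      IntegrableOn (fun s => f₂ (s, z)) (Icc (a : ℝ) b) := by
    rw [ae_all_iff]
    intro a
    rw [ae_all_iff]
    intro b
    by_cases ha : (a : ℝ) ∈ J
    · by_cases hb : (b : ℝ) ∈ J
      · filter_upwards [hall a b ha hb, integrable_slice hW h1 isCompact_Icc (hc.out ha hb),
          integrable_slice hW h2 isCompact_Icc (hc.out ha hb)] with z g1 g2 g3 _ _ hz
        exact ⟨g1 hz, g2 hz, g3 hz⟩
      · exact Eventually.of_forall fun z _ h => absurd h hb
    · exact Eventually.of_forall fun z h => absurd h ha
  filter_upwards [hcount] with z hz hzW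
  refine ⟨?_, ?_, fun χ hχ => ?_⟩
  · rw [locallyIntegrableOn_iff hJ.isLocallyClosed]
    intro k hk hkc
    obtain ⟨a, b, ha, hb, hab, -⟩ := exists_rat_Ioo hJ hkc hk hs0
    exact (hz a b ha hb hzW).2.1.mono_set (hab.trans Ioo_subset_Icc_self)
  · rw [locallyIntegrableOn_iff hJ.isLocallyClosed]
    intro k hk hkc
    obtain ⟨a, b, ha, hb, hab, -⟩ := exists_rat_Ioo hJ hkc hk hs0
    exact (hz a b ha hb hzW).2.2.mono_set (hab.trans Ioo_subset_Icc_self)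
  · obtain ⟨a, b, ha, hb, hab, -⟩ := exists_rat_Ioo hJ hχ.compact hχ.subset hs0
    exact (hz a b ha hb hzW).1 χ hχ (hab.trans Ioo_subset_Icc_self)

end Slices

/-! ### The expansion of a function of `x` -/

section Expansion

theorem exists_wN_sum_le {ι : Type} (s : Finset ι) (c : ι → ℝ) : ∃ C : ℝ≥0, ∀ (S : Set ℝ) (ρ : ℝ)
    (u : ι → ℝ → ℝ), (∀ i ∈ s, AEMeasurable (u i) (volume.restrict S)) →
    wN S ρ (fun x => ∑ i ∈ s, c i * u i x) ≤ C * ∑ i ∈ s, wN S ρ (u i) := by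
  classical
  induction s using Finset.induction_on with
  | empty => exact ⟨0, fun S ρ u _ => by simp [wN]⟩
  | insert i s hi ih =>
    obtain ⟨C, hC⟩ := ih
    refine ⟨2 * ‖c i‖₊ ^ 2 + 2 * C, fun S ρ u hu => ?_⟩
    have h1 := hC S ρ u fun j hj => hu j (Finset.mem_insert_of_mem hj)
    simp only [Finset.sum_insert hi]
    refine (wN_add_le ((hu i (Finset.mem_insert_self i s)).const_mul (c i))).trans ?_
    rw [wN_const_mul]
    have e : ((2 * ‖c i‖₊ ^ 2 + 2 * C : ℝ≥0) : ℝ≥0∞) = 2 * ‖c i‖ₑ ^ 2 + 2 * C := by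
      push_cast
      rfl
    rw [e]
    set a := wN S ρ (u i)
    set b := ∑ j ∈ s, wN S ρ (u j)
    calc 2 * (‖c i‖ₑ ^ 2 * a) + 2 * wN S ρ (fun x => ∑ j ∈ s, c j * u j x)
        ≤ 2 * (‖c i‖ₑ ^ 2 * a) + 2 * (C * b) := by gcongr
      _ = (2 * ‖c i‖ₑ ^ 2) * a + (2 * C) * b := by ring
      _ ≤ (2 * ‖c i‖ₑ ^ 2 + 2 * C) * (a + b) := by
        rw [mul_add]
        refine add_le_add ?_ ?_
        · gcongr
          exact le_self_add
        · gcongr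
          exact le_add_self

/-- `u ∈ L²(S; x^(-2ρ-1) dx)`. -/
def WF (S : Set ℝ) (ρ : ℝ) (u : ℝ → ℝ) : Prop :=
  AEMeasurable u (volume.restrict S) ∧ wN S ρ u ≠ ⊤

namespace WF

variable {S : Set ℝ} {ρ : ℝ} {u u' : ℝ → ℝ}

theorem const_mul (h : WF S ρ u) (c : ℝ) : WF S ρ fun x => c * u x :=
  ⟨h.1.const_mul c, by
    rw [wN_const_mul]
    exact ENNReal.mul_ne_top (by simp) h.2⟩

theorem sum {ι : Type} {s : Finset ι} {c : ι → ℝ} {u : ι → ℝ → ℝ}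
    (h : ∀ i ∈ s, WF S ρ (u i)) : WF S ρ fun x => ∑ i ∈ s, c i * u i x := by
  obtain ⟨C, hC⟩ := exists_wN_sum_le s c
  refine ⟨Finset.aemeasurable_fun_sum _ fun i hi => (h i hi).1.const_mul _, ?_⟩
  refine ne_top_of_le_ne_top ?_ (hC S ρ u fun i hi => (h i hi).1)
  exact ENNReal.mul_ne_top ENNReal.coe_ne_top (ENNReal.sum_ne_top.2 fun i hi => (h i hi).2)

theorem add (h : WF S ρ u) (h' : WF S ρ u') : WF S ρ fun x => u x + u' x :=
  ⟨h.1.add h'.1, ne_top_of_le_ne_top (ENNReal.add_ne_top.2 ⟨ENNReal.mul_ne_top (by simp) h.2,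
    ENNReal.mul_ne_top (by simp) h'.2⟩) (wN_add_le h.1)⟩

theorem sub (h : WF S ρ u) (h' : WF S ρ u') : WF S ρ fun x => u x - u' x := by
  simpa [sub_eq_add_neg] using h.add (h'.const_mul (-1))

theorem rpow_iff {a : ℝ} : WF (Ioo 0 1) ρ (fun x => x ^ a) ↔ ρ < a := by
  have hm : Measurable fun x : ℝ => x ^ a := measurable_id.pow_const a
  rw [WF, and_iff_right hm.aemeasurable]
  have e : wN (Ioo 0 1) ρ (fun x => x ^ a) =
      ∫⁻ x in Ioo (0 : ℝ) 1, ENNReal.ofReal (x ^ (2 * a - 2 * ρ - 1)) := by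
    refine setLIntegral_congr_fun measurableSet_Ioo fun x hx => ?_
    have hx0 : 0 < x := hx.1
    simp only
    rw [enorm_sq, ← Real.rpow_mul_natCast hx0.le, ofReal_rpow_mul hx0]
    congr 2
    push_cast
    ring
  have h1 := intervalIntegral.integrableOn_Ioo_rpow_iff (s := 2 * a - 2 * ρ - 1) (t := 1) one_pos
  rw [e, ← lt_top_iff_ne_top]
  have h2 : IntegrableOn (fun x : ℝ => x ^ (2 * a - 2 * ρ - 1)) (Ioo 0 1) ↔
      ∫⁻ x in Ioo (0 : ℝ) 1, ENNReal.ofReal (x ^ (2 * a - 2 * ρ - 1)) < ⊤ := by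
    rw [IntegrableOn, Integrable, hasFiniteIntegral_iff_ofReal, and_iff_right]
    · exact (measurable_id.pow_const _).aestronglyMeasurable
    · filter_upwards [ae_restrict_mem measurableSet_Ioo] with x hx
      exact Real.rpow_nonneg hx.1.le _
  rw [← h2, h1]
  constructor <;> intro h <;> linarith

end WF

open Polynomial

/-- `u n` stands for `D_y^b D_x^n v`, so that `D_x (u n) = u (n+1) + b u n`. -/
def JetX (u : ℕ → ℝ → ℝ) (b : ℝ) (N : ℕ) : Prop :=
  (∀ n, Measurable (u n)) ∧ ∀ n, n + 1 ≤ N → XD (u n) fun x => u (n + 1) x + b * u n x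

theorem JetX.xd_ev {u : ℕ → ℝ → ℝ} {b : ℝ} {N : ℕ} (h : JetX u b N) {p : ℝ[X]}
    (hp : p.natDegree + 1 ≤ N) : XD (ev u p) (ev u ((X + C b) * p)) := by
  have hzero : XD (0 : ℝ → ℝ) 0 := by
    have h1 := XD.one.const_mul 0
    simp only [zero_mul] at h1
    exact h1
  have key : ∀ s : Finset ℕ, (∀ n ∈ s, n + 1 ≤ N) →
      XD (ev u (∑ n ∈ s, p.coeff n • (X : ℝ[X]) ^ n))
        (ev u ((X + C b) * ∑ n ∈ s, p.coeff n • (X : ℝ[X]) ^ n)) := by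
    intro s
    induction s using Finset.induction_on with
    | empty => intro _; simpa using hzero
    | insert n s hn ih =>
      intro hs
      have h1 := ih fun j hj => hs j (Finset.mem_insert_of_mem hj)
      have h2 := (h.2 n (hs n (Finset.mem_insert_self n s))).const_mul (p.coeff n)
      rw [Finset.sum_insert hn, mul_add, map_add, map_add]
      have e1 : ev u (p.coeff n • (X : ℝ[X]) ^ n) = fun x => p.coeff n * u n x := by
        rw [map_smul, ev_X_pow]
        rfl
      have e2 : ev u ((X + C b) * p.coeff n • (X : ℝ[X]) ^ n) =
          fun x => p.coeff n * (u (n + 1) x + b * u n x) := by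
        have : (X + C b) * p.coeff n • (X : ℝ[X]) ^ n =
            p.coeff n • (X ^ (n + 1) + b • X ^ n) := by
          rw [mul_smul_comm, add_mul, ← pow_succ', C_mul']
        rw [this, map_smul, map_add, map_smul, ev_X_pow, ev_X_pow]
        rfl
      rw [e1, e2]
      exact h2.add h1
  have e : p = ∑ n ∈ Finset.range (p.natDegree + 1), p.coeff n • (X : ℝ[X]) ^ n := by
    conv_lhs => rw [p.as_sum_range]
    exact Finset.sum_congr rfl fun n _ => (smul_X_eq_monomial).symm
  rw [e]
  exact key _ fun n hn => by
    have := Finset.mem_range.1 hn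
    omega

/-- The product of the `D_x - γ'` over the roots `γ' ≠ γ`, which keeps only the power `x^γ`. -/
def filt (Γ : Finset ℝ) (γ : ℝ) : ℝ[X] := Lagrange.nodal (Γ.erase γ) id

/-- The product of the `D_x - γ` over all roots. -/
def full (Γ : Finset ℝ) : ℝ[X] := Lagrange.nodal Γ id

theorem filt_mul {Γ : Finset ℝ} {γ : ℝ} (hγ : γ ∈ Γ) : (X - C γ) * filt Γ γ = full Γ :=
  (Lagrange.nodal_eq_mul_nodal_erase (v := id) hγ).symm

theorem natDegree_filt {Γ : Finset ℝ} {γ : ℝ} (hγ : γ ∈ Γ) :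
    (filt Γ γ).natDegree + 1 = Γ.card := by
  rw [filt, Lagrange.natDegree_nodal, Finset.card_erase_add_one hγ]

theorem eval_filt_ne {Γ : Finset ℝ} {γ : ℝ} : (filt Γ γ).eval γ ≠ 0 := by
  rw [filt, Lagrange.eval_nodal, Finset.prod_ne_zero_iff]
  intro γ' h
  exact sub_ne_zero.2 (Finset.ne_of_mem_erase h).symm

theorem eval_filt_eq_zero {Γ : Finset ℝ} {γ γ' : ℝ} (h : γ' ∈ Γ) (hne : γ' ≠ γ) :
    (filt Γ γ).eval γ' = 0 :=
  Lagrange.eval_nodal_at_node (v := id) (Finset.mem_erase.2 ⟨hne, h⟩)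

/-- Division with remainder by `full Γ` and Lagrange interpolation of the remainder. -/
theorem exists_decomp (Γ : Finset ℝ) (p : ℝ[X]) : ∃ s : ℝ[X],
    s.natDegree ≤ p.natDegree - Γ.card ∧
    p = full Γ * s + ∑ γ ∈ Γ, (p.eval γ / (filt Γ γ).eval γ) • filt Γ γ := by
  have hm : (full Γ).Monic := Lagrange.nodal_monic
  refine ⟨p /ₘ full Γ, ?_, ?_⟩
  · rw [natDegree_divByMonic _ hm, full, Lagrange.natDegree_nodal]
  · have h1 := modByMonic_add_div p (full Γ)
    have h2 : p %ₘ full Γ = ∑ γ ∈ Γ, (p.eval γ / (filt Γ γ).eval γ) • filt Γ γ := by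
      refine eq_of_degrees_lt_of_eval_finset_eq Γ ?_ ?_ fun γ hγ => ?_
      · refine (degree_modByMonic_lt _ hm).trans_eq ?_
        rw [full, Lagrange.degree_nodal]
      · refine (degree_sum_le _ _).trans_lt ?_
        rw [Finset.sup_lt_iff (WithBot.bot_lt_coe _)]
        intro γ hγ
        refine (degree_smul_le _ _).trans_lt ?_
        rw [filt, Lagrange.degree_nodal]
        exact_mod_cast Finset.card_erase_lt_of_mem hγ
      · have h3 : (full Γ).eval γ = 0 := Lagrange.eval_nodal_at_node (v := id) hγ
        have h4 : (p %ₘ full Γ).eval γ = p.eval γ := by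
          conv_rhs => rw [← h1]
          simp [h3]
        rw [h4, eval_finsetSum, Finset.sum_eq_single γ]
        · rw [eval_smul, smul_eq_mul, div_mul_cancel₀ _ eval_filt_ne]
        · intro γ' _ hne
          rw [eval_smul, eval_filt_eq_zero hγ hne.symm, smul_zero]
        · exact fun h => absurd hγ h
    rw [← h2, add_comm]
    exact h1.symm

/-- The coefficient `c_γ` such that `D_y^b v` contains the term `c_γ x^(γ+b)`. -/
def cf (Γ : Finset ℝ) (b : ℝ) (u : ℕ → ℝ → ℝ) (γ : ℝ) : ℝ :=
  coef (γ + b) (ev u (filt Γ γ)) / (filt Γ γ).eval γ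

theorem JetX.xd_filt {u : ℕ → ℝ → ℝ} {b : ℝ} {N : ℕ} (h : JetX u b N) {Γ : Finset ℝ}
    (hN : Γ.card ≤ N) {γ : ℝ} (hγ : γ ∈ Γ) :
    XD (ev u (filt Γ γ)) (ev u ((X + C b) * filt Γ γ)) ∧
    (fun x => ev u ((X + C b) * filt Γ γ) x - (γ + b) * ev u (filt Γ γ) x) = ev u (full Γ) := by
  refine ⟨h.xd_ev ((natDegree_filt hγ).trans_le hN), ?_⟩
  rw [← filt_mul hγ]
  have e : (X - C γ) * filt Γ γ = (X + C b) * filt Γ γ - (γ + b) • filt Γ γ := by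
    rw [← C_mul', map_add]
    ring
  rw [e, map_sub, map_smul]
  rfl

/-- If `full Γ (D_x) v` and its derivatives lie in `L²(x^(-2ρ-1) dx)`, then `p(D_x) v` is in this
space up to the terms `p(γ) c_γ x^(γ+b)` with `γ + b < ρ`. -/
theorem exists_expansion (Γ : Finset ℝ) {b ρ ρ₀ : ℝ} (hne : ∀ γ ∈ Γ, γ + b ≠ ρ) (hρ : ρ₀ ≤ ρ)
    (p : ℝ[X]) : ∃ K : ℝ≥0, ∀ (u : ℕ → ℝ → ℝ) (N : ℕ), JetX u b N → Γ.card ≤ N →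
      (∀ γ ∈ Γ, wN (Ioi 0) ρ₀ (ev u (filt Γ γ)) ≠ ⊤) → wN (Ioi 0) ρ (ev u (full Γ)) ≠ ⊤ →
      wN (Ioi 0) ρ (fun x => ev u p x -
        ∑ γ ∈ Γ with γ + b < ρ, p.eval γ * cf Γ b u γ * x ^ (γ + b)) ≤
      K * ∑ j ∈ Finset.range (p.natDegree - Γ.card + 1), wN (Ioi 0) ρ (ev u (full Γ * X ^ j)) := by
  classical
  obtain ⟨s, hs, hps⟩ := exists_decomp Γ p
  set M := p.natDegree - Γ.card + 1 with hM
  -- the remainder of `filt Γ γ`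
  have hrem : ∀ γ : ℝ, ∃ K : ℝ≥0, γ ∈ Γ → ∀ (u : ℕ → ℝ → ℝ) (N : ℕ), JetX u b N → Γ.card ≤ N →
      (∀ γ ∈ Γ, wN (Ioi 0) ρ₀ (ev u (filt Γ γ)) ≠ ⊤) → wN (Ioi 0) ρ (ev u (full Γ)) ≠ ⊤ →
      wN (Ioi 0) ρ (fun x => ev u (filt Γ γ) x - (if γ + b < ρ then
        (filt Γ γ).eval γ * cf Γ b u γ * x ^ (γ + b) else 0)) ≤
      K * wN (Ioi 0) ρ (ev u (full Γ)) := by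
    intro γ
    by_cases hγ : γ ∈ Γ
    · rcases lt_or_gt_of_ne (hne γ hγ) with hlt | hgt
      · obtain ⟨K, hK⟩ := exists_trace (γ + b) ρ₀ ρ hlt
        refine ⟨K, fun _ u N hu hN _ h1 => ?_⟩
        obtain ⟨g1, g2⟩ := hu.xd_filt hN hγ
        have := (hK _ _ g1 (by rwa [g2])).1
        rw [g2] at this
        simp only [if_pos hlt]
        convert this using 4
        rw [cf, mul_div_cancel₀ _ eval_filt_ne]
      · refine ⟨Real.toNNReal (((ρ - (γ + b)) ^ 2)⁻¹), fun _ u N hu hN h0 h1 => ?_⟩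
        obtain ⟨g1, g2⟩ := hu.xd_filt hN hγ
        have := g1.wN_le hgt hρ (h0 γ hγ) (by rwa [g2])
        rw [g2] at this
        simp only [if_neg hgt.not_gt, sub_zero]
        exact this
    · exact ⟨0, fun h => absurd h hγ⟩
  choose K hK using hrem
  obtain ⟨C1, hC1⟩ := exists_wN_sum_le (Finset.range M) fun j => s.coeff j
  obtain ⟨C2, hC2⟩ := exists_wN_sum_le Γ fun γ => p.eval γ / (filt Γ γ).eval γ
  refine ⟨2 * C1 + 2 * (C2 * ∑ γ ∈ Γ, K γ), fun u N hu hN h0 h1 => ?_⟩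
  have hmeas : ∀ q, Measurable (ev u q) := fun q => measurable_ev hu.1 q
  set R : ℝ → ℝ → ℝ := fun γ x => ev u (filt Γ γ) x - (if γ + b < ρ then
        (filt Γ γ).eval γ * cf Γ b u γ * x ^ (γ + b) else 0) with hR
  have hRm : ∀ γ, Measurable (R γ) := fun γ => by
    refine (hmeas _).sub ?_
    split_ifs
    · exact (measurable_id.pow_const _).const_mul _
    · exact measurable_const
  have e : (fun x => ev u p x - ∑ γ ∈ Γ with γ + b < ρ, p.eval γ * cf Γ b u γ * x ^ (γ + b)) =
      fun x => (∑ j ∈ Finset.range M, s.coeff j * ev u (full Γ * X ^ j) x) +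
        ∑ γ ∈ Γ, p.eval γ / (filt Γ γ).eval γ * R γ x := by
    ext x
    have e1 : ev u (full Γ * s) x = ∑ j ∈ Finset.range M, s.coeff j * ev u (full Γ * X ^ j) x := by
      have : full Γ * s = ∑ j ∈ Finset.range M, s.coeff j • (full Γ * X ^ j) := by
        conv_lhs => rw [s.as_sum_range' M (by omega), Finset.mul_sum]
        refine Finset.sum_congr rfl fun j _ => ?_
        rw [← smul_X_eq_monomial, mul_smul_comm]
      rw [this, map_sum, Finset.sum_apply]
      refine Finset.sum_congr rfl fun j _ => ?_
      rw [map_smul]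
      rfl
    have e2 : ev u p x = ev u (full Γ * s) x +
        ∑ γ ∈ Γ, p.eval γ / (filt Γ γ).eval γ * ev u (filt Γ γ) x := by
      conv_lhs => rw [hps, map_add, map_sum, Pi.add_apply, Finset.sum_apply]
      congr 1
      refine Finset.sum_congr rfl fun j _ => ?_
      rw [map_smul]
      rfl
    have e3 : ∑ γ ∈ Γ, p.eval γ / (filt Γ γ).eval γ * R γ x =
        (∑ γ ∈ Γ, p.eval γ / (filt Γ γ).eval γ * ev u (filt Γ γ) x) -
          ∑ γ ∈ Γ with γ + b < ρ, p.eval γ * cf Γ b u γ * x ^ (γ + b) := by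
      rw [Finset.sum_filter, ← Finset.sum_sub_distrib]
      refine Finset.sum_congr rfl fun γ _ => ?_
      simp only [hR]
      split_ifs
      · rw [mul_sub, ← mul_assoc, ← mul_assoc, div_mul_cancel₀ _ eval_filt_ne]
      · rw [sub_zero, sub_zero]
    rw [e2, e1, e3]
    ring
  rw [e]
  refine (wN_add_le (Finset.measurable_fun_sum _ fun j _ =>
    (hmeas _).const_mul _).aemeasurable).trans ?_
  set A := ∑ j ∈ Finset.range M, wN (Ioi 0) ρ (ev u (full Γ * X ^ j)) with hA
  have hA0 : wN (Ioi 0) ρ (ev u (full Γ)) ≤ A := by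
    have := Finset.single_le_sum (f := fun j => wN (Ioi 0) ρ (ev u (full Γ * X ^ j)))
      (fun _ _ => zero_le) (Finset.mem_range.2 (show 0 < M by omega))
    simpa using this
  have b1 := hC1 (Ioi 0) ρ (fun j => ev u (full Γ * X ^ j)) fun j _ => (hmeas _).aemeasurable
  have b2 : wN (Ioi 0) ρ (fun x => ∑ γ ∈ Γ, p.eval γ / (filt Γ γ).eval γ * R γ x) ≤
      C2 * ((∑ γ ∈ Γ, K γ : ℝ≥0) * A) := by
    refine (hC2 (Ioi 0) ρ R fun γ _ => (hRm γ).aemeasurable).trans ?_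
    gcongr
    rw [ENNReal.ofNNReal_finsetSum, Finset.sum_mul]
    refine Finset.sum_le_sum fun γ hγ => (hK γ hγ u N hu hN h0 h1).trans ?_
    gcongr
  calc _ ≤ 2 * (C1 * A) + 2 * (C2 * ((∑ γ ∈ Γ, K γ : ℝ≥0) * A)) := by gcongr
    _ = _ := by
      push_cast
      ring

/-- The coefficient of `x^(γ+b)` vanishes if `f(D_x) v` with `f(γ) ≠ 0` decays faster and `f` is
zero at the other roots which are not larger than this decay. -/
theorem cf_eq_zero {Γ : Finset ℝ} {b ρ ρ₀ ρ₁ : ℝ} (hne : ∀ γ ∈ Γ, γ + b ≠ ρ) (hρ : ρ₀ ≤ ρ)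
    (hρ₁ : ρ₁ ≤ ρ) {f : ℝ[X]} {γ : ℝ} (hγ : γ ∈ Γ) (hγρ : γ + b < ρ₁) (hf : f.eval γ ≠ 0)
    (hf' : ∀ γ' ∈ Γ, γ' ≠ γ → γ' + b ≤ ρ₁ → f.eval γ' = 0) (hdeg : f.natDegree ≤ Γ.card)
    {u : ℕ → ℝ → ℝ} {N : ℕ} (hu : JetX u b N) (hN : Γ.card ≤ N)
    (h0 : ∀ γ ∈ Γ, wN (Ioi 0) ρ₀ (ev u (filt Γ γ)) ≠ ⊤) (h1 : wN (Ioi 0) ρ (ev u (full Γ)) ≠ ⊤)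
    (hfu : wN (Ioi 0) ρ₁ (ev u f) ≠ ⊤) : cf Γ b u γ = 0 := by
  classical
  obtain ⟨K, hK⟩ := exists_expansion Γ hne hρ f
  have h2 := hK u N hu hN h0 h1
  rw [Nat.sub_eq_zero_of_le hdeg] at h2
  simp only [zero_add, Finset.range_one, Finset.sum_singleton, pow_zero, mul_one] at h2
  set R : ℝ → ℝ := fun x => ev u f x -
    ∑ γ ∈ Γ with γ + b < ρ, f.eval γ * cf Γ b u γ * x ^ (γ + b) with hR
  have hsub : Ioo (0 : ℝ) 1 ⊆ Ioi 0 := fun x hx => hx.1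
  have hmeas : Measurable (ev u f) := measurable_ev hu.1 f
  have hRf : WF (Ioo 0 1) ρ₁ R := by
    refine ⟨(hmeas.sub (Finset.measurable_fun_sum _ fun j _ =>
      (measurable_id.pow_const _).const_mul _)).aemeasurable, ?_⟩
    refine ne_top_of_le_ne_top ?_ ((wN_le_of_le' hρ₁ R).trans ((wN_mono hsub ρ R).trans h2))
    exact ENNReal.mul_ne_top ENNReal.coe_ne_top h1
  have hfu' : WF (Ioo 0 1) ρ₁ (ev u f) :=
    ⟨hmeas.aemeasurable, ne_top_of_le_ne_top hfu (wN_mono hsub _ _)⟩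
  set Γ' := {γ' ∈ Γ | γ' + b < ρ}.erase γ with hΓ'
  have hrest : WF (Ioo 0 1) ρ₁
      fun x => ∑ γ' ∈ Γ' with ρ₁ < γ' + b, f.eval γ' * cf Γ b u γ' * x ^ (γ' + b) :=
    WF.sum fun γ' hγ' => WF.rpow_iff.2 (Finset.mem_filter.1 hγ').2
  have e : (fun x : ℝ => f.eval γ * cf Γ b u γ * x ^ (γ + b)) = fun x => (ev u f x - R x) -
      ∑ γ' ∈ Γ' with ρ₁ < γ' + b, f.eval γ' * cf Γ b u γ' * x ^ (γ' + b) := by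
    ext x
    have e1 : ∑ γ' ∈ Γ' with ρ₁ < γ' + b, f.eval γ' * cf Γ b u γ' * x ^ (γ' + b) =
        ∑ γ' ∈ Γ', f.eval γ' * cf Γ b u γ' * x ^ (γ' + b) := by
      refine Finset.sum_filter_of_ne fun γ' hγ' hne' => ?_
      by_contra hle
      have h3 := Finset.mem_erase.1 hγ'
      rw [hf' γ' (Finset.mem_filter.1 h3.2).1 h3.1 (not_lt.1 hle)] at hne'
      simp at hne'
    have hmem : γ ∈ {γ' ∈ Γ | γ' + b < ρ} := Finset.mem_filter.2 ⟨hγ, hγρ.trans_le hρ₁⟩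
    have e2 : R x = ev u f x - (f.eval γ * cf Γ b u γ * x ^ (γ + b) +
        ∑ γ' ∈ Γ', f.eval γ' * cf Γ b u γ' * x ^ (γ' + b)) := by
      rw [hR, Finset.add_sum_erase _ (fun γ' => f.eval γ' * cf Γ b u γ' * x ^ (γ' + b)) hmem]
    rw [e1, e2]
    ring
  by_contra hc
  have h4 : WF (Ioo 0 1) ρ₁ fun x : ℝ => f.eval γ * cf Γ b u γ * x ^ (γ + b) := by
    rw [e]
    exact (hfu'.sub hRf).sub hrest
  have h5 := h4.const_mul (f.eval γ * cf Γ b u γ)⁻¹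
  have h6 : WF (Ioo 0 1) ρ₁ fun x : ℝ => x ^ (γ + b) := by
    convert h5 using 2 with x
    rw [inv_mul_cancel_left₀ (mul_ne_zero hf hc)]
  exact absurd (WF.rpow_iff.1 h6) (not_lt.2 hγρ.le)

end Expansion

/-! ### Slices in the three coordinate directions -/

section Directions

/-- `(x, (t, y)) ↦ (t, (x, y))`. -/
def slX : (ℝ × ℝ × ℝ) ≃L[ℝ] (ℝ × ℝ × ℝ) :=
  (ContinuousLinearEquiv.prodAssoc ℝ ℝ ℝ ℝ).symm.trans
    (((ContinuousLinearEquiv.prodComm ℝ ℝ ℝ).prodCongr (ContinuousLinearEquiv.refl ℝ ℝ)).trans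
      (ContinuousLinearEquiv.prodAssoc ℝ ℝ ℝ ℝ))

/-- `(y, (t, x)) ↦ (t, (x, y))`. -/
def slY : (ℝ × ℝ × ℝ) ≃L[ℝ] (ℝ × ℝ × ℝ) :=
  (ContinuousLinearEquiv.prodComm ℝ ℝ (ℝ × ℝ)).trans (ContinuousLinearEquiv.prodAssoc ℝ ℝ ℝ ℝ)

/-- `((t, y), x) ↦ (t, (x, y))`. -/
def slP : ((ℝ × ℝ) × ℝ) ≃L[ℝ] (ℝ × ℝ × ℝ) :=
  (ContinuousLinearEquiv.prodAssoc ℝ ℝ ℝ ℝ).trans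
    ((ContinuousLinearEquiv.refl ℝ ℝ).prodCongr (ContinuousLinearEquiv.prodComm ℝ ℝ ℝ))

theorem measurePreserving_slX : MeasurePreserving slX := by
  have h1 : MeasurePreserving (Prod.map (Prod.swap : ℝ × ℝ → ℝ × ℝ) (id : ℝ → ℝ)) :=
    (Measure.measurePreserving_swap (μ := volume) (ν := volume)).prod (MeasurePreserving.id volume)
  exact volume_preserving_prodAssoc.comp (h1.comp volume_preserving_prodAssoc.symm)

theorem measurePreserving_slY : MeasurePreserving slY := by
  have h1 : MeasurePreserving (Prod.swap : ℝ × ℝ × ℝ → (ℝ × ℝ) × ℝ) :=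
    Measure.measurePreserving_swap (μ := volume) (ν := volume)
  exact volume_preserving_prodAssoc.comp h1

theorem measurePreserving_slP : MeasurePreserving slP := by
  have h1 : MeasurePreserving (Prod.map (id : ℝ → ℝ) (Prod.swap : ℝ × ℝ → ℝ × ℝ)) :=
    (MeasurePreserving.id volume).prod (Measure.measurePreserving_swap (μ := volume) (ν := volume))
  exact h1.comp volume_preserving_prodAssoc

theorem locallyIntegrableOn_comp {E F : Type} [NormedAddCommGroup E] [NormedSpace ℝ E]
    [MeasureSpace E] [BorelSpace E] [ProperSpace E] [NormedAddCommGroup F] [NormedSpace ℝ F]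
    [MeasureSpace F] [BorelSpace F] (Φ : E ≃L[ℝ] F) (hΦ : MeasurePreserving Φ) {U : Set F}
    (hU : IsOpen U) {f : F → ℝ} (hf : LocallyIntegrableOn f U) :
    LocallyIntegrableOn (fun p => f (Φ p)) (Φ ⁻¹' U) := by
  rw [locallyIntegrableOn_iff (hU.preimage Φ.continuous).isLocallyClosed]
  intro k hk hkc
  have h1 : IntegrableOn f (Φ '' k) :=
    hf.integrableOn_compact_subset (image_subset_iff.2 hk) (hkc.image Φ.continuous)
  have h2 := (hΦ.integrableOn_comp_preimage Φ.toHomeomorph.measurableEmbedding).2 h1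
  exact h2.mono_set (subset_preimage_image Φ k)

theorem IsTest.comp_equiv {E F : Type} [NormedAddCommGroup E] [NormedSpace ℝ E]
    [NormedAddCommGroup F] [NormedSpace ℝ F] (Φ : E ≃L[ℝ] F) {U : Set E} {φ : E → ℝ}
    (h : IsTest U φ) : IsTest (Φ.symm ⁻¹' U) (fun p => φ (Φ.symm p)) := by
  have e : (fun p => φ (Φ.symm p)) = φ ∘ Φ.symm.toHomeomorph := rfl
  refine ⟨h.smooth.comp Φ.symm.contDiff, ?_, ?_⟩
  · rw [e]
    exact h.compact.comp_homeomorph _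
  · intro p hp
    rw [e, tsupport_comp_eq_preimage] at hp
    exact h.subset hp

theorem pdT_tensor_comp (Φ : (ℝ × ℝ × ℝ) ≃L[ℝ] (ℝ × ℝ × ℝ)) {J : Set ℝ} {W : Set (ℝ × ℝ)}
    {χ : ℝ → ℝ} {ψ : ℝ × ℝ → ℝ} (hχ : IsTest J χ) (hψ : IsTest W ψ) (p : ℝ × ℝ × ℝ) :
    pdT (Φ (1, 0)) (fun p => χ (Φ.symm p).1 * ψ (Φ.symm p).2) (Φ p) =
      -(deriv χ p.1 * ψ p.2) := by
  have hd : DifferentiableAt ℝ (fun q : ℝ × ℝ × ℝ => χ q.1 * ψ q.2) p :=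
    (hχ.tensor hψ).smooth.differentiable (by simp) p
  have h1 : (fun p => χ (Φ.symm p).1 * ψ (Φ.symm p).2) =
      (fun q : ℝ × ℝ × ℝ => χ q.1 * ψ q.2) ∘ Φ.symm := rfl
  rw [pdT, h1, fderiv_comp _ (by simpa using hd) Φ.symm.differentiableAt, Φ.symm.fderiv]
  simp only [ContinuousLinearMap.comp_apply, ContinuousLinearEquiv.coe_coe,
    ContinuousLinearEquiv.symm_apply_apply]
  have hχd : DifferentiableAt ℝ (fun q : ℝ × ℝ × ℝ => χ q.1) p :=
    (hχ.smooth.differentiable (by simp)).differentiableAt.comp p differentiableAt_fst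
  have hψd : DifferentiableAt ℝ (fun q : ℝ × ℝ × ℝ => ψ q.2) p :=
    (hψ.smooth.differentiable (by simp)).differentiableAt.comp p differentiableAt_snd
  have e1 : fderiv ℝ (fun q : ℝ × ℝ × ℝ => χ q.1) p (1, 0) = deriv χ p.1 := by
    have h2 : (fun q : ℝ × ℝ × ℝ => χ q.1) = χ ∘ Prod.fst := rfl
    rw [h2, fderiv_comp _ ((hχ.smooth.differentiable (by simp)) _) differentiableAt_fst, fderiv_fst]
    simp
  have e2 : fderiv ℝ (fun q : ℝ × ℝ × ℝ => ψ q.2) p (1, 0) = 0 := by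
    have h2 : (fun q : ℝ × ℝ × ℝ => ψ q.2) = ψ ∘ Prod.snd := rfl
    rw [h2, fderiv_comp _ ((hψ.smooth.differentiable (by simp)) _) differentiableAt_snd, fderiv_snd]
    simp
  rw [fderiv_fun_mul hχd hψd]
  simp [e1, e2, mul_comm]

/-- Functions with a weak derivative in the direction of `Φ (1, 0)` are weakly differentiable on
almost all lines in this direction. -/
theorem ae_weakD (Φ : (ℝ × ℝ × ℝ) ≃L[ℝ] (ℝ × ℝ × ℝ)) (hΦ : MeasurePreserving Φ)
    {U : Set (ℝ × ℝ × ℝ)} (hU : IsOpen U) {J : Set ℝ} {W : Set (ℝ × ℝ)} (hJ : IsOpen J)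
    (hc : J.OrdConnected) (hW : IsOpen W) (hUJ : Φ ⁻¹' U = J ×ˢ W) {u g : ℝ × ℝ × ℝ → ℝ}
    (h : WeakOp U (pdEnd U (Φ (1, 0))) u g) :
    ∀ᵐ z : ℝ × ℝ, z ∈ W → WeakD J (fun s => u (Φ (s, z))) (fun s => g (Φ (s, z))) := by
  have hU' : Φ.symm ⁻¹' (J ×ˢ W) = U := by
    rw [← hUJ, ← preimage_comp]
    simp
  have h1 := locallyIntegrableOn_comp Φ hΦ hU h.1
  have h2 := locallyIntegrableOn_comp Φ hΦ hU h.2.1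
  rw [hUJ] at h1 h2
  have hmain := ae_slice_of_tensor hJ hc hW h1 h2 fun χ ψ hχ hψ => by
    have ht : IsTest U (fun p => χ (Φ.symm p).1 * ψ (Φ.symm p).2) := by
      rw [← hU']
      exact (hχ.tensor hψ).comp_equiv Φ
    have h3 := h.2.2 ⟨_, ht⟩
    have e1 : ∫ p, u p * pdT (Φ (1, 0)) (fun p => χ (Φ.symm p).1 * ψ (Φ.symm p).2) p =
        -∫ p, u (Φ p) * (deriv χ p.1 * ψ p.2) := by
      rw [← hΦ.integral_comp Φ.toHomeomorph.measurableEmbedding, ← integral_neg]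
      congr 1
      ext p
      rw [pdT_tensor_comp Φ hχ hψ]
      ring
    have e2 : ∫ p, g p * (χ (Φ.symm p).1 * ψ (Φ.symm p).2) = ∫ p, g (Φ p) * (χ p.1 * ψ p.2) := by
      rw [← hΦ.integral_comp Φ.toHomeomorph.measurableEmbedding]
      simp
    have h4 : -∫ p, u (Φ p) * (deriv χ p.1 * ψ p.2) = ∫ p, g (Φ p) * (χ p.1 * ψ p.2) :=
      (e1.symm.trans h3).trans e2
    rw [← h4]
    ring
  filter_upwards [hmain] with z hz hzW
  obtain ⟨g1, g2, g3⟩ := hz hzW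
  exact ⟨g1, g2, fun χ hχ => by linarith [g3 χ hχ]⟩

variable {T : ℝ≥0∞}

theorem isOpen_dom : IsOpen (spaceTime T).dom := HalfSpace.IsLinear.isOpen

theorem ordConnected_timeO : (timeO T).OrdConnected :=
  ⟨fun _ ha _ hb _ hc => ⟨ha.1.trans_le hc.1,
    (ENNReal.ofReal_le_ofReal hc.2).trans_lt hb.2⟩⟩

theorem locallyIntegrableOn_mul_rpow {u : ℝ × ℝ × ℝ → ℝ}
    (hu : LocallyIntegrableOn u (spaceTime T).dom) :
    LocallyIntegrableOn (fun p => (p.2.1)⁻¹ * u p) (spaceTime T).dom := by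
  have hc : ContinuousOn (fun p : ℝ × ℝ × ℝ => (p.2.1)⁻¹) (spaceTime T).dom :=
    continuous_snd.fst.continuousOn.inv₀ fun p hp => ne_of_gt hp.2.2
  exact hu.continuousOn_mul hc isOpen_dom.isLocallyClosed

theorem weakOp_xInvEnd {u : ℝ × ℝ × ℝ → ℝ} (hu : LocallyIntegrableOn u (spaceTime T).dom) :
    WeakOp (spaceTime T).dom (xInvEnd (spaceTime T)) u fun p => (p.2.1)⁻¹ * u p := by
  refine ⟨hu, locallyIntegrableOn_mul_rpow hu, fun φ => ?_⟩
  congr 1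
  ext p
  change u p * ((p.2.1)⁻¹ * φ.1 p) = _
  ring

/-- `∂_x = x⁻¹ D_x`. -/
theorem WeakOp.pd_ex {u g : ℝ × ℝ × ℝ → ℝ}
    (h : WeakOp (spaceTime T).dom (dxEnd (spaceTime T)) u g) :
    WeakOp (spaceTime T).dom (pdEnd _ (0, 1, 0)) u fun p => (p.2.1)⁻¹ * g p := by
  have h1 := h.comp (weakOp_xInvEnd h.2.1)
  rwa [dxEnd, mul_assoc, xEnd_mul_xInvEnd, mul_one] at h1

/-- `∂_y = x⁻¹ D_y`. -/
theorem WeakOp.pd_ey {u g : ℝ × ℝ × ℝ → ℝ}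
    (h : WeakOp (spaceTime T).dom (dyEnd (spaceTime T)) u g) :
    WeakOp (spaceTime T).dom (pdEnd _ (0, 0, 1)) u fun p => (p.2.1)⁻¹ * g p := by
  have h1 := h.comp (weakOp_xInvEnd h.2.1)
  rwa [dyEnd, mul_assoc, xEnd_mul_xInvEnd, mul_one] at h1

theorem isOpen_timeO_univ : IsOpen (timeO T ×ˢ (univ : Set ℝ)) := (isOpen_timeO T).prod isOpen_univ

theorem ae_xd {u g : ℝ × ℝ × ℝ → ℝ}
    (h : WeakOp (spaceTime T).dom (dxEnd (spaceTime T)) u g) :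
    ∀ᵐ z ∂volume.restrict (timeO T ×ˢ (univ : Set ℝ)),
      XD (fun x => u (z.1, x, z.2)) fun x => g (z.1, x, z.2) := by
  rw [ae_restrict_iff' isOpen_timeO_univ.measurableSet]
  have hUJ : slX ⁻¹' (spaceTime T).dom = Ioi 0 ×ˢ (timeO T ×ˢ (univ : Set ℝ)) := by
    ext ⟨x, t, y⟩
    rw [spaceTime_dom]
    simp [slX, plane, and_comm]
  have h1 := ae_weakD slX measurePreserving_slX isOpen_dom isOpen_Ioi ordConnected_Ioi
    isOpen_timeO_univ hUJ h.pd_ex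
  filter_upwards [h1] with z hz hzW
  obtain ⟨w, hw, hp⟩ := (hz hzW).exists_primitive isOpen_Ioi ordConnected_Ioi
  refine ⟨w, hw, fun a b ha hb => ?_⟩
  have h2 := hp a ha b hb
  have e : (fun s => g (z.1, s, z.2) / s) = fun s => (slX (s, z)).2.1⁻¹ * g (slX (s, z)) := by
    ext s
    rw [div_eq_inv_mul]
    rfl
  rw [e]
  exact h2

theorem ae_weakD_y {u g : ℝ × ℝ × ℝ → ℝ}
    (h : WeakOp (spaceTime T).dom (dyEnd (spaceTime T)) u g) :
    ∀ᵐ z ∂volume.restrict (timeO T ×ˢ Ioi (0 : ℝ)),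
      WeakD univ (fun y => u (z.1, z.2, y)) fun y => z.2⁻¹ * g (z.1, z.2, y) := by
  have ho := (isOpen_timeO T).prod (isOpen_Ioi (a := (0 : ℝ)))
  rw [ae_restrict_iff' ho.measurableSet]
  have hUJ : slY ⁻¹' (spaceTime T).dom = univ ×ˢ (timeO T ×ˢ Ioi (0 : ℝ)) := by
    ext ⟨y, t, x⟩
    rw [spaceTime_dom]
    simp [slY, plane]
  exact ae_weakD slY measurePreserving_slY isOpen_dom isOpen_univ ordConnected_univ ho hUJ h.pd_ey

theorem ae_weakD_t {u g : ℝ × ℝ × ℝ → ℝ} (h : WeakOp (spaceTime T).dom (dtEnd T) u g) :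
    ∀ᵐ q ∂volume.restrict plane.dom, WeakD (timeO T) (fun t => u (t, q)) fun t => g (t, q) := by
  have ho : IsOpen plane.dom := HalfSpace.IsLinear.isOpen
  rw [ae_restrict_iff' ho.measurableSet]
  exact ae_weakD (ContinuousLinearEquiv.refl ℝ _) (MeasurePreserving.id volume) isOpen_dom
    (isOpen_timeO T) ordConnected_timeO ho (spaceTime_dom T) h

end Directions

/-! ### Norms on slices -/

section SliceNorms

/-- `∫_ℝ ∫_0^∞ x^(-2ρ-1) w(t, x, y)² dx dy`. -/
def sN (ρ : ℝ) (w : ℝ × ℝ × ℝ → ℝ) (t : ℝ) : ℝ≥0∞ :=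
  ∫⁻ y, wN (Ioi 0) ρ fun x => w (t, x, y)

theorem measurable_wN {w : ℝ × ℝ × ℝ → ℝ} (hw : Measurable w) (S : Set ℝ) (ρ : ℝ) :
    Measurable fun z : ℝ × ℝ => wN S ρ fun x => w (z.1, x, z.2) := by
  have h1 : Measurable fun q : (ℝ × ℝ) × ℝ =>
      ENNReal.ofReal (q.2 ^ (-2 * ρ - 1)) * ‖w (q.1.1, q.2, q.1.2)‖ₑ ^ 2 :=
    ((measurable_ofReal_rpow _).comp measurable_snd).mul
      ((hw.comp (by fun_prop)).enorm.pow_const 2)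
  exact h1.lintegral_prod_right'

theorem measurable_sN {w : ℝ × ℝ × ℝ → ℝ} (hw : Measurable w) (ρ : ℝ) : Measurable (sN ρ w) :=
  (measurable_wN hw (Ioi 0) ρ).lintegral_prod_right'

theorem weightSq_eq_lintegral {w : ℝ × ℝ → ℝ} (hw : Measurable w) (α : ℝ) :
    weightSq α w = ∫⁻ y, wN (Ioi 0) (α + 1 / 2) fun x => w (x, y) := by
  have e : {p : ℝ × ℝ | 0 < p.1} = Ioi 0 ×ˢ univ := by
    ext p
    simp
  have hm : Measurable fun p : ℝ × ℝ => ENNReal.ofReal (p.1 ^ (-2 * α - 2)) * ‖w p‖ₑ ^ 2 :=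
    ((measurable_ofReal_rpow _).comp measurable_fst).mul (hw.enorm.pow_const 2)
  rw [weightSq, e, Measure.volume_eq_prod, setLIntegral_prod_symm _ hm.aemeasurable,
    Measure.restrict_univ]
  have e2 : -2 * (α + 1 / 2) - 1 = -2 * α - 2 := by ring
  simp only [wN, e2]

theorem weightSq_eq_sN {w : ℝ × ℝ × ℝ → ℝ} (hw : Measurable w) (α t : ℝ) :
    weightSq α (fun q => w (t, q)) = sN (α + 1 / 2) w t :=
  weightSq_eq_lintegral (hw.comp measurable_prodMk_left) α

theorem lintegral_timeO_prod {T : ℝ≥0∞} {F : ℝ × ℝ → ℝ≥0∞} (hF : Measurable F) :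
    ∫⁻ z in timeO T ×ˢ (univ : Set ℝ), F z = ∫⁻ t in timeO T, ∫⁻ y, F (t, y) := by
  rw [Measure.volume_eq_prod, setLIntegral_prod _ hF.aemeasurable, Measure.restrict_univ]

theorem lintegral_wN_eq {T : ℝ≥0∞} {w : ℝ × ℝ × ℝ → ℝ} (hw : Measurable w) (ρ : ℝ) :
    ∫⁻ z in timeO T ×ˢ (univ : Set ℝ), wN (Ioi 0) ρ (fun x => w (z.1, x, z.2)) =
      ∫⁻ t in timeO T, sN ρ w t :=
  lintegral_timeO_prod (measurable_wN hw _ _)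

end SliceNorms

/-! ### The coefficients as functions of `(t, y)` -/

section Coefficients

open Polynomial

variable {T : ℝ≥0∞} {v : ℝ × ℝ × ℝ → ℝ} {N : ℕ} {g : ℕ → ℕ → ℝ × ℝ × ℝ → ℝ}

/-- The functions `g n b` are measurable representatives of `D_y^b D_x^n v`. -/
structure Jets (T : ℝ≥0∞) (v : ℝ × ℝ × ℝ → ℝ) (N : ℕ) (g : ℕ → ℕ → ℝ × ℝ × ℝ → ℝ) : Prop where
  meas : ∀ n b, Measurable (g n b)
  weak : ∀ n b, n + b ≤ N + 7 → b ≤ N →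
    WeakOp (spaceTime T).dom (opEnd (spaceTime T) (X ^ n) b) v (g n b)

/-- The representative of `D_y^b p(D_x) v`. -/
def jet (g : ℕ → ℕ → ℝ × ℝ × ℝ → ℝ) (p : ℝ[X]) (b : ℕ) : ℝ × ℝ × ℝ → ℝ :=
  ev (fun n => g n b) p

/-- The functions `D_y^b D_x^n v` at a fixed point `z = (t, y)`, as functions of `x`. -/
def sl (g : ℕ → ℕ → ℝ × ℝ × ℝ → ℝ) (b : ℕ) (z : ℝ × ℝ) : ℕ → ℝ → ℝ :=
  fun n x => g n b (z.1, x, z.2)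

theorem ev_sl (p : ℝ[X]) (b : ℕ) (z : ℝ × ℝ) :
    ev (sl g b z) p = fun x => jet g p b (z.1, x, z.2) := by
  ext x
  rw [jet, ev_apply, ev_apply]
  rfl

namespace Jets

theorem measurable_jet (h : Jets T v N g) (p : ℝ[X]) (b : ℕ) : Measurable (jet g p b) :=
  measurable_ev (fun n => h.meas n b) p

theorem weakOp (h : Jets T v N g) {p : ℝ[X]} {b : ℕ} (hp : p.natDegree + b ≤ N + 7) (hb : b ≤ N) :
    WeakOp (spaceTime T).dom (opEnd (spaceTime T) p b) v (jet g p b) :=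
  WeakOp.ev (spaceTime T) (N := N + 7 - b) (fun n hn => h.weak n b (by omega) hb) (by omega)

theorem natDegree_X_add_C_mul_le (p : ℝ[X]) (c : ℝ) :
    ((X + C c) * p).natDegree ≤ p.natDegree + 1 := by
  refine natDegree_mul_le.trans ?_
  rw [natDegree_X_add_C]
  omega

theorem dx (h : Jets T v N g) {p : ℝ[X]} {b : ℕ} (hp : p.natDegree + 1 + b ≤ N + 7) (hb : b ≤ N) :
    WeakOp (spaceTime T).dom (dxEnd (spaceTime T)) (jet g p b) (jet g ((X + C (b : ℝ)) * p) b) := by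
  refine (h.weakOp (p := p) (by omega) hb).of_comp ?_
  rw [opEnd_mul_dxEnd, mul_comm p]
  exact h.weakOp (by have := natDegree_X_add_C_mul_le p b; omega) hb

theorem dy (h : Jets T v N g) {p : ℝ[X]} {b : ℕ} (hp : p.natDegree + (b + 1) ≤ N + 7)
    (hb : b + 1 ≤ N) :
    WeakOp (spaceTime T).dom (dyEnd (spaceTime T)) (jet g p b) (jet g p (b + 1)) := by
  refine (h.weakOp (p := p) (by omega) (by omega)).of_comp ?_
  rw [opEnd_mul_dyEnd]
  exact h.weakOp hp hb

theorem ae_jetX (h : Jets T v N g) {b : ℕ} (hb : b ≤ N) :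
    ∀ᵐ z ∂volume.restrict (timeO T ×ˢ (univ : Set ℝ)), JetX (sl g b z) b (N + 7 - b) := by
  have h1 : ∀ n : ℕ, ∀ᵐ z ∂volume.restrict (timeO T ×ˢ (univ : Set ℝ)), n + 1 ≤ N + 7 - b →
      XD (sl g b z n) fun x => sl g b z (n + 1) x + b * sl g b z n x := by
    intro n
    by_cases hn : n + 1 ≤ N + 7 - b
    · have h2 := h.dx (p := X ^ n) (b := b) (by rw [natDegree_X_pow]; omega) hb
      have e1 : jet g (X ^ n) b = g n b := ev_X_pow _ n
      have e2 : jet g ((X + C (b : ℝ)) * X ^ n) b = fun p => g (n + 1) b p + b * g n b p := by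
        have : (X + C (b : ℝ)) * X ^ n = X ^ (n + 1) + (b : ℝ) • X ^ n := by
          rw [add_mul, ← pow_succ', C_mul']
        rw [jet, this, map_add, map_smul, ev_X_pow, ev_X_pow]
        rfl
      rw [e1, e2] at h2
      filter_upwards [ae_xd h2] with z hz _
      exact hz
    · exact Eventually.of_forall fun z h => absurd h hn
  filter_upwards [ae_all_iff.2 h1] with z hz
  exact ⟨fun n => (h.meas n b).comp (by fun_prop), hz⟩

end Jets

/-- The coefficient of `x^(γ+b)` in `D_y^b v` as a function of `(t, y)`. -/
def cfT (Γ : Finset ℝ) (g : ℕ → ℕ → ℝ × ℝ × ℝ → ℝ) (b : ℕ) (γ : ℝ) (z : ℝ × ℝ) : ℝ :=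
  cf Γ b (sl g b z) γ

/-- The average `av γ l` in the variable `x`. -/
def avT (γ l : ℝ) (w : ℝ × ℝ × ℝ → ℝ) (z : ℝ × ℝ) : ℝ := av γ l fun x => w (z.1, x, z.2)

theorem measurable_avT {w : ℝ × ℝ × ℝ → ℝ} (hw : Measurable w) (γ : ℝ) {l : ℝ} (hl : 0 < l) :
    Measurable (avT γ l w) := by
  have h1 : Measurable fun q : (ℝ × ℝ) × ℝ => avKer γ l q.2 * w (q.1.1, q.2, q.1.2) :=
    ((isTest_avKer γ hl).smooth.continuous.measurable.comp measurable_snd).mul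
      (hw.comp (by fun_prop))
  exact h1.stronglyMeasurable.integral_prod_right'.measurable

theorem Jets.measurable_cfT (h : Jets T v N g) (Γ : Finset ℝ) (b : ℕ) (γ : ℝ) :
    Measurable (cfT Γ g b γ) := by
  have h1 : StronglyMeasurable fun z => limUnder atTop fun n : ℕ =>
      avT (γ + b) ((n : ℝ) + 1)⁻¹ (jet g (filt Γ γ) b) z :=
    StronglyMeasurable.limUnder fun n =>
      (measurable_avT (h.measurable_jet _ b) _ (by positivity)).stronglyMeasurable
  have e : cfT Γ g b γ = fun z => (limUnder atTop fun n : ℕ =>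
      avT (γ + b) ((n : ℝ) + 1)⁻¹ (jet g (filt Γ γ) b) z) / (filt Γ γ).eval γ := by
    ext z
    rw [cfT, cf, coef, ev_sl]
    rfl
  rw [e]
  exact h1.measurable.div_const _

theorem ae_wN_ne_top {w : ℝ × ℝ × ℝ → ℝ} (hw : Measurable w) {ρ : ℝ}
    (h : ∫⁻ t in timeO T, sN ρ w t ≠ ⊤) :
    ∀ᵐ z ∂volume.restrict (timeO T ×ˢ (univ : Set ℝ)),
      wN (Ioi 0) ρ (fun x => w (z.1, x, z.2)) ≠ ⊤ := by
  rw [← lintegral_wN_eq hw] at h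
  filter_upwards [ae_lt_top (measurable_wN hw _ _) h] with z hz
  exact hz.ne

/-- Bounds for the coefficients, and for the speed at which the averages converge to them. -/
theorem exists_cfT_bounds (Γ : Finset ℝ) {γ : ℝ} (hγ : γ ∈ Γ) (b : ℕ) {ρ : ℝ} (ρ₀ : ℝ)
    (hρ : γ + b < ρ) :
    ∃ K : ℝ≥0, ∀ (T : ℝ≥0∞) (v : ℝ × ℝ × ℝ → ℝ) (N : ℕ) (g : ℕ → ℕ → ℝ × ℝ × ℝ → ℝ),
      Jets T v N g → b ≤ N → Γ.card + b ≤ N + 7 →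
      ∀ᵐ z ∂volume.restrict (timeO T ×ˢ (univ : Set ℝ)),
      wN (Ioi 0) ρ (fun x => jet g (full Γ) b (z.1, x, z.2)) ≠ ⊤ →
      ‖cfT Γ g b γ z‖ₑ ^ 2 ≤ K * (wN (Ioi 0) ρ₀ (fun x => jet g (filt Γ γ) b (z.1, x, z.2)) +
        wN (Ioi 0) ρ (fun x => jet g (full Γ) b (z.1, x, z.2))) ∧
      ∀ l, 0 < l →
        ‖((filt Γ γ).eval γ)⁻¹ * avT (γ + b) l (jet g (filt Γ γ) b) z - cfT Γ g b γ z‖ₑ ^ 2 ≤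
        K * ENNReal.ofReal (l ^ (2 * (ρ - (γ + b)))) *
          wN (Ioi 0) ρ (fun x => jet g (full Γ) b (z.1, x, z.2)) := by
  obtain ⟨K, hK⟩ := exists_trace (γ + b) ρ₀ ρ hρ
  set e := (filt Γ γ).eval γ with he
  refine ⟨‖e⁻¹‖₊ ^ 2 * K, fun T v N g hJ hb hN => ?_⟩
  filter_upwards [hJ.ae_jetX hb] with z hz hfin
  obtain ⟨g1, g2⟩ := hz.xd_filt (Γ := Γ) (by omega) hγ
  rw [ev_sl (full Γ)] at g2
  obtain ⟨-, k1, k2, -⟩ := hK _ _ g1 (by rwa [g2])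
  rw [g2] at k1 k2
  rw [ev_sl (filt Γ γ)] at k1 k2
  have hcf : cfT Γ g b γ z = e⁻¹ * coef (γ + b) (fun x => jet g (filt Γ γ) b (z.1, x, z.2)) := by
    rw [cfT, cf, ev_sl, div_eq_inv_mul]
  have hc : ((‖e⁻¹‖₊ ^ 2 * K : ℝ≥0) : ℝ≥0∞) = ‖e⁻¹‖ₑ ^ 2 * K := by
    push_cast
    rfl
  rw [hcf, hc]
  refine ⟨?_, fun l hl => ?_⟩
  · rw [enorm_mul, mul_pow, mul_assoc]
    gcongr
  · rw [← mul_sub, enorm_mul, mul_pow, mul_assoc, mul_assoc, ← mul_assoc (K : ℝ≥0∞)]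
    gcongr
    exact k2 l hl

theorem locallyIntegrableOn_of_sq {E : Type} [NormedAddCommGroup E] [NormedSpace ℝ E]
    [ProperSpace E] [MeasureSpace E] [BorelSpace E] [IsLocallyFiniteMeasure (volume : Measure E)]
    {U : Set E} (hU : IsOpen U) {f : E → ℝ} (hf : Measurable f)
    (h : ∫⁻ p in U, ‖f p‖ₑ ^ 2 ≠ ⊤) : LocallyIntegrableOn f U := by
  rw [locallyIntegrableOn_iff hU.isLocallyClosed]
  intro k hk hkc
  refine ⟨hf.aestronglyMeasurable, ?_⟩
  have h1 : ∀ p, ‖f p‖ₑ ≤ 1 + ‖f p‖ₑ ^ 2 := by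
    intro p
    rcases le_total ‖f p‖ₑ 1 with h2 | h2
    · exact h2.trans le_self_add
    · exact (le_self_pow₀ h2 two_ne_zero).trans le_add_self
  calc ∫⁻ p in k, ‖f p‖ₑ ≤ ∫⁻ p in k, (1 + ‖f p‖ₑ ^ 2) := lintegral_mono h1
    _ = volume k + ∫⁻ p in k, ‖f p‖ₑ ^ 2 := by
      rw [lintegral_add_left measurable_const]
      simp
    _ < ⊤ := ENNReal.add_lt_top.2 ⟨hkc.measure_lt_top,
      (lintegral_mono_set hk).trans_lt (lt_top_iff_ne_top.2 h)⟩

theorem tendsto_integral_mul_of_sq {α : Type} [MeasurableSpace α] {μ : Measure α}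
    {F : ℕ → α → ℝ} {G φ : α → ℝ} {b : ℕ → ℝ≥0∞} (hF : ∀ n, Integrable (fun a => F n a * φ a) μ)
    (hG : Integrable (fun a => G a * φ a) μ) (hFm : ∀ n, Measurable (F n)) (hGm : Measurable G)
    (hφm : AEStronglyMeasurable φ μ) (hφ : ∫⁻ a, ‖φ a‖ₑ ^ 2 ∂μ ≠ ⊤)
    (h : ∀ n, ∫⁻ a, ‖F n a - G a‖ₑ ^ 2 ∂μ ≤ b n) (hb : Tendsto b atTop (𝓝 0)) :
    Tendsto (fun n => ∫ a, F n a * φ a ∂μ) atTop (𝓝 (∫ a, G a * φ a ∂μ)) := by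
  refine tendsto_of_enorm_sq_le (b := fun n => b n * ∫⁻ a, ‖φ a‖ₑ ^ 2 ∂μ) ?_ fun n => ?_
  · simpa using ENNReal.Tendsto.mul_const hb (Or.inr hφ)
  · rw [← integral_sub (hF n) hG]
    calc _ ≤ (∫⁻ a, ‖F n a - G a‖ₑ * ‖φ a‖ₑ ∂μ) ^ 2 := by
          gcongr
          refine (enorm_integral_le_lintegral_enorm _).trans (lintegral_mono fun a => ?_)
          rw [← sub_mul, enorm_mul]
      _ ≤ _ := (lintegral_mul_sq_le ((hFm n).sub hGm).enorm.aemeasurable hφm.enorm)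
      _ ≤ _ := by gcongr; exact h n

theorem avKer_add_one {γ l : ℝ} (hl : 0 < l) (x : ℝ) : avKer (γ + 1) l x = x⁻¹ * avKer γ l x := by
  by_cases hx : x ∈ Ioo l (2 * l)
  · have h0 : 0 < x := hl.trans hx.1
    rw [avKer, avKer, neg_add, Real.rpow_add h0, Real.rpow_neg_one]
    ring
  · rw [avKer_eq_zero hl hx, avKer_eq_zero hl hx, mul_zero]

/-- Averages in `x` are tested with tensor products. -/
theorem integral_avT_mul {w : ℝ × ℝ × ℝ → ℝ} (hw : LocallyIntegrableOn w (spaceTime T).dom)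
    (γ : ℝ) {l : ℝ} (hl : 0 < l) {χ ψ : ℝ → ℝ} (hχ : IsTest univ χ) (hψ : IsTest (timeO T) ψ) :
    Integrable (fun z : ℝ × ℝ => avT γ l w z * (χ z.2 * ψ z.1)) ∧
    ∫ z : ℝ × ℝ, avT γ l w z * (χ z.2 * ψ z.1) =
      ∫ q : ℝ × ℝ × ℝ, w (slY q) * (χ q.1 * (ψ q.2.1 * avKer γ l q.2.2)) := by
  have ht : IsTest (spaceTime T).dom fun p => ψ p.1 * (avKer γ l p.2.1 * χ p.2.2) := by
    rw [spaceTime_dom]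
    have h1 := hψ.tensor ((isTest_avKer γ hl).tensor hχ)
    have e : (Ioi (0 : ℝ) ×ˢ (univ : Set ℝ)) = plane.dom := by
      ext p
      simp [plane]
    rwa [e] at h1
  have h1 := ht.integrable_mul hw
  have h2 := (measurePreserving_slP.integrable_comp_emb
    slP.toHomeomorph.measurableEmbedding).2 h1
  have h3 := measurePreserving_slP.integral_comp slP.toHomeomorph.measurableEmbedding
    fun p => w p * (ψ p.1 * (avKer γ l p.2.1 * χ p.2.2))
  have h4 := measurePreserving_slY.integral_comp slY.toHomeomorph.measurableEmbedding
    fun p => w p * (ψ p.1 * (avKer γ l p.2.1 * χ p.2.2))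
  have e : ∀ z : ℝ × ℝ, ∫ x, w (slP (z, x)) * (ψ (slP (z, x)).1 * (avKer γ l (slP (z, x)).2.1 *
      χ (slP (z, x)).2.2)) = avT γ l w z * (χ z.2 * ψ z.1) := by
    intro z
    rw [avT, av, ← integral_mul_const]
    congr 1
    ext x
    change w (z.1, x, z.2) * (ψ z.1 * (avKer γ l x * χ z.2)) = _
    ring
  rw [Measure.volume_eq_prod] at h2 h3
  have h5 := h2.integral_prod_left
  have h6 := integral_prod _ h2
  simp only [Function.comp_apply] at h5 h6
  simp only [e] at h5 h6
  refine ⟨h5, h6.symm.trans (h3.trans (h4.symm.trans ?_))⟩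
  congr 1
  ext q
  change w (slY q) * (ψ q.2.1 * (avKer γ l q.2.2 * χ q.1)) = _
  ring

end Coefficients

/-! ### The derivatives of the coefficients in `y` -/

section CoefficientDerivatives

open Polynomial

variable {T : ℝ≥0∞} {v : ℝ × ℝ × ℝ → ℝ} {N : ℕ} {g : ℕ → ℕ → ℝ × ℝ × ℝ → ℝ}

/-- The coefficients of `D_y^b v` are square integrable in `(t, y)`. -/
theorem exists_lintegral_cfT_sq_le (Γ : Finset ℝ) {γ : ℝ} (hγ : γ ∈ Γ) (b : ℕ) {ρ : ℝ} (ρ₀ : ℝ)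
    (hρ : γ + b < ρ) :
    ∃ K : ℝ≥0, ∀ (T : ℝ≥0∞) (v : ℝ × ℝ × ℝ → ℝ) (N : ℕ) (g : ℕ → ℕ → ℝ × ℝ × ℝ → ℝ),
      Jets T v N g → b ≤ N → Γ.card + b ≤ N + 7 →
      ∫⁻ t in timeO T, sN ρ (jet g (full Γ) b) t ≠ ⊤ →
      ∫⁻ z in timeO T ×ˢ (univ : Set ℝ), ‖cfT Γ g b γ z‖ₑ ^ 2 ≤
        K * ((∫⁻ t in timeO T, sN ρ₀ (jet g (filt Γ γ) b) t) +
          ∫⁻ t in timeO T, sN ρ (jet g (full Γ) b) t) := by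
  obtain ⟨K, hK⟩ := exists_cfT_bounds Γ hγ b ρ₀ hρ
  refine ⟨K, fun T v N g hJ hb hN hfin => ?_⟩
  have hm := fun p => hJ.measurable_jet p b
  rw [← lintegral_wN_eq (hm _), ← lintegral_wN_eq (hm _),
    ← lintegral_add_left (measurable_wN (hm _) _ _), ← lintegral_const_mul' _ _ ENNReal.coe_ne_top]
  refine lintegral_mono_ae ?_
  filter_upwards [hK T v N g hJ hb hN, ae_wN_ne_top (hm _) hfin] with z h1 h2
  exact (h1 h2).1

theorem Jets.tendsto_integral_avT (hJ : Jets T v N g) (Γ : Finset ℝ) {γ : ℝ} (hγ : γ ∈ Γ) {b : ℕ}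
    {ρ ρ₀ : ℝ} (hρ : γ + b < ρ) (hb : b ≤ N) (hN : Γ.card + b ≤ N + 7)
    (hfin : ∫⁻ t in timeO T, sN ρ (jet g (full Γ) b) t ≠ ⊤)
    (h0 : ∫⁻ t in timeO T, sN ρ₀ (jet g (filt Γ γ) b) t ≠ ⊤)
    {χ ψ : ℝ → ℝ} (hχ : IsTest univ χ) (hψ : IsTest (timeO T) ψ) :
    LocallyIntegrableOn (cfT Γ g b γ) (timeO T ×ˢ (univ : Set ℝ)) ∧
    Tendsto (fun n : ℕ => ∫ z : ℝ × ℝ, ((filt Γ γ).eval γ)⁻¹ *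
      avT (γ + b) ((n : ℝ) + 1)⁻¹ (jet g (filt Γ γ) b) z * (χ z.2 * ψ z.1)) atTop
      (𝓝 (∫ z : ℝ × ℝ, cfT Γ g b γ z * (χ z.2 * ψ z.1))) := by
  obtain ⟨K, hK⟩ := exists_lintegral_cfT_sq_le Γ hγ b ρ₀ hρ
  obtain ⟨K', hK'⟩ := exists_cfT_bounds Γ hγ b ρ₀ hρ
  have hm := fun p => hJ.measurable_jet p b
  have hcm := hJ.measurable_cfT Γ b γ
  have hsq : ∫⁻ z in timeO T ×ˢ (univ : Set ℝ), ‖cfT Γ g b γ z‖ₑ ^ 2 ≠ ⊤ :=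
    ne_top_of_le_ne_top (ENNReal.mul_ne_top ENNReal.coe_ne_top (ENNReal.add_ne_top.2 ⟨h0, hfin⟩))
      (hK T v N g hJ hb hN hfin)
  have hloc := locallyIntegrableOn_of_sq (U := timeO T ×ˢ (univ : Set ℝ)) isOpen_timeO_univ hcm hsq
  refine ⟨hloc, ?_⟩
  have ht : IsTest (timeO T ×ˢ (univ : Set ℝ)) fun z : ℝ × ℝ => χ z.2 * ψ z.1 := by
    simpa only [mul_comm] using hψ.tensor hχ
  have hz : ∀ z : ℝ × ℝ, z ∉ timeO T ×ˢ (univ : Set ℝ) → χ z.2 * ψ z.1 = 0 := fun z hz =>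
    image_eq_zero_of_notMem_tsupport (f := fun z : ℝ × ℝ => χ z.2 * ψ z.1) fun h => hz (ht.subset h)
  have hres : ∀ f : ℝ × ℝ → ℝ, ∫ z in timeO T ×ˢ (univ : Set ℝ), f z * (χ z.2 * ψ z.1) =
      ∫ z : ℝ × ℝ, f z * (χ z.2 * ψ z.1) := fun f =>
    setIntegral_eq_integral_of_forall_compl_eq_zero fun z hz' => by rw [hz z hz', mul_zero]
  simp only [← hres]
  have hpos : ∀ n : ℕ, (0 : ℝ) < ((n : ℝ) + 1)⁻¹ := fun n => by positivity
  have hwl : LocallyIntegrableOn (jet g (filt Γ γ) b) (spaceTime T).dom :=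
    (hJ.weakOp (p := filt Γ γ) (by have := natDegree_filt hγ; omega) hb).2.1
  refine tendsto_integral_mul_of_sq (b := fun n : ℕ => K' * ENNReal.ofReal (((n : ℝ) + 1)⁻¹ ^
    (2 * (ρ - (γ + b)))) * ∫⁻ t in timeO T, sN ρ (jet g (full Γ) b) t) (fun n => ?_)
    (ht.integrable_mul hloc).integrableOn (fun n => (measurable_avT (hm _) _ (hpos n)).const_mul _)
    hcm ht.smooth.continuous.aestronglyMeasurable ?_ (fun n => ?_) ?_
  · have h1 := ((integral_avT_mul hwl (γ + b) (hpos n) hχ hψ).1.const_mul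
      ((filt Γ γ).eval γ)⁻¹).integrableOn (s := timeO T ×ˢ (univ : Set ℝ))
    rw [IntegrableOn] at h1
    simpa only [mul_assoc] using h1
  · have h1 : MemLp (fun z : ℝ × ℝ => χ z.2 * ψ z.1) 2 (volume.restrict (timeO T ×ˢ univ)) :=
      (ht.smooth.continuous.memLp_of_hasCompactSupport ht.compact).restrict _
    have h2 := h1.2
    rw [eLpNorm_lt_top_iff_lintegral_rpow_enorm_lt_top (by simp) (by simp)] at h2
    simpa using h2.ne
  · rw [← lintegral_wN_eq (hm _), ← lintegral_const_mul' _ _ (by finiteness)]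
    refine lintegral_mono_ae ?_
    filter_upwards [hK' T v N g hJ hb hN, ae_wN_ne_top (hm _) hfin] with z h1 h2
    exact (h1 h2).2 _ (hpos n)
  · have h2 := ENNReal.tendsto_ofReal (tendsto_inv_rpow (a := 2 * (ρ - (γ + b))) (by linarith))
    rw [ENNReal.ofReal_zero] at h2
    have h3 := ENNReal.Tendsto.mul_const (ENNReal.Tendsto.const_mul h2
      (Or.inr (ENNReal.coe_ne_top (r := K'))))
      (b := ∫⁻ t in timeO T, sN ρ (jet g (full Γ) b) t) (Or.inr hfin)
    simpa using h3

/-- The coefficient in `D_y^(b+1) v` is the derivative of the coefficient in `D_y^b v`. -/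
theorem Jets.weakD_cfT (hJ : Jets T v N g) (Γ : Finset ℝ) {γ : ℝ} (hγ : γ ∈ Γ) {b : ℕ}
    {ρ ρ' ρ₀ : ℝ} (hρ : γ + b < ρ) (hρ' : γ + (b + 1) < ρ') (hb : b + 1 ≤ N)
    (hN : Γ.card + (b + 1) ≤ N + 7)
    (hfin : ∫⁻ t in timeO T, sN ρ (jet g (full Γ) b) t ≠ ⊤)
    (h0 : ∫⁻ t in timeO T, sN ρ₀ (jet g (filt Γ γ) b) t ≠ ⊤)
    (hfin' : ∫⁻ t in timeO T, sN ρ' (jet g (full Γ) (b + 1)) t ≠ ⊤)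
    (h0' : ∫⁻ t in timeO T, sN ρ₀ (jet g (filt Γ γ) (b + 1)) t ≠ ⊤) :
    ∀ᵐ t ∂volume.restrict (timeO T),
      WeakD univ (fun y => cfT Γ g b γ (t, y)) fun y => cfT Γ g (b + 1) γ (t, y) := by
  have hρ'' : γ + ((b + 1 : ℕ) : ℝ) < ρ' := by push_cast; exact hρ'
  have htest0 : ∀ U : Set ℝ, IsTest U (0 : ℝ → ℝ) := fun U => (testSpace U).zero_mem
  have hloc := (hJ.tendsto_integral_avT Γ hγ hρ (by omega) (by omega) hfin h0 (htest0 _)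
    (htest0 _)).1
  have hloc' := (hJ.tendsto_integral_avT Γ hγ hρ'' hb hN hfin' h0' (htest0 _) (htest0 _)).1
  have hsw : MeasurePreserving (ContinuousLinearEquiv.prodComm ℝ ℝ ℝ) :=
    Measure.measurePreserving_swap (μ := volume) (ν := volume)
  have hpre : (ContinuousLinearEquiv.prodComm ℝ ℝ ℝ) ⁻¹' (timeO T ×ˢ (univ : Set ℝ)) =
      univ ×ˢ timeO T := by
    ext q
    simp [and_comm]
  have h1 := locallyIntegrableOn_comp _ hsw isOpen_timeO_univ hloc
  have h2 := locallyIntegrableOn_comp _ hsw isOpen_timeO_univ hloc'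
  rw [hpre] at h1 h2
  have hmain := ae_slice_of_tensor isOpen_univ ordConnected_univ (isOpen_timeO T) h1 h2
    fun χ ψ hχ hψ => by
      have hflip : ∀ (f : ℝ × ℝ → ℝ) (θ : ℝ → ℝ),
          ∫ q : ℝ × ℝ, f ((ContinuousLinearEquiv.prodComm ℝ ℝ ℝ) q) * (θ q.1 * ψ q.2) =
          ∫ z : ℝ × ℝ, f z * (θ z.2 * ψ z.1) := fun f θ =>
        hsw.integral_comp (ContinuousLinearEquiv.prodComm ℝ ℝ ℝ).toHomeomorph.measurableEmbedding
          fun z => f z * (θ z.2 * ψ z.1)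
      rw [hflip _ (deriv χ), hflip]
      have t1 := (hJ.tendsto_integral_avT Γ hγ hρ (by omega) (by omega) hfin h0 hχ.deriv hψ).2
      have t2 := (hJ.tendsto_integral_avT Γ hγ hρ'' hb hN hfin' h0' hχ hψ).2
      refine tendsto_nhds_unique (t1.add t2) ?_
      -- the averages satisfy the identity exactly
      have hzero : ∀ n : ℕ, (∫ z : ℝ × ℝ, ((filt Γ γ).eval γ)⁻¹ *
            avT (γ + b) ((n : ℝ) + 1)⁻¹ (jet g (filt Γ γ) b) z * (deriv χ z.2 * ψ z.1)) +
          ∫ z : ℝ × ℝ, ((filt Γ γ).eval γ)⁻¹ * avT (γ + (b + 1 : ℕ)) ((n : ℝ) + 1)⁻¹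
            (jet g (filt Γ γ) (b + 1)) z * (χ z.2 * ψ z.1) = 0 := by
        intro n
        have hn : (0 : ℝ) < ((n : ℝ) + 1)⁻¹ := by positivity
        set l := ((n : ℝ) + 1)⁻¹
        have hdeg := natDegree_filt hγ
        have hdy := hJ.dy (p := filt Γ γ) (b := b) (by omega) hb
        simp only [mul_assoc, integral_const_mul]
        rw [(integral_avT_mul hdy.1 _ hn hχ.deriv hψ).2, (integral_avT_mul hdy.2.1 _ hn hχ hψ).2,
          ← mul_add]
        have hpd := hdy.pd_ey
        set w0 := jet g (filt Γ γ) b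
        set w1 := jet g (filt Γ γ) (b + 1)
        have ht2 := hψ.tensor (isTest_avKer (γ + b) hn)
        have ht : IsTest (spaceTime T).dom fun p => χ (slY.symm p).1 *
            (ψ (slY.symm p).2.1 * avKer (γ + b) l (slY.symm p).2.2) := by
          have h3 := (hχ.tensor ht2).comp_equiv slY
          have e :
              slY.symm ⁻¹' ((univ : Set ℝ) ×ˢ (timeO T ×ˢ Ioi (0 : ℝ))) = (spaceTime T).dom := by
            rw [spaceTime_dom]
            ext p
            change (p.2.2 ∈ univ ∧ p.1 ∈ timeO T ∧ 0 < p.2.1) ↔ (p.1 ∈ timeO T ∧ 0 < p.2.1)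
            simp
          rwa [e] at h3
        have h4 := hpd.2.2 ⟨_, ht⟩
        have e1 : ∫ p, w0 p * pdT (slY (1, 0)) (fun p => χ (slY.symm p).1 *
            (ψ (slY.symm p).2.1 * avKer (γ + b) l (slY.symm p).2.2)) p =
            -∫ q : ℝ × ℝ × ℝ, w0 (slY q) * (deriv χ q.1 * (ψ q.2.1 * avKer (γ + b) l q.2.2)) := by
          rw [← measurePreserving_slY.integral_comp slY.toHomeomorph.measurableEmbedding,
            ← integral_neg]
          congr 1
          ext q
          rw [pdT_tensor_comp slY hχ ht2]
          ring
        have e2 : ∫ p : ℝ × ℝ × ℝ, (p.2.1)⁻¹ * w1 p * (χ (slY.symm p).1 *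
            (ψ (slY.symm p).2.1 * avKer (γ + b) l (slY.symm p).2.2)) =
            ∫ q : ℝ × ℝ × ℝ, w1 (slY q) *
              (χ q.1 * (ψ q.2.1 * avKer (γ + (b + 1 : ℕ)) l q.2.2)) := by
          rw [← measurePreserving_slY.integral_comp slY.toHomeomorph.measurableEmbedding]
          congr 1
          ext q
          have e3 : γ + ((b + 1 : ℕ) : ℝ) = γ + b + 1 := by push_cast; ring
          rw [ContinuousLinearEquiv.symm_apply_apply, e3, avKer_add_one hn]
          change q.2.2⁻¹ * _ * _ = _
          ring
        have h5 := (e1.symm.trans h4).trans e2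
        rw [← h5]
        ring
      simp only [hzero]
      exact tendsto_const_nhds
  rw [ae_restrict_iff' (isOpen_timeO T).measurableSet]
  filter_upwards [hmain] with t ht htT
  obtain ⟨g1, g2, g3⟩ := ht htT
  exact ⟨g1, g2, fun χ hχ => eq_neg_of_add_eq_zero_left (g3 χ hχ)⟩

end CoefficientDerivatives

/-! ### Expansions of functions of `(t, x, y)` -/

section SpaceTimeExpansion

open Polynomial

variable {T : ℝ≥0∞} {v : ℝ × ℝ × ℝ → ℝ} {N : ℕ} {g : ℕ → ℕ → ℝ × ℝ × ℝ → ℝ}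

theorem XD.sum {ι : Type} (s : Finset ι) (c : ι → ℝ) {u g : ι → ℝ → ℝ}
    (h : ∀ i ∈ s, XD (u i) (g i)) :
    XD (fun x => ∑ i ∈ s, c i * u i x) fun x => ∑ i ∈ s, c i * g i x := by
  classical
  induction s using Finset.induction_on with
  | empty =>
    have h1 := XD.one.const_mul 0
    simp only [zero_mul] at h1
    simpa using h1
  | insert i s hi ih =>
    simp only [Finset.sum_insert hi]
    exact ((h i (Finset.mem_insert_self i s)).const_mul (c i)).add
      (ih fun j hj => h j (Finset.mem_insert_of_mem hj))

theorem locallyIntegrable_of_univ {u : ℝ → ℝ} (h : LocallyIntegrableOn u univ) :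
    LocallyIntegrable u := locallyIntegrableOn_univ.1 h

theorem isWeakDeriv_of_chain {c : ℕ → ℝ → ℝ} {b : ℕ} (h0 : LocallyIntegrable (c 0))
    (h : ∀ j < b, WeakD univ (c j) (c (j + 1))) : IsWeakDeriv b (c 0) (c b) := by
  induction b with
  | zero => exact ⟨h0, h0, fun φ _ _ => by simp⟩
  | succ b ih =>
    obtain ⟨h1, -, h3⟩ := ih fun j hj => h j (hj.trans (Nat.lt_succ_self b))
    obtain ⟨k1, k2, k3⟩ := h b (Nat.lt_succ_self b)
    refine ⟨h1, locallyIntegrable_of_univ k2, fun φ hφ hc => ?_⟩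
    have ht : IsTest univ φ := ⟨hφ, hc, subset_univ _⟩
    have h4 := h3 (deriv φ) ht.deriv.smooth ht.deriv.compact
    rw [iteratedDeriv_succ', h4, k3 φ ht, pow_succ]
    ring

theorem WeakD.ae_eq_zero {c : ℝ → ℝ} {u : ℝ → ℝ} (h : WeakD univ u c) (hu : ∀ᵐ y, u y = 0) :
    ∀ᵐ y, c y = 0 := by
  have h1 := isOpen_univ.ae_eq_zero_of_integral_contDiff_smul_eq_zero (μ := volume) h.2.1
    fun φ g1 g2 g3 => by
      have h2 := h.2.2 φ ⟨g1, g2, g3⟩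
      have h3 : ∫ s, u s * deriv φ s = 0 := by
        rw [← integral_zero ℝ ℝ (μ := volume)]
        refine integral_congr_ae ?_
        filter_upwards [hu] with s hs
        rw [hs, zero_mul]
      rw [h3, zero_eq_neg] at h2
      simpa [mul_comm] using h2
  filter_upwards [h1] with y hy using hy (mem_univ y)

theorem ae_timeO_prod_iff {P : ℝ × ℝ → Prop} (hP : MeasurableSet {z | P z}) :
    (∀ᵐ z ∂volume.restrict (timeO T ×ˢ (univ : Set ℝ)), P z) ↔
      ∀ᵐ t ∂volume.restrict (timeO T), ∀ᵐ y, P (t, y) := by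
  rw [Measure.volume_eq_prod, ← Measure.prod_restrict, Measure.restrict_univ,
    Measure.ae_prod_iff_ae_ae hP]

theorem ae_ae_of_timeO_prod {P : ℝ × ℝ → Prop}
    (h : ∀ᵐ z ∂volume.restrict (timeO T ×ˢ (univ : Set ℝ)), P z) :
      ∀ᵐ t ∂volume.restrict (timeO T), ∀ᵐ y, P (t, y) := by
  rw [Measure.volume_eq_prod, ← Measure.prod_restrict, Measure.restrict_univ] at h
  exact Measure.ae_ae_of_ae_prod h

/-- The hypotheses under which `v` has an expansion up to `o(x^ρ)`: `full Γ (D_x) v` is in the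
weighted space belonging to `ρ`, the function `v` itself in the one belonging to `ρ₀`, and the
roots in `Bad` do not contribute since suitable `f(D_x) v` are in the space belonging to `ρ₁`. -/
structure ExpData (T : ℝ≥0∞) (v : ℝ × ℝ × ℝ → ℝ) (N : ℕ) (g : ℕ → ℕ → ℝ × ℝ × ℝ → ℝ)
    (Γ Bad : Finset ℝ) (ρ₀ ρ₁ ρ : ℝ) : Prop where
  jets : Jets T v N g
  card : Γ.card = 7
  ne : ∀ γ ∈ Γ, ∀ b : ℕ, γ + b ≠ ρ
  le₀ : ρ₀ ≤ ρ
  le₁ : ρ₁ ≤ ρ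
  pos : -1 < 2 * ρ
  fin : ∀ j b : ℕ, j + b ≤ N → ∫⁻ t in timeO T, sN ρ (jet g (full Γ * X ^ j) b) t ≠ ⊤
  fin₀ : ∀ γ ∈ Γ, ∀ b ≤ N, ∫⁻ t in timeO T, sN ρ₀ (jet g (filt Γ γ) b) t ≠ ⊤
  bad : ∀ γ ∈ Bad, γ ∈ Γ ∧ γ < ρ₁ ∧ ∃ f : ℝ[X], f.natDegree ≤ 7 ∧ f.eval γ ≠ 0 ∧
    (∀ γ' ∈ Γ, γ' ≠ γ → γ' ≤ ρ₁ → f.eval γ' = 0) ∧ ∫⁻ t in timeO T, sN ρ₁ (jet g f 0) t ≠ ⊤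

namespace ExpData

variable {Γ Bad : Finset ℝ} {ρ₀ ρ₁ ρ : ℝ}

theorem fin_full (h : ExpData T v N g Γ Bad ρ₀ ρ₁ ρ) {b : ℕ} (hb : b ≤ N) :
    ∫⁻ t in timeO T, sN ρ (jet g (full Γ) b) t ≠ ⊤ := by
  simpa using h.fin 0 b (by omega)

theorem weakD (h : ExpData T v N g Γ Bad ρ₀ ρ₁ ρ) {γ : ℝ} (hγ : γ ∈ Γ) {b : ℕ} (hb : b + 1 ≤ N)
    (hlt : γ + (b + 1) < ρ) : ∀ᵐ t ∂volume.restrict (timeO T),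
      WeakD univ (fun y => cfT Γ g b γ (t, y)) fun y => cfT Γ g (b + 1) γ (t, y) :=
  h.jets.weakD_cfT Γ hγ (by linarith) hlt hb (by rw [h.card]; omega) (h.fin_full (by omega))
    (h.fin₀ γ hγ b (by omega)) (h.fin_full hb) (h.fin₀ γ hγ _ hb)

theorem cf_bad (h : ExpData T v N g Γ Bad ρ₀ ρ₁ ρ) {γ : ℝ} (hγ : γ ∈ Bad) {b : ℕ} (hb : b ≤ N)
    (hlt : γ + b < ρ) :
    ∀ᵐ z ∂volume.restrict (timeO T ×ˢ (univ : Set ℝ)), cfT Γ g b γ z = 0 := by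
  obtain ⟨hγΓ, hγρ, f, hdeg, hf, hf', hfin⟩ := h.bad γ hγ
  have hJ := h.jets
  induction b with
  | zero =>
    have h0 : ∀ γ' : Γ, ∀ᵐ z ∂volume.restrict (timeO T ×ˢ (univ : Set ℝ)),
        wN (Ioi 0) ρ₀ (fun x => jet g (filt Γ γ') 0 (z.1, x, z.2)) ≠ ⊤ := fun γ' =>
      ae_wN_ne_top (hJ.measurable_jet _ 0) (h.fin₀ γ' γ'.2 0 (Nat.zero_le N))
    filter_upwards [hJ.ae_jetX (Nat.zero_le N), ae_all_iff.2 h0,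
      ae_wN_ne_top (hJ.measurable_jet _ 0) (h.fin_full hb),
      ae_wN_ne_top (hJ.measurable_jet _ 0) hfin] with z hz h1 h2 h3
    refine cf_eq_zero (ρ := ρ) (ρ₀ := ρ₀) (ρ₁ := ρ₁) (f := f) (fun γ' hγ' => ?_) h.le₀ h.le₁ hγΓ
      (by simpa using hγρ) hf (fun γ' hγ' hne hle => hf' γ' hγ' hne (by simpa using hle))
      (by rw [h.card]; exact hdeg) hz (by rw [h.card]; omega) (fun γ' hγ' => ?_) ?_ ?_
    · exact h.ne γ' hγ' 0
    · rw [ev_sl]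
      exact h1 ⟨γ', hγ'⟩
    · rwa [ev_sl]
    · rwa [ev_sl]
  | succ b ih =>
    push_cast at hlt
    have h1 := ih (by omega) (by linarith)
    rw [ae_timeO_prod_iff (measurableSet_eq_fun (hJ.measurable_cfT Γ _ γ) measurable_const)]
    filter_upwards [h.weakD hγΓ hb hlt, ae_ae_of_timeO_prod h1] with t g1 g2
    exact g1.ae_eq_zero g2

theorem isWeakDeriv (h : ExpData T v N g Γ Bad ρ₀ ρ₁ ρ) {γ : ℝ} (hγ : γ ∈ Γ) {b : ℕ} (hb : b ≤ N)
    (hlt : γ + b < ρ) : ∀ᵐ t ∂volume.restrict (timeO T),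
      IsWeakDeriv b (fun y => cfT Γ g 0 γ (t, y)) fun y => cfT Γ g b γ (t, y) := by
  have hJ := h.jets
  have hγ0 : γ + (0 : ℕ) < ρ := by
    have : (0 : ℝ) ≤ b := b.cast_nonneg
    push_cast
    linarith
  obtain ⟨K, hK⟩ := exists_lintegral_cfT_sq_le Γ hγ 0 ρ₀ hγ0
  have h1 := hK T v N g hJ (Nat.zero_le N) (by rw [h.card]; omega) (h.fin_full (Nat.zero_le N))
  have h2 : ∫⁻ z in timeO T ×ˢ (univ : Set ℝ), ‖cfT Γ g 0 γ z‖ₑ ^ 2 ≠ ⊤ :=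
    ne_top_of_le_ne_top (ENNReal.mul_ne_top ENNReal.coe_ne_top (ENNReal.add_ne_top.2
      ⟨h.fin₀ γ hγ 0 (Nat.zero_le N), h.fin_full (Nat.zero_le N)⟩)) h1
  have hcm := hJ.measurable_cfT Γ 0 γ
  have hm : Measurable fun z => ‖cfT Γ g 0 γ z‖ₑ ^ 2 := hcm.enorm.pow_const 2
  rw [lintegral_timeO_prod hm] at h2
  have h3 : ∀ j : ℕ, ∀ᵐ t ∂volume.restrict (timeO T), j < b →
      WeakD univ (fun y => cfT Γ g j γ (t, y)) fun y => cfT Γ g (j + 1) γ (t, y) := by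
    intro j
    by_cases hj : j < b
    · have : (j : ℝ) + 1 ≤ b := by exact_mod_cast hj
      filter_upwards [h.weakD hγ (b := j) (by omega) (by linarith)] with t ht _
      exact ht
    · exact Eventually.of_forall fun t h => absurd h hj
  filter_upwards [ae_lt_top hm.lintegral_prod_right' h2, ae_all_iff.2 h3] with t g1 g2
  refine isWeakDeriv_of_chain (c := fun j y => cfT Γ g j γ (t, y)) ?_ g2
  refine locallyIntegrable_of_univ (locallyIntegrableOn_of_sq isOpen_univ
    (hcm.comp measurable_prodMk_left) ?_)
  rw [Measure.restrict_univ]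
  exact g1.ne

/-- The remainder of `p(D_x) v`. -/
theorem ae_remainder (h : ExpData T v N g Γ Bad ρ₀ ρ₁ ρ) (p : ℝ[X]) {b : ℕ} (hb : b ≤ N)
    (hp : p.natDegree + b ≤ N + 7) : ∀ᵐ z ∂volume.restrict (timeO T ×ˢ (univ : Set ℝ)),
      wN (Ioi 0) ρ (fun x => jet g p b (z.1, x, z.2) -
        ∑ γ ∈ Γ with γ + b < ρ, p.eval γ * cfT Γ g b γ z * x ^ (γ + b)) ≠ ⊤ := by
  have hJ := h.jets
  obtain ⟨K, hK⟩ := exists_expansion Γ (b := b) (fun γ hγ => h.ne γ hγ b) h.le₀ p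
  have h0 : ∀ γ' : Γ, ∀ᵐ z ∂volume.restrict (timeO T ×ˢ (univ : Set ℝ)),
      wN (Ioi 0) ρ₀ (fun x => jet g (filt Γ γ') b (z.1, x, z.2)) ≠ ⊤ := fun γ' =>
    ae_wN_ne_top (hJ.measurable_jet _ b) (h.fin₀ γ' γ'.2 b hb)
  have h1 : ∀ j : ℕ, ∀ᵐ z ∂volume.restrict (timeO T ×ˢ (univ : Set ℝ)), j + b ≤ N →
      wN (Ioi 0) ρ (fun x => jet g (full Γ * X ^ j) b (z.1, x, z.2)) ≠ ⊤ := by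
    intro j
    by_cases hj : j + b ≤ N
    · filter_upwards [ae_wN_ne_top (hJ.measurable_jet _ b) (h.fin j b hj)] with z hz _
      exact hz
    · exact Eventually.of_forall fun z h => absurd h hj
  filter_upwards [hJ.ae_jetX hb, ae_all_iff.2 h0, ae_all_iff.2 h1] with z hz g0 g1
  have h2 := hK (sl g b z) (N + 7 - b) hz (by rw [h.card]; omega)
    (fun γ hγ => by rw [ev_sl]; exact g0 ⟨γ, hγ⟩)
    (by rw [ev_sl]; simpa using g1 0 (by omega))
  rw [ev_sl p] at h2
  refine ne_top_of_le_ne_top (ENNReal.mul_ne_top ENNReal.coe_ne_top (ENNReal.sum_ne_top.2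
    fun j hj => ?_)) h2
  rw [ev_sl]
  refine g1 j ?_
  have := Finset.mem_range.1 hj
  rw [h.card] at this
  omega

/-- The expansion, for an enumeration `e` of the contributing roots. -/
theorem hasExpansionT (h : ExpData T v N g Γ Bad ρ₀ ρ₁ ρ) {n : ℕ} (e : Fin n → ℝ)
    (he : Function.Injective e) (heΓ : ∀ i, e i ∈ Γ)
    (hall : ∀ γ ∈ Γ, γ ∉ Bad → γ < ρ → ∃ i, e i = γ) (c : Fin n → ℝ → ℝ → ℝ)
    (hc : ∀ i, ∀ᵐ t ∂volume.restrict (timeO T), ∀ᵐ y, c i t y = cfT Γ g 0 (e i) (t, y)) :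
    HasExpansionT T v e c ρ (N + 7) N := by
  classical
  intro a b hab hb
  have hJ := h.jets
  have hI : timeI T ×ˢ (univ : Set ℝ) =ᵐ[volume] timeO T ×ˢ (univ : Set ℝ) := by
    have h1 : (timeI T : Set ℝ) =ᵐ[volume] timeO T := by
      have h2 : ∀ᵐ t : ℝ, t ≠ 0 := by simp [ae_iff, measure_singleton]
      filter_upwards [h2] with t ht
      simp only [eq_iff_iff]
      exact ⟨fun h => ⟨lt_of_le_of_ne h.1 (Ne.symm ht), h.2⟩, fun h => timeO_subset T h⟩
    exact Measure.set_prod_ae_eq h1 (ae_eq_refl _)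
  have hvol : (volume : Measure (ℝ × ℝ)).restrict (timeI T ×ˢ (univ : Set ℝ)) =
      volume.restrict (timeO T ×ˢ (univ : Set ℝ)) := Measure.restrict_congr_set hI
  -- the sum over the roots is the sum over the enumeration
  have hsum : ∀ p : ℝ[X], ∀ᵐ z ∂volume.restrict (timeO T ×ˢ (univ : Set ℝ)), ∀ x : ℝ,
      ∑ γ ∈ Γ with γ + b < ρ, p.eval γ * cfT Γ g b γ z * x ^ (γ + b) =
      ∑ i, if e i + b < ρ then p.eval (e i) * cfT Γ g b (e i) z * x ^ (e i + b) else 0 := by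
    intro p
    have hbad : ∀ γ : Bad, ∀ᵐ z ∂volume.restrict (timeO T ×ˢ (univ : Set ℝ)),
        (γ : ℝ) + b < ρ → cfT Γ g b γ z = 0 := by
      intro γ
      by_cases hlt : (γ : ℝ) + b < ρ
      · filter_upwards [h.cf_bad γ.2 hb hlt] with z hz _
        exact hz
      · exact Eventually.of_forall fun z h => absurd h hlt
    filter_upwards [ae_all_iff.2 hbad] with z hz x
    rw [← Finset.sum_filter]
    symm
    refine Finset.sum_of_injOn e he.injOn ?_ ?_ fun i _ => rfl
    · intro i hi
      have := (Finset.mem_filter.1 hi).2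
      exact Finset.mem_filter.2 ⟨heΓ i, this⟩
    · intro γ hγ hnot
      obtain ⟨hγΓ, hlt⟩ := Finset.mem_filter.1 hγ
      by_cases hB : γ ∈ Bad
      · rw [hz ⟨γ, hB⟩ hlt, mul_zero, zero_mul]
      · refine absurd ?_ hnot
        have : (0 : ℝ) ≤ b := b.cast_nonneg
        obtain ⟨i, rfl⟩ := hall γ hγΓ hB (by linarith)
        exact ⟨i, by simpa using hlt, rfl⟩
  have hterm : ∀ (z : ℝ × ℝ) (x : ℝ),
      (∑ i, if e i + b < ρ then (X ^ a : ℝ[X]).eval (e i) * cfT Γ g b (e i) z * x ^ (e i + b)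
        else 0) = ∑ i, expTerm (e i) ρ a b (cfT Γ g b (e i) z) x := by
    intro z x
    refine Finset.sum_congr rfl fun i _ => ?_
    rw [expTerm]
    split_ifs
    · simp only [eval_pow, eval_X]
      ring
    · rfl
  have hjet : jet g (X ^ a) b = g a b := ev_X_pow _ a
  have hR : ∀ᵐ z ∂volume.restrict (timeO T ×ˢ (univ : Set ℝ)),
      wN (Ioo 0 1) ρ (fun x => g a b (z.1, x, z.2) -
        ∑ i, expTerm (e i) ρ a b (cfT Γ g b (e i) z) x) ≠ ⊤ := by
    filter_upwards [h.ae_remainder (X ^ a) hb (by rw [natDegree_X_pow]; exact hab),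
      hsum (X ^ a)] with z h1 h2
    simp only [h2, hterm, hjet] at h1
    exact ne_top_of_le_ne_top h1 (wN_mono (fun x hx => hx.1) _ _)
  refine ⟨g a b, fun i t y => cfT Γ g b (e i) (t, y), ?_, fun i hi => ?_, ?_, fun hlt => ?_⟩
  · exact (isWeak_iff _ (coe_powT _ a b) _ _).2 (hJ.weak a b hab hb)
  · rw [restrict_timeO]
    filter_upwards [h.isWeakDeriv (heΓ i) hb hi, hc i] with t h1 h2
    have h3 : c i t =ᵐ[volume] fun y => cfT Γ g 0 (e i) (t, y) := h2
    refine ⟨(locallyIntegrable_congr h3).2 h1.1, h1.2.1, fun φ k1 k2 => ?_⟩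
    rw [← h1.2.2 φ k1 k2]
    refine integral_congr_ae ?_
    filter_upwards [h3] with y hy
    rw [hy]
  · rw [hvol]
    filter_upwards [hR] with z hz
    exact meanLittleO_of_wN h.pos hz
  · rw [hvol]
    set p : ℝ[X] := (X + C (b : ℝ)) * X ^ a with hp
    have hpd : p.natDegree + b ≤ N + 7 := by
      have h9 := Jets.natDegree_X_add_C_mul_le (X ^ a) (b : ℝ)
      rw [natDegree_X_pow, ← hp] at h9
      omega
    filter_upwards [hR, h.ae_remainder p hb hpd, hsum p, hsum (X ^ a),
      hJ.ae_jetX hb] with z h1 h2 h3 h4 h5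
    have h6 := h5.xd_ev (p := X ^ a) (by rw [natDegree_X_pow]; omega)
    rw [ev_sl, ev_sl, hjet] at h6
    have h7 : XD (fun x => ∑ γ ∈ Γ with γ + b < ρ,
        ((X ^ a : ℝ[X]).eval γ * cfT Γ g b γ z) * x ^ (γ + b))
        fun x => ∑ γ ∈ Γ with γ + b < ρ,
          ((X ^ a : ℝ[X]).eval γ * cfT Γ g b γ z) * ((γ + b) * x ^ (γ + b)) :=
      XD.sum _ _ fun γ _ => XD.rpow (γ + b)
    have h8 := h6.add (h7.const_mul (-1))
    have e1 : (fun x => jet g p b (z.1, x, z.2) + -1 * ∑ γ ∈ Γ with γ + b < ρ,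
          ((X ^ a : ℝ[X]).eval γ * cfT Γ g b γ z) * ((γ + b) * x ^ (γ + b))) =
        fun x => jet g p b (z.1, x, z.2) -
          ∑ γ ∈ Γ with γ + b < ρ, p.eval γ * cfT Γ g b γ z * x ^ (γ + b) := by
      ext x
      rw [neg_one_mul, sub_eq_add_neg]
      congr 2
      refine Finset.sum_congr rfl fun γ _ => ?_
      simp only [hp, eval_mul, eval_add, eval_X, eval_C]
      ring
    have e2 : (fun x => g a b (z.1, x, z.2) + -1 * ∑ γ ∈ Γ with γ + b < ρ,
          ((X ^ a : ℝ[X]).eval γ * cfT Γ g b γ z) * x ^ (γ + b)) =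
        fun x => g a b (z.1, x, z.2) - ∑ i, expTerm (e i) ρ a b (cfT Γ g b (e i) z) x := by
      ext x
      rw [h4, hterm, neg_one_mul, sub_eq_add_neg]
    rw [← hp, e1, e2] at h8
    exact h8.aeLittleO h1 (ne_top_of_le_ne_top h2 (wN_mono (fun x hx => hx.1) _ _))

end ExpData

end SpaceTimeExpansion

/-! ### Pointwise bounds on the half-plane -/

section HalfPlane

theorem PrimOn.continuous {U f : ℝ → ℝ} (h : PrimOn univ U f) : Continuous U := by
  have h1 : Continuous fun b => U 0 + ∫ s in (0 : ℝ)..b, f s :=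
    continuous_const.add (intervalIntegral.continuous_primitive
      (fun a b => (h a (mem_univ a) b (mem_univ b)).1) 0)
  convert h1 using 2 with b
  rw [← (h 0 (mem_univ 0) b (mem_univ b)).2]
  ring

/-- The Sobolev embedding `H¹(ℝ) ⊆ L^∞(ℝ)`, with a free parameter `r`. -/
theorem PrimOn.enorm_sq_le {U f : ℝ → ℝ} (h : PrimOn univ U f) {r : ℝ} (hr : 0 < r) (y : ℝ) :
    ‖U y‖ₑ ^ 2 ≤ 2 * (ENNReal.ofReal r⁻¹ * ∫⁻ z, ‖U z‖ₑ ^ 2) +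
      2 * (ENNReal.ofReal r * ∫⁻ z, ‖f z‖ₑ ^ 2) := by
  have hvol : volume (Ioc y (y + r)) = ENNReal.ofReal r := by
    rw [Real.volume_Ioc, add_sub_cancel_left]
  have hf : AEMeasurable (fun z => ‖f z‖ₑ) (volume.restrict (Ioc y (y + r))) :=
    (h y (mem_univ _) (y + r) (mem_univ _)).1.1.aestronglyMeasurable.enorm
  have h1 : (∫⁻ z in Ioc y (y + r), ‖f z‖ₑ) ^ 2 ≤ ENNReal.ofReal r * ∫⁻ z, ‖f z‖ₑ ^ 2 := by
    have h2 := lintegral_mul_sq_le (μ := volume.restrict (Ioc y (y + r)))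
      (aemeasurable_const (b := (1 : ℝ≥0∞))) hf
    simp only [one_mul, one_pow, lintegral_const, Measure.restrict_apply_univ, hvol] at h2
    exact h2.trans (mul_le_mul_right (setLIntegral_le_lintegral _ _) _)
  have key : ∀ z ∈ Ioc y (y + r), ‖U y‖ₑ ^ 2 ≤
      2 * ‖U z‖ₑ ^ 2 + 2 * (ENNReal.ofReal r * ∫⁻ z, ‖f z‖ₑ ^ 2) := by
    intro z hz
    have h2 := (h y (mem_univ _) z (mem_univ _)).2
    have e : U y = U z + -∫ s in y..z, f s := by rw [← h2]; ring
    rw [e]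
    refine (enorm_add_sq_le _ _).trans ?_
    gcongr
    refine le_trans ?_ h1
    rw [enorm_neg, intervalIntegral.integral_of_le hz.1.le]
    gcongr
    exact (enorm_integral_le_lintegral_enorm _).trans
      (lintegral_mono_set (Ioc_subset_Ioc_right hz.2))
  have h3 : ENNReal.ofReal r * ‖U y‖ₑ ^ 2 ≤ 2 * (∫⁻ z, ‖U z‖ₑ ^ 2) +
      2 * (ENNReal.ofReal r * ∫⁻ z, ‖f z‖ₑ ^ 2) * ENNReal.ofReal r := by
    calc ENNReal.ofReal r * ‖U y‖ₑ ^ 2 = ∫⁻ _ in Ioc y (y + r), ‖U y‖ₑ ^ 2 := by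
          rw [lintegral_const, Measure.restrict_apply_univ, hvol, mul_comm]
      _ ≤ ∫⁻ z in Ioc y (y + r), (2 * ‖U z‖ₑ ^ 2 + 2 * (ENNReal.ofReal r * ∫⁻ z, ‖f z‖ₑ ^ 2)) :=
          setLIntegral_mono' measurableSet_Ioc key
      _ = 2 * (∫⁻ z in Ioc y (y + r), ‖U z‖ₑ ^ 2) +
          2 * (ENNReal.ofReal r * ∫⁻ z, ‖f z‖ₑ ^ 2) * ENNReal.ofReal r := by
          rw [lintegral_add_left ((h.continuous.measurable.enorm.pow_const 2).const_mul 2),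
            lintegral_const_mul' _ _ (by simp), lintegral_const, Measure.restrict_apply_univ, hvol]
      _ ≤ _ := by
          gcongr
          exact Measure.restrict_le_self
  have hrr : ENNReal.ofReal r⁻¹ * ENNReal.ofReal r = 1 := by
    rw [← ENNReal.ofReal_mul (by positivity), inv_mul_cancel₀ hr.ne', ENNReal.ofReal_one]
  calc ‖U y‖ₑ ^ 2 = ENNReal.ofReal r⁻¹ * (ENNReal.ofReal r * ‖U y‖ₑ ^ 2) := by
        rw [← mul_assoc, hrr, one_mul]
    _ ≤ ENNReal.ofReal r⁻¹ * (2 * (∫⁻ z, ‖U z‖ₑ ^ 2) +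
      2 * (ENNReal.ofReal r * ∫⁻ z, ‖f z‖ₑ ^ 2) * ENNReal.ofReal r) := by gcongr
    _ = 2 * (ENNReal.ofReal r⁻¹ * ∫⁻ z, ‖U z‖ₑ ^ 2) + (ENNReal.ofReal r⁻¹ * ENNReal.ofReal r) *
      (2 * (ENNReal.ofReal r * ∫⁻ z, ‖f z‖ₑ ^ 2)) := by ring
    _ = _ := by rw [hrr, one_mul]

/-- `∫_ℝ ∫_0^∞ x^(-2ρ-1) u(x, y)² dx dy`. -/
def plN (ρ : ℝ) (u : ℝ × ℝ → ℝ) : ℝ≥0∞ := ∫⁻ y, wN (Ioi 0) ρ fun x => u (x, y)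

/-- `u₁ = D_x u₀`, `u₂ = D_y u₀` and `u₃ = D_x D_y u₀` on almost all lines parallel to the axes. -/
structure PlaneQuad (u₀ u₁ u₂ u₃ : ℝ × ℝ → ℝ) : Prop where
  dx : ∀ᵐ y, XD (fun x => u₀ (x, y)) fun x => u₁ (x, y)
  dxy : ∀ᵐ y, XD (fun x => u₂ (x, y)) fun x => u₃ (x, y)
  dy : ∀ᵐ x ∂volume.restrict (Ioi (0 : ℝ)), WeakD univ (fun y => u₀ (x, y)) fun y => x⁻¹ * u₂ (x, y)

theorem WeakD.sub {J : Set ℝ} {u g u' g' : ℝ → ℝ} (h : WeakD J u g) (h' : WeakD J u' g') :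
    WeakD J (fun s => u s - u' s) fun s => g s - g' s := by
  obtain ⟨h1, h2, h3⟩ := h
  obtain ⟨k1, k2, k3⟩ := h'
  refine ⟨h1.sub k1, h2.sub k2, fun χ hχ => ?_⟩
  have a1 := (hχ.deriv.integrable_mul h1)
  have a2 := (hχ.deriv.integrable_mul k1)
  have a3 := (hχ.integrable_mul h2)
  have a4 := (hχ.integrable_mul k2)
  simp only [sub_mul]
  rw [integral_sub a1 a2, integral_sub a3 a4, h3 χ hχ, k3 χ hχ]
  ring

theorem XD.sub {u g u' g' : ℝ → ℝ} (h : XD u g) (h' : XD u' g') :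
    XD (fun s => u s - u' s) fun s => g s - g' s := by
  have := h.add (h'.const_mul (-1))
  simpa only [neg_one_mul, ← sub_eq_add_neg] using this

theorem PlaneQuad.sub {u₀ u₁ u₂ u₃ v₀ v₁ v₂ v₃ : ℝ × ℝ → ℝ} (h : PlaneQuad u₀ u₁ u₂ u₃)
    (h' : PlaneQuad v₀ v₁ v₂ v₃) : PlaneQuad (fun q => u₀ q - v₀ q) (fun q => u₁ q - v₁ q)
      (fun q => u₂ q - v₂ q) fun q => u₃ q - v₃ q := by
  refine ⟨?_, ?_, ?_⟩
  · filter_upwards [h.dx, h'.dx] with y h1 h2 using h1.sub h2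
  · filter_upwards [h.dxy, h'.dxy] with y h1 h2 using h1.sub h2
  · filter_upwards [h.dy, h'.dy] with x h1 h2
    simpa only [mul_sub] using h1.sub h2

theorem measurable_wN_line {w : ℝ × ℝ → ℝ} (hw : Measurable w) (ρ : ℝ) :
    Measurable fun y => wN (Ioi 0) ρ fun x => w (x, y) := by
  have h1 : Measurable fun q : ℝ × ℝ =>
      ENNReal.ofReal (q.2 ^ (-2 * ρ - 1)) * ‖w (q.2, q.1)‖ₑ ^ 2 :=
    ((measurable_ofReal_rpow _).comp measurable_snd).mul
      ((hw.comp measurable_swap).enorm.pow_const 2)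
  exact h1.lintegral_prod_right'

theorem exists_lintegral_line_le (ρ : ℝ) : ∃ K : ℝ≥0, ∀ u g : ℝ × ℝ → ℝ, Measurable u →
    Measurable g → (∀ᵐ y, XD (fun x => u (x, y)) fun x => g (x, y)) →
    ∀ᵐ x ∂volume.restrict (Ioi (0 : ℝ)),
      ∫⁻ y, ‖u (x, y)‖ₑ ^ 2 ≤ K * ENNReal.ofReal (x ^ (2 * ρ)) * (plN ρ u + plN ρ g) := by
  obtain ⟨K, hK⟩ := exists_pointwise ρ
  refine ⟨K, fun u g hu hg h => ?_⟩
  have h1 : ∀ᵐ y, ∀ᵐ x ∂volume.restrict (Ioi (0 : ℝ)), ‖u (x, y)‖ₑ ^ 2 ≤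
      K * ENNReal.ofReal (x ^ (2 * ρ)) *
        (wN (Ioi 0) ρ (fun x => u (x, y)) + wN (Ioi 0) ρ fun x => g (x, y)) := by
    filter_upwards [h] with y hy
    obtain ⟨w, hw, hp⟩ := hy
    filter_upwards [hw, ae_restrict_mem measurableSet_Ioi] with x hx hx0
    have hx0' : (0 : ℝ) < x := hx0
    have hsub : Ioo x (2 * x) ⊆ Ioi 0 := fun s hs => hx0'.trans hs.1
    rw [hx]
    refine (hK w _ hp (hg.comp measurable_prodMk_right).aemeasurable x hx0).trans ?_
    rw [wN_congr hw]
    gcongr <;> exact wN_mono hsub _ _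
  rw [Measure.ae_ae_comm] at h1
  · filter_upwards [h1] with x hx
    refine (lintegral_mono_ae hx).trans ?_
    rw [lintegral_const_mul' _ _ (by finiteness), lintegral_add_left (measurable_wN_line hu ρ)]
    rfl
  · refine measurableSet_le ((hu.comp measurable_swap).enorm.pow_const 2) ?_
    exact (measurable_const.mul ((measurable_ofReal_rpow _).comp measurable_snd)).mul
      (((measurable_wN_line hu ρ).comp measurable_fst).add
        ((measurable_wN_line hg ρ).comp measurable_fst))

/-- A function on the half-plane is bounded pointwise by weighted norms of four derivatives. -/
theorem exists_pointwise_plane (ρ : ℝ) : ∃ K : ℝ≥0, ∀ u₀ u₁ u₂ u₃ : ℝ × ℝ → ℝ, Measurable u₀ →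
    Measurable u₁ → Measurable u₂ → Measurable u₃ → PlaneQuad u₀ u₁ u₂ u₃ →
    ∀ᵐ x ∂volume.restrict (Ioi (0 : ℝ)), ∀ᵐ y,
      ‖u₀ (x, y)‖ₑ ^ 2 ≤ K * ENNReal.ofReal (x ^ (2 * ρ - 1)) *
        (plN ρ u₀ + plN ρ u₁ + plN ρ u₂ + plN ρ u₃) := by
  obtain ⟨K, hK⟩ := exists_lintegral_line_le ρ
  refine ⟨2 * K, fun u₀ u₁ u₂ u₃ m0 m1 m2 m3 h => ?_⟩
  filter_upwards [hK u₀ u₁ m0 m1 h.dx, hK u₂ u₃ m2 m3 h.dxy, h.dy,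
    ae_restrict_mem measurableSet_Ioi] with x h1 h2 h3 hx
  have hx' : (0 : ℝ) < x := hx
  obtain ⟨U, hU, hp⟩ := h3.exists_primitive isOpen_univ ordConnected_univ
  rw [Measure.restrict_univ] at hU
  have e1 : ∫⁻ z, ‖U z‖ₑ ^ 2 = ∫⁻ z, ‖u₀ (x, z)‖ₑ ^ 2 := by
    refine lintegral_congr_ae ?_
    filter_upwards [hU] with z hz
    rw [hz]
  have e2 : ∫⁻ z, ‖x⁻¹ * u₂ (x, z)‖ₑ ^ 2 =
      ENNReal.ofReal (x ^ (-2 : ℝ)) * ∫⁻ z, ‖u₂ (x, z)‖ₑ ^ 2 := by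
    rw [← lintegral_const_mul' _ _ (by finiteness)]
    congr 1
    ext z
    rw [enorm_mul, mul_pow, enorm_sq, Real.rpow_neg hx'.le, Real.rpow_ofNat, inv_pow]
  filter_upwards [hU] with y hy
  rw [hy]
  refine (hp.enorm_sq_le hx' y).trans ?_
  rw [e1, e2]
  have a1 : ENNReal.ofReal x⁻¹ = ENNReal.ofReal (x ^ (-1 : ℝ)) := by rw [Real.rpow_neg_one]
  have a2 : ENNReal.ofReal x = ENNReal.ofReal (x ^ (1 : ℝ)) := by rw [Real.rpow_one]
  rw [a1, a2]
  calc _ ≤ 2 * (ENNReal.ofReal (x ^ (-1 : ℝ)) *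
          (K * ENNReal.ofReal (x ^ (2 * ρ)) * (plN ρ u₀ + plN ρ u₁))) +
        2 * (ENNReal.ofReal (x ^ (1 : ℝ)) * (ENNReal.ofReal (x ^ (-2 : ℝ)) *
          (K * ENNReal.ofReal (x ^ (2 * ρ)) * (plN ρ u₂ + plN ρ u₃)))) := by gcongr
    _ = 2 * K * (ENNReal.ofReal (x ^ (-1 : ℝ)) * ENNReal.ofReal (x ^ (2 * ρ))) *
          (plN ρ u₀ + plN ρ u₁) +
        2 * K * (ENNReal.ofReal (x ^ (1 : ℝ)) * ENNReal.ofReal (x ^ (-2 : ℝ)) *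
          ENNReal.ofReal (x ^ (2 * ρ))) * (plN ρ u₂ + plN ρ u₃) := by ring
    _ = _ := by
      rw [ofReal_rpow_mul hx', ofReal_rpow_mul hx', ofReal_rpow_mul hx',
        show -1 + 2 * ρ = 2 * ρ - 1 by ring, show (1 : ℝ) + -2 + 2 * ρ = 2 * ρ - 1 by ring]
      push_cast
      ring

end HalfPlane

/-! ### Regularity in time -/

section TimeRegularity

variable {T : ℝ≥0∞}

theorem plN_eq_lintegral {u : ℝ × ℝ → ℝ} (hu : Measurable u) (ρ : ℝ) :
    plN ρ u = ∫⁻ q in plane.dom, ENNReal.ofReal (q.1 ^ (-2 * ρ - 1)) * ‖u q‖ₑ ^ 2 := by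
  have h := weightSq_eq_lintegral hu (ρ - 1 / 2)
  rw [sub_add_cancel, weightSq, show -2 * (ρ - 1 / 2) - 2 = -2 * ρ - 1 by ring] at h
  exact h.symm

/-- Functions with `∂_t u ∈ L²` are Hölder continuous in time. -/
theorem ae_plN_sub_le {u w : ℝ × ℝ × ℝ → ℝ} (hu : Measurable u) (hw : Measurable w)
    (h : WeakOp (spaceTime T).dom (dtEnd T) u w) (ρ : ℝ) :
    ∀ᵐ t₁ ∂volume.restrict (timeO T), ∀ᵐ t₂ ∂volume.restrict (timeO T),
      plN ρ (fun q => u (t₂, q) - u (t₁, q)) ≤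
        ENNReal.ofReal |t₂ - t₁| * ∫⁻ t in timeO T, sN ρ w t := by
  set τ := (volume : Measure ℝ).restrict (timeO T) with hτ
  have hmw : Measurable fun q : ℝ × ℝ => ∫⁻ s in timeO T, ‖w (s, q)‖ₑ ^ 2 :=
    (hw.enorm.pow_const 2).lintegral_prod_left'
  have h1 : ∀ᵐ q ∂volume.restrict plane.dom, ∀ᵐ z ∂τ.prod τ,
      ‖u (z.2, q) - u (z.1, q)‖ₑ ^ 2 ≤
        ENNReal.ofReal |z.2 - z.1| * ∫⁻ s in timeO T, ‖w (s, q)‖ₑ ^ 2 := by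
    filter_upwards [ae_weakD_t h] with q hq
    obtain ⟨U, hU, hp⟩ := hq.exists_primitive (isOpen_timeO T) ordConnected_timeO
    rw [Measure.ae_prod_iff_ae_ae]
    · filter_upwards [hU, ae_restrict_mem (isOpen_timeO T).measurableSet] with t₁ g1 m1
      filter_upwards [hU, ae_restrict_mem (isOpen_timeO T).measurableSet] with t₂ g2 m2
      have hsub : uIoc t₁ t₂ ⊆ timeO T :=
        uIoc_subset_uIcc.trans (ordConnected_timeO.uIcc_subset m1 m2)
      rw [g1, g2, (hp t₁ m1 t₂ m2).2]
      have h2 := lintegral_mul_sq_le (μ := volume.restrict (uIoc t₁ t₂))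
        (aemeasurable_const (b := (1 : ℝ≥0∞)))
        ((hw.comp (measurable_prodMk_right (y := q))).enorm.aemeasurable)
      simp only [one_mul, one_pow, lintegral_const, Measure.restrict_apply_univ, Real.volume_uIoc,
        Function.comp_apply] at h2
      refine le_trans ?_ (h2.trans (mul_le_mul_right (lintegral_mono_set hsub) _))
      gcongr
      rw [← enorm_norm, intervalIntegral.norm_intervalIntegral_eq, enorm_norm]
      exact enorm_integral_le_lintegral_enorm _
    · refine measurableSet_le ?_ ?_
      · exact ((hu.comp (by fun_prop)).sub (hu.comp (by fun_prop))).enorm.pow_const 2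
      · exact (measurable_snd.sub measurable_fst).norm.ennreal_ofReal.mul_const _
  rw [Measure.ae_ae_comm] at h1
  · have h2 := Measure.ae_ae_of_ae_prod h1
    filter_upwards [h2] with t₁ ht₁
    filter_upwards [ht₁] with t₂ ht
    have hmd : Measurable fun q : ℝ × ℝ => u (t₂, q) - u (t₁, q) :=
      (hu.comp measurable_prodMk_left).sub (hu.comp measurable_prodMk_left)
    have hmk : Measurable fun q : ℝ × ℝ => ENNReal.ofReal (q.1 ^ (-2 * ρ - 1)) :=
      (measurable_ofReal_rpow _).comp measurable_fst
    have e : ∫⁻ t in timeO T, sN ρ w t = ∫⁻ q in plane.dom,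
        ENNReal.ofReal (q.1 ^ (-2 * ρ - 1)) * ∫⁻ s in timeO T, ‖w (s, q)‖ₑ ^ 2 := by
      have e1 : ∀ t, sN ρ w t = ∫⁻ q in plane.dom,
          ENNReal.ofReal (q.1 ^ (-2 * ρ - 1)) * ‖w (t, q)‖ₑ ^ 2 := fun t =>
        plN_eq_lintegral (u := fun q => w (t, q)) (hw.comp measurable_prodMk_left) ρ
      simp only [e1]
      rw [lintegral_lintegral_swap]
      · refine lintegral_congr fun q => ?_
        rw [lintegral_const_mul' _ _ (by finiteness)]
      · exact ((hmk.comp measurable_snd).mul (hw.enorm.pow_const 2)).aemeasurable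
    rw [plN_eq_lintegral hmd, e, ← lintegral_const_mul' _ _ (by finiteness)]
    refine lintegral_mono_ae ?_
    filter_upwards [ht] with q hq
    rw [mul_left_comm]
    gcongr
  · refine measurableSet_le ?_ ?_
    · exact ((hu.comp (by fun_prop)).sub (hu.comp (by fun_prop))).enorm.pow_const 2
    · exact (by fun_prop : Measurable fun p : (ℝ × ℝ) × ℝ × ℝ =>
        ENNReal.ofReal |p.2.2 - p.2.1|).mul (hmw.comp measurable_fst)

/-- A function whose oscillation between almost all pairs of points is controlled has a
representative which is continuous, up to the boundary. -/
theorem exists_continuousOn_of_ae {E F : Type} [TopologicalSpace E] [MeasurableSpace E]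
    {ν : Measure E} [MetricSpace F] [CompleteSpace F] {S : Set E} (hS : ∀ᵐ p ∂ν, p ∈ S)
    (hne : ∀ s ∈ S, (𝓝 s ⊓ ae ν).NeBot) {u : E → F} {d : E → E → ℝ}
    (hd : ∀ s ∈ S, Tendsto (fun p : E × E => d p.1 p.2) (𝓝[S] s ×ˢ 𝓝[S] s) (𝓝 0))
    (h : ∀ᵐ p ∂ν, ∀ᵐ q ∂ν, dist (u p) (u q) ≤ d p q) :
    ∃ G : E → F, ContinuousOn G S ∧ ∀ᵐ p ∂ν, G p = u p := by
  set D : Set E := {p | p ∈ S ∧ ∀ᵐ q ∂ν, dist (u p) (u q) ≤ d p q} with hD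
  have hDν : D ∈ ae ν := hS.and h
  have hle : ∀ s, 𝓝 s ⊓ ae ν ≤ 𝓝[D] s := fun s => inf_le_inf_left _ (le_principal_iff.2 hDν)
  have hleS : ∀ s, 𝓝 s ⊓ ae ν ≤ 𝓝[S] s := fun s => inf_le_inf_left _ (le_principal_iff.2 hS)
  have hnb : ∀ s ∈ S, (𝓝[D] s).NeBot := fun s hs => (hne s hs).mono (hle s)
  have hcl : S ⊆ closure D := fun s hs => mem_closure_iff_nhdsWithin_neBot.2 (hnb s hs)
  have hDS : ∀ s, 𝓝[D] s ≤ 𝓝[S] s := fun s => nhdsWithin_mono s fun p hp => hp.1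
  have hlim : ∀ s ∈ S, ∃ y, Tendsto u (𝓝[D] s) (𝓝 y) := by
    intro s hs
    have := hnb s hs
    have := hne s hs
    refine cauchy_map_iff_exists_tendsto.1 (Metric.cauchy_iff.2 ⟨inferInstance, fun ε hε => ?_⟩)
    have h1 := (hd s hs).eventually (gt_mem_nhds (half_pos hε))
    obtain ⟨A, hA, hA2⟩ := mem_prod_same_iff.1 h1
    refine ⟨u '' (A ∩ D), image_mem_map (inter_mem (hDS s hA) self_mem_nhdsWithin), ?_⟩
    rintro _ ⟨p, ⟨hpA, hpD⟩, rfl⟩ _ ⟨q, ⟨hqA, hqD⟩, rfl⟩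
    have h2 : ∀ᶠ r in 𝓝 s ⊓ ae ν, r ∈ A ∧ dist (u p) (u r) ≤ d p r ∧ dist (u q) (u r) ≤ d q r := by
      have k0 : ∀ᶠ r in 𝓝 s ⊓ ae ν, r ∈ A := hleS s hA
      have k1 : ∀ᶠ r in 𝓝 s ⊓ ae ν, dist (u p) (u r) ≤ d p r ∧ dist (u q) (u r) ≤ d q r :=
        inf_le_right (a := 𝓝 s) (hpD.2.and hqD.2)
      exact k0.and k1
    obtain ⟨r, hrA, hr1, hr2⟩ := h2.exists
    have k1 : d p r < ε / 2 := hA2 (mk_mem_prod hpA hrA)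
    have k2 : d q r < ε / 2 := hA2 (mk_mem_prod hqA hrA)
    calc dist (u p) (u q) ≤ dist (u p) (u r) + dist (u q) (u r) := dist_triangle_right _ _ _
      _ < ε := by linarith
  refine ⟨extendFrom D u, continuousOn_extendFrom hcl hlim, ?_⟩
  filter_upwards [hDν] with p hp
  obtain ⟨y, hy⟩ := hlim p hp.1
  rw [extendFrom_eq (hcl hp.1) hy]
  have h1 : Tendsto u (pure p) (𝓝 y) := hy.mono_left (pure_le_nhdsWithin hp)
  rw [tendsto_pure_left] at h1
  by_contra hne'
  obtain ⟨V, W, hV, hW, hyV, huW, hdis⟩ := t2_separation hne'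
  exact disjoint_left.1 hdis (h1 V (hV.mem_nhds hyV)) huW

theorem forall_enorm_le_of_ae {E F : Type} [TopologicalSpace E] [MeasurableSpace E] {ν : Measure E}
    [NormedAddCommGroup F] {S : Set E} (hS : ∀ᵐ p ∂ν, p ∈ S)
    (hne : ∀ s ∈ S, (𝓝 s ⊓ ae ν).NeBot) {G : E → F} (hG : ContinuousOn G S) {M : ℝ≥0∞}
    (h : ∀ᵐ p ∂ν, ‖G p‖ₑ ≤ M) : ∀ s ∈ S, ‖G s‖ₑ ≤ M := by
  intro s hs
  have := hne s hs
  have hle : 𝓝 s ⊓ ae ν ≤ 𝓝[S] s := inf_le_inf_left _ (le_principal_iff.2 hS)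
  exact le_of_tendsto ((hG s hs).enorm.mono_left hle) (inf_le_right (a := 𝓝 s) h)

theorem neBot_nhds_inf_ae {E : Type} [TopologicalSpace E] [MeasureSpace E] [OpensMeasurableSpace E]
    [(volume : Measure E).IsOpenPosMeasure] {U : Set E} (hU : IsOpen U) {s : E}
    (hs : s ∈ closure U) : (𝓝 s ⊓ ae (volume.restrict U)).NeBot := by
  rw [inf_neBot_iff]
  intro V hV A hA
  obtain ⟨W, hWV, hW, hsW⟩ := mem_nhds_iff.1 hV
  have h1 : (W ∩ U).Nonempty := mem_closure_iff.1 hs W hW hsW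
  have h2 : 0 < volume (W ∩ U) := (hW.inter hU).measure_pos volume h1
  have h3 : volume.restrict U Aᶜ = 0 := hA
  by_contra hemp
  have h4 : W ∩ U ⊆ Aᶜ ∩ U := fun p hp =>
    ⟨fun hpA => hemp ⟨p, hWV hp.1, hpA⟩, hp.2⟩
  have h5 : volume (W ∩ U) ≤ volume.restrict U Aᶜ :=
    (measure_mono h4).trans (Measure.le_restrict_apply U Aᶜ)
  rw [h3] at h5
  exact absurd (h2.trans_le h5) (lt_irrefl 0)

end TimeRegularity

/-! ### Continuity in space and time -/

section JointContinuity

variable {T : ℝ≥0∞}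

theorem ae_comp_of_surjective {E F : Type} [NormedAddCommGroup E] [NormedSpace ℝ E]
    [FiniteDimensional ℝ E] [MeasureSpace E] [BorelSpace E] [(volume : Measure E).IsAddHaarMeasure]
    [NormedAddCommGroup F] [NormedSpace ℝ F] [MeasureSpace F] [BorelSpace F]
    [(volume : Measure F).IsAddHaarMeasure] (L : E →L[ℝ] F) (hL : Function.Surjective L)
    {P : F → Prop} (h : ∀ᵐ z, P z) : ∀ᵐ p, P (L p) := by
  obtain ⟨c, -, hc⟩ := LinearMap.exists_map_addHaar_eq_smul_addHaar (L := (L : E →ₗ[ℝ] F))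
    volume volume hL
  have h1 : ∀ᵐ z ∂(Measure.map (L : E →ₗ[ℝ] F) volume), P z := by
    rw [hc]
    exact Measure.ae_smul_measure h c
  exact ae_of_ae_map L.continuous.aemeasurable h1

theorem ae_prod_of_ae {A B C D : Set ℝ} (hA : MeasurableSet A) (hB : MeasurableSet B)
    (hC : MeasurableSet C) (hD : MeasurableSet D) {P : ℝ × ℝ × ℝ × ℝ → Prop}
    (hP : MeasurableSet {z | P z})
    (h : ∀ᵐ a ∂volume.restrict A, ∀ᵐ b ∂volume.restrict B, ∀ᵐ c ∂volume.restrict C,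
      ∀ᵐ d ∂volume.restrict D, P (a, b, c, d)) :
    ∀ᵐ z : ℝ × ℝ × ℝ × ℝ, z ∈ A ×ˢ B ×ˢ C ×ˢ D → P z := by
  rw [← ae_restrict_iff' (hA.prod (hB.prod (hC.prod hD))), Measure.volume_eq_prod,
    ← Measure.prod_restrict, Measure.ae_prod_iff_ae_ae hP]
  filter_upwards [h] with a ha
  have h1 : MeasurableSet {z : ℝ × ℝ × ℝ | P (a, z)} := measurable_prodMk_left hP
  rw [Measure.volume_eq_prod, ← Measure.prod_restrict, Measure.ae_prod_iff_ae_ae h1]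
  filter_upwards [ha] with b hb
  have h2 : MeasurableSet {z : ℝ × ℝ | P (a, b, z)} := measurable_prodMk_left h1
  rw [Measure.volume_eq_prod, ← Measure.prod_restrict, Measure.ae_prod_iff_ae_ae h2]
  exact hb

theorem ae_dom_of_ae {P : ℝ × ℝ × ℝ → Prop} (hP : MeasurableSet {z | P z})
    (h : ∀ᵐ t ∂volume.restrict (timeO T), ∀ᵐ x ∂volume.restrict (Ioi (0 : ℝ)), ∀ᵐ y, P (t, x, y)) :
    ∀ᵐ p ∂volume.restrict (spaceTime T).dom, P p := by
  have e : plane.dom = Ioi (0 : ℝ) ×ˢ univ := by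
    ext p
    simp [plane]
  rw [spaceTime_dom, e, Measure.volume_eq_prod, ← Measure.prod_restrict,
    Measure.ae_prod_iff_ae_ae hP]
  filter_upwards [h] with t ht
  have h1 : MeasurableSet {z : ℝ × ℝ | P (t, z)} := measurable_prodMk_left hP
  rw [Measure.volume_eq_prod, ← Measure.prod_restrict, Measure.ae_prod_iff_ae_ae h1,
    Measure.restrict_univ]
  exact ht

/-- `I × (0,∞) × ℝ`. -/
def domI (T : ℝ≥0∞) : Set (ℝ × ℝ × ℝ) := {p | p.1 ∈ timeI T ∧ 0 < p.2.1}

theorem timeI_subset_closure (hT : 0 < T) : timeI T ⊆ closure (timeO T) := by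
  intro t ht
  rcases ht.1.eq_or_lt with h0 | h0
  · have h1 : ∀ᶠ s in 𝓝[>] (0 : ℝ), s ∈ timeO T := by
      have h2 : ∀ᶠ s in 𝓝 (0 : ℝ), ENNReal.ofReal s < T :=
        (isOpen_ofReal_lt T).mem_nhds (by simpa using hT)
      filter_upwards [self_mem_nhdsWithin, h2.filter_mono nhdsWithin_le_nhds] with s g1 g2
      exact ⟨g1, g2⟩
    rw [← h0]
    exact mem_closure_of_frequently_of_tendsto h1.frequently nhdsWithin_le_nhds
  · exact subset_closure ⟨h0, ht.2⟩

theorem neBot_domI (hT : 0 < T) : ∀ s ∈ domI T,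
    (𝓝 s ⊓ ae (volume.restrict (spaceTime T).dom)).NeBot := by
  intro s hs
  refine neBot_nhds_inf_ae isOpen_dom ?_
  rw [spaceTime_dom, closure_prod_eq]
  exact ⟨timeI_subset_closure hT hs.1, subset_closure hs.2⟩

theorem ae_mem_domI : ∀ᵐ p ∂volume.restrict (spaceTime T).dom, p ∈ domI T := by
  filter_upwards [ae_restrict_mem isOpen_dom.measurableSet] with p hp
  exact ⟨⟨hp.1.le, hp.2.1⟩, hp.2.2⟩

theorem abs_prim_sub_le {w f : ℝ → ℝ} {A θ : ℝ} (hθ : θ ≠ 0) (hp : Prim w fun s => f s / s)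
    (hf : ∀ᵐ s ∂volume.restrict (Ioi (0 : ℝ)), |f s| ≤ A * s ^ θ) {x₁ x₂ : ℝ} (h1 : 0 < x₁)
    (h2 : 0 < x₂) : |w x₂ - w x₁| ≤ A * |x₂ ^ θ - x₁ ^ θ| / |θ| := by
  have h0 : (0 : ℝ) ∉ uIcc x₁ x₂ := fun h =>
    lt_irrefl (0 : ℝ) (show (0 : ℝ) < 0 from uIcc_subset_Ioi h1 h2 h)
  have hA : 0 ≤ A ∨ volume.restrict (Ioi (0 : ℝ)) = 0 := by
    by_contra! hA
    have : (ae (volume.restrict (Ioi (0 : ℝ)))).NeBot := ae_neBot.2 hA.2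
    obtain ⟨s, hs, hs0⟩ := (hf.and (ae_restrict_mem measurableSet_Ioi)).exists
    have h3 : 0 < s ^ θ := Real.rpow_pos_of_pos hs0 θ
    nlinarith [abs_nonneg (f s)]
  have hA : 0 ≤ A := hA.resolve_right (by simp)
  rw [(hp x₁ x₂ h1 h2).2]
  have hii : IntervalIntegrable (fun s : ℝ => A * s ^ (θ - 1)) volume x₁ x₂ :=
    (intervalIntegral.intervalIntegrable_rpow (Or.inr h0)).const_mul A
  have hb : ∀ᵐ s, s ∈ uIoc x₁ x₂ → ‖f s / s‖ ≤ A * s ^ (θ - 1) := by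
    rw [ae_restrict_iff' measurableSet_Ioi] at hf
    filter_upwards [hf] with s hs hsu
    have hs0 : 0 < s := uIcc_subset_Ioi h1 h2 (uIoc_subset_uIcc hsu)
    rw [norm_div, Real.norm_eq_abs, Real.norm_eq_abs, abs_of_pos hs0, Real.rpow_sub_one hs0.ne',
      mul_div_assoc']
    gcongr
    exact hs hs0
  have h3 := intervalIntegral.norm_integral_le_abs_of_norm_le
    ((ae_restrict_iff' measurableSet_uIoc).2 hb) hii
  refine h3.trans (le_of_eq ?_)
  rw [intervalIntegral.integral_const_mul, integral_rpow (Or.inr ⟨by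
    intro h
    exact hθ (by linarith), h0⟩), sub_add_cancel, abs_mul, abs_div, abs_of_nonneg hA,
    mul_div_assoc]

/-- A function on `(0, T) × (0,∞) × ℝ` which is locally Lipschitz continuous in space and Hölder
continuous in time is continuous up to `t = 0`. -/
theorem exists_continuousOn_domI (hT : 0 < T) {w₀ w₁ w₂ : ℝ × ℝ × ℝ → ℝ} (m0 : Measurable w₀)
    (hx : WeakOp (spaceTime T).dom (dxEnd (spaceTime T)) w₀ w₁)
    (hy : WeakOp (spaceTime T).dom (dyEnd (spaceTime T)) w₀ w₂) {A θ θ' : ℝ} (hθ : θ ≠ 0)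
    (h1 : ∀ᵐ t ∂volume.restrict (timeO T), ∀ᵐ x ∂volume.restrict (Ioi (0 : ℝ)), ∀ᵐ y,
      |w₁ (t, x, y)| ≤ A * x ^ θ) (m1 : Measurable w₁)
    (h2 : ∀ᵐ t ∂volume.restrict (timeO T), ∀ᵐ x ∂volume.restrict (Ioi (0 : ℝ)), ∀ᵐ y,
      |w₂ (t, x, y)| ≤ A * x ^ θ)
    (ht : ∀ᵐ t₁ ∂volume.restrict (timeO T), ∀ᵐ t₂ ∂volume.restrict (timeO T),
      ∀ᵐ x ∂volume.restrict (Ioi (0 : ℝ)), ∀ᵐ y,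
      |w₀ (t₂, x, y) - w₀ (t₁, x, y)| ≤ A * x ^ θ' * |t₂ - t₁| ^ (1 / 2 : ℝ)) :
    ∃ G, ContinuousOn G (domI T) ∧ ∀ᵐ p ∂volume.restrict (spaceTime T).dom, G p = w₀ p := by
  have hmO := (isOpen_timeO T).measurableSet
  -- the three estimates, almost everywhere in the product of all variables
  have ET : ∀ᵐ z : ℝ × ℝ × ℝ × ℝ, z ∈ timeO T ×ˢ timeO T ×ˢ Ioi 0 ×ˢ univ →
      |w₀ (z.2.1, z.2.2.1, z.2.2.2) - w₀ (z.1, z.2.2.1, z.2.2.2)| ≤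
        A * z.2.2.1 ^ θ' * |z.2.1 - z.1| ^ (1 / 2 : ℝ) := by
    refine ae_prod_of_ae hmO hmO measurableSet_Ioi MeasurableSet.univ ?_ (by simpa using ht)
    exact measurableSet_le (((m0.comp (by fun_prop)).sub (m0.comp (by fun_prop))).norm)
      (by fun_prop)
  have EX : ∀ᵐ z : ℝ × ℝ × ℝ × ℝ, z ∈ timeO T ×ˢ univ ×ˢ Ioi 0 ×ˢ Ioi 0 →
      |w₀ (z.1, z.2.2.2, z.2.1) - w₀ (z.1, z.2.2.1, z.2.1)| ≤
        A * |z.2.2.2 ^ θ - z.2.2.1 ^ θ| / |θ| := by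
    refine ae_prod_of_ae hmO MeasurableSet.univ measurableSet_Ioi measurableSet_Ioi ?_ ?_
    · exact measurableSet_le (((m0.comp (by fun_prop)).sub (m0.comp (by fun_prop))).norm)
        (by fun_prop)
    · filter_upwards [ae_ae_of_timeO_prod (ae_xd hx), h1] with t g1 g2
      rw [Measure.ae_ae_comm] at g2
      · rw [Measure.restrict_univ]
        filter_upwards [g1, g2] with y k1 k2
        obtain ⟨w, hw, hp⟩ := k1
        filter_upwards [hw, ae_restrict_mem measurableSet_Ioi] with x₁ l1 l2
        filter_upwards [hw, ae_restrict_mem measurableSet_Ioi] with x₂ l3 l4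
        rw [l1, l3]
        exact abs_prim_sub_le hθ hp k2 l2 l4
      · exact measurableSet_le ((m1.comp (by fun_prop)).norm) (by fun_prop)
  have EY : ∀ᵐ z : ℝ × ℝ × ℝ × ℝ, z ∈ timeO T ×ˢ Ioi 0 ×ˢ univ ×ˢ univ →
      |w₀ (z.1, z.2.1, z.2.2.2) - w₀ (z.1, z.2.1, z.2.2.1)| ≤
        A * z.2.1 ^ (θ - 1) * |z.2.2.2 - z.2.2.1| := by
    refine ae_prod_of_ae hmO measurableSet_Ioi MeasurableSet.univ MeasurableSet.univ ?_ ?_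
    · exact measurableSet_le (((m0.comp (by fun_prop)).sub (m0.comp (by fun_prop))).norm)
        (by fun_prop)
    · have g0 := ae_weakD_y hy
      rw [Measure.volume_eq_prod, ← Measure.prod_restrict] at g0
      filter_upwards [Measure.ae_ae_of_ae_prod g0, h2] with t g1 g2
      filter_upwards [g1, g2, ae_restrict_mem measurableSet_Ioi] with x k1 k2 k3
      have hx0 : (0 : ℝ) < x := k3
      rw [Measure.restrict_univ]
      obtain ⟨w, hw, hp⟩ := k1.exists_primitive isOpen_univ ordConnected_univ
      rw [Measure.restrict_univ] at hw
      filter_upwards [hw] with y₁ l1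
      filter_upwards [hw] with y₂ l2
      rw [l1, l2, (hp y₁ (mem_univ _) y₂ (mem_univ _)).2]
      refine intervalIntegral.norm_integral_le_of_norm_le_const_ae (E := ℝ)
        (f := fun y => x⁻¹ * w₂ (t, x, y)) (C := A * x ^ (θ - 1)) ?_
      filter_upwards [k2] with y hy _
      rw [norm_mul, norm_inv, Real.norm_eq_abs, Real.norm_eq_abs, abs_of_pos hx0,
        Real.rpow_sub_one hx0.ne', inv_mul_eq_div, mul_div_assoc']
      gcongr
  set d : ℝ × ℝ × ℝ → ℝ × ℝ × ℝ → ℝ := fun p q =>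
    A * p.2.1 ^ θ' * |q.1 - p.1| ^ (1 / 2 : ℝ) + A * |q.2.1 ^ θ - p.2.1 ^ θ| / |θ| +
      A * q.2.1 ^ (θ - 1) * |q.2.2 - p.2.2| with hd
  refine exists_continuousOn_of_ae (d := d) ae_mem_domI (neBot_domI hT) ?_ ?_
  · intro s hs
    have hs0 : s.2.1 ≠ 0 := hs.2.ne'
    have hc : ContinuousAt (fun p : (ℝ × ℝ × ℝ) × ℝ × ℝ × ℝ => d p.1 p.2) (s, s) := by
      have c1 : ContinuousAt (fun p : (ℝ × ℝ × ℝ) × ℝ × ℝ × ℝ => p.1.2.1) (s, s) := by fun_prop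
      have c2 : ContinuousAt (fun p : (ℝ × ℝ × ℝ) × ℝ × ℝ × ℝ => p.2.2.1) (s, s) := by fun_prop
      have c3 : ContinuousAt (fun p : (ℝ × ℝ × ℝ) × ℝ × ℝ × ℝ => |p.2.1 - p.1.1| ^ (1 / 2 : ℝ))
          (s, s) := ContinuousAt.rpow_const (by fun_prop) (Or.inr (by norm_num))
      have c4 : ∀ a : ℝ, ContinuousAt (fun p : (ℝ × ℝ × ℝ) × ℝ × ℝ × ℝ => p.1.2.1 ^ a) (s, s) :=
        fun a => c1.rpow_const (Or.inl hs0)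
      have c5 : ∀ a : ℝ, ContinuousAt (fun p : (ℝ × ℝ × ℝ) × ℝ × ℝ × ℝ => p.2.2.1 ^ a) (s, s) :=
        fun a => c2.rpow_const (Or.inl hs0)
      have c6 : ContinuousAt (fun p : (ℝ × ℝ × ℝ) × ℝ × ℝ × ℝ => |p.2.2.2 - p.1.2.2|) (s, s) := by
        fun_prop
      exact (((continuousAt_const.mul (c4 θ')).mul c3).add
        ((continuousAt_const.mul ((c5 θ).sub (c4 θ)).abs).div_const _)).add
        ((continuousAt_const.mul (c5 (θ - 1))).mul c6)
    have h0 : d s s = 0 := by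
      simp only [hd, sub_self, abs_zero]
      rw [Real.zero_rpow (by norm_num)]
      simp
    have h3 := hc.tendsto
    rw [h0, nhds_prod_eq] at h3
    exact h3.mono_left (Filter.prod_mono nhdsWithin_le_nhds nhdsWithin_le_nhds)
  · have hvol : (volume : Measure ((ℝ × ℝ × ℝ) × ℝ × ℝ × ℝ)) = volume.prod volume := rfl
    -- the coordinates in which the three estimates are formulated
    let p1 := ContinuousLinearMap.fst ℝ (ℝ × ℝ × ℝ) (ℝ × ℝ × ℝ)
    let p2 := ContinuousLinearMap.snd ℝ (ℝ × ℝ × ℝ) (ℝ × ℝ × ℝ)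
    let ct := ContinuousLinearMap.fst ℝ ℝ (ℝ × ℝ)
    let cx := (ContinuousLinearMap.fst ℝ ℝ ℝ).comp (ContinuousLinearMap.snd ℝ ℝ (ℝ × ℝ))
    let cy := (ContinuousLinearMap.snd ℝ ℝ ℝ).comp (ContinuousLinearMap.snd ℝ ℝ (ℝ × ℝ))
    have i2 : (volume : Measure (ℝ × ℝ)).IsAddHaarMeasure :=
      Measure.prod.instIsAddHaarMeasure volume volume
    have i3 : (volume : Measure (ℝ × ℝ × ℝ)).IsAddHaarMeasure :=
      Measure.prod.instIsAddHaarMeasure volume volume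
    have i4 : (volume : Measure (ℝ × ℝ × ℝ × ℝ)).IsAddHaarMeasure :=
      Measure.prod.instIsAddHaarMeasure volume volume
    have i6 : (volume : Measure ((ℝ × ℝ × ℝ) × ℝ × ℝ × ℝ)).IsAddHaarMeasure :=
      Measure.prod.instIsAddHaarMeasure volume volume
    have F1 := ae_comp_of_surjective ((ct.comp p1).prod ((ct.comp p2).prod
      ((cx.comp p1).prod (cy.comp p1))))
      (fun z => ⟨((z.1, z.2.2.1, z.2.2.2), (z.2.1, 0, 0)), rfl⟩) ET
    have F2 := ae_comp_of_surjective ((ct.comp p2).prod ((cy.comp p1).prod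
      ((cx.comp p1).prod (cx.comp p2))))
      (fun z => ⟨((0, z.2.2.1, z.2.1), (z.1, z.2.2.2, 0)), rfl⟩) EX
    have F3 := ae_comp_of_surjective ((ct.comp p2).prod ((cx.comp p2).prod
      ((cy.comp p1).prod (cy.comp p2))))
      (fun z => ⟨((0, 0, z.2.2.1), (z.1, z.2.1, z.2.2.2)), rfl⟩) EY
    rw [hvol] at F1 F2 F3
    have G1 := Measure.ae_ae_of_ae_prod F1
    have G2 := Measure.ae_ae_of_ae_prod F2
    have G3 := Measure.ae_ae_of_ae_prod F3
    rw [ae_restrict_iff' isOpen_dom.measurableSet]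
    filter_upwards [G1, G2, G3] with p g1 g2 g3 hp
    rw [ae_restrict_iff' isOpen_dom.measurableSet]
    filter_upwards [g1, g2, g3] with q k1 k2 k3 hq
    have hpt : p.1 ∈ timeO T := ⟨hp.1, hp.2.1⟩
    have hqt : q.1 ∈ timeO T := ⟨hq.1, hq.2.1⟩
    have j1 : |w₀ (q.1, p.2.1, p.2.2) - w₀ (p.1, p.2.1, p.2.2)| ≤
        A * p.2.1 ^ θ' * |q.1 - p.1| ^ (1 / 2 : ℝ) := k1 ⟨hpt, hqt, hp.2.2, mem_univ _⟩
    have j2 : |w₀ (q.1, q.2.1, p.2.2) - w₀ (q.1, p.2.1, p.2.2)| ≤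
        A * |q.2.1 ^ θ - p.2.1 ^ θ| / |θ| := k2 ⟨hqt, mem_univ _, hp.2.2, hq.2.2⟩
    have j3 : |w₀ (q.1, q.2.1, q.2.2) - w₀ (q.1, q.2.1, p.2.2)| ≤
        A * q.2.1 ^ (θ - 1) * |q.2.2 - p.2.2| := k3 ⟨hqt, hq.2.2, mem_univ _, mem_univ _⟩
    rw [dist_comm, Real.dist_eq]
    have e : w₀ q - w₀ p = (w₀ (q.1, p.2.1, p.2.2) - w₀ (p.1, p.2.1, p.2.2)) +
        (w₀ (q.1, q.2.1, p.2.2) - w₀ (q.1, p.2.1, p.2.2)) +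
        (w₀ (q.1, q.2.1, q.2.2) - w₀ (q.1, q.2.1, p.2.2)) := by ring
    rw [e]
    exact (abs_add_three _ _ _).trans (add_le_add (add_le_add j1 j2) j3)

end JointContinuity

section

open Polynomial

/-! ### Linear combinations of derivatives -/

section Combinations

variable {T : ℝ≥0∞} {v : ℝ × ℝ × ℝ → ℝ} {N : ℕ} {g h : ℕ → ℕ → ℝ × ℝ × ℝ → ℝ}

theorem exists_sN_ev_le (p : ℝ[X]) : ∃ K : ℝ≥0, ∀ (ρ : ℝ) (f : ℕ → ℝ × ℝ × ℝ → ℝ) (t : ℝ),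
    (∀ n, Measurable (f n)) →
    sN ρ (ev f p) t ≤ K * ∑ n ∈ Finset.range (p.natDegree + 1), sN ρ (f n) t := by
  obtain ⟨K, hK⟩ := exists_wN_sum_le (Finset.range (p.natDegree + 1)) p.coeff
  refine ⟨K, fun ρ f t hf => ?_⟩
  have e : ∀ y, (fun x => ev f p (t, x, y)) =
      fun x => ∑ n ∈ Finset.range (p.natDegree + 1), p.coeff n * f n (t, x, y) := by
    intro y
    ext x
    rw [ev_eq_sum f p (Nat.lt_succ_self _), Finset.sum_apply]
    rfl
  have hm : ∀ n, Measurable fun y => wN (Ioi 0) ρ fun x => f n (t, x, y) := fun n =>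
    measurable_wN_line (w := fun q => f n (t, q)) ((hf n).comp measurable_prodMk_left) ρ
  calc sN ρ (ev f p) t ≤ ∫⁻ y, K * ∑ n ∈ Finset.range (p.natDegree + 1),
        wN (Ioi 0) ρ fun x => f n (t, x, y) := by
        refine lintegral_mono fun y => ?_
        rw [e]
        exact hK _ _ (fun n x => f n (t, x, y)) fun n _ =>
          ((hf n).comp (by fun_prop : Measurable fun x : ℝ => (t, x, y))).aemeasurable
    _ = _ := by
        rw [lintegral_const_mul' _ _ ENNReal.coe_ne_top, lintegral_finsetSum _ fun n _ => hm n]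
        rfl

theorem exists_ae_sN_ev_le (p : ℝ[X]) : ∃ K : ℝ≥0, ∀ (T : ℝ≥0∞) (ρ : ℝ)
    (f : ℕ → ℝ × ℝ × ℝ → ℝ) (M : ℝ≥0∞), (∀ n, Measurable (f n)) →
    (∀ n ≤ p.natDegree, ∀ᵐ t ∂volume.restrict (timeO T), sN ρ (f n) t ≤ M) →
    ∀ᵐ t ∂volume.restrict (timeO T), sN ρ (ev f p) t ≤ K * M := by
  obtain ⟨K, hK⟩ := exists_sN_ev_le p
  refine ⟨K * (p.natDegree + 1 : ℕ), fun T ρ f M hf h => ?_⟩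
  have h1 : ∀ n : ℕ, ∀ᵐ t ∂volume.restrict (timeO T), n ≤ p.natDegree → sN ρ (f n) t ≤ M := by
    intro n
    by_cases hn : n ≤ p.natDegree
    · filter_upwards [h n hn] with t ht _ using ht
    · exact Eventually.of_forall fun t h => absurd h hn
  filter_upwards [ae_all_iff.2 h1] with t ht
  refine (hK ρ f t hf).trans ?_
  rw [ENNReal.coe_mul, mul_assoc]
  gcongr
  calc _ ≤ ∑ n ∈ Finset.range (p.natDegree + 1), M := Finset.sum_le_sum fun n hn =>
        ht n (Nat.lt_succ_iff.1 (Finset.mem_range.1 hn))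
    _ = _ := by simp

theorem exists_lintegral_sN_ev_le (p : ℝ[X]) : ∃ K : ℝ≥0, ∀ (T : ℝ≥0∞) (ρ : ℝ)
    (f : ℕ → ℝ × ℝ × ℝ → ℝ) (M : ℝ≥0∞), (∀ n, Measurable (f n)) →
    (∀ n ≤ p.natDegree, ∫⁻ t in timeO T, sN ρ (f n) t ≤ M) →
    ∫⁻ t in timeO T, sN ρ (ev f p) t ≤ K * M := by
  obtain ⟨K, hK⟩ := exists_sN_ev_le p
  refine ⟨K * (p.natDegree + 1 : ℕ), fun T ρ f M hf h => ?_⟩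
  calc ∫⁻ t in timeO T, sN ρ (ev f p) t
      ≤ ∫⁻ t in timeO T, K * ∑ n ∈ Finset.range (p.natDegree + 1), sN ρ (f n) t :=
        lintegral_mono fun t => hK ρ f t hf
    _ = K * ∑ n ∈ Finset.range (p.natDegree + 1), ∫⁻ t in timeO T, sN ρ (f n) t := by
        rw [lintegral_const_mul' _ _ ENNReal.coe_ne_top,
          lintegral_finsetSum _ fun n _ => measurable_sN (hf n) ρ]
    _ ≤ K * ∑ n ∈ Finset.range (p.natDegree + 1), M := by
        gcongr with n hn
        exact h n (Nat.lt_succ_iff.1 (Finset.mem_range.1 hn))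
    _ = _ := by simp [mul_assoc]

/-- `∂_t` commutes with the other derivatives. -/
theorem weakOp_dt_jet {p : ℝ[X]} {b L : ℕ} (hg : WeakOp (spaceTime T).dom
    (opEnd (spaceTime T) p b) v (jet g p b))
    (hh : ∀ n ≤ L, WeakOp (spaceTime T).dom (opEnd (spaceTime T) (X ^ n) b * dtEnd T) v (h n b))
    (hp : p.natDegree ≤ L) : WeakOp (spaceTime T).dom (dtEnd T) (jet g p b) (jet h p b) := by
  refine hg.of_comp ?_
  have hp' : p.natDegree < L + 1 := Nat.lt_succ_of_le hp
  have h1 : opEnd (spaceTime T) p b * dtEnd T = ∑ n ∈ Finset.range (L + 1),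
      p.coeff n • (opEnd (spaceTime T) (X ^ n) b * dtEnd T) := by
    conv_lhs => rw [opEnd, p.as_sum_range' (L + 1) hp', map_sum, Finset.sum_mul, Finset.sum_mul]
    refine Finset.sum_congr rfl fun n _ => ?_
    rw [opEnd, ← smul_mul_assoc, ← smul_mul_assoc, ← map_smul, smul_X_eq_monomial]
  rw [h1, jet, ev_eq_sum _ p hp']
  exact WeakOp.sum _ _ hg.1 fun n hn => hh n (Nat.lt_succ_iff.1 (Finset.mem_range.1 hn))

/-- Four derivatives of a function of `(t, x, y)` which control it pointwise. -/
structure SpaceQuad (T : ℝ≥0∞) (w₀ w₁ w₂ w₃ : ℝ × ℝ × ℝ → ℝ) : Prop where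
  m₀ : Measurable w₀
  m₁ : Measurable w₁
  m₂ : Measurable w₂
  m₃ : Measurable w₃
  dx : WeakOp (spaceTime T).dom (dxEnd (spaceTime T)) w₀ w₁
  dy : WeakOp (spaceTime T).dom (dyEnd (spaceTime T)) w₀ w₂
  dxy : WeakOp (spaceTime T).dom (dxEnd (spaceTime T)) w₂ w₃

theorem SpaceQuad.ae_planeQuad {w₀ w₁ w₂ w₃ : ℝ × ℝ × ℝ → ℝ} (hw : SpaceQuad T w₀ w₁ w₂ w₃) :
    ∀ᵐ t ∂volume.restrict (timeO T), PlaneQuad (fun q => w₀ (t, q)) (fun q => w₁ (t, q))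
      (fun q => w₂ (t, q)) fun q => w₃ (t, q) := by
  have h1 := ae_weakD_y hw.dy
  rw [Measure.volume_eq_prod, ← Measure.prod_restrict] at h1
  filter_upwards [ae_ae_of_timeO_prod (ae_xd hw.dx), ae_ae_of_timeO_prod (ae_xd hw.dxy),
    Measure.ae_ae_of_ae_prod h1] with t h1 h2 h3
  exact ⟨h1, h2, h3⟩

theorem exists_pointwise_space (ρ : ℝ) : ∃ K : ℝ≥0, ∀ (T : ℝ≥0∞) (w₀ w₁ w₂ w₃ : ℝ × ℝ × ℝ → ℝ),
    SpaceQuad T w₀ w₁ w₂ w₃ → ∀ M : ℝ≥0∞,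
    (∀ᵐ t ∂volume.restrict (timeO T), sN ρ w₀ t ≤ M) →
    (∀ᵐ t ∂volume.restrict (timeO T), sN ρ w₁ t ≤ M) →
    (∀ᵐ t ∂volume.restrict (timeO T), sN ρ w₂ t ≤ M) →
    (∀ᵐ t ∂volume.restrict (timeO T), sN ρ w₃ t ≤ M) →
    ∀ᵐ t ∂volume.restrict (timeO T), ∀ᵐ x ∂volume.restrict (Ioi (0 : ℝ)), ∀ᵐ y,
      ‖w₀ (t, x, y)‖ₑ ^ 2 ≤ ENNReal.ofReal (x ^ (2 * ρ - 1)) * (K * M) := by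
  obtain ⟨K, hK⟩ := exists_pointwise_plane ρ
  refine ⟨K * 4, fun T w₀ w₁ w₂ w₃ hw M h0 h1 h2 h3 => ?_⟩
  filter_upwards [h0, h1, h2, h3, hw.ae_planeQuad] with t k0 k1 k2 k3 hq
  filter_upwards [hK _ _ _ _ (hw.m₀.comp measurable_prodMk_left) (hw.m₁.comp measurable_prodMk_left)
    (hw.m₂.comp measurable_prodMk_left) (hw.m₃.comp measurable_prodMk_left) hq] with x hx
  filter_upwards [hx] with y hy
  refine hy.trans ?_
  calc _ ≤ K * ENNReal.ofReal (x ^ (2 * ρ - 1)) * (M + M + M + M) := by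
        gcongr
        · exact k0
        · exact k1
        · exact k2
        · exact k3
    _ = _ := by
        push_cast
        ring

theorem exists_pointwise_sub (ρ : ℝ) : ∃ K : ℝ≥0, ∀ (T : ℝ≥0∞)
    (w₀ w₁ w₂ w₃ k₀ k₁ k₂ k₃ : ℝ × ℝ × ℝ → ℝ),
    SpaceQuad T w₀ w₁ w₂ w₃ → Measurable k₀ → Measurable k₁ → Measurable k₂ → Measurable k₃ →
    WeakOp (spaceTime T).dom (dtEnd T) w₀ k₀ → WeakOp (spaceTime T).dom (dtEnd T) w₁ k₁ →
    WeakOp (spaceTime T).dom (dtEnd T) w₂ k₂ → WeakOp (spaceTime T).dom (dtEnd T) w₃ k₃ →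
    ∀ M : ℝ≥0∞, (∫⁻ t in timeO T, sN ρ k₀ t ≤ M) → (∫⁻ t in timeO T, sN ρ k₁ t ≤ M) →
    (∫⁻ t in timeO T, sN ρ k₂ t ≤ M) → (∫⁻ t in timeO T, sN ρ k₃ t ≤ M) →
    ∀ᵐ t₁ ∂volume.restrict (timeO T), ∀ᵐ t₂ ∂volume.restrict (timeO T),
      ∀ᵐ x ∂volume.restrict (Ioi (0 : ℝ)), ∀ᵐ y,
      ‖w₀ (t₂, x, y) - w₀ (t₁, x, y)‖ₑ ^ 2 ≤
        ENNReal.ofReal (x ^ (2 * ρ - 1)) * ENNReal.ofReal |t₂ - t₁| * (K * M) := by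
  obtain ⟨K, hK⟩ := exists_pointwise_plane ρ
  refine ⟨K * 4, fun T w₀ w₁ w₂ w₃ k₀ k₁ k₂ k₃ hw n0 n1 n2 n3 d0 d1 d2 d3 M h0 h1 h2 h3 => ?_⟩
  filter_upwards [ae_plN_sub_le hw.m₀ n0 d0 ρ, ae_plN_sub_le hw.m₁ n1 d1 ρ,
    ae_plN_sub_le hw.m₂ n2 d2 ρ, ae_plN_sub_le hw.m₃ n3 d3 ρ, hw.ae_planeQuad] with t₁ l0 l1 l2 l3 l
  filter_upwards [l0, l1, l2, l3, hw.ae_planeQuad] with t₂ j0 j1 j2 j3 j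
  have hm : ∀ {w : ℝ × ℝ × ℝ → ℝ}, Measurable w →
      Measurable fun q : ℝ × ℝ => w (t₂, q) - w (t₁, q) := fun hw =>
    (hw.comp measurable_prodMk_left).sub (hw.comp measurable_prodMk_left)
  filter_upwards [hK _ _ _ _ (hm hw.m₀) (hm hw.m₁) (hm hw.m₂) (hm hw.m₃) (j.sub l)] with x hx
  filter_upwards [hx] with y hy
  refine hy.trans ?_
  set τ := ENNReal.ofReal |t₂ - t₁|
  calc _ ≤ K * ENNReal.ofReal (x ^ (2 * ρ - 1)) * (τ * M + τ * M + τ * M + τ * M) := by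
        gcongr
        · exact j0.trans (by gcongr)
        · exact j1.trans (by gcongr)
        · exact j2.trans (by gcongr)
        · exact j3.trans (by gcongr)
    _ = _ := by
        push_cast
        ring

theorem sN_le_add {ρ ρ₁ ρ₂ : ℝ} (h1 : ρ₁ ≤ ρ) (h2 : ρ ≤ ρ₂) {w : ℝ × ℝ × ℝ → ℝ} (hw : Measurable w)
    (t : ℝ) : sN ρ w t ≤ sN ρ₁ w t + sN ρ₂ w t := by
  have hm := measurable_wN_line (w := fun q => w (t, q)) (hw.comp measurable_prodMk_left) ρ₁
  rw [sN, sN, sN, ← lintegral_add_left hm]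
  refine lintegral_mono fun y => ?_
  have hmx : Measurable fun x : ℝ => ENNReal.ofReal (x ^ (-2 * ρ₁ - 1)) * ‖w (t, x, y)‖ₑ ^ 2 :=
    (measurable_ofReal_rpow _).mul ((hw.comp (by fun_prop)).enorm.pow_const 2)
  change wN _ _ _ ≤ wN _ _ _ + wN _ _ _
  rw [wN, wN, wN, ← lintegral_add_left hmx]
  refine setLIntegral_mono' measurableSet_Ioi fun x hx => ?_
  have hx0 : (0 : ℝ) < x := hx
  rw [← add_mul]
  gcongr
  rcases le_total x 1 with h | h
  · refine le_add_left (ENNReal.ofReal_le_ofReal ?_)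
    exact Real.rpow_le_rpow_of_exponent_ge hx0 h (by linarith)
  · refine le_add_right (ENNReal.ofReal_le_ofReal ?_)
    exact Real.rpow_le_rpow_of_exponent_le h (by linarith)

theorem ae_wN_ne_top_of_sN {w : ℝ × ℝ × ℝ → ℝ} (hw : Measurable w) {ρ : ℝ} {M : ℝ≥0∞} (hM : M ≠ ⊤)
    (h : ∀ᵐ t ∂volume.restrict (timeO T), sN ρ w t ≤ M) :
    ∀ᵐ t ∂volume.restrict (timeO T), ∀ᵐ y, wN (Ioi 0) ρ (fun x => w (t, x, y)) ≠ ⊤ := by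
  filter_upwards [h] with t ht
  filter_upwards [ae_lt_top (measurable_wN_line (w := fun q => w (t, q))
    (hw.comp measurable_prodMk_left) ρ) (ne_top_of_le_ne_top hM ht)] with y hy using hy.ne

/-- A function on `(0,∞)` is bounded if its derivative decays at `0` and `∞`, and if it is small
at `∞` in the mean. -/
theorem XD.abs_le {U f : ℝ → ℝ} (h : XD U f) {A δ σ : ℝ} (hA : 0 ≤ A) (hδ : 0 < δ)
    (h1 : ∀ᵐ s ∂volume.restrict (Ioi (0 : ℝ)), |f s| ≤ A * s ^ δ)
    (h2 : ∀ᵐ s ∂volume.restrict (Ioi (0 : ℝ)), |f s| ≤ A * s ^ (-δ)) (hσ : σ ≤ 0)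
    (hfin : wN (Ioi 1) σ U ≠ ⊤) : ∀ᵐ s ∂volume.restrict (Ioi (0 : ℝ)), |U s| ≤ 2 * A / δ := by
  obtain ⟨w, hw, hp⟩ := h
  have key : ∀ x : ℝ, 0 < x → |w x - w 1| ≤ A / δ := by
    intro x hx
    rcases le_total x 1 with hx1 | hx1
    · refine (abs_prim_sub_le hδ.ne' hp h1 one_pos hx).trans ?_
      rw [Real.one_rpow, abs_of_pos hδ]
      gcongr
      have g1 : 0 < x ^ δ := Real.rpow_pos_of_pos hx δ
      have g2 : x ^ δ ≤ 1 := Real.rpow_le_one hx.le hx1 hδ.le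
      refine mul_le_of_le_one_right hA (_root_.abs_le.2 ⟨by linarith, by linarith⟩)
    · refine (abs_prim_sub_le (neg_ne_zero.2 hδ.ne') hp h2 one_pos hx).trans ?_
      rw [Real.one_rpow, abs_neg, abs_of_pos hδ]
      gcongr
      have g1 : 0 < x ^ (-δ) := Real.rpow_pos_of_pos hx _
      have g2 : x ^ (-δ) ≤ 1 := Real.rpow_le_one_of_one_le_of_nonpos hx1 (by linarith)
      refine mul_le_of_le_one_right hA (_root_.abs_le.2 ⟨by linarith, by linarith⟩)
  have h3 : |w 1| ≤ A / δ := by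
    by_contra! hlt
    refine hfin (top_le_iff.1 ?_)
    set c := |w 1| - A / δ with hc
    have hc0 : 0 < c := sub_pos.2 hlt
    have hle : wN (Ioi 1) σ (fun _ => c * 1) ≤ wN (Ioi 1) σ U := by
      refine lintegral_mono_ae ?_
      have hsub : Ioi (1 : ℝ) ⊆ Ioi 0 := Ioi_subset_Ioi zero_le_one
      filter_upwards [ae_restrict_of_ae_restrict_of_subset hsub hw,
        ae_restrict_mem measurableSet_Ioi] with x g1 g2
      have hx : (0 : ℝ) < x := hsub g2
      gcongr
      rw [g1, mul_one, Real.enorm_eq_ofReal_abs, Real.enorm_eq_ofReal_abs, abs_of_pos hc0]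
      refine ENNReal.ofReal_le_ofReal ?_
      have g3 := key x hx
      have g4 := abs_sub_abs_le_abs_sub (w 1) (w x)
      rw [abs_sub_comm] at g4
      linarith
    rw [wN_const_mul, wN_one_Ioi hσ, ENNReal.mul_top (by simpa using hc0.ne')] at hle
    exact hle
  filter_upwards [hw, ae_restrict_mem measurableSet_Ioi] with s g1 g2
  rw [g1]
  have g3 := key s g2
  have g4 := abs_sub_abs_le_abs_sub (w s) (w 1)
  have g5 : 2 * A / δ = A / δ + A / δ := by ring
  linarith

end Combinations

end

section

open Polynomial

/-! ### The roots of the symbol -/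

section Roots

theorem beta_bounds : 13 / 20 < β ∧ β < 163 / 250 := by
  have h1 : (18 / 5 : ℝ) < √13 := Real.lt_sqrt_of_sq_lt (by norm_num)
  have h2 : √13 < (451 / 125 : ℝ) := (Real.sqrt_lt' (by norm_num)).2 (by norm_num)
  unfold β
  constructor <;> linarith

/-- The roots of `(ζ - 3) (ζ - 2) q̃(ζ) ζ`. -/
def roots : Finset ℝ := {0, 1, 2, 3, 1 + β, -(1 / 2), 1 / 2 - β}

/-- The negative roots; they do not occur in the expansions. -/
def badRoots : Finset ℝ := {-(1 / 2), 1 / 2 - β}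

theorem mem_roots {γ : ℝ} : γ ∈ roots ↔ γ = 0 ∨ γ = 1 ∨ γ = 2 ∨ γ = 3 ∨ γ = 1 + β ∨
    γ = -(1 / 2) ∨ γ = 1 / 2 - β := by
  simp only [roots, Finset.mem_insert, Finset.mem_singleton]

theorem mem_badRoots {γ : ℝ} : γ ∈ badRoots ↔ γ = -(1 / 2) ∨ γ = 1 / 2 - β := by
  simp only [badRoots, Finset.mem_insert, Finset.mem_singleton]

theorem prod_roots {M : Type} [CommMonoid M] (f : ℝ → M) : ∏ γ ∈ roots, f γ =
    f 0 * (f 1 * (f 2 * (f 3 * (f (1 + β) * (f (-(1 / 2)) * f (1 / 2 - β)))))) := by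
  obtain ⟨h1, h2⟩ := beta_bounds
  rw [roots, Finset.prod_insert, Finset.prod_insert, Finset.prod_insert, Finset.prod_insert,
    Finset.prod_insert, Finset.prod_insert, Finset.prod_singleton] <;>
  · intro h
    simp only [Finset.mem_insert, Finset.mem_singleton] at h
    (try casesm* _ ∨ _) <;> linarith

theorem card_roots : roots.card = 7 := by
  rw [Finset.card_eq_sum_ones]
  have h := prod_roots fun _ => Multiplicative.ofAdd (1 : ℕ)
  exact h

theorem full_roots : full roots = symb := by
  rw [full, Lagrange.nodal, prod_roots, symb, qt]
  simp only [id, map_zero, map_one, map_sub, map_add, map_neg]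
  ring

/-- No exponent of the expansions is equal to `ρ`, for the `ρ` that occur. -/
theorem roots_add_ne {ρ : ℝ} (m : ℤ) (hρ : (m < ρ ∧ ρ < m + 1 / 2) ∨
    (m + 1 / 2 < ρ ∧ ρ < m + 13 / 20) ∨ (m + 17 / 20 < ρ ∧ ρ < m + 1)) :
    ∀ γ ∈ roots, ∀ b : ℕ, γ + b ≠ ρ := by
  intro γ hγ b hb
  obtain ⟨h1, h2⟩ := beta_bounds
  have key : ∀ c : ℤ, ((m + c : ℤ) : ℝ) < b → (b : ℝ) < ((m + c : ℤ) : ℝ) + 1 → False := by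
    intro c g1 g2
    have k1 : m + c < (b : ℤ) := by exact_mod_cast g1
    have k2 : (b : ℤ) < m + c + 1 := by exact_mod_cast g2
    omega
  have a0 := key 0
  have a1 := key (-1)
  have a2 := key (-2)
  have a3 := key (-3)
  have a4 := key 1
  push_cast at a0 a1 a2 a3 a4
  rcases mem_roots.1 hγ with rfl | rfl | rfl | rfl | rfl | rfl | rfl <;>
  rcases hρ with ⟨g1, g2⟩ | ⟨g1, g2⟩ | ⟨g1, g2⟩ <;>
  first
  | exact a0 (by linarith) (by linarith)
  | exact a1 (by linarith) (by linarith)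
  | exact a2 (by linarith) (by linarith)
  | exact a3 (by linarith) (by linarith)
  | exact a4 (by linarith) (by linarith)

end Roots

/-! ### Functions with bounded norms at almost every time -/

section Core

variable {T : ℝ≥0∞} {v : ℝ × ℝ × ℝ → ℝ} {N : ℕ} {g h : ℕ → ℕ → ℝ × ℝ × ℝ → ℝ} {kc : ℕ} {δ : ℝ}
  {M : ℝ≥0∞}

/-- The part of the hypotheses on a solution which concerns bounds that are uniform in time. Here
`g n b` and `h n b` are representatives of `D_y^b D_x^n v` and `∂_t D_y^b D_x^n v`. -/
structure Core (T : ℝ≥0∞) (v : ℝ × ℝ × ℝ → ℝ) (N : ℕ) (g h : ℕ → ℕ → ℝ × ℝ × ℝ → ℝ) (kc : ℕ)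
    (δ : ℝ) (M : ℝ≥0∞) : Prop where
  jets : Jets T v N g
  le_N : kc ≤ N
  four_le : 4 ≤ kc
  δ_pos : 0 < δ
  ne_top : M ≠ ⊤
  weak : ∀ n b, n + b ≤ kc + 6 →
    WeakOp (spaceTime T).dom (opEnd (spaceTime T) (X ^ n) b) v (g n b)
  meas_dt : ∀ n b, Measurable (h n b)
  weak_dt : ∀ n b, n + b ≤ kc + 4 →
    WeakOp (spaceTime T).dom (opEnd (spaceTime T) (X ^ n) b * dtEnd T) v (h n b)
  low : ∀ n b, n + b ≤ kc + 6 →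
    ∀ᵐ t ∂volume.restrict (timeO T), sN (-(1 / 2) - δ) (g n b) t ≤ M
  dt : ∀ n b, n + b ≤ kc + 4 → ∫⁻ t in timeO T, sN (-1 - δ) (h n b) t ≤ M
  top : ∀ n b, n + b ≤ kc →
    ∀ᵐ t ∂volume.restrict (timeO T), sN (3 / 2 + δ) (jet g (symb * X ^ n) b) t ≤ M
  top' : ∀ b, 1 ≤ b → b ≤ 2 →
    ∀ᵐ t ∂volume.restrict (timeO T), sN (5 / 2 - δ) (jet g symb b) t ≤ M
  bad : ∀ γ ∈ badRoots, ∀ b : ℕ, b ≤ kc → γ + b < 3 / 2 + δ →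
    ∀ᵐ z ∂volume.restrict (timeO T ×ˢ (univ : Set ℝ)), cfT roots g b γ z = 0
  dy₀ : ∀ b ≤ 1, ∀ᵐ t ∂volume.restrict (timeO T),
    WeakD univ (fun y => cfT roots g b 0 (t, y)) fun y => cfT roots g (b + 1) 0 (t, y)
  dy₁ : ∀ᵐ t ∂volume.restrict (timeO T),
    WeakD univ (fun y => cfT roots g 0 1 (t, y)) fun y => cfT roots g 1 1 (t, y)

namespace Core

theorem weakOp (hC : Core T v N g h kc δ M) {p : ℝ[X]} {b : ℕ} (hp : p.natDegree + b ≤ kc + 6) :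
    WeakOp (spaceTime T).dom (opEnd (spaceTime T) p b) v (jet g p b) :=
  WeakOp.ev (spaceTime T) (N := kc + 6 - b) (fun n hn => hC.weak n b (by omega)) (by omega)

theorem dtOp (hC : Core T v N g h kc δ M) {p : ℝ[X]} {b : ℕ} (hp : p.natDegree + b ≤ kc + 4) :
    WeakOp (spaceTime T).dom (dtEnd T) (jet g p b) (jet h p b) :=
  weakOp_dt_jet (L := kc + 4 - b) (hC.weakOp (by omega)) (fun n hn => hC.weak_dt n b (by omega))
    (by omega)

theorem spaceQuad (hC : Core T v N g h kc δ M) {p : ℝ[X]} {b : ℕ}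
    (hp : p.natDegree + b + 2 ≤ kc + 6) :
    SpaceQuad T (jet g p b) (jet g ((X + C (b : ℝ)) * p) b) (jet g p (b + 1))
      (jet g ((X + C ((b + 1 : ℕ) : ℝ)) * p) (b + 1)) := by
  have hdx : ∀ b : ℕ, p.natDegree + b + 1 ≤ kc + 6 → WeakOp (spaceTime T).dom
      (dxEnd (spaceTime T)) (jet g p b) (jet g ((X + C (b : ℝ)) * p) b) := by
    intro b hb
    refine (hC.weakOp (p := p) (b := b) (by omega)).of_comp ?_
    rw [opEnd_mul_dxEnd, mul_comm p]
    exact hC.weakOp (by have := Jets.natDegree_X_add_C_mul_le p b; omega)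
  refine ⟨hC.jets.measurable_jet _ _, hC.jets.measurable_jet _ _, hC.jets.measurable_jet _ _,
    hC.jets.measurable_jet _ _, hdx b (by omega), ?_, hdx (b + 1) (by omega)⟩
  refine (hC.weakOp (p := p) (b := b) (by omega)).of_comp ?_
  rw [opEnd_mul_dyEnd]
  exact hC.weakOp (by omega)

end Core

theorem exists_sN_low (p : ℝ[X]) (b : ℕ) : ∃ K : ℝ≥0, ∀ (T : ℝ≥0∞) (v : ℝ × ℝ × ℝ → ℝ) (N : ℕ)
    (g h : ℕ → ℕ → ℝ × ℝ × ℝ → ℝ) (kc : ℕ) (δ : ℝ) (M : ℝ≥0∞), Core T v N g h kc δ M →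
    p.natDegree + b ≤ kc + 6 →
    ∀ᵐ t ∂volume.restrict (timeO T), sN (-(1 / 2) - δ) (jet g p b) t ≤ K * M := by
  obtain ⟨K, hK⟩ := exists_ae_sN_ev_le p
  exact ⟨K, fun T v N g h kc δ M hC hp => hK T _ _ M (fun n => hC.jets.meas n b)
    fun n hn => hC.low n b (by omega)⟩

theorem exists_sN_dt (p : ℝ[X]) (b : ℕ) : ∃ K : ℝ≥0, ∀ (T : ℝ≥0∞) (v : ℝ × ℝ × ℝ → ℝ) (N : ℕ)
    (g h : ℕ → ℕ → ℝ × ℝ × ℝ → ℝ) (kc : ℕ) (δ : ℝ) (M : ℝ≥0∞), Core T v N g h kc δ M →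
    p.natDegree + b ≤ kc + 4 → ∫⁻ t in timeO T, sN (-1 - δ) (jet h p b) t ≤ K * M := by
  obtain ⟨K, hK⟩ := exists_lintegral_sN_ev_le p
  exact ⟨K, fun T v N g h kc δ M hC hp => hK T _ _ M (fun n => hC.meas_dt n b)
    fun n hn => hC.dt n b (by omega)⟩

theorem abs_le_of_enorm_sq_le {r x a : ℝ} {M : ℝ≥0∞} (hM : M ≠ ⊤) (hx : 0 < x)
    (h : ‖r‖ₑ ^ 2 ≤ ENNReal.ofReal (x ^ (2 * a)) * M) : |r| ≤ (M ^ (1 / 2 : ℝ)).toReal * x ^ a := by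
  have h1 := ENNReal.rpow_le_rpow h (by norm_num : (0 : ℝ) ≤ 1 / 2)
  rw [← ENNReal.rpow_natCast, ← ENNReal.rpow_mul, ENNReal.mul_rpow_of_nonneg _ _ (by norm_num),
    ENNReal.ofReal_rpow_of_nonneg (by positivity) (by norm_num), ← Real.rpow_mul hx.le] at h1
  norm_num at h1
  rw [show 2 * a * (1 / 2) = a by ring] at h1
  have hfin : M ^ (1 / 2 : ℝ) ≠ ⊤ := ENNReal.rpow_ne_top_of_nonneg (by norm_num) hM
  have h2 := ENNReal.toReal_mono (by finiteness) h1
  rw [ENNReal.toReal_mul, ENNReal.toReal_ofReal (by positivity), toReal_enorm,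
    Real.norm_eq_abs] at h2
  linarith [mul_comm (x ^ a) (M ^ (1 / 2 : ℝ)).toReal]

/-- The derivatives of low order are continuous. -/
theorem Core.exists_continuousOn (hC : Core T v N g h kc δ M) (hT : 0 < T) {p : ℝ[X]} {b : ℕ}
    (hp : p.natDegree + b + 2 ≤ kc + 4) : ∃ G, ContinuousOn G (domI T) ∧
      ∀ᵐ q ∂volume.restrict (spaceTime T).dom, G q = jet g p b q := by
  have hM := hC.ne_top
  have hδ := hC.δ_pos
  -- the bounds for two first-order derivatives
  have hlow : ∀ (q : ℝ[X]) (c : ℕ), q.natDegree + c + 2 ≤ kc + 6 → ∃ A : ℝ≥0∞, A ≠ ⊤ ∧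
      ∀ᵐ t ∂volume.restrict (timeO T), ∀ᵐ x ∂volume.restrict (Ioi (0 : ℝ)), ∀ᵐ y,
        ‖jet g q c (t, x, y)‖ₑ ^ 2 ≤ ENNReal.ofReal (x ^ (2 * (-1 - δ))) * A := by
    intro q c hq
    obtain ⟨K, hK⟩ := exists_pointwise_space (-(1 / 2) - δ)
    obtain ⟨K0, h0⟩ := exists_sN_low q c
    obtain ⟨K1, h1⟩ := exists_sN_low ((X + C (c : ℝ)) * q) c
    obtain ⟨K2, h2⟩ := exists_sN_low q (c + 1)
    obtain ⟨K3, h3⟩ := exists_sN_low ((X + C ((c + 1 : ℕ) : ℝ)) * q) (c + 1)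
    have d1 := Jets.natDegree_X_add_C_mul_le q (c : ℝ)
    have d2 := Jets.natDegree_X_add_C_mul_le q ((c + 1 : ℕ) : ℝ)
    set B : ℝ≥0∞ := K0 * M + K1 * M + K2 * M + K3 * M with hB
    refine ⟨K * B, by finiteness, ?_⟩
    have e : 2 * (-1 - δ) = 2 * (-(1 / 2) - δ) - 1 := by ring
    rw [e]
    refine hK T _ _ _ _ (hC.spaceQuad hq) B ?_ ?_ ?_ ?_
    · filter_upwards [h0 T v N g h kc δ M hC (by omega)] with t ht
      exact ht.trans (by rw [hB, add_assoc, add_assoc]; exact le_self_add)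
    · filter_upwards [h1 T v N g h kc δ M hC (by omega)] with t ht
      refine ht.trans ?_
      rw [hB, add_assoc, add_comm (K0 * M) (K1 * M), add_assoc]
      exact le_self_add
    · filter_upwards [h2 T v N g h kc δ M hC (by omega)] with t ht
      exact ht.trans (le_self_add.trans' le_add_self)
    · filter_upwards [h3 T v N g h kc δ M hC (by omega)] with t ht
      exact ht.trans le_add_self
  have d1 := Jets.natDegree_X_add_C_mul_le p (b : ℝ)
  have d2 := Jets.natDegree_X_add_C_mul_le p ((b + 1 : ℕ) : ℝ)
  obtain ⟨A1, hA1, k1⟩ := hlow ((X + C (b : ℝ)) * p) b (by omega)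
  obtain ⟨A2, hA2, k2⟩ := hlow p (b + 1) (by omega)
  -- the bound for differences in time
  obtain ⟨K, hK⟩ := exists_pointwise_sub (-1 - δ)
  obtain ⟨K0, h0⟩ := exists_sN_dt p b
  obtain ⟨K1, h1⟩ := exists_sN_dt ((X + C (b : ℝ)) * p) b
  obtain ⟨K2, h2⟩ := exists_sN_dt p (b + 1)
  obtain ⟨K3, h3⟩ := exists_sN_dt ((X + C ((b + 1 : ℕ) : ℝ)) * p) (b + 1)
  set B : ℝ≥0∞ := K0 * M + K1 * M + K2 * M + K3 * M with hB
  have hm := fun (q : ℝ[X]) (c : ℕ) => measurable_ev (fun n => hC.meas_dt n c) q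
  have hsq := hC.spaceQuad (p := p) (b := b) (by omega)
  have k3 := hK T _ _ _ _ _ _ _ _ hsq (hm _ _) (hm _ _) (hm _ _) (hm _ _) (hC.dtOp (by omega))
    (hC.dtOp (by omega)) (hC.dtOp (by omega)) (hC.dtOp (by omega)) B
    ((h0 T v N g h kc δ M hC (by omega)).trans
      (by rw [hB, add_assoc, add_assoc]; exact le_self_add))
    ((h1 T v N g h kc δ M hC (by omega)).trans
      (by rw [hB, add_assoc, add_comm (K0 * M) (K1 * M), add_assoc]; exact le_self_add))
    ((h2 T v N g h kc δ M hC (by omega)).trans (le_self_add.trans' le_add_self))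
    ((h3 T v N g h kc δ M hC (by omega)).trans le_add_self)
  set A : ℝ≥0∞ := A1 + A2 + K * B with hA
  have hAfin : A ≠ ⊤ := by finiteness
  refine exists_continuousOn_domI hT hsq.m₀ hsq.dx hsq.dy (A := (A ^ (1 / 2 : ℝ)).toReal)
    (θ := -1 - δ) (θ' := -1 - δ - 1 / 2) (by linarith) ?_ hsq.m₁ ?_ ?_
  · filter_upwards [k1] with t ht
    filter_upwards [ht, ae_restrict_mem measurableSet_Ioi] with x hx hx0
    filter_upwards [hx] with y hy
    refine abs_le_of_enorm_sq_le hAfin hx0 (hy.trans ?_)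
    gcongr
    rw [hA, add_assoc]
    exact le_self_add
  · filter_upwards [k2] with t ht
    filter_upwards [ht, ae_restrict_mem measurableSet_Ioi] with x hx hx0
    filter_upwards [hx] with y hy
    refine abs_le_of_enorm_sq_le hAfin hx0 (hy.trans ?_)
    gcongr
    exact le_self_add.trans' le_add_self
  · filter_upwards [k3] with t₁ ht₁
    filter_upwards [ht₁, Measure.ae_ne (volume.restrict (timeO T)) t₁] with t₂ ht hne
    filter_upwards [ht, ae_restrict_mem measurableSet_Ioi] with x hx hx0
    filter_upwards [hx] with y hy
    have hx0' : (0 : ℝ) < x := hx0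
    have hτ : 0 < |t₂ - t₁| := abs_pos.2 (sub_ne_zero.2 hne)
    have h4 := abs_le_of_enorm_sq_le (r := jet g p b (t₂, x, y) - jet g p b (t₁, x, y)) (x := x)
      (a := -1 - δ - 1 / 2) (M := ENNReal.ofReal |t₂ - t₁| * A) (by finiteness) hx0' (by
        refine hy.trans ?_
        rw [mul_assoc, show 2 * (-1 - δ - 1 / 2) = 2 * (-1 - δ) - 1 by ring]
        gcongr
        exact le_add_self)
    refine h4.trans (le_of_eq ?_)
    rw [ENNReal.mul_rpow_of_nonneg _ _ (by norm_num), ENNReal.toReal_mul,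
      ENNReal.ofReal_rpow_of_nonneg (abs_nonneg _) (by norm_num),
      ENNReal.toReal_ofReal (by positivity)]
    ring

end Core

end

section

open Polynomial

/-! ### Bounds for the gradient -/

section Gradient

variable {T : ℝ≥0∞} {v : ℝ × ℝ × ℝ → ℝ} {N : ℕ} {g h : ℕ → ℕ → ℝ × ℝ × ℝ → ℝ} {kc : ℕ} {δ : ℝ}
  {M : ℝ≥0∞}

/-- The expansion of `D_y^b p(D_x) v` has no terms of lower order than `x^(8/5)`. -/
def Vanishes (p : ℝ[X]) (b : ℕ) : Prop :=
  (b = 0 → p.eval 0 = 0 ∧ p.eval 1 = 0) ∧ (b = 1 → p.eval 0 = 0)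

theorem Vanishes.mul {p : ℝ[X]} {b : ℕ} (h : Vanishes p b) (q : ℝ[X]) : Vanishes (q * p) b :=
  ⟨fun hb => by simp [h.1 hb], fun hb => by simp [h.2 hb]⟩

theorem Vanishes.succ {p : ℝ[X]} {b : ℕ} (h : Vanishes p b) : Vanishes p (b + 1) :=
  ⟨fun hb => absurd hb (Nat.succ_ne_zero b), fun hb => (h.1 (by omega)).1⟩

/-- A derivative without terms of low order is as small as the remainder of the expansion. -/
theorem exists_sN_top (hδ : 0 < δ) (hδ' : δ < 1 / 10) {p : ℝ[X]} {b : ℕ} (hp : Vanishes p b) :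
    ∃ K : ℝ≥0, ∀ (T : ℝ≥0∞) (v : ℝ × ℝ × ℝ → ℝ) (N : ℕ) (g h : ℕ → ℕ → ℝ × ℝ × ℝ → ℝ) (kc : ℕ)
      (M : ℝ≥0∞), Core T v N g h kc δ M → p.natDegree - 7 + b ≤ kc →
      ∀ᵐ t ∂volume.restrict (timeO T), sN (3 / 2 + δ) (jet g p b) t ≤ K * M := by
  obtain ⟨β1, β2⟩ := beta_bounds
  obtain ⟨K, hK⟩ := exists_expansion roots (b := (b : ℝ)) (ρ := 3 / 2 + δ) (ρ₀ := -(1 / 2) - δ)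
    (fun γ hγ => roots_add_ne 1 (Or.inr (Or.inl ⟨by push_cast; linarith, by push_cast; linarith⟩))
      γ hγ b) (by linarith) p
  refine ⟨K * (p.natDegree - 7 + 1 : ℕ), fun T v N g h kc M hC hd => ?_⟩
  have hJ := hC.jets
  have hM := hC.ne_top
  have hN := hC.le_N
  have hfilt : ∀ γ : roots, ∀ᵐ t ∂volume.restrict (timeO T), ∀ᵐ y,
      wN (Ioi 0) (-(1 / 2) - δ) (fun x => jet g (filt roots γ) b (t, x, y)) ≠ ⊤ := by
    intro γ
    obtain ⟨K', hK'⟩ := exists_sN_low (filt roots γ) b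
    have h1 := natDegree_filt γ.2
    rw [card_roots] at h1
    exact ae_wN_ne_top_of_sN (hJ.measurable_jet _ b) (M := K' * M) (by finiteness)
      (hK' T v N g h kc δ M hC (by omega))
  have htop : ∀ j, ∀ᵐ t ∂volume.restrict (timeO T), j + b ≤ kc →
      sN (3 / 2 + δ) (jet g (full roots * X ^ j) b) t ≤ M := by
    intro j
    by_cases hj : j + b ≤ kc
    · rw [full_roots]
      filter_upwards [hC.top j b hj] with t ht _ using ht
    · exact Eventually.of_forall fun t h => absurd h hj
  have hfull := ae_wN_ne_top_of_sN (hJ.measurable_jet (symb * X ^ 0) b) hM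
    (hC.top 0 b (by omega))
  have hbad : ∀ γ : badRoots, ∀ᵐ t ∂volume.restrict (timeO T), ∀ᵐ y,
      (γ : ℝ) + b < 3 / 2 + δ → cfT roots g b γ (t, y) = 0 := by
    intro γ
    by_cases hγ : (γ : ℝ) + b < 3 / 2 + δ
    · filter_upwards [ae_ae_of_timeO_prod (hC.bad γ γ.2 b (by omega) hγ)] with t ht
      filter_upwards [ht] with y hy _ using hy
    · exact Eventually.of_forall fun t => Eventually.of_forall fun y h => absurd h hγ
  filter_upwards [ae_all_iff.2 hfilt, ae_all_iff.2 htop, hfull, ae_all_iff.2 hbad,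
    ae_ae_of_timeO_prod (hJ.ae_jetX (b := b) (by omega))] with t h1 h2 h3 h4 h5
  have hm : ∀ q : ℝ[X], Measurable fun y => wN (Ioi 0) (3 / 2 + δ) fun x => jet g q b (t, x, y) :=
    fun q => measurable_wN_line (w := fun z => jet g q b (t, z))
      ((hJ.measurable_jet q b).comp measurable_prodMk_left) _
  calc sN (3 / 2 + δ) (jet g p b) t
      ≤ ∫⁻ y, K * ∑ j ∈ Finset.range (p.natDegree - 7 + 1),
          wN (Ioi 0) (3 / 2 + δ) fun x => jet g (full roots * X ^ j) b (t, x, y) := by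
        refine lintegral_mono_ae ?_
        filter_upwards [ae_all_iff.2 h1, h3, ae_all_iff.2 h4, h5] with y k1 k3 k4 k5
        have k6 := hK _ _ k5 (by rw [card_roots]; omega)
          (fun γ hγ => by rw [ev_sl]; exact k1 ⟨γ, hγ⟩)
          (by rw [ev_sl, full_roots]; simpa using k3)
        simp only [ev_sl, card_roots] at k6
        have e : (fun x => jet g p b (t, x, y) - ∑ γ ∈ roots with γ + b < 3 / 2 + δ,
            p.eval γ * cf roots b (sl g b (t, y)) γ * x ^ (γ + b)) =
            fun x => jet g p b (t, x, y) := by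
          ext x
          rw [Finset.sum_eq_zero, sub_zero]
          intro γ hγ
          obtain ⟨hγ, hlt⟩ := Finset.mem_filter.1 hγ
          have hb0 : (0 : ℝ) ≤ b := b.cast_nonneg
          have hzero : p.eval γ = 0 ∨ cf roots b (sl g b (t, y)) γ = 0 := by
            rcases mem_roots.1 hγ with rfl | rfl | rfl | rfl | rfl | rfl | rfl
            · have h6 : (b : ℝ) < (2 : ℕ) := by push_cast; linarith
              have h7 : b < 2 := by exact_mod_cast h6
              interval_cases b
              · exact Or.inl (hp.1 rfl).1
              · exact Or.inl (hp.2 rfl)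
            · have h6 : (b : ℝ) < (1 : ℕ) := by push_cast; linarith
              have h7 : b < 1 := by exact_mod_cast h6
              exact Or.inl (hp.1 (by omega)).2
            · linarith
            · linarith
            · linarith
            · exact Or.inr (k4 ⟨-(1 / 2), mem_badRoots.2 (Or.inl rfl)⟩ hlt)
            · exact Or.inr (k4 ⟨1 / 2 - β, mem_badRoots.2 (Or.inr rfl)⟩ hlt)
          rcases hzero with h | h <;> rw [h] <;> ring
        rw [e] at k6
        exact k6
    _ = K * ∑ j ∈ Finset.range (p.natDegree - 7 + 1),
          sN (3 / 2 + δ) (jet g (full roots * X ^ j) b) t := by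
        rw [lintegral_const_mul' _ _ ENNReal.coe_ne_top, lintegral_finsetSum _ fun j _ => hm _]
        rfl
    _ ≤ K * ∑ j ∈ Finset.range (p.natDegree - 7 + 1), M := by
        gcongr with j hj
        exact h2 j (by have := Finset.mem_range.1 hj; omega)
    _ = _ := by simp [mul_assoc]

theorem exists_sN_mid (hδ : 0 < δ) (hδ' : δ < 1 / 10) {p : ℝ[X]} {b : ℕ} (hp : Vanishes p b) :
    ∃ K : ℝ≥0, ∀ (T : ℝ≥0∞) (v : ℝ × ℝ × ℝ → ℝ) (N : ℕ) (g h : ℕ → ℕ → ℝ × ℝ × ℝ → ℝ) (kc : ℕ)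
      (M : ℝ≥0∞), Core T v N g h kc δ M → p.natDegree + b ≤ kc + 6 → b ≤ kc →
      ∀ ρ, ρ = 3 / 2 + δ ∨ ρ = 3 / 2 - δ →
      ∀ᵐ t ∂volume.restrict (timeO T), sN ρ (jet g p b) t ≤ K * M := by
  obtain ⟨K1, h1⟩ := exists_sN_top hδ hδ' hp
  obtain ⟨K2, h2⟩ := exists_sN_low p b
  refine ⟨K2 + K1, fun T v N g h kc M hC hd hb ρ hρ => ?_⟩
  filter_upwards [h1 T v N g h kc M hC (by omega), h2 T v N g h kc δ M hC hd] with t k1 k2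
  rw [ENNReal.coe_add, add_mul]
  refine (sN_le_add (ρ₁ := -(1 / 2) - δ) (ρ₂ := 3 / 2 + δ) ?_ ?_ (hC.jets.measurable_jet p b)
    t).trans (add_le_add k2 k1)
  · rcases hρ with rfl | rfl <;> linarith
  · rcases hρ with rfl | rfl <;> linarith

theorem exists_abs_le_top (hδ : 0 < δ) (hδ' : δ < 1 / 10) {p : ℝ[X]} {b : ℕ} (hp : Vanishes p b) :
    ∃ K : ℝ≥0, ∀ (T : ℝ≥0∞) (v : ℝ × ℝ × ℝ → ℝ) (N : ℕ) (g h : ℕ → ℕ → ℝ × ℝ × ℝ → ℝ) (kc : ℕ)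
      (M : ℝ≥0∞), Core T v N g h kc δ M → p.natDegree + b + 2 ≤ kc + 6 → b + 1 ≤ kc →
      ∀ θ, θ = 1 + δ ∨ θ = 1 - δ →
      ∀ᵐ t ∂volume.restrict (timeO T), ∀ᵐ x ∂volume.restrict (Ioi (0 : ℝ)), ∀ᵐ y,
        |jet g p b (t, x, y)| ≤ ((K * M) ^ (1 / 2 : ℝ)).toReal * x ^ θ := by
  obtain ⟨K0, h0⟩ := exists_sN_mid hδ hδ' hp
  obtain ⟨K1, h1⟩ := exists_sN_mid hδ hδ' (hp.mul (X + C (b : ℝ)))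
  obtain ⟨K2, h2⟩ := exists_sN_mid hδ hδ' hp.succ
  obtain ⟨K3, h3⟩ := exists_sN_mid hδ hδ' (hp.succ.mul (X + C ((b + 1 : ℕ) : ℝ)))
  obtain ⟨Kp, hKp⟩ := exists_pointwise_space (3 / 2 + δ)
  obtain ⟨Km, hKm⟩ := exists_pointwise_space (3 / 2 - δ)
  have d1 := Jets.natDegree_X_add_C_mul_le p (b : ℝ)
  have d2 := Jets.natDegree_X_add_C_mul_le p ((b + 1 : ℕ) : ℝ)
  refine ⟨(Kp + Km) * (K0 + K1 + K2 + K3), fun T v N g h kc M hC hd hb θ hθ => ?_⟩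
  have hM := hC.ne_top
  set B : ℝ≥0 := K0 + K1 + K2 + K3 with hB
  have hle : ∀ K : ℝ≥0, K ≤ B → (K : ℝ≥0∞) * M ≤ B * M := fun K hK => by gcongr
  have l0 : K0 ≤ B := by rw [hB, add_assoc, add_assoc]; exact le_self_add
  have l1 : K1 ≤ B := by
    rw [hB, add_comm K0 K1, add_assoc, add_assoc]
    exact le_self_add
  have l2 : K2 ≤ B := le_self_add.trans' le_add_self
  have l3 : K3 ≤ B := le_add_self
  have main : ∀ ρ, ρ = 3 / 2 + δ ∨ ρ = 3 / 2 - δ → ∀ K : ℝ≥0, K ≤ Kp + Km →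
      (∀ (T : ℝ≥0∞) (w₀ w₁ w₂ w₃ : ℝ × ℝ × ℝ → ℝ), SpaceQuad T w₀ w₁ w₂ w₃ → ∀ M : ℝ≥0∞,
        (∀ᵐ t ∂volume.restrict (timeO T), sN ρ w₀ t ≤ M) →
        (∀ᵐ t ∂volume.restrict (timeO T), sN ρ w₁ t ≤ M) →
        (∀ᵐ t ∂volume.restrict (timeO T), sN ρ w₂ t ≤ M) →
        (∀ᵐ t ∂volume.restrict (timeO T), sN ρ w₃ t ≤ M) →
        ∀ᵐ t ∂volume.restrict (timeO T), ∀ᵐ x ∂volume.restrict (Ioi (0 : ℝ)), ∀ᵐ y,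
          ‖w₀ (t, x, y)‖ₑ ^ 2 ≤ ENNReal.ofReal (x ^ (2 * ρ - 1)) * (K * M)) →
      ∀ᵐ t ∂volume.restrict (timeO T), ∀ᵐ x ∂volume.restrict (Ioi (0 : ℝ)), ∀ᵐ y,
        |jet g p b (t, x, y)| ≤ ((((Kp + Km) * B : ℝ≥0) * M) ^ (1 / 2 : ℝ)).toReal *
          x ^ (ρ - 1 / 2) := by
    intro ρ hρ K hK hpt
    have h4 := hpt T _ _ _ _ (hC.spaceQuad (p := p) (b := b) hd) (B * M)
      ((h0 T v N g h kc M hC (by omega) (by omega) ρ hρ).mono fun t ht => ht.trans (hle K0 l0))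
      ((h1 T v N g h kc M hC (by omega) (by omega) ρ hρ).mono fun t ht => ht.trans (hle K1 l1))
      ((h2 T v N g h kc M hC (by omega) (by omega) ρ hρ).mono fun t ht => ht.trans (hle K2 l2))
      ((h3 T v N g h kc M hC (by omega) (by omega) ρ hρ).mono fun t ht => ht.trans (hle K3 l3))
    filter_upwards [h4] with t ht
    filter_upwards [ht, ae_restrict_mem measurableSet_Ioi] with x hx hx0
    filter_upwards [hx] with y hy
    refine abs_le_of_enorm_sq_le (by finiteness) hx0 ?_
    rw [show 2 * (ρ - 1 / 2) = 2 * ρ - 1 by ring]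
    refine hy.trans ?_
    rw [ENNReal.coe_mul, mul_assoc]
    gcongr
  rcases hθ with rfl | rfl
  · have := main _ (Or.inl rfl) Kp le_self_add hKp
    rwa [show 3 / 2 + δ - 1 / 2 = 1 + δ by ring] at this
  · have := main _ (Or.inr rfl) Km le_add_self hKm
    rwa [show 3 / 2 - δ - 1 / 2 = 1 - δ by ring] at this

/-- `x⁻¹ D_y^b p(D_x) v` is bounded and continuous if the derivative of this function with respect
to `log x`, which is `x⁻¹ D_y^b (D_x + b - 1) p(D_x) v`, decays as `x → 0` and as `x → ∞`. -/
theorem exists_bcBound (hδ : 0 < δ) (hδ' : δ < 1 / 10) {p : ℝ[X]} {b : ℕ}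
    (hp : Vanishes ((X + C ((b : ℝ) - 1)) * p) b) :
    ∃ K : ℝ≥0, ∀ (T : ℝ≥0∞) (v : ℝ × ℝ × ℝ → ℝ) (N : ℕ) (g h : ℕ → ℕ → ℝ × ℝ × ℝ → ℝ) (kc : ℕ)
      (M : ℝ≥0∞), Core T v N g h kc δ M → 0 < T → p.natDegree + b ≤ kc → b + 1 ≤ kc →
      ∃ G, WeakOp (spaceTime T).dom (opEnd (spaceTime T) p b * xInvEnd (spaceTime T)) v G ∧
        BCBound (domI T) G (K * M ^ (1 / 2 : ℝ)) := by
  obtain ⟨K, hK⟩ := exists_abs_le_top hδ hδ' hp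
  refine ⟨Real.toNNReal (2 / δ) * K ^ (1 / 2 : ℝ), fun T v N g h kc M hC hT hd hb => ?_⟩
  have hM := hC.ne_top
  have h4 := hC.four_le
  set q : ℝ[X] := (X + C ((b : ℝ) - 1)) * p with hq
  have dq : q.natDegree ≤ p.natDegree + 1 := Jets.natDegree_X_add_C_mul_le p _
  set A : ℝ := ((K * M) ^ (1 / 2 : ℝ)).toReal with hA
  have hA0 : 0 ≤ A := ENNReal.toReal_nonneg
  have hmp := hC.jets.measurable_jet p b
  have hmq := hC.jets.measurable_jet q b
  have kp := hK T v N g h kc M hC (by omega) hb _ (Or.inl rfl)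
  have km := hK T v N g h kc M hC (by omega) hb _ (Or.inr rfl)
  obtain ⟨Kl, hKl⟩ := exists_sN_low p b
  have kl := ae_wN_ne_top_of_sN hmp (M := Kl * M) (by finiteness)
    (hKl T v N g h kc δ M hC (by omega))
  have kx := ae_ae_of_timeO_prod (ae_xd (hC.spaceQuad (p := p) (b := b) (by omega)).dx)
  have hbound : ∀ᵐ z ∂volume.restrict (spaceTime T).dom, |z.2.1⁻¹ * jet g p b z| ≤ 2 * A / δ := by
    refine ae_dom_of_ae (measurableSet_le
      ((measurable_fst.comp measurable_snd).inv.mul hmp).norm measurable_const) ?_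
    filter_upwards [kp, km, kl, kx] with t g1 g2 g3 g4
    have hsw : ∀ θ : ℝ, (∀ᵐ x ∂volume.restrict (Ioi (0 : ℝ)), ∀ᵐ y,
        |jet g q b (t, x, y)| ≤ A * x ^ θ) → ∀ᵐ y, ∀ᵐ x ∂volume.restrict (Ioi (0 : ℝ)),
        |jet g q b (t, x, y)| ≤ A * x ^ θ := by
      intro θ hθ
      rw [Measure.ae_ae_comm] at hθ
      · exact hθ
      · exact measurableSet_le ((hmq.comp (by fun_prop)).norm) (by fun_prop)
    replace g1 := hsw _ g1
    replace g2 := hsw _ g2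
    rw [Measure.ae_ae_comm]
    · filter_upwards [g1, g2, g3, g4] with y k1 k2 k3 k4
      have k5 := k4.rpow_mul (-1)
      have e : (fun x : ℝ => x ^ (-1 : ℝ) * (jet g ((X + C (b : ℝ)) * p) b (t, x, y) +
          -1 * jet g p b (t, x, y))) = fun x => x ^ (-1 : ℝ) * jet g q b (t, x, y) := by
        ext x
        have : q = (X + C (b : ℝ)) * p - p := by
          rw [hq, map_sub, map_one]
          ring
        rw [this, jet, jet, jet, map_sub, Pi.sub_apply]
        ring
      rw [e] at k5
      have hb1 : ∀ θ : ℝ, (∀ᵐ x ∂volume.restrict (Ioi (0 : ℝ)),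
          |jet g q b (t, x, y)| ≤ A * x ^ (1 + θ)) → ∀ᵐ x ∂volume.restrict (Ioi (0 : ℝ)),
          |x ^ (-1 : ℝ) * jet g q b (t, x, y)| ≤ A * x ^ θ := by
        intro θ hθ
        filter_upwards [hθ, ae_restrict_mem measurableSet_Ioi] with x hx hx0
        have hx0' : (0 : ℝ) < x := hx0
        rw [abs_mul, abs_of_pos (Real.rpow_pos_of_pos hx0' _)]
        calc x ^ (-1 : ℝ) * |jet g q b (t, x, y)| ≤ x ^ (-1 : ℝ) * (A * x ^ (1 + θ)) := by gcongr
          _ = A * (x ^ (-1 : ℝ) * x ^ (1 + θ)) := by ring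
          _ = _ := by rw [← Real.rpow_add hx0', show -1 + (1 + θ) = θ by ring]
      have k6 := k5.abs_le (σ := -(3 / 2) - δ) hA0 hδ (hb1 δ k1)
        (hb1 (-δ) (by simpa only [← sub_eq_add_neg] using k2)) (by linarith) (by
          rw [wN_rpow_mul measurableSet_Ioi (Ioi_subset_Ioi zero_le_one)]
          refine ne_top_of_le_ne_top k3 ?_
          rw [show -(3 / 2) - δ - -1 = -(1 / 2) - δ by ring]
          exact wN_mono (Ioi_subset_Ioi zero_le_one) _ _)
      filter_upwards [k6] with x hx
      rwa [Real.rpow_neg_one] at hx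
    · exact measurableSet_le ((measurable_fst.inv.mul (hmp.comp measurable_prodMk_left)).norm)
        measurable_const
  obtain ⟨G, hGc, hG⟩ := hC.exists_continuousOn hT (p := p) (b := b) (by omega)
  have hcont : ContinuousOn (fun z : ℝ × ℝ × ℝ => z.2.1⁻¹ * G z) (domI T) :=
    ContinuousOn.mul (ContinuousOn.inv₀ (by fun_prop) fun z hz => hz.2.ne') hGc
  refine ⟨fun z => z.2.1⁻¹ * G z, ?_, hcont, ?_⟩
  · have h1 := hC.weakOp (p := p) (b := b) (by omega)
    refine (h1.comp (weakOp_xInvEnd h1.2.1)).congr_ae isOpen_dom ?_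
    filter_upwards [hG] with z hz
    rw [hz]
  · refine forall_enorm_le_of_ae ae_mem_domI (neBot_domI hT) hcont ?_
    filter_upwards [hG, hbound] with z h1 h2
    rw [h1, Real.enorm_eq_ofReal_abs]
    refine (ENNReal.ofReal_le_ofReal h2).trans (le_of_eq ?_)
    rw [show 2 * A / δ = 2 / δ * A by ring, ENNReal.ofReal_mul (by positivity), hA,
      ENNReal.ofReal_toReal (ENNReal.rpow_ne_top_of_nonneg (by norm_num) (by finiteness)),
      ENNReal.mul_rpow_of_nonneg _ _ (by norm_num), ENNReal.coe_mul,
      ENNReal.coe_rpow_of_nonneg _ (by norm_num), ENNReal.ofReal, mul_assoc]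

end Gradient

end

/-! ### The space `H¹(ℝ)` -/

section SobolevSpace

theorem enorm_sq_eq_lintegral (f : Lp ℝ 2 (volume : Measure ℝ)) :
    ‖f‖ₑ ^ 2 = ∫⁻ y, ‖f y‖ₑ ^ 2 := by
  rw [Lp.enorm_def, eLpNorm_eq_lintegral_rpow_enorm_toReal (by simp) (by simp),
    ← ENNReal.rpow_natCast, ← ENNReal.rpow_mul]
  simp

theorem enorm_sq_H1 (B : H1) :
    ‖B‖ₑ ^ 2 = (∫⁻ y, ‖B.1.fst y‖ₑ ^ 2) + ∫⁻ y, ‖B.1.snd y‖ₑ ^ 2 := by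
  rw [← enorm_sq_eq_lintegral, ← enorm_sq_eq_lintegral]
  have h : ‖B‖₊ ^ 2 = ‖B.1.fst‖₊ ^ 2 + ‖B.1.snd‖₊ ^ 2 :=
    NNReal.eq (WithLp.prod_norm_sq_eq_of_L2 B.1)
  change ((‖B‖₊ : ℝ≥0∞)) ^ 2 = (‖B.1.fst‖₊ : ℝ≥0∞) ^ 2 + (‖B.1.snd‖₊ : ℝ≥0∞) ^ 2
  exact_mod_cast h

theorem enorm_sq_H1_of_ae (B : H1) {u u' : ℝ → ℝ} (h1 : B.1.fst =ᵐ[volume] u)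
    (h2 : B.1.snd =ᵐ[volume] u') : ‖B‖ₑ ^ 2 = (∫⁻ y, ‖u y‖ₑ ^ 2) + ∫⁻ y, ‖u' y‖ₑ ^ 2 := by
  rw [enorm_sq_H1]
  congr 1
  · exact lintegral_congr_ae (h1.mono fun y hy => by simp only [hy])
  · exact lintegral_congr_ae (h2.mono fun y hy => by simp only [hy])

theorem enorm_sub_sq_H1 (B B' : H1) {u u' w w' : ℝ → ℝ} (h1 : B.1.fst =ᵐ[volume] u)
    (h2 : B.1.snd =ᵐ[volume] u') (h3 : B'.1.fst =ᵐ[volume] w) (h4 : B'.1.snd =ᵐ[volume] w') :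
    ‖B - B'‖ₑ ^ 2 = (∫⁻ y, ‖u y - w y‖ₑ ^ 2) + ∫⁻ y, ‖u' y - w' y‖ₑ ^ 2 :=
  enorm_sq_H1_of_ae (B - B') ((Lp.coeFn_sub B.1.fst B'.1.fst).trans (h1.sub h3))
    ((Lp.coeFn_sub B.1.snd B'.1.snd).trans (h2.sub h4))

theorem isClosed_H1 : IsClosed (H1 : Set (WithLp 2 (Lp ℝ 2 (volume : Measure ℝ) ×
    Lp ℝ 2 (volume : Measure ℝ)))) := by
  have hL : ∀ ψ : ℝ → ℝ, Continuous ψ → HasCompactSupport ψ →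
      Continuous fun f : Lp ℝ 2 (volume : Measure ℝ) => ∫ y, f y * ψ y := by
    intro ψ h1 h2
    have hm : MemLp ψ 2 (volume : Measure ℝ) := h1.memLp_of_hasCompactSupport h2
    have e : ∀ f : Lp ℝ 2 (volume : Measure ℝ), ∫ y, f y * ψ y = inner ℝ (hm.toLp ψ) f := by
      intro f
      rw [L2.inner_def]
      refine integral_congr_ae ?_
      filter_upwards [hm.coeFn_toLp] with y hy
      rw [hy]
      simp
    simp only [e]
    fun_prop
  have e : (H1 : Set (WithLp 2 (Lp ℝ 2 (volume : Measure ℝ) × Lp ℝ 2 (volume : Measure ℝ)))) =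
      ⋂ φ ∈ {φ : ℝ → ℝ | ContDiff ℝ ∞ φ ∧ HasCompactSupport φ},
        {p | ∫ y, p.fst y * deriv φ y = -∫ y, p.snd y * φ y} := by
    ext p
    simp only [mem_iInter]
    exact ⟨fun h φ hφ => h φ hφ.1 hφ.2, fun h φ h1 h2 => h φ ⟨h1, h2⟩⟩
  rw [e]
  refine isClosed_biInter fun φ hφ => isClosed_eq ?_ ?_
  · exact (hL _ (hφ.1.continuous_deriv (by simp)) hφ.2.deriv).comp (by fun_prop)
  · exact ((hL _ hφ.1.continuous hφ.2).comp (by fun_prop)).neg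

instance : CompleteSpace H1 := isClosed_H1.completeSpace_coe

instance : SecondCountableTopology H1 := by
  have : Fact ((2 : ℝ≥0∞) ≠ ⊤) := ⟨by simp⟩
  have : SecondCountableTopology (WithLp 2 (Lp ℝ 2 (volume : Measure ℝ) ×
      Lp ℝ 2 (volume : Measure ℝ))) :=
    (WithLp.homeomorphProd 2 _ _).secondCountableTopology
  exact inferInstanceAs (SecondCountableTopology (Subtype _))

theorem exists_H1 {u u' : ℝ → ℝ} (hu : MemLp u 2) (hu' : MemLp u' 2) (h : WeakD univ u u') :
    ∃ B : H1, B.1.fst =ᵐ[volume] u ∧ B.1.snd =ᵐ[volume] u' := by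
  refine ⟨⟨WithLp.toLp 2 (hu.toLp u, hu'.toLp u'), fun φ h1 h2 => ?_⟩, hu.coeFn_toLp,
    hu'.coeFn_toLp⟩
  have h3 := h.2.2 φ ⟨h1, h2, subset_univ _⟩
  have e1 : ∫ y, hu.toLp u y * deriv φ y = ∫ y, u y * deriv φ y := by
    refine integral_congr_ae ?_
    filter_upwards [hu.coeFn_toLp] with y hy
    rw [hy]
  have e2 : ∫ y, hu'.toLp u' y * φ y = ∫ y, u' y * φ y := by
    refine integral_congr_ae ?_
    filter_upwards [hu'.coeFn_toLp] with y hy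
    rw [hy]
  change ∫ y, hu.toLp u y * deriv φ y = -∫ y, hu'.toLp u' y * φ y
  rw [e1, e2, h3]

theorem weakD_H1 (B : H1) : WeakD univ B.1.fst B.1.snd := by
  have h : ∀ f : Lp ℝ 2 (volume : Measure ℝ), LocallyIntegrableOn f univ := fun f =>
    ((Lp.memLp f).locallyIntegrable (by norm_num)).locallyIntegrableOn univ
  exact ⟨h _, h _, fun χ hχ => B.2 χ hχ.smooth hχ.compact⟩

theorem exists_primitive_H1 (B : H1) :
    ∃ U : ℝ →ᵇ ℝ, B.1.fst =ᵐ[volume] U ∧ PrimOn univ U B.1.snd ∧ ∀ y, ‖U y‖ ≤ 2 * ‖B‖ := by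
  obtain ⟨U, hU, hp⟩ := (weakD_H1 B).exists_primitive isOpen_univ ordConnected_univ
  rw [Measure.restrict_univ] at hU
  have hb : ∀ y, ‖U y‖ ≤ 2 * ‖B‖ := by
    intro y
    have h1 := hp.enorm_sq_le one_pos y
    have e : ∫⁻ y, ‖U y‖ₑ ^ 2 = ∫⁻ y, ‖B.1.fst y‖ₑ ^ 2 := by
      refine lintegral_congr_ae ?_
      filter_upwards [hU] with y hy
      rw [hy]
    rw [inv_one, ENNReal.ofReal_one, one_mul, one_mul, e, ← mul_add, ← enorm_sq_H1] at h1
    have h2 : ‖U y‖₊ ^ 2 ≤ 2 * ‖B‖₊ ^ 2 := by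
      change (‖U y‖₊ : ℝ≥0∞) ^ 2 ≤ 2 * (‖B‖₊ : ℝ≥0∞) ^ 2 at h1
      exact_mod_cast h1
    replace h2 : ‖U y‖ ^ 2 ≤ 2 * ‖B‖ ^ 2 := by exact_mod_cast h2
    refine le_of_sq_le_sq ?_ (by positivity)
    nlinarith [sq_nonneg ‖B‖]
  exact ⟨BoundedContinuousFunction.ofNormedAddCommGroup U hp.continuous _ hb, hU, hp, hb⟩

/-- The continuous representative of an element of `H¹(ℝ)`. -/
def toBC (B : H1) : ℝ →ᵇ ℝ := (exists_primitive_H1 B).choose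

theorem toBC_ae_eq (B : H1) : B.1.fst =ᵐ[volume] toBC B := (exists_primitive_H1 B).choose_spec.1

theorem primOn_toBC (B : H1) : PrimOn univ (toBC B) B.1.snd :=
  (exists_primitive_H1 B).choose_spec.2.1

theorem norm_toBC_le (B : H1) : ‖toBC B‖ ≤ 2 * ‖B‖ :=
  (BoundedContinuousFunction.norm_le (by positivity)).2 (exists_primitive_H1 B).choose_spec.2.2

theorem toBC_sub (B B' : H1) : toBC (B - B') = toBC B - toBC B' := by
  have h : toBC (B - B') =ᵐ[volume] ⇑(toBC B - toBC B') := by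
    have e1 : (B - B').1.fst = B.1.fst - B'.1.fst := rfl
    have h0 := toBC_ae_eq (B - B')
    rw [e1] at h0
    filter_upwards [h0, Lp.coeFn_sub B.1.fst B'.1.fst, toBC_ae_eq B, toBC_ae_eq B']
      with y k0 k1 k2 k3
    rw [← k0, k1, Pi.sub_apply, k2, k3]
    rfl
  exact DFunLike.coe_injective ((BoundedContinuousFunction.continuous _).ae_eq_iff_eq _
    (BoundedContinuousFunction.continuous _) |>.1 h)

theorem continuous_toBC : Continuous toBC := by
  refine (LipschitzWith.of_dist_le_mul (K := 2) fun B B' => ?_).continuous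
  rw [dist_eq_norm, dist_eq_norm, ← toBC_sub]
  exact norm_toBC_le _

/-- If `B'` represents the derivative of `B`, then the continuous representative of `B` is
continuously differentiable. -/
theorem hasDerivAt_toBC {B B' : H1} (h : B.1.snd = B'.1.fst) (y : ℝ) :
    HasDerivAt (toBC B) (toBC B' y) y := by
  have hc := BoundedContinuousFunction.continuous (toBC B')
  have h1 : ⇑(toBC B) = fun s => toBC B 0 + ∫ r in (0 : ℝ)..s, toBC B' r := by
    ext s
    have h2 := (primOn_toBC B 0 (mem_univ _) s (mem_univ _)).2
    rw [h, intervalIntegral.integral_congr_ae (g := toBC B')] at h2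
    · linarith
    · filter_upwards [toBC_ae_eq B'] with r hr _ using hr
  rw [h1]
  exact (intervalIntegral.integral_hasDerivAt_right (hc.intervalIntegrable _ _)
    (hc.stronglyMeasurableAtFilter _ _) hc.continuousAt).const_add _

end SobolevSpace

/-! ### Curves in `H¹(ℝ)` -/

section Curves

theorem aestronglyMeasurable_of_edist {α F : Type} [MeasurableSpace α] [NormedAddCommGroup F]
    [SecondCountableTopology F] {μ : Measure α} {f : α → F}
    (h : ∀ B, AEMeasurable (fun t => edist (f t) B) μ) : AEStronglyMeasurable f μ := by
  borelize F
  refine AEMeasurable.aestronglyMeasurable (NullMeasurable.aemeasurable ?_)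
  have hball : ∀ B r, NullMeasurableSet (f ⁻¹' Metric.eball B r) μ := fun B r =>
    (h B).nullMeasurable measurableSet_Iio
  have : @Measurable (NullMeasurableSpace α μ) F _ _ f := measurable_of_isOpen fun U hU => by
    choose! r hr using fun x (hx : x ∈ U) => EMetric.isOpen_iff.1 hU x hx
    obtain ⟨I, hIU, hI, hIeq⟩ := TopologicalSpace.isOpen_biUnion_countable U
      (fun x => Metric.eball x (r x)) fun x _ => Metric.isOpen_eball
    have e : U = ⋃ x ∈ I, Metric.eball x (r x) := by
      rw [hIeq]
      exact subset_antisymm (fun x hx => mem_biUnion (t := fun x => Metric.eball x (r x)) hx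
        (Metric.mem_eball_self (hr x hx).1)) (iUnion₂_subset fun x hx => (hr x hx).2)
    have h1 : NullMeasurableSet (f ⁻¹' U) μ := by
      rw [e, preimage_iUnion₂]
      exact NullMeasurableSet.biUnion hI fun x _ => hball x _
    exact h1
  exact this

open Classical in
/-- The curve in `H¹(ℝ)` with values `(c(t, ·), c'(t, ·))`, where `c'` is the weak derivative
of `c` in `y`. The value is `0` at times at which this is not an element of `H¹(ℝ)`. -/
def h1Curve (c c' : ℝ × ℝ → ℝ) (t : ℝ) : H1 :=
  if h : ∃ B : H1, B.1.fst =ᵐ[volume] (fun y => c (t, y)) ∧ B.1.snd =ᵐ[volume] fun y => c' (t, y)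
  then h.choose else 0

variable {T : ℝ≥0∞} {c c' : ℝ × ℝ → ℝ}

theorem memLp_two_of_lintegral {f : ℝ → ℝ} (hf : Measurable f) (h : ∫⁻ y, ‖f y‖ₑ ^ 2 ≠ ⊤) :
    MemLp f 2 := by
  refine ⟨hf.aestronglyMeasurable, ?_⟩
  rw [eLpNorm_lt_top_iff_lintegral_rpow_enorm_lt_top (by simp) (by simp)]
  simpa using lt_top_iff_ne_top.2 h

theorem ae_h1Curve (hc : Measurable c) (hc' : Measurable c')
    (h : ∀ᵐ t ∂volume.restrict (timeO T), ∫⁻ y, ‖c (t, y)‖ₑ ^ 2 ≠ ⊤)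
    (h' : ∀ᵐ t ∂volume.restrict (timeO T), ∫⁻ y, ‖c' (t, y)‖ₑ ^ 2 ≠ ⊤)
    (hd : ∀ᵐ t ∂volume.restrict (timeO T), WeakD univ (fun y => c (t, y)) fun y => c' (t, y)) :
    ∀ᵐ t ∂volume.restrict (timeO T), (h1Curve c c' t).1.fst =ᵐ[volume] (fun y => c (t, y)) ∧
      (h1Curve c c' t).1.snd =ᵐ[volume] fun y => c' (t, y) := by
  filter_upwards [h, h', hd] with t h1 h2 h3
  have h4 := exists_H1 (u := fun y => c (t, y)) (u' := fun y => c' (t, y))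
    (memLp_two_of_lintegral (hc.comp measurable_prodMk_left) h1)
    (memLp_two_of_lintegral (hc'.comp measurable_prodMk_left) h2) h3
  rw [h1Curve, dif_pos h4]
  exact h4.choose_spec

theorem aestronglyMeasurable_h1Curve (hc : Measurable c) (hc' : Measurable c')
    (h : ∀ᵐ t ∂volume.restrict (timeO T), (h1Curve c c' t).1.fst =ᵐ[volume] (fun y => c (t, y)) ∧
      (h1Curve c c' t).1.snd =ᵐ[volume] fun y => c' (t, y)) :
    AEStronglyMeasurable (h1Curve c c') (volume.restrict (timeO T)) := by
  refine aestronglyMeasurable_of_edist fun B => ?_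
  have hm : ∀ (u : ℝ × ℝ → ℝ) (f : Lp ℝ 2 (volume : Measure ℝ)), Measurable u →
      Measurable fun t => ∫⁻ y, ‖u (t, y) - f y‖ₑ ^ 2 := fun u f hu =>
    ((hu.sub ((Lp.stronglyMeasurable f).measurable.comp measurable_snd)).enorm.pow_const
      2).lintegral_prod_right'
  refine ⟨fun t => ((∫⁻ y, ‖c (t, y) - B.1.fst y‖ₑ ^ 2) +
    ∫⁻ y, ‖c' (t, y) - B.1.snd y‖ₑ ^ 2) ^ (1 / 2 : ℝ),
    ((hm c _ hc).add (hm c' _ hc')).pow_const _, ?_⟩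
  filter_upwards [h] with t ht
  rw [← enorm_sub_sq_H1 _ B ht.1 ht.2 (ae_eq_refl _) (ae_eq_refl _), edist_eq_enorm_sub,
    ← ENNReal.rpow_natCast, ← ENNReal.rpow_mul]
  norm_num

/-- A curve which is Hölder continuous at almost all times has a continuous representative. -/
theorem exists_continuousOn_h1Curve (hT : 0 < T) {A A' : ℝ≥0} {η η' : ℝ} (hη : 0 < η)
    (hη' : 0 < η')
    (h : ∀ᵐ t ∂volume.restrict (timeO T), (h1Curve c c' t).1.fst =ᵐ[volume] (fun y => c (t, y)) ∧
      (h1Curve c c' t).1.snd =ᵐ[volume] fun y => c' (t, y))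
    (h1 : ∀ᵐ t₁ ∂volume.restrict (timeO T), ∀ᵐ t₂ ∂volume.restrict (timeO T),
      ∫⁻ y, ‖c (t₂, y) - c (t₁, y)‖ₑ ^ 2 ≤ A * ENNReal.ofReal (|t₂ - t₁| ^ η))
    (h2 : ∀ᵐ t₁ ∂volume.restrict (timeO T), ∀ᵐ t₂ ∂volume.restrict (timeO T),
      ∫⁻ y, ‖c' (t₂, y) - c' (t₁, y)‖ₑ ^ 2 ≤ A' * ENNReal.ofReal (|t₂ - t₁| ^ η')) :
    ∃ B : ℝ → H1, ContinuousOn B (timeI T) ∧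
      ∀ᵐ t ∂volume.restrict (timeO T), B t = h1Curve c c' t := by
  refine exists_continuousOn_of_ae (d := fun t₁ t₂ => √(A * |t₂ - t₁| ^ η + A' * |t₂ - t₁| ^ η')) ?_
    (fun t ht => neBot_nhds_inf_ae (isOpen_timeO T) (timeI_subset_closure hT ht)) (fun t ht => ?_)
    ?_
  · filter_upwards [ae_restrict_mem (isOpen_timeO T).measurableSet] with t ht
    exact ⟨ht.1.le, ht.2⟩
  · have hc : Continuous fun p : ℝ × ℝ => √(A * |p.2 - p.1| ^ η + A' * |p.2 - p.1| ^ η') := by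
      have := hη.le
      have := hη'.le
      fun_prop (disch := assumption)
    have h3 := hc.tendsto (t, t)
    simp only [sub_self, abs_zero, Real.zero_rpow hη.ne', Real.zero_rpow hη'.ne',
      mul_zero, add_zero, Real.sqrt_zero] at h3
    rw [nhds_prod_eq] at h3
    exact h3.mono_left (Filter.prod_mono nhdsWithin_le_nhds nhdsWithin_le_nhds)
  · filter_upwards [h, h1, h2] with t₁ g0 g1 g2
    filter_upwards [h, g1, g2] with t₂ k0 k1 k2
    have h3 := enorm_sub_sq_H1 _ _ k0.1 k0.2 g0.1 g0.2
    rw [dist_comm, dist_eq_norm]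
    refine Real.le_sqrt_of_sq_le ?_
    have h4 : ‖h1Curve c c' t₂ - h1Curve c c' t₁‖ₑ ^ 2 ≤
        ENNReal.ofReal (A * |t₂ - t₁| ^ η + A' * |t₂ - t₁| ^ η') := by
      rw [h3, ENNReal.ofReal_add (by positivity) (by positivity),
        ENNReal.ofReal_mul (by positivity), ENNReal.ofReal_mul (by positivity),
        ENNReal.ofReal_coe_nnreal, ENNReal.ofReal_coe_nnreal]
      exact add_le_add k1 k2
    rwa [← ofReal_norm, ← ENNReal.ofReal_pow (norm_nonneg _),
      ENNReal.ofReal_le_ofReal_iff (by positivity)] at h4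

end Curves

section

open Polynomial

/-! ### Coefficients that are continuous in time -/

section ContinuousCoefficients

variable {T : ℝ≥0∞} {v : ℝ × ℝ × ℝ → ℝ} {N : ℕ} {g h : ℕ → ℕ → ℝ × ℝ × ℝ → ℝ} {kc : ℕ} {δ : ℝ}
  {M : ℝ≥0∞}

/-- The coefficients are Hölder continuous in time with values in `L²(ℝ)`, by interpolation between
the bound for `∂_t v` and the bound for the speed at which the averages converge: the scale `l` of
the average is adapted to the time difference. -/
theorem exists_holder_cfT {γ : ℝ} (hγ : γ ∈ roots) {b : ℕ} {ρ : ℝ} (hρ : γ + b < ρ)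
    (hlow : -1 - δ < γ + b) :
    ∃ (K : ℝ≥0) (η : ℝ), 0 < η ∧ ∀ (T : ℝ≥0∞) (v : ℝ × ℝ × ℝ → ℝ) (N : ℕ)
      (g h : ℕ → ℕ → ℝ × ℝ × ℝ → ℝ) (kc : ℕ) (M : ℝ≥0∞), Core T v N g h kc δ M → 6 + b ≤ kc + 4 →
      (∀ᵐ t ∂volume.restrict (timeO T), sN ρ (jet g symb b) t ≤ M) →
      ∀ᵐ t₁ ∂volume.restrict (timeO T), ∀ᵐ t₂ ∂volume.restrict (timeO T),
        ∫⁻ y, ‖cfT roots g b γ (t₂, y) - cfT roots g b γ (t₁, y)‖ₑ ^ 2 ≤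
          K * M * ENNReal.ofReal (|t₂ - t₁| ^ η) := by
  obtain ⟨K, hK⟩ := exists_cfT_bounds roots hγ b 0 hρ
  obtain ⟨K1, h1⟩ := exists_av_sq_le (γ + b) (-1 - δ)
  obtain ⟨K2, h2⟩ := exists_sN_dt (filt roots γ) b
  set p := filt roots γ with hp
  set e := p.eval γ with he
  have dp : p.natDegree ≤ 6 := by
    have := natDegree_filt hγ
    rw [card_roots, ← hp] at this
    omega
  have hpos : 0 < ρ + 1 + δ := by linarith
  set η : ℝ := (ρ - (γ + b)) / (ρ + 1 + δ) with hη
  refine ⟨8 * K + 2 * ‖e⁻¹‖₊ ^ 2 * K1 * K2, η, div_pos (sub_pos.2 hρ) hpos,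
    fun T v N g h kc M hC hb htop => ?_⟩
  have hJ := hC.jets
  have hN := hC.le_N
  have hM := hC.ne_top
  have hm := hJ.measurable_jet p b
  have a1 := ae_plN_sub_le hm (measurable_ev (fun n => hC.meas_dt n b) p)
    (hC.dtOp (by omega)) (-1 - δ)
  have a2 := h2 T v N g h kc δ M hC (by omega)
  have a3 := ae_wN_ne_top_of_sN (hJ.measurable_jet symb b) hM htop
  have a4 := ae_ae_of_timeO_prod (hK T v N g hJ (by omega) (by rw [card_roots]; omega))
  have a5 := ae_ae_of_timeO_prod (hJ.ae_jetX (b := b) (by omega))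
  have a6 : ∀ᵐ t ∂volume.restrict (timeO T), ∀ᵐ y,
      LocallyIntegrableOn (fun x => jet g p b (t, x, y)) (Ioi 0) := by
    filter_upwards [a5] with t ht
    filter_upwards [ht] with y hy
    have h3 := (hy.xd_filt (Γ := roots) (by rw [card_roots]; omega) hγ).1.locallyIntegrableOn
    rwa [ev_sl] at h3
  have hmean : ∀ᵐ t ∂volume.restrict (timeO T), ∀ l, 0 < l →
      ∫⁻ y, ‖e⁻¹ * avT (γ + b) l (jet g p b) (t, y) - cfT roots g b γ (t, y)‖ₑ ^ 2 ≤
        K * ENNReal.ofReal (l ^ (2 * (ρ - (γ + b)))) * M := by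
    filter_upwards [a3, a4, htop] with t g3 g4 g5 l hl
    calc _ ≤ ∫⁻ y, K * ENNReal.ofReal (l ^ (2 * (ρ - (γ + b)))) *
          wN (Ioi 0) ρ (fun x => jet g symb b (t, x, y)) := by
          refine lintegral_mono_ae ?_
          filter_upwards [g3, g4] with y k3 k4
          rw [full_roots] at k4
          exact (k4 k3).2 l hl
      _ = K * ENNReal.ofReal (l ^ (2 * (ρ - (γ + b)))) * sN ρ (jet g symb b) t := by
          rw [lintegral_const_mul' _ _ (by finiteness)]
          rfl
      _ ≤ _ := by gcongr
  filter_upwards [a1, a6, hmean] with t₁ g1 g2 g3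
  filter_upwards [g1, a6, hmean] with t₂ k1 k2 k3
  rcases eq_or_ne t₁ t₂ with rfl | hne
  · simp
  have hτ : 0 < |t₂ - t₁| := abs_pos.2 (sub_ne_zero.2 hne.symm)
  set τ := |t₂ - t₁| with hτdef
  set l : ℝ := τ ^ (1 / (2 * (ρ + 1 + δ))) with hl
  have hl0 : 0 < l := by positivity
  have e1 : l ^ (2 * (ρ - (γ + b))) = τ ^ η := by
    rw [hl, ← Real.rpow_mul hτ.le]
    congr 1
    rw [hη]
    field_simp
  have e2 : l ^ (2 * (-1 - δ - (γ + b))) * τ = τ ^ η := by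
    rw [hl, ← Real.rpow_mul hτ.le, ← Real.rpow_add_one hτ.ne']
    congr 1
    rw [hη]
    field_simp
    ring
  have hmav := measurable_avT hm (γ + b) hl0
  have hmc := hJ.measurable_cfT roots b γ
  set c := cfT roots g b γ with hc
  set A := fun z => e⁻¹ * avT (γ + b) l (jet g p b) z with hA
  have hmd : ∀ t, Measurable fun y => ‖A (t, y) - c (t, y)‖ₑ ^ 2 := fun t =>
    (((hmav.const_mul e⁻¹).sub hmc).comp measurable_prodMk_left).enorm.pow_const 2
  have hmd2 : Measurable fun y => 2 * (2 * ‖A (t₁, y) - c (t₁, y)‖ₑ ^ 2 +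
      2 * ‖A (t₂, y) - c (t₂, y)‖ₑ ^ 2) :=
    (((hmd t₁).const_mul 2).add ((hmd t₂).const_mul 2)).const_mul 2
  have hdiff : ∫⁻ y, ‖A (t₂, y) - A (t₁, y)‖ₑ ^ 2 ≤
      ‖e⁻¹‖ₑ ^ 2 * (K1 * (K2 * M) * ENNReal.ofReal (τ ^ η)) := by
    calc _ ≤ ∫⁻ y, ‖e⁻¹‖ₑ ^ 2 * (K1 * ENNReal.ofReal (l ^ (2 * (-1 - δ - (γ + b)))) *
          wN (Ioi 0) (-1 - δ) fun x => jet g p b (t₂, x, y) - jet g p b (t₁, x, y)) := by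
          refine lintegral_mono_ae ?_
          filter_upwards [g2, k2] with y q1 q2
          have i : ∀ t, LocallyIntegrableOn (fun x => jet g p b (t, x, y)) (Ioi 0) →
              Integrable fun x => avKer (γ + b) l x * jet g p b (t, x, y) := fun t ht => by
            simpa only [mul_comm] using (isTest_avKer (γ + b) hl0).integrable_mul ht
          have h3 : avT (γ + b) l (jet g p b) (t₂, y) - avT (γ + b) l (jet g p b) (t₁, y) =
              av (γ + b) l fun x => jet g p b (t₂, x, y) - jet g p b (t₁, x, y) := by
            rw [avT, avT, av, av, av, ← integral_sub (i t₂ q2) (i t₁ q1)]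
            simp only [mul_sub]
          simp only [hA]
          rw [← mul_sub, enorm_mul, mul_pow, h3]
          gcongr
          exact h1 l hl0 _ ((hm.comp (by fun_prop)).sub (hm.comp (by fun_prop))).aemeasurable
      _ = ‖e⁻¹‖ₑ ^ 2 * (K1 * ENNReal.ofReal (l ^ (2 * (-1 - δ - (γ + b)))) *
          plN (-1 - δ) fun q => jet g p b (t₂, q) - jet g p b (t₁, q)) := by
          rw [lintegral_const_mul' _ _ (by finiteness), lintegral_const_mul' _ _ (by finiteness)]
          rfl
      _ ≤ ‖e⁻¹‖ₑ ^ 2 * (K1 * ENNReal.ofReal (l ^ (2 * (-1 - δ - (γ + b)))) *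
          (ENNReal.ofReal τ * (K2 * M))) := by
          gcongr
          exact k1.trans (mul_le_mul_right a2 _)
      _ = ‖e⁻¹‖ₑ ^ 2 * (K1 * (K2 * M) * (ENNReal.ofReal (l ^ (2 * (-1 - δ - (γ + b)))) *
          ENNReal.ofReal τ)) := by ring
      _ = _ := by rw [← ENNReal.ofReal_mul (by positivity), e2]
  calc ∫⁻ y, ‖c (t₂, y) - c (t₁, y)‖ₑ ^ 2
      ≤ ∫⁻ y, (2 * (2 * ‖A (t₁, y) - c (t₁, y)‖ₑ ^ 2 + 2 * ‖A (t₂, y) - c (t₂, y)‖ₑ ^ 2) +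
          2 * ‖A (t₂, y) - A (t₁, y)‖ₑ ^ 2) := by
        refine lintegral_mono fun y => ?_
        have h3 : c (t₂, y) - c (t₁, y) = ((A (t₁, y) - c (t₁, y)) + -(A (t₂, y) - c (t₂, y))) +
          (A (t₂, y) - A (t₁, y)) := by ring
        rw [h3]
        refine (enorm_add_sq_le _ _).trans ?_
        gcongr
        refine (enorm_add_sq_le _ _).trans ?_
        rw [enorm_neg]
    _ = 2 * (2 * (∫⁻ y, ‖A (t₁, y) - c (t₁, y)‖ₑ ^ 2) + 2 * ∫⁻ y, ‖A (t₂, y) - c (t₂, y)‖ₑ ^ 2) +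
          2 * ∫⁻ y, ‖A (t₂, y) - A (t₁, y)‖ₑ ^ 2 := by
        rw [lintegral_add_left hmd2,
          lintegral_const_mul' _ _ (by simp), lintegral_const_mul' _ _ (by simp),
          lintegral_add_left ((hmd t₁).const_mul 2), lintegral_const_mul' _ _ (by simp),
          lintegral_const_mul' _ _ (by simp)]
    _ ≤ 2 * (2 * (K * ENNReal.ofReal (τ ^ η) * M) + 2 * (K * ENNReal.ofReal (τ ^ η) * M)) +
          2 * (‖e⁻¹‖ₑ ^ 2 * (K1 * (K2 * M) * ENNReal.ofReal (τ ^ η))) := by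
        rw [← e1] at hdiff ⊢
        gcongr
        · exact g3 l hl0
        · exact k3 l hl0
    _ = _ := by
        push_cast
        change _ = (8 * (K : ℝ≥0∞) + 2 * ‖e⁻¹‖ₑ ^ 2 * K1 * K2) * M * ENNReal.ofReal (τ ^ η)
        ring

/-- The coefficients are bounded in time with values in `L²(ℝ)`. -/
theorem exists_ae_lintegral_cfT_sq_le {γ : ℝ} (hγ : γ ∈ roots) {b : ℕ} {ρ : ℝ} (hρ : γ + b < ρ) :
    ∃ K : ℝ≥0, ∀ (T : ℝ≥0∞) (v : ℝ × ℝ × ℝ → ℝ) (N : ℕ) (g h : ℕ → ℕ → ℝ × ℝ × ℝ → ℝ) (kc : ℕ)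
      (M : ℝ≥0∞), Core T v N g h kc δ M → 6 + b ≤ kc + 4 →
      (∀ᵐ t ∂volume.restrict (timeO T), sN ρ (jet g symb b) t ≤ M) →
      ∀ᵐ t ∂volume.restrict (timeO T), ∫⁻ y, ‖cfT roots g b γ (t, y)‖ₑ ^ 2 ≤ K * M := by
  obtain ⟨K, hK⟩ := exists_cfT_bounds roots hγ b (-(1 / 2) - δ) hρ
  obtain ⟨K1, h1⟩ := exists_sN_low (filt roots γ) b
  refine ⟨K * (K1 + 1), fun T v N g h kc M hC hb htop => ?_⟩
  have hJ := hC.jets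
  have hN := hC.le_N
  have dp := natDegree_filt hγ
  rw [card_roots] at dp
  filter_upwards [ae_wN_ne_top_of_sN (hJ.measurable_jet symb b) hC.ne_top htop, htop,
    ae_ae_of_timeO_prod (hK T v N g hJ (by omega) (by rw [card_roots]; omega)),
    h1 T v N g h kc δ M hC (by omega)] with t a1 a2 a3 a4
  calc _ ≤ ∫⁻ y, K * (wN (Ioi 0) (-(1 / 2) - δ) (fun x => jet g (filt roots γ) b (t, x, y)) +
        wN (Ioi 0) ρ fun x => jet g symb b (t, x, y)) := by
        refine lintegral_mono_ae ?_
        filter_upwards [a1, a3] with y k1 k3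
        rw [full_roots] at k3
        exact (k3 k1).1
    _ = K * (sN (-(1 / 2) - δ) (jet g (filt roots γ) b) t + sN ρ (jet g symb b) t) := by
        rw [lintegral_const_mul' _ _ (by finiteness), lintegral_add_left (measurable_wN_line
          (w := fun q => jet g (filt roots γ) b (t, q))
          ((hJ.measurable_jet _ b).comp measurable_prodMk_left) _)]
        rfl
    _ ≤ K * (K1 * M + M) := by gcongr
    _ = _ := by
        push_cast
        ring

theorem enorm_le_of_sq_le {a M : ℝ≥0∞} {K : ℝ≥0} (h : a ^ 2 ≤ K * M) :
    a ≤ (K ^ (1 / 2 : ℝ) : ℝ≥0) * M ^ (1 / 2 : ℝ) := by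
  have h1 := ENNReal.rpow_le_rpow h (by norm_num : (0 : ℝ) ≤ 1 / 2)
  rw [← ENNReal.rpow_natCast, ← ENNReal.rpow_mul,
    ENNReal.mul_rpow_of_nonneg _ _ (by norm_num)] at h1
  rw [ENNReal.coe_rpow_of_nonneg _ (by norm_num)]
  simpa using h1

/-- The coefficients of `x^γ` and their derivatives in `y` form a bounded continuous curve
in `H¹(ℝ)`. -/
theorem exists_h1Curve {γ : ℝ} (hγ : γ ∈ roots) {b : ℕ} {ρ ρ' : ℝ} (hρ : γ + b < ρ)
    (hρ' : γ + (b + 1 : ℕ) < ρ') (hlow : -1 - δ < γ + b) :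
    ∃ K : ℝ≥0, ∀ (T : ℝ≥0∞) (v : ℝ × ℝ × ℝ → ℝ) (N : ℕ) (g h : ℕ → ℕ → ℝ × ℝ × ℝ → ℝ) (kc : ℕ)
      (M : ℝ≥0∞), Core T v N g h kc δ M → 0 < T → 6 + (b + 1) ≤ kc + 4 →
      (∀ᵐ t ∂volume.restrict (timeO T), sN ρ (jet g symb b) t ≤ M) →
      (∀ᵐ t ∂volume.restrict (timeO T), sN ρ' (jet g symb (b + 1)) t ≤ M) →
      (∀ᵐ t ∂volume.restrict (timeO T), WeakD univ (fun y => cfT roots g b γ (t, y))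
        fun y => cfT roots g (b + 1) γ (t, y)) →
      ∃ B : ℝ → H1, ContinuousOn B (timeI T) ∧ (∀ t ∈ timeI T, ‖B t‖ₑ ≤ K * M ^ (1 / 2 : ℝ)) ∧
        ∀ᵐ t ∂volume.restrict (timeO T),
          (B t).1.fst =ᵐ[volume] (fun y => cfT roots g b γ (t, y)) ∧
          (B t).1.snd =ᵐ[volume] fun y => cfT roots g (b + 1) γ (t, y) := by
  obtain ⟨K0, h0⟩ := exists_ae_lintegral_cfT_sq_le (δ := δ) hγ hρ
  obtain ⟨K1, h1⟩ := exists_ae_lintegral_cfT_sq_le (δ := δ) hγ hρ'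
  obtain ⟨K2, η, hη, h2⟩ := exists_holder_cfT hγ hρ hlow
  obtain ⟨K3, η', hη', h3⟩ := exists_holder_cfT (δ := δ) hγ hρ' (by push_cast; linarith)
  refine ⟨(K0 + K1) ^ (1 / 2 : ℝ), fun T v N g h kc M hC hT hb t0 t1 hd => ?_⟩
  have hJ := hC.jets
  have hM := hC.ne_top
  have a0 := h0 T v N g h kc M hC (by omega) t0
  have a1 := h1 T v N g h kc M hC (by omega) t1
  have hae := ae_h1Curve (hJ.measurable_cfT roots b γ) (hJ.measurable_cfT roots (b + 1) γ)
    (a0.mono fun t ht => ne_top_of_le_ne_top (by finiteness) ht)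
    (a1.mono fun t ht => ne_top_of_le_ne_top (by finiteness) ht) hd
  have hfin : ∀ K : ℝ≥0, (K * M : ℝ≥0∞) = ((K * M).toNNReal : ℝ≥0∞) := fun K =>
    (ENNReal.coe_toNNReal (by finiteness)).symm
  have a2 := h2 T v N g h kc M hC (by omega) t0
  have a3 := h3 T v N g h kc M hC hb t1
  rw [hfin] at a2 a3
  obtain ⟨B, hBc, hB⟩ := exists_continuousOn_h1Curve hT hη hη' hae a2 a3
  refine ⟨B, hBc, ?_, ?_⟩
  · refine forall_enorm_le_of_ae (ν := volume.restrict (timeO T)) ?_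
      (fun t ht => neBot_nhds_inf_ae (isOpen_timeO T) (timeI_subset_closure hT ht)) hBc ?_
    · filter_upwards [ae_restrict_mem (isOpen_timeO T).measurableSet] with t ht
      exact ⟨ht.1.le, ht.2⟩
    · filter_upwards [hB, hae, a0, a1] with t g1 g2 g3 g4
      have h5 : ‖B t‖ₑ ^ 2 ≤ (K0 + K1 : ℝ≥0) * M := by
        rw [g1, enorm_sq_H1_of_ae _ g2.1 g2.2, ENNReal.coe_add, add_mul]
        exact add_le_add g3 g4
      exact enorm_le_of_sq_le h5
  · filter_upwards [hB, hae] with t g1 g2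
    rwa [g1]

end ContinuousCoefficients

end

section

open Polynomial

/-! ### From the norms to the hypotheses on the derivatives -/

section Setup

variable {T : ℝ≥0∞} {v : ℝ × ℝ × ℝ → ℝ}

open Classical in
/-- A measurable representative of the distribution with transpose operator `A`; it is `0` if this
distribution is not a locally integrable function. -/
def rep {E : Type} [NormedAddCommGroup E] [NormedSpace ℝ E] [MeasureSpace E] {U : Set E}
    (A : Module.End ℝ (testSpace U)) (v : E → ℝ) : E → ℝ :=
  if h : ∃ w, Measurable w ∧ WeakOp U A v w then h.choose else 0

section Rep

variable {E : Type} [NormedAddCommGroup E] [NormedSpace ℝ E] [MeasureSpace E] {U : Set E}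
  {A : Module.End ℝ (testSpace U)} {v : E → ℝ}

theorem measurable_rep : Measurable (rep A v) := by
  rw [rep]
  split_ifs with h
  · exact h.choose_spec.1
  · exact measurable_const

theorem weakOp_rep [BorelSpace E] [SecondCountableTopology E] (hU : IsOpen U)
    (h : ∃ w, WeakOp U A v w) : WeakOp U A v (rep A v) := by
  have h1 : ∃ w, Measurable w ∧ WeakOp U A v w := by
    obtain ⟨w, hw⟩ := h
    exact hw.exists_measurable hU
  rw [rep, dif_pos h1]
  exact h1.choose_spec.2

end Rep

/-- The representative of `D_y^b D_x^n v`. -/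
def gT (T : ℝ≥0∞) (v : ℝ × ℝ × ℝ → ℝ) (n b : ℕ) : ℝ × ℝ × ℝ → ℝ :=
  rep (opEnd (spaceTime T) (X ^ n) b) v

/-- The representative of `∂_t D_y^b D_x^n v`. -/
def hT (T : ℝ≥0∞) (v : ℝ × ℝ × ℝ → ℝ) (n b : ℕ) : ℝ × ℝ × ℝ → ℝ :=
  rep (opEnd (spaceTime T) (X ^ n) b * dtEnd T) v

theorem measurable_jet_gT (p : ℝ[X]) (b : ℕ) : Measurable (jet (gT T v) p b) :=
  measurable_ev (fun _ => measurable_rep) p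

theorem weakOp_jet_gT {b L : ℕ}
    (h : ∀ n ≤ L, ∃ w, WeakOp (spaceTime T).dom (opEnd (spaceTime T) (X ^ n) b) v w) {p : ℝ[X]}
    (hp : p.natDegree ≤ L) :
    WeakOp (spaceTime T).dom (opEnd (spaceTime T) p b) v (jet (gT T v) p b) :=
  WeakOp.ev (spaceTime T) (fun n hn => weakOp_rep isOpen_dom (h n hn)) hp

theorem opPoly_zero_one (n : ℕ) : opPoly 0 1 n = X ^ n := by
  rw [opPoly, Nat.cast_zero, map_zero, add_zero, one_mul]

theorem opPoly_zero (P : ℝ[X]) (n : ℕ) : opPoly 0 P n = P * X ^ n := by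
  rw [opPoly, Nat.cast_zero, map_zero, add_zero]

theorem exists_weakOp_X_pow {κ : ℕ} {α : ℝ} (h : intNormSq T 0 1 κ α v < ⊤) {n b : ℕ}
    (hnb : n + b ≤ κ) : ∃ w, WeakOp (spaceTime T).dom (opEnd (spaceTime T) (X ^ n) b) v w := by
  have h1 := exists_of_intNormSq_lt_top h hnb
  rwa [opPoly_zero_one] at h1

/-- The derivatives of highest order exist since `P(D_x) v` has the remaining ones, where `P` is
monic of degree `7`. -/
theorem jets_gT {P : ℝ[X]} (hP : P.Monic) (hdeg : P.natDegree = 7) {κ N : ℕ} (hκ : N + 6 ≤ κ)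
    {α α' : ℝ} (h0 : intNormSq T 0 1 κ α v < ⊤) (h1 : intNormSq T 0 P N α' v < ⊤) :
    Jets T v N (gT T v) := by
  refine ⟨fun _ _ => measurable_rep, fun n b hnb hb => weakOp_rep isOpen_dom ?_⟩
  rcases Nat.lt_or_ge (n + b) (N + 7) with hlt | hge
  · exact exists_weakOp_X_pow h0 (by omega)
  obtain ⟨a, rfl⟩ : ∃ a, n = 7 + a := ⟨n - 7, by omega⟩
  obtain ⟨w, hw⟩ := exists_of_intNormSq_lt_top h1 (show a + b ≤ N by omega)
  have hq : (P * X ^ a).Monic := hP.mul (monic_X_pow a)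
  have hqd : (P * X ^ a).natDegree = 7 + a := by
    rw [hP.natDegree_mul (monic_X_pow a), natDegree_X_pow, hdeg]
  rw [opPoly_zero] at hw
  have h2 := weakOp_jet_gT (p := (P * X ^ a).eraseLead) (b := b) (L := 6 + a)
    (fun n hn => exists_weakOp_X_pow h0 (by omega))
    ((eraseLead_natDegree_le _).trans (by omega))
  have h3 := WeakOp.sum Finset.univ ![1, -1] (A := ![opEnd (spaceTime T) (P * X ^ a) b,
    opEnd (spaceTime T) (P * X ^ a).eraseLead b]) (g := ![w, jet (gT T v) (P * X ^ a).eraseLead b])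
    hw.1 (fun i _ => by fin_cases i; exacts [hw, h2])
  simp only [Fin.sum_univ_two, Matrix.cons_val_zero, Matrix.cons_val_one] at h3
  have e : (1 : ℝ) • opEnd (spaceTime T) (P * X ^ a) b +
      (-1 : ℝ) • opEnd (spaceTime T) (P * X ^ a).eraseLead b =
      opEnd (spaceTime T) (X ^ (7 + a)) b := by
    have h4 := eraseLead_add_monomial_natDegree_leadingCoeff (P * X ^ a)
    rw [hq.leadingCoeff, hqd, monomial_one_right_eq_X_pow] at h4
    have h5 : (X : ℝ[X]) ^ (7 + a) = P * X ^ a - (P * X ^ a).eraseLead := by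
      linear_combination h4
    rw [h5, opEnd, opEnd, opEnd, ← smul_mul_assoc, ← smul_mul_assoc, ← map_smul, ← map_smul,
      ← add_mul, ← map_add, one_smul, neg_one_smul, ← sub_eq_add_neg]
  rw [e] at h3
  exact ⟨_, h3⟩

section Extract

variable {m : ℕ} {P : ℝ[X]} {κ : ℕ} {α : ℝ} {a b : ℕ} {w : ℝ × ℝ × ℝ → ℝ}

theorem lintegral_sN_le (hm : Measurable w)
    (hw : WeakOp (spaceTime T).dom (opEnd (spaceTime T) (opPoly m P a) (b + m)) v w)
    (hl : a + b ≤ κ) : ∫⁻ t in timeO T, sN (α + 1 / 2) w t ≤ intNormSq T m P κ α v := by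
  have h := lintegral_weightSq_le_intNormSq (α := α) hl hw
  rw [restrict_timeO] at h
  simpa only [weightSq_eq_sN hm] using h

theorem lintegral_sN_dt_le (hm : Measurable w)
    (hw : WeakOp (spaceTime T).dom (dtEnd T * opEnd (spaceTime T) (opPoly m P a) (b + m)) v w)
    (hl : a + b ≤ κ) : ∫⁻ t in timeO T, sN (α + 1 / 2) w t ≤ intNormDtSq T m P κ α v := by
  have h := lintegral_weightSq_le_intNormDtSq (α := α) hl hw
  rw [restrict_timeO] at h
  simpa only [weightSq_eq_sN hm] using h

theorem ae_sN_le (hm : Measurable w)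
    (hw : WeakOp (spaceTime T).dom (opEnd (spaceTime T) (opPoly m P a) (b + m)) v w)
    (hl : a + b ≤ κ) :
    ∀ᵐ t ∂volume.restrict (timeO T), sN (α + 1 / 2) w t ≤ supNormSq T m P κ α v := by
  have h := ae_weightSq_le_supNormSq (α := α) hl hw
  rw [restrict_timeO] at h
  simpa only [weightSq_eq_sN hm] using h

end Extract

theorem ev_jet_opPoly (g : ℕ → ℕ → ℝ × ℝ × ℝ → ℝ) (m : ℕ) (P p : ℝ[X]) (b : ℕ) :
    ev (fun a => jet g (opPoly m P a) b) p = jet g (P * p.comp (X + C (m : ℝ))) b := by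
  rw [ev_eq_sum _ p (Nat.lt_succ_self _)]
  conv_rhs => rw [p.as_sum_range_C_mul_X_pow, ← coe_compRingHom_apply, map_sum, Finset.mul_sum, jet,
    map_sum]
  refine Finset.sum_congr rfl fun n _ => ?_
  rw [coe_compRingHom_apply, mul_comp, C_comp, X_pow_comp, mul_left_comm, C_mul', map_smul]
  rfl

/-- The norm of `D_y^m P(D_x) v` controls `D_y^(b+m) p(D_x + m) P(D_x) v`. -/
theorem exists_lintegral_sN_opPoly_le (m : ℕ) (P p : ℝ[X]) (b : ℕ) : ∃ K : ℝ≥0, ∀ (T : ℝ≥0∞)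
    (v : ℝ × ℝ × ℝ → ℝ) (κ : ℕ) (α : ℝ),
    (∀ n ≤ P.natDegree + p.natDegree,
      ∃ w, WeakOp (spaceTime T).dom (opEnd (spaceTime T) (X ^ n) (b + m)) v w) →
    p.natDegree + b ≤ κ →
    ∫⁻ t in timeO T, sN (α + 1 / 2) (jet (gT T v) (P * p.comp (X + C (m : ℝ))) (b + m)) t ≤
      K * intNormSq T m P κ α v := by
  obtain ⟨K, hK⟩ := exists_lintegral_sN_ev_le p
  refine ⟨K, fun T v κ α hex hκ => ?_⟩
  rw [← ev_jet_opPoly]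
  refine hK T _ _ _ (fun n => measurable_jet_gT _ _) fun n hn => lintegral_sN_le
    (measurable_jet_gT _ _) (weakOp_jet_gT hex ?_) (by omega)
  refine natDegree_mul_le.trans (add_le_add_right ?_ _)
  rwa [natDegree_pow, natDegree_X_add_C, mul_one]

theorem exists_ae_sN_opPoly_le (m : ℕ) (P p : ℝ[X]) (b : ℕ) : ∃ K : ℝ≥0, ∀ (T : ℝ≥0∞)
    (v : ℝ × ℝ × ℝ → ℝ) (κ : ℕ) (α : ℝ),
    (∀ n ≤ P.natDegree + p.natDegree,
      ∃ w, WeakOp (spaceTime T).dom (opEnd (spaceTime T) (X ^ n) (b + m)) v w) →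
    p.natDegree + b ≤ κ → ∀ᵐ t ∂volume.restrict (timeO T),
      sN (α + 1 / 2) (jet (gT T v) (P * p.comp (X + C (m : ℝ))) (b + m)) t ≤
        K * supNormSq T m P κ α v := by
  obtain ⟨K, hK⟩ := exists_ae_sN_ev_le p
  refine ⟨K, fun T v κ α hex hκ => ?_⟩
  rw [← ev_jet_opPoly]
  refine hK T _ _ _ (fun n => measurable_jet_gT _ _) fun n hn => ae_sN_le
    (measurable_jet_gT _ _) (weakOp_jet_gT hex ?_) (by omega)
  refine natDegree_mul_le.trans (add_le_add_right ?_ _)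
  rwa [natDegree_pow, natDegree_X_add_C, mul_one]

theorem exists_lintegral_sN_jet_le (p : ℝ[X]) (b : ℕ) : ∃ K : ℝ≥0, ∀ (T : ℝ≥0∞)
    (v : ℝ × ℝ × ℝ → ℝ) (κ : ℕ) (α : ℝ), intNormSq T 0 1 κ α v < ⊤ → p.natDegree + b ≤ κ →
    ∫⁻ t in timeO T, sN (α + 1 / 2) (jet (gT T v) p b) t ≤ K * intNormSq T 0 1 κ α v := by
  obtain ⟨K, hK⟩ := exists_lintegral_sN_opPoly_le 0 1 p b
  refine ⟨K, fun T v κ α h hκ => ?_⟩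
  have h1 := hK T v κ α (fun n hn => exists_weakOp_X_pow h
    (by rw [natDegree_one] at hn; omega)) hκ
  simpa using h1

theorem lintegral_sN_full_le {Γ : Finset ℝ} (hΓ : Γ.card = 7) {N : ℕ} (hJ : Jets T v N (gT T v))
    (ρ : ℝ) {j b : ℕ} (hjb : j + b ≤ N) :
    ∫⁻ t in timeO T, sN ρ (jet (gT T v) (full Γ * X ^ j) b) t ≤
      intNormSq T 0 (full Γ) N (ρ - 1 / 2) v := by
  have hdeg : (full Γ).natDegree = 7 := by rw [full, Lagrange.natDegree_nodal, hΓ]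
  have hw := hJ.weakOp (p := full Γ * X ^ j) (b := b)
    (by
      have := natDegree_mul_le (p := full Γ) (q := X ^ j)
      rw [natDegree_X_pow] at this
      omega) (by omega)
  rw [← opPoly_zero] at hw ⊢
  have h3 := lintegral_sN_le (α := ρ - 1 / 2) (measurable_jet_gT _ _) hw hjb
  rwa [sub_add_cancel] at h3

/-- Three finite norms suffice for the expansion: one of `v`, one of `full Γ (D_x) v`, and one of
`(D_x - s) v`, by which the roots in `Bad` are excluded. -/
theorem expData_gT {Γ Bad : Finset ℝ} (hΓ : Γ.card = 7) {ρ₀ ρ₁ ρ s : ℝ} {κ₀ κ₁ N : ℕ}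
    (hκ₀ : N + 6 ≤ κ₀) (hκ₁ : 1 ≤ κ₁)
    (h0 : intNormSq T 0 1 κ₀ (ρ₀ - 1 / 2) v < ⊤)
    (h1 : intNormSq T 0 (X - C s) κ₁ (ρ₁ - 1 / 2) v < ⊤)
    (h2 : intNormSq T 0 (full Γ) N (ρ - 1 / 2) v < ⊤)
    (hne : ∀ γ ∈ Γ, ∀ b : ℕ, γ + b ≠ ρ) (hle₀ : ρ₀ ≤ ρ) (hle₁ : ρ₁ ≤ ρ) (hpos : -1 < 2 * ρ)
    (hbad : ∀ γ ∈ Bad, γ ∈ Γ ∧ γ < ρ₁ ∧ γ ≠ s ∧ ∃ c, γ ≠ c ∧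
      ∀ γ' ∈ Γ, γ' ≠ γ → γ' ≤ ρ₁ → γ' = s ∨ γ' = c) :
    ExpData T v N (gT T v) Γ Bad ρ₀ ρ₁ ρ := by
  have hmon : (full Γ).Monic := Lagrange.nodal_monic
  have hdeg : (full Γ).natDegree = 7 := by rw [full, Lagrange.natDegree_nodal, hΓ]
  have hJ := jets_gT hmon hdeg hκ₀ h0 h2
  refine ⟨hJ, hΓ, hne, hle₀, hle₁, hpos, fun j b hjb => ?_, fun γ hγ b hb => ?_, fun γ hγ => ?_⟩
  · exact ne_top_of_le_ne_top h2.ne (lintegral_sN_full_le hΓ hJ ρ hjb)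
  · obtain ⟨K, hK⟩ := exists_lintegral_sN_jet_le (filt Γ γ) b
    have dp := natDegree_filt hγ
    have h3 := hK T v κ₀ _ h0 (by omega)
    rw [sub_add_cancel] at h3
    exact ne_top_of_le_ne_top (ENNReal.mul_ne_top ENNReal.coe_ne_top h0.ne) h3
  · obtain ⟨g1, g2, g3, c, g4, g5⟩ := hbad γ hγ
    obtain ⟨K, hK⟩ := exists_lintegral_sN_opPoly_le 0 (X - C s) (X - C c) 0
    refine ⟨g1, g2, (X - C s) * (X - C c), ?_, ?_, fun γ' k1 k2 k3 => ?_, ?_⟩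
    · refine natDegree_mul_le.trans ?_
      rw [natDegree_X_sub_C, natDegree_X_sub_C]
      norm_num
    · simp only [eval_mul, eval_sub, eval_X, eval_C]
      exact mul_ne_zero (sub_ne_zero.2 g3) (sub_ne_zero.2 g4)
    · simp only [eval_mul, eval_sub, eval_X, eval_C]
      rcases g5 γ' k1 k2 k3 with rfl | rfl <;> simp
    · have h3 := hK T v κ₁ (ρ₁ - 1 / 2) (fun n hn => exists_weakOp_X_pow h0 (by
        rw [natDegree_X_sub_C, natDegree_X_sub_C] at hn
        omega)) (by rw [natDegree_X_sub_C]; omega)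
      rw [sub_add_cancel] at h3
      refine ne_top_of_le_ne_top (ENNReal.mul_ne_top (ENNReal.coe_ne_top (r := K)) h1.ne) ?_
      simpa using h3

theorem symb_eq : symb = qt * X * ((X - C 4) * (X - C 3) : ℝ[X]).comp (X + C ((1 : ℕ) : ℝ)) := by
  have h : ((X - C 4) * (X - C 3) : ℝ[X]).comp (X + C ((1 : ℕ) : ℝ)) = (X - C 3) * (X - C 2) := by
    simp only [mul_comp, sub_comp, X_comp, C_comp, Nat.cast_one]
    rw [show (4 : ℝ) = 3 + 1 by norm_num, show (3 : ℝ) = 2 + 1 by norm_num]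
    simp only [map_add]
    ring
  rw [h, symb]
  ring

theorem natDegree_symb : symb.natDegree = 7 := by
  rw [← full_roots, full, Lagrange.natDegree_nodal, card_roots]

theorem natDegree_qt_mul_X_le : (qt * X).natDegree ≤ 5 := by
  have h : qt.natDegree ≤ 4 := by
    rw [qt]
    compute_degree
  refine natDegree_mul_le.trans ?_
  rw [natDegree_X]
  omega

/-- Control over `D_y^b (D_x - 3)(D_x - 2) q̃(D_x) D_x v` by the last summand of the norms. -/
theorem exists_lintegral_sN_symb_le (b : ℕ) : ∃ K : ℝ≥0, ∀ (T : ℝ≥0∞) (v : ℝ × ℝ × ℝ → ℝ) (κ : ℕ)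
    (α : ℝ), (∀ n ≤ 7, ∃ w, WeakOp (spaceTime T).dom (opEnd (spaceTime T) (X ^ n) (b + 1)) v w) →
    2 + b ≤ κ → ∫⁻ t in timeO T, sN (α + 1 / 2) (jet (gT T v) symb (b + 1)) t ≤
      K * intNormSq T 1 (qt * X) κ α v := by
  obtain ⟨K, hK⟩ := exists_lintegral_sN_opPoly_le 1 (qt * X) ((X - C 4) * (X - C 3)) b
  have h1 := natDegree_qt_mul_X_le
  have h2 : ((X - C 4) * (X - C 3) : ℝ[X]).natDegree ≤ 2 := by compute_degree
  refine ⟨K, fun T v κ α hex hκ => ?_⟩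
  rw [symb_eq]
  exact hK T v κ α (fun n hn => hex n (by omega)) (by omega)

theorem exists_ae_sN_symb_le (b : ℕ) : ∃ K : ℝ≥0, ∀ (T : ℝ≥0∞) (v : ℝ × ℝ × ℝ → ℝ) (κ : ℕ)
    (α : ℝ), (∀ n ≤ 7, ∃ w, WeakOp (spaceTime T).dom (opEnd (spaceTime T) (X ^ n) (b + 1)) v w) →
    2 + b ≤ κ → ∀ᵐ t ∂volume.restrict (timeO T),
      sN (α + 1 / 2) (jet (gT T v) symb (b + 1)) t ≤ K * supNormSq T 1 (qt * X) κ α v := by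
  obtain ⟨K, hK⟩ := exists_ae_sN_opPoly_le 1 (qt * X) ((X - C 4) * (X - C 3)) b
  have h1 := natDegree_qt_mul_X_le
  have h2 : ((X - C 4) * (X - C 3) : ℝ[X]).natDegree ≤ 2 := by compute_degree
  refine ⟨K, fun T v κ α hex hκ => ?_⟩
  rw [symb_eq]
  exact hK T v κ α (fun n hn => hex n (by omega)) (by omega)

end Setup

end

section

open Polynomial

section CoreSetup

variable {T : ℝ≥0∞} {v : ℝ × ℝ × ℝ → ℝ} {N : ℕ} {kc : ℕ} {δ : ℝ}

/-- The hypotheses `Core` used for all the bounds, with a multiple of the norm as constant. Only the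
terms of the norm with the weights `-δ - 1`, `δ + 1` and `-δ + 2` enter the constant. -/
theorem exists_core_gT (hδ : 0 < δ) (hδ' : δ < 1 / 10) : ∃ K : ℝ≥0, ∀ (T : ℝ≥0∞)
    (v : ℝ × ℝ × ℝ → ℝ) (k kc kb N κ₀ κ' : ℕ) (ρ₀ ρ₁ ρ ρ' : ℝ) (S : ℝ≥0∞), 4 ≤ kc → kc ≤ N →
    kc + 6 ≤ k → 4 ≤ kb → kc + 6 ≤ κ₀ → 3 ≤ κ' → 3 / 2 + δ ≤ ρ → 2 < ρ' →
    ExpData T v N (gT T v) roots badRoots ρ₀ ρ₁ ρ → intNormSq T 0 1 κ₀ (ρ₀ - 1 / 2) v < ⊤ →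
    intNormSq T 1 (qt * X) κ' (ρ' - 1 / 2) v < ⊤ → supNormSq T 0 1 k (-δ - 1) v ≤ S →
    intNormDtSq T 0 1 (k - 2) (-δ - 1 - 1 / 2) v ≤ S → supNormSq T 0 symb kc (δ + 1) v ≤ S →
    supNormSq T 1 (qt * X) kb (-δ + 2) v ≤ S → S ≠ ⊤ →
    Core T v N (gT T v) (hT T v) kc δ (K * S) := by
  obtain ⟨K1, hK1⟩ := exists_ae_sN_symb_le 0
  obtain ⟨K2, hK2⟩ := exists_ae_sN_symb_le 1
  refine ⟨1 + K1 + K2, fun T v k kc kb N κ₀ κ' ρ₀ ρ₁ ρ ρ' S hkc hN hk hkb hκ₀ hκ' hρ hρ' hE i0 i1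
    s0 sd s1 s2 hS => ?_⟩
  have hJ := hE.jets
  have hex : ∀ n b, n + b ≤ kc + 6 →
      ∃ w, WeakOp (spaceTime T).dom (opEnd (spaceTime T) (X ^ n) b) v w := fun n b h =>
    exists_weakOp_X_pow i0 (by omega)
  have hle : ∀ L : ℝ≥0, L ≤ 1 + K1 + K2 → ∀ a : ℝ≥0∞, a ≤ L * S →
      a ≤ (1 + K1 + K2 : ℝ≥0) * S := fun L hL a ha => ha.trans (by gcongr)
  have hle1 : ∀ a : ℝ≥0∞, a ≤ S → a ≤ (1 + K1 + K2 : ℝ≥0) * S := fun a ha =>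
    hle 1 (by rw [add_assoc]; exact le_self_add) a (by simpa using ha)
  have hdt : ∀ n b, n + b ≤ kc + 4 → WeakOp (spaceTime T).dom
      (opEnd (spaceTime T) (X ^ n) b * dtEnd T) v (hT T v n b) := by
    intro n b h
    have h1 := exists_of_intNormDtSq_lt_top (sd.trans_lt hS.lt_top)
      (show n + b ≤ k - 2 by omega)
    rw [opPoly_zero_one, dtEnd_mul_opEnd] at h1
    exact weakOp_rep isOpen_dom h1
  have hsymb : ∀ b, b + 1 ≤ 2 →
      ∫⁻ t in timeO T, sN ρ' (jet (gT T v) (full roots) (b + 1)) t ≠ ⊤ := by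
    intro b hb
    obtain ⟨K, hK⟩ := exists_lintegral_sN_symb_le b
    have h1 := hK T v κ' (ρ' - 1 / 2) (fun n hn => hex n (b + 1) (by omega)) (by omega)
    rw [sub_add_cancel] at h1
    rw [full_roots]
    exact ne_top_of_le_ne_top (ENNReal.mul_ne_top ENNReal.coe_ne_top i1.ne) h1
  have hD : ∀ γ ∈ roots, ∀ b : ℕ, b + 1 ≤ 2 → γ + b < ρ → γ + (b + 1) < ρ' →
      ∀ᵐ t ∂volume.restrict (timeO T), WeakD univ (fun y => cfT roots (gT T v) b γ (t, y))
        fun y => cfT roots (gT T v) (b + 1) γ (t, y) := by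
    intro γ hγ b hb h1 h2
    exact hJ.weakD_cfT roots hγ h1 h2 (by omega) (by rw [card_roots]; omega)
      (hE.fin_full (by omega)) (hE.fin₀ γ hγ b (by omega)) (hsymb b hb)
      (hE.fin₀ γ hγ _ (by omega))
  refine ⟨hJ, hN, hkc, hδ, by finiteness, fun n b h => weakOp_rep isOpen_dom (hex n b h),
    fun _ _ => measurable_rep, hdt, fun n b h => ?_, fun n b h => ?_, fun n b h => ?_,
    fun b hb1 hb2 => ?_, fun γ hγ b hb h => ?_, fun b hb => ?_, ?_⟩
  · have h1 := weakOp_rep isOpen_dom (hex n b h)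
    rw [← opPoly_zero_one] at h1
    filter_upwards [ae_sN_le (α := -δ - 1) (κ := k) measurable_rep h1 (by omega)] with t ht
    rw [opPoly_zero_one, show -δ - 1 + 1 / 2 = -(1 / 2) - δ by ring] at ht
    exact hle1 _ (ht.trans s0)
  · have h1 := hdt n b h
    rw [← opPoly_zero_one, ← dtEnd_mul_opEnd] at h1
    have h2 := lintegral_sN_dt_le (α := -δ - 1 - 1 / 2) (κ := k - 2) measurable_rep h1 (by omega)
    rw [show -δ - 1 - 1 / 2 + 1 / 2 = -1 - δ by ring] at h2
    exact hle1 _ (h2.trans sd)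
  · have h1 := hJ.weakOp (p := symb * X ^ n) (b := b) (by
      have := natDegree_mul_le (p := symb) (q := X ^ n)
      rw [natDegree_X_pow, natDegree_symb] at this
      omega) (by omega)
    rw [← opPoly_zero] at h1 ⊢
    filter_upwards [ae_sN_le (α := δ + 1) (κ := kc) (measurable_jet_gT _ _) h1 h] with t ht
    rw [show δ + 1 + 1 / 2 = 3 / 2 + δ by ring] at ht
    exact hle1 _ (ht.trans s1)
  · have e : -δ + 2 + 1 / 2 = 5 / 2 - δ := by ring
    interval_cases b
    · filter_upwards [hK1 T v kb (-δ + 2) (fun n hn => hex n _ (by omega)) (by omega)] with t ht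
      rw [e] at ht
      exact hle K1 (by rw [add_right_comm]; exact le_add_self) _ (ht.trans (by gcongr))
    · filter_upwards [hK2 T v kb (-δ + 2) (fun n hn => hex n _ (by omega)) (by omega)] with t ht
      rw [e] at ht
      exact hle K2 le_add_self _ (ht.trans (by gcongr))
  · exact hE.cf_bad hγ (by omega) (by linarith)
  · have h1 : (b : ℝ) ≤ 1 := by exact_mod_cast hb
    exact hD 0 (mem_roots.2 (Or.inl rfl)) b (by omega) (by linarith) (by linarith)
  · have h1 := hD 1 (mem_roots.2 (Or.inr (Or.inl rfl))) 0 (by omega) (by push_cast; linarith)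
      (by push_cast; linarith)
    exact h1

/-- `D_x` annihilates, up to the weight `ρ₁`, all powers but those of the negative roots. -/
theorem roots_bad {ρ₁ : ℝ} (h1 : -(3 / 20) < ρ₁) (h2 : ρ₁ < 1) : ∀ γ ∈ badRoots,
    γ ∈ roots ∧ γ < ρ₁ ∧ γ ≠ 0 ∧ ∃ c, γ ≠ c ∧
      ∀ γ' ∈ roots, γ' ≠ γ → γ' ≤ ρ₁ → γ' = 0 ∨ γ' = c := by
  obtain ⟨β1, β2⟩ := beta_bounds
  intro γ hγ
  have key : ∀ c, (γ = -(1 / 2) ∧ c = 1 / 2 - β ∨ γ = 1 / 2 - β ∧ c = -(1 / 2)) →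
      ∀ γ' ∈ roots, γ' ≠ γ → γ' ≤ ρ₁ → γ' = 0 ∨ γ' = c := by
    intro c hc γ' g1 g2 g3
    rcases mem_roots.1 g1 with rfl | rfl | rfl | rfl | rfl | rfl | rfl
    · exact Or.inl rfl
    · linarith
    · linarith
    · linarith
    · linarith
    · rcases hc with ⟨h, rfl⟩ | ⟨-, h⟩
      · exact absurd h.symm g2
      · exact Or.inr h.symm
    · rcases hc with ⟨-, h⟩ | ⟨h, rfl⟩
      · exact Or.inr h.symm
      · exact absurd h.symm g2
  rcases mem_badRoots.1 hγ with rfl | rfl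
  · refine ⟨mem_roots.2 (by simp), by linarith, by norm_num, 1 / 2 - β, by linarith, key _ ?_⟩
    exact Or.inl ⟨rfl, rfl⟩
  · refine ⟨mem_roots.2 (by simp), by linarith, by linarith, -(1 / 2), by linarith, key _ ?_⟩
    exact Or.inr ⟨rfl, rfl⟩

end CoreSetup

/-! ### Bounds for the coefficients -/

section CoefficientBounds

variable {T : ℝ≥0∞} {δ : ℝ}

/-- The coefficients of `x^0` and `x^1`, and their derivatives in `y`, as continuous curves. -/
theorem exists_curves (hδ : 0 < δ) (hδ' : δ < 1 / 10) : ∃ K : ℝ≥0, ∀ (T : ℝ≥0∞)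
    (v : ℝ × ℝ × ℝ → ℝ) (N : ℕ) (g h : ℕ → ℕ → ℝ × ℝ × ℝ → ℝ) (kc : ℕ) (M : ℝ≥0∞),
    Core T v N g h kc δ M → 0 < T → ∃ B : Fin 3 → ℝ → H1,
      (∀ i, ContinuousOn (B i) (timeI T)) ∧
      (∀ i, ∀ t ∈ timeI T, ‖B i t‖ₑ ≤ K * M ^ (1 / 2 : ℝ)) ∧
      (∀ᵐ t ∂volume.restrict (timeO T), (B 0 t).1.fst =ᵐ[volume] fun y => cfT roots g 0 0 (t, y)) ∧
      (∀ᵐ t ∂volume.restrict (timeO T), (B 1 t).1.fst =ᵐ[volume] fun y => cfT roots g 1 0 (t, y)) ∧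
      (∀ᵐ t ∂volume.restrict (timeO T), (B 2 t).1.fst =ᵐ[volume] fun y => cfT roots g 0 1 (t, y)) ∧
      ∀ t ∈ timeI T, (B 0 t).1.snd = (B 1 t).1.fst := by
  have m0 : (0 : ℝ) ∈ roots := mem_roots.2 (Or.inl rfl)
  have m1 : (1 : ℝ) ∈ roots := mem_roots.2 (Or.inr (Or.inl rfl))
  obtain ⟨K0, h0⟩ := exists_h1Curve (δ := δ) (b := 0) (ρ := 3 / 2 + δ) (ρ' := 3 / 2 + δ) m0
    (by push_cast; linarith) (by push_cast; linarith) (by push_cast; linarith)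
  obtain ⟨K1, h1⟩ := exists_h1Curve (δ := δ) (b := 1) (ρ := 3 / 2 + δ) (ρ' := 5 / 2 - δ) m0
    (by push_cast; linarith) (by push_cast; linarith) (by push_cast; linarith)
  obtain ⟨K2, h2⟩ := exists_h1Curve (δ := δ) (b := 0) (ρ := 3 / 2 + δ) (ρ' := 5 / 2 - δ) m1
    (by push_cast; linarith) (by push_cast; linarith) (by push_cast; linarith)
  refine ⟨K0 + K1 + K2, fun T v N g h kc M hC hT => ?_⟩
  have hkc := hC.four_le
  have t0 : ∀ b, b ≤ kc → ∀ᵐ t ∂volume.restrict (timeO T), sN (3 / 2 + δ) (jet g symb b) t ≤ M := by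
    intro b hb
    simpa using hC.top 0 b (by omega)
  obtain ⟨B0, c0, n0, r0⟩ := h0 T v N g h kc M hC hT (by omega) (t0 0 (by omega)) (t0 1 (by omega))
    (hC.dy₀ 0 (by omega))
  obtain ⟨B1, c1, n1, r1⟩ := h1 T v N g h kc M hC hT (by omega) (t0 1 (by omega))
    (hC.top' 2 (by omega) (by omega)) (hC.dy₀ 1 (by omega))
  obtain ⟨B2, c2, n2, r2⟩ := h2 T v N g h kc M hC hT (by omega) (t0 0 (by omega))
    (hC.top' 1 (by omega) (by omega)) hC.dy₁
  have hle : ∀ K : ℝ≥0, K ≤ K0 + K1 + K2 → ∀ a : ℝ≥0∞, a ≤ K * M ^ (1 / 2 : ℝ) →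
      a ≤ (K0 + K1 + K2 : ℝ≥0) * M ^ (1 / 2 : ℝ) := fun K hK a ha => ha.trans (by gcongr)
  refine ⟨![B0, B1, B2], fun i => ?_, fun i t ht => ?_, r0.mono fun t ht => ht.1,
    r1.mono fun t ht => ht.1, r2.mono fun t ht => ht.1, ?_⟩
  · fin_cases i
    exacts [c0, c1, c2]
  · fin_cases i
    · exact hle K0 (by rw [add_assoc]; exact le_self_add) _ (n0 t ht)
    · exact hle K1 (by rw [add_right_comm]; exact le_add_self) _ (n1 t ht)
    · exact hle K2 le_add_self _ (n2 t ht)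
  · have hc : ContinuousOn (fun t => (B0 t).1.snd - (B1 t).1.fst) (timeI T) := by
      have f1 : Continuous fun B : H1 => B.1.fst :=
        (WithLp.prod_continuous_ofLp 2 _ _).fst.comp continuous_subtype_val
      have f2 : Continuous fun B : H1 => B.1.snd :=
        (WithLp.prod_continuous_ofLp 2 _ _).snd.comp continuous_subtype_val
      exact (f2.comp_continuousOn c0).sub (f1.comp_continuousOn c1)
    have h3 := forall_enorm_le_of_ae (ν := volume.restrict (timeO T)) (M := 0)
      (by filter_upwards [ae_restrict_mem (isOpen_timeO T).measurableSet] with t ht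
          exact ⟨ht.1.le, ht.2⟩)
      (fun t ht => neBot_nhds_inf_ae (isOpen_timeO T) (timeI_subset_closure hT ht)) hc (by
        filter_upwards [r0, r1] with t g0 g1
        have : (B0 t).1.snd = (B1 t).1.fst := Lp.ext (g0.2.trans g1.1.symm)
        simp [this])
    intro t ht
    have h4 := h3 t ht
    simpa [sub_eq_zero] using h4

theorem eLpNorm_two_le {α F : Type} [MeasurableSpace α] [NormedAddCommGroup F] {μ : Measure α}
    {f : α → F} {K : ℝ≥0} {S : ℝ≥0∞} (h : ∫⁻ a, ‖f a‖ₑ ^ 2 ∂μ ≤ K * S) :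
    eLpNorm f 2 μ ≤ (K ^ (1 / 2 : ℝ) : ℝ≥0) * S ^ (1 / 2 : ℝ) := by
  refine enorm_le_of_sq_le (le_trans (le_of_eq ?_) h)
  rw [eLpNorm_eq_lintegral_rpow_enorm_toReal (by simp) (by simp), ← ENNReal.rpow_natCast,
    ← ENNReal.rpow_mul]
  simp

variable {c c' : ℝ × ℝ → ℝ} {K : ℝ≥0} {S : ℝ≥0∞}

theorem l2Bound_of_lintegral (hc : Measurable c)
    (h : ∫⁻ z in timeO T ×ˢ (univ : Set ℝ), ‖c z‖ₑ ^ 2 ≤ K * S) :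
    L2Bound T (fun t y => c (t, y)) ((K ^ (1 / 2 : ℝ) : ℝ≥0) * S ^ (1 / 2 : ℝ)) := by
  refine ⟨hc.aestronglyMeasurable, eLpNorm_two_le ?_⟩
  rw [Measure.volume_eq_prod, ← Measure.prod_restrict] at h ⊢
  rwa [restrict_timeO]

theorem ae_lintegral_ne_top (hc : Measurable c)
    (h : ∫⁻ z in timeO T ×ˢ (univ : Set ℝ), ‖c z‖ₑ ^ 2 ≠ ⊤) :
    ∀ᵐ t ∂volume.restrict (timeO T), ∫⁻ y, ‖c (t, y)‖ₑ ^ 2 ≠ ⊤ := by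
  have hm : Measurable fun z => ‖c z‖ₑ ^ 2 := hc.enorm.pow_const 2
  rw [lintegral_timeO_prod hm] at h
  exact (ae_lt_top hm.lintegral_prod_right' h).mono fun t ht => ht.ne

theorem l2Into_h1Curve (hc : Measurable c) (hc' : Measurable c') (hS : S ≠ ⊤)
    (hd : ∀ᵐ t ∂volume.restrict (timeO T), WeakD univ (fun y => c (t, y)) fun y => c' (t, y))
    (h : ∫⁻ z in timeO T ×ˢ (univ : Set ℝ), ‖c z‖ₑ ^ 2 ≤ K * S) {K' : ℝ≥0}
    (h' : ∫⁻ z in timeO T ×ˢ (univ : Set ℝ), ‖c' z‖ₑ ^ 2 ≤ K' * S) :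
    (∀ᵐ t ∂volume.restrict (timeO T), (h1Curve c c' t).1.fst =ᵐ[volume] fun y => c (t, y)) ∧
    (∀ u : ℝ → ℝ → ℝ, (∀ᵐ t ∂volume.restrict (timeO T), ∀ᵐ y, c (t, y) = u t y) →
      L2Into RepH1 T u (((K + K') ^ (1 / 2 : ℝ) : ℝ≥0) * S ^ (1 / 2 : ℝ))) ∧
    L2Into RepBC0 T (fun t => toBC (h1Curve c c' t))
      (((4 * (K + K')) ^ (1 / 2 : ℝ) : ℝ≥0) * S ^ (1 / 2 : ℝ)) := by
  have hae := ae_h1Curve hc hc' (ae_lintegral_ne_top hc (ne_top_of_le_ne_top (by finiteness) h))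
    (ae_lintegral_ne_top hc' (ne_top_of_le_ne_top (by finiteness) h')) hd
  have hm := aestronglyMeasurable_h1Curve hc hc' hae
  have hint : ∫⁻ t in timeO T, ‖h1Curve c c' t‖ₑ ^ 2 ≤ (K + K' : ℝ≥0) * S := by
    have m1 : Measurable fun z => ‖c z‖ₑ ^ 2 := hc.enorm.pow_const 2
    have m2 : Measurable fun z => ‖c' z‖ₑ ^ 2 := hc'.enorm.pow_const 2
    rw [lintegral_timeO_prod m1] at h
    rw [lintegral_timeO_prod m2] at h'
    calc _ = ∫⁻ t in timeO T, ((∫⁻ y, ‖c (t, y)‖ₑ ^ 2) + ∫⁻ y, ‖c' (t, y)‖ₑ ^ 2) := by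
          refine lintegral_congr_ae ?_
          filter_upwards [hae] with t ht using enorm_sq_H1_of_ae _ ht.1 ht.2
      _ ≤ _ := by
          rw [lintegral_add_left m1.lintegral_prod_right', ENNReal.coe_add, add_mul]
          exact add_le_add h h'
  refine ⟨hae.mono fun t ht => ht.1, fun u hu => ⟨h1Curve c c', ?_, ?_, ?_⟩,
    fun t => toBC (h1Curve c c' t), Eventually.of_forall fun t y => rfl, ?_, ?_⟩
  · rw [restrict_timeO]
    filter_upwards [hae, hu] with t h1 h2 using h1.1.trans h2
  · rwa [restrict_timeO]
  · rw [restrict_timeO]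
    exact eLpNorm_two_le hint
  · rw [restrict_timeO]
    exact continuous_toBC.comp_aestronglyMeasurable hm
  · rw [restrict_timeO]
    refine eLpNorm_two_le ?_
    have hb : ∀ B : H1, ‖toBC B‖ₑ ^ 2 ≤ 4 * ‖B‖ₑ ^ 2 := by
      intro B
      have h1 : ‖toBC B‖₊ ≤ 2 * ‖B‖₊ := norm_toBC_le B
      have h2 : ‖toBC B‖ₑ ≤ 2 * ‖B‖ₑ := by
        change (‖toBC B‖₊ : ℝ≥0∞) ≤ 2 * (‖B‖₊ : ℝ≥0∞)
        exact_mod_cast h1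
      calc _ ≤ (2 * ‖B‖ₑ) ^ 2 := by gcongr
        _ = _ := by ring
    calc _ ≤ ∫⁻ t in timeO T, 4 * ‖h1Curve c c' t‖ₑ ^ 2 := lintegral_mono fun t => hb _
      _ = 4 * ∫⁻ t in timeO T, ‖h1Curve c c' t‖ₑ ^ 2 := lintegral_const_mul' _ _ (by simp)
      _ ≤ 4 * ((K + K' : ℝ≥0) * S) := by gcongr
      _ = _ := by
          push_cast
          ring

theorem exists_lintegral_cfT_gT_le (Γ : Finset ℝ) {γ : ℝ} (hγ : γ ∈ Γ) (b : ℕ) {ρ : ℝ} (ρ₀ : ℝ)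
    (hρ : γ + b < ρ) : ∃ K : ℝ≥0, ∀ (T : ℝ≥0∞) (v : ℝ × ℝ × ℝ → ℝ) (N κ₀ : ℕ) (S : ℝ≥0∞),
    Jets T v N (gT T v) → b ≤ N → Γ.card + b ≤ κ₀ + 1 → Γ.card + b ≤ N + 7 →
    intNormSq T 0 1 κ₀ (ρ₀ - 1 / 2) v ≤ S → S ≠ ⊤ →
    ∫⁻ t in timeO T, sN ρ (jet (gT T v) (full Γ) b) t ≤ S →
    ∫⁻ z in timeO T ×ˢ (univ : Set ℝ), ‖cfT Γ (gT T v) b γ z‖ₑ ^ 2 ≤ K * S := by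
  obtain ⟨K, hK⟩ := exists_lintegral_cfT_sq_le Γ hγ b ρ₀ hρ
  obtain ⟨K1, hK1⟩ := exists_lintegral_sN_jet_le (filt Γ γ) b
  refine ⟨K * (K1 + 1), fun T v N κ₀ S hJ hb h1 h2 h3 hS h4 => ?_⟩
  have dp := natDegree_filt hγ
  have h5 := hK1 T v κ₀ (ρ₀ - 1 / 2) (h3.trans_lt hS.lt_top) (by omega)
  rw [sub_add_cancel] at h5
  calc _ ≤ K * ((∫⁻ t in timeO T, sN ρ₀ (jet (gT T v) (filt Γ γ) b) t) +
        ∫⁻ t in timeO T, sN ρ (jet (gT T v) (full Γ) b) t) :=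
        hK T v N _ hJ hb h2 (ne_top_of_le_ne_top hS h4)
    _ ≤ K * (K1 * S + S) := by
        gcongr
        exact h5.trans (by gcongr)
    _ = _ := by
        push_cast
        ring

end CoefficientBounds

end

/-! ### Functions that do not depend on time -/

section Stationary

variable {T : ℝ≥0∞}

/-- The restriction of a test function to the time `t`. -/
def sliceMap (T : ℝ≥0∞) (t : ℝ) : testSpace (spaceTime T).dom →ₗ[ℝ] testSpace plane.dom where
  toFun ψ := ⟨fun q => ψ.1 (t, q), ψ.2.smooth.comp (by fun_prop),
    HasCompactSupport.intro (ψ.2.compact.isCompact.image continuous_snd) fun q hq =>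
      image_eq_zero_of_notMem_tsupport fun h => hq ⟨(t, q), h, rfl⟩,
    fun q hq => (ψ.2.subset (tsupport_comp_subset_preimage ψ.1
      (f := fun q : ℝ × ℝ => (t, q)) (by fun_prop) hq)).2.2⟩
  map_add' _ _ := rfl
  map_smul' _ _ := rfl

/-- The operator `A` on functions of `(t, x, y)` acts as `A'` at each time. -/
def SliceComm (T : ℝ≥0∞) (A : Module.End ℝ (testSpace (spaceTime T).dom))
    (A' : Module.End ℝ (testSpace plane.dom)) : Prop :=
  ∀ t ψ, sliceMap T t (A ψ) = A' (sliceMap T t ψ)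

theorem SliceComm.mul {A B : Module.End ℝ (testSpace (spaceTime T).dom)}
    {A' B' : Module.End ℝ (testSpace plane.dom)} (h : SliceComm T A A') (h' : SliceComm T B B') :
    SliceComm T (A * B) (A' * B') := fun t ψ => by
  rw [Module.End.mul_apply, h, h', Module.End.mul_apply]

theorem SliceComm.pow {A : Module.End ℝ (testSpace (spaceTime T).dom)}
    {A' : Module.End ℝ (testSpace plane.dom)} (h : SliceComm T A A') (n : ℕ) :
    SliceComm T (A ^ n) (A' ^ n) := by
  induction n with
  | zero => exact fun t ψ => rfl
  | succ n ih => rw [pow_succ, pow_succ]; exact ih.mul h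

theorem sliceComm_pdEnd (e : ℝ × ℝ) :
    SliceComm T (pdEnd _ ((0 : ℝ), e)) (pdEnd _ e) := fun t ψ => by
  ext q
  have h1 : HasFDerivAt (fun q : ℝ × ℝ => ψ.1 (t, q))
      ((fderiv ℝ ψ.1 (t, q)).comp (ContinuousLinearMap.inr ℝ ℝ (ℝ × ℝ))) q :=
    ((ψ.2.smooth.differentiable (by simp)) (t, q)).hasFDerivAt.comp q (hasFDerivAt_prodMk_right t q)
  change -(fderiv ℝ ψ.1 (t, q) (0, e)) = -(fderiv ℝ (fun q : ℝ × ℝ => ψ.1 (t, q)) q e)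
  rw [h1.fderiv]
  rfl

theorem sliceComm_opEnd (p : ℝ[X]) (b : ℕ) :
    SliceComm T (opEnd (spaceTime T) p b) (opEnd plane p b) := by
  have hx : SliceComm T (xEnd (spaceTime T)) (xEnd plane) := fun t ψ => rfl
  refine SliceComm.mul ?_ (((sliceComm_pdEnd (0, 1)).mul hx).pow b)
  induction p using Polynomial.induction_on' with
  | add p q hp hq =>
    intro t ψ
    rw [map_add, map_add, LinearMap.add_apply, map_add, hp, hq, LinearMap.add_apply]
  | monomial n a =>
    rw [Polynomial.aeval_monomial, Polynomial.aeval_monomial]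
    exact SliceComm.mul (fun t ψ => rfl) (((sliceComm_pdEnd (1, 0)).mul hx).pow n)

theorem locallyIntegrableOn_comp_snd {v : ℝ × ℝ → ℝ} (hv : LocallyIntegrableOn v plane.dom) :
    LocallyIntegrableOn (fun p : ℝ × ℝ × ℝ => v p.2) (spaceTime T).dom := by
  rw [locallyIntegrableOn_iff isOpen_dom.isLocallyClosed]
  intro K hK hKc
  have h1 : IntegrableOn v (Prod.snd '' K) := by
    refine hv.integrableOn_compact_subset ?_ (hKc.image continuous_snd)
    rintro - ⟨p, hp, rfl⟩
    exact (hK hp).2.2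
  have : IsFiniteMeasure (volume.restrict (Prod.fst '' K)) :=
    isFiniteMeasure_restrict.2 (hKc.image continuous_fst).measure_lt_top.ne
  have h2 := Integrable.comp_snd h1 (volume.restrict (Prod.fst '' K))
  rw [Measure.prod_restrict] at h2
  exact IntegrableOn.mono_set h2 fun p hp => ⟨⟨p, hp, rfl⟩, ⟨p, hp, rfl⟩⟩

theorem integral_comp_snd {v : ℝ × ℝ → ℝ} (hv : LocallyIntegrableOn v plane.dom)
    (ψ : testSpace (spaceTime T).dom) :
    ∫ p : ℝ × ℝ × ℝ, v p.2 * ψ.1 p = ∫ t, ∫ q, v q * (sliceMap T t ψ).1 q :=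
  integral_prod _ (ψ.2.integrable_mul (locallyIntegrableOn_comp_snd hv))

variable {A : Module.End ℝ (testSpace (spaceTime T).dom)} {A' : Module.End ℝ (testSpace plane.dom)}

theorem WeakOp.comp_snd (hA : SliceComm T A A') {v w : ℝ × ℝ → ℝ}
    (h : WeakOp plane.dom A' v w) :
    WeakOp (spaceTime T).dom A (fun p => v p.2) fun p => w p.2 := by
  refine ⟨locallyIntegrableOn_comp_snd h.1, locallyIntegrableOn_comp_snd h.2.1, fun ψ => ?_⟩
  rw [integral_comp_snd h.1, integral_comp_snd h.2.1]
  refine integral_congr_ae (Eventually.of_forall fun t => ?_)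
  beta_reduce
  rw [hA, h.2.2]

theorem weakOp_dtEnd_comp_snd {v : ℝ × ℝ → ℝ} (hv : LocallyIntegrableOn v plane.dom) :
    WeakOp (spaceTime T).dom (dtEnd T) (fun p => v p.2) fun _ => 0 := by
  refine ⟨locallyIntegrableOn_comp_snd hv, locallyIntegrableOn_const 0, fun ψ => ?_⟩
  have h1 := (dtEnd T ψ).2.integrable_mul (locallyIntegrableOn_comp_snd hv)
  rw [Measure.volume_eq_prod, integral_prod_symm _ h1, ← Measure.volume_eq_prod]
  have h2 : ∀ q, ∫ t, v q * (dtEnd T ψ).1 (t, q) = 0 := by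
    intro q
    have hd : ∀ t, HasDerivAt (fun t => ψ.1 (t, q)) (-(dtEnd T ψ).1 (t, q)) t := by
      intro t
      have := ((ψ.2.smooth.differentiable (by simp)) (t, q)).hasFDerivAt.comp_hasDerivAt t
        ((hasDerivAt_id t).prodMk (hasDerivAt_const t q))
      have e : -(dtEnd T ψ).1 (t, q) = fderiv ℝ ψ.1 (t, q) (1, 0) := neg_neg _
      rwa [e]
    have hint : ∀ ψ : testSpace (spaceTime T).dom, Integrable fun t => ψ.1 (t, q) := fun ψ =>
      (show Continuous fun t => ψ.1 (t, q) from
        ψ.2.smooth.continuous.comp (by fun_prop)).integrable_of_hasCompactSupport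
        (HasCompactSupport.intro (ψ.2.compact.isCompact.image continuous_fst) fun t ht =>
          image_eq_zero_of_notMem_tsupport fun h => ht ⟨(t, q), h, rfl⟩)
    have h3 := integral_eq_zero_of_hasDerivAt_of_integrable hd (hint (dtEnd T ψ)).neg (hint ψ)
    rw [integral_neg, neg_eq_zero] at h3
    rw [integral_const_mul, h3, mul_zero]
  simp [h2]

/-- A differential operator in `(x, y)` maps a function without time dependence to one whose
restriction to almost every time is the same: compare with the average in time. -/
theorem WeakOp.ae_comp_snd {A : Module.End ℝ (testSpace (spaceTime 1).dom)}
    (hA : SliceComm 1 A A') {v : ℝ × ℝ → ℝ} (hv : LocallyIntegrableOn v plane.dom)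
    {g : ℝ × ℝ × ℝ → ℝ} (h : WeakOp (spaceTime 1).dom A (fun p => v p.2) g) :
    ∀ᵐ t ∂volume.restrict (timeI 1), WeakOp plane.dom A' v fun q => g (t, q) := by
  let χ : ContDiffBump (1 / 2 : ℝ) := ⟨1 / 8, 1 / 4, by norm_num, by norm_num⟩
  have hχ : IsTest (timeO 1) (χ.normed volume) := by
    refine ⟨χ.contDiff_normed, χ.hasCompactSupport_normed, ?_⟩
    rw [χ.tsupport_normed_eq, Real.closedBall_eq_Icc]
    intro t ht
    have h1 : (1 : ℝ) / 2 - 1 / 4 ≤ t := ht.1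
    have h2 : t ≤ (1 : ℝ) / 2 + 1 / 4 := ht.2
    exact ⟨by linarith, by rw [ENNReal.ofReal_lt_one]; linarith⟩
  have hg : LocallyIntegrableOn g (timeO 1 ×ˢ plane.dom) := by
    rw [← spaceTime_dom]
    exact h.2.1
  have hw : WeakOp plane.dom A' v fun q => ∫ t, g (t, q) * χ.normed volume t := by
    refine ⟨hv, locallyIntegrableOn_integral_mul HalfSpace.IsLinear.isOpen hg hχ, fun φ => ?_⟩
    have h1 := hχ.tensor φ.2
    rw [← integral_mul_tensor hg hχ φ.2]
    rw [← spaceTime_dom] at h1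
    let Ψ : testSpace (spaceTime 1).dom := ⟨_, h1⟩
    have h2 : ∀ t, ∫ q, v q * (sliceMap 1 t (A Ψ)).1 q =
        χ.normed volume t * ∫ q, v q * (A' φ).1 q := by
      intro t
      rw [hA, show sliceMap 1 t Ψ = χ.normed volume t • φ from rfl, map_smul,
        ← integral_const_mul]
      congr 1
      ext q
      change v q * (χ.normed volume t * (A' φ).1 q) = _
      ring
    refine Eq.trans ?_ (h.2.2 Ψ)
    rw [integral_comp_snd hv, integral_congr_ae (Eventually.of_forall h2)]
    rw [integral_mul_const, χ.integral_normed, one_mul]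
  filter_upwards [ae_slice ((hw.comp_snd hA).ae_eq isOpen_dom h)] with t ht
  exact hw.congr_ae HalfSpace.IsLinear.isOpen ht

variable {m κ : ℕ} {P : ℝ[X]} {α : ℝ} {v : ℝ × ℝ → ℝ}

theorem timeI_one : timeI 1 = Ico 0 1 := by
  ext t
  simp [timeI]

theorem neBot_timeI_one : (ae (volume.restrict (timeI 1))).NeBot := by
  rw [ae_neBot, Ne, Measure.restrict_eq_zero, timeI_one]
  simp

theorem isWeak_comp_snd {a b : ℕ} {g : ℝ × ℝ → ℝ} (h : IsWeak plane (opT plane m P a b) v g) :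
    IsWeak (spaceTime T) (opT (spaceTime T) m P a b) (fun p => v p.2) fun p => g p.2 :=
  (isWeak_iff _ (coe_opT _ m P a b) _ _).2
    (((isWeak_iff _ (coe_opT _ m P a b) _ _).1 h).comp_snd (sliceComm_opEnd _ _))

theorem supNormSq_comp_snd_le :
    supNormSq T m P κ α (fun p => v p.2) ≤ normSq m P κ α v := by
  refine le_iInf₂ fun g hg => ?_
  refine (iInf₂_le (fun l p => g l p.2) fun l hl => isWeak_comp_snd (hg l hl)).trans ?_
  exact essSup_le_of_ae_le _ (Eventually.of_forall fun _ => le_rfl)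

theorem intNormSq_comp_snd_le :
    intNormSq 1 m P κ α (fun p => v p.2) ≤ normSq m P κ α v := by
  refine le_iInf₂ fun g hg => ?_
  refine (iInf₂_le (fun l p => g l p.2) fun l hl => isWeak_comp_snd (hg l hl)).trans ?_
  simp [timeI_one]

theorem intNormDtSq_comp_snd (hv : LocallyIntegrableOn v plane.dom) :
    intNormDtSq T m P κ α (fun p => v p.2) = 0 := by
  have h0 : LocallyIntegrableOn (fun _ => (0 : ℝ)) (spaceTime T).dom := locallyIntegrableOn_const 0
  have h1 : ∀ l ∈ multiIdx κ, IsWeak (spaceTime T)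
      (fun φ => pdT (1, 0, 0) (opT (spaceTime T) m P l.1 l.2 φ)) (fun p => v p.2) fun _ => 0 :=
    fun l _ => (isWeak_iff _ (coe_pdT_opT m P l.1 l.2) _ _).2
      ((weakOp_dtEnd_comp_snd hv).comp ⟨h0, h0, fun φ => by simp only [zero_mul]⟩)
  refine le_antisymm ((iInf₂_le (fun _ _ => 0) h1).trans ?_) zero_le
  simp [weightSq]

theorem HasExpansionT.ae_hasExpansion {n L Ly : ℕ} {ρ : ℝ} {e : Fin n → ℝ} {c : Fin n → ℝ → ℝ → ℝ}
    (hv : LocallyIntegrableOn v plane.dom)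
    (h : HasExpansionT 1 (fun p => v p.2) e c ρ L Ly) :
    ∀ᵐ t ∂volume.restrict (timeI 1), HasExpansion v e (fun i => c i t) ρ L Ly := by
  have hs : ∀ {Q : ℝ × ℝ → Prop}, (∀ᵐ s ∂volume.restrict (timeI 1 ×ˢ univ), Q s) →
      ∀ᵐ t ∂volume.restrict (timeI 1), ∀ᵐ y, Q (t, y) := by
    intro Q hQ
    rw [Measure.volume_eq_prod, ← Measure.prod_restrict, Measure.restrict_univ] at hQ
    exact Measure.ae_ae_of_ae_prod hQ
  refine ae_all_iff.2 fun a => ae_all_iff.2 fun b => ae_all_iff.2 fun h1 =>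
    ae_all_iff.2 fun h2 => ?_
  obtain ⟨g, k, hg, hk, hm, hp⟩ := h a b h1 h2
  filter_upwards [((isWeak_iff _ (coe_powT _ a b) _ _).1 hg).ae_comp_snd (sliceComm_opEnd _ _) hv,
    ae_all_iff.2 fun i => ae_all_iff.2 (hk i), hs hm, ae_all_iff.2 fun hab => hs (hp hab)]
    with t g1 g2 g3 g4
  exact ⟨fun q => g (t, q), fun i => k i t, (isWeak_iff _ (coe_powT _ a b) _ _).2 g1, g2, g3, g4⟩

/-- Bounds on `[0, 1)` for a function without time dependence are bounds at one time. -/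
theorem exists_bcBound_of_comp_snd {A : Module.End ℝ (testSpace (spaceTime 1).dom)}
    (hA : SliceComm 1 A A') (hv : LocallyIntegrableOn v plane.dom) {M : ℝ≥0∞}
    (h : ∃ G, WeakOp (spaceTime 1).dom A (fun p => v p.2) G ∧ BCBound (domI 1) G M) :
    ∃ G, WeakOp plane.dom A' v G ∧ BCBound plane.dom G M := by
  obtain ⟨G, hG, hc, hb⟩ := h
  have := neBot_timeI_one
  obtain ⟨t, ht, hI⟩ :=
    ((hG.ae_comp_snd hA hv).and (ae_restrict_mem (measurableSet_timeI 1))).exists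
  exact ⟨_, ht, hc.comp (by fun_prop) fun q hq => ⟨hI, hq⟩, fun q hq => hb (t, q) ⟨hI, hq⟩⟩

end Stationary

/-! ### The derivatives of the gradient -/

open Polynomial in
theorem exists_gradient_bounds {δ : ℝ} (hδ : 0 < δ) (hδ' : δ < 1 / 10) (m : ℕ) :
    ∃ K : ℝ≥0, ∀ (T : ℝ≥0∞) (v : ℝ × ℝ × ℝ → ℝ) (N : ℕ) (g h : ℕ → ℕ → ℝ × ℝ × ℝ → ℝ) (kc : ℕ)
      (M : ℝ≥0∞), Core T v N g h kc δ M → 0 < T → m + 2 ≤ kc → ∀ a b, a + b ≤ m →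
      (∃ G, WeakOp (spaceTime T).dom
        (opEnd (spaceTime T) (X * (X - 1) ^ a) b * xInvEnd (spaceTime T)) v G ∧
          BCBound (domI T) G (K * M ^ (1 / 2 : ℝ))) ∧
      ∃ G, WeakOp (spaceTime T).dom
        (opEnd (spaceTime T) (X ^ a) (b + 1) * xInvEnd (spaceTime T)) v G ∧
          BCBound (domI T) G (K * M ^ (1 / 2 : ℝ)) := by
  choose K₁ h₁ using fun a b : ℕ => exists_bcBound hδ hδ' (p := X * (X - 1) ^ a) (b := b)
    ⟨fun hb => by simp [hb], fun hb => by simp [hb]⟩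
  choose K₂ h₂ using fun a b : ℕ => exists_bcBound hδ hδ' (p := X ^ a) (b := b + 1)
    ⟨fun hb => absurd hb b.succ_ne_zero, fun hb => by simp [Nat.succ.inj hb]⟩
  refine ⟨∑ a ∈ Finset.range (m + 1), ∑ b ∈ Finset.range (m + 1), (K₁ a b + K₂ a b),
    fun T v N g h kc M hC hT hm a b hab => ?_⟩
  have hle : K₁ a b + K₂ a b ≤
      ∑ a ∈ Finset.range (m + 1), ∑ b ∈ Finset.range (m + 1), (K₁ a b + K₂ a b) :=
    (Finset.single_le_sum (f := fun b => K₁ a b + K₂ a b) (fun _ _ => zero_le)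
      (Finset.mem_range.2 (by omega))).trans
    (Finset.single_le_sum (f := fun a => ∑ b ∈ Finset.range (m + 1), (K₁ a b + K₂ a b))
      (fun _ _ => zero_le) (Finset.mem_range.2 (by omega)))
  have hd₁ : (X * (X - 1) ^ a : ℝ[X]).natDegree ≤ 1 + a := by compute_degree
  have hd₂ : (X ^ a : ℝ[X]).natDegree ≤ a := by compute_degree
  obtain ⟨G₁, w₁, c₁, b₁⟩ := h₁ a b T v N g h kc M hC hT (by omega) (by omega)
  obtain ⟨G₂, w₂, c₂, b₂⟩ := h₂ a b T v N g h kc M hC hT (by omega) (by omega)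
  refine ⟨⟨G₁, w₁, c₁, fun p hp => (b₁ p hp).trans ?_⟩, G₂, w₂, c₂, fun p hp => (b₂ p hp).trans ?_⟩
  all_goals gcongr
  · exact (le_add_right le_rfl).trans hle
  · exact (le_add_left le_rfl).trans hle

section

open Polynomial

/-! ### The three cases -/

section Mono

variable {T M M' : ℝ≥0∞} {c : ℝ → ℝ → ℝ}

theorem BCBound.mono {E : Type} [TopologicalSpace E] {S : Set E} {G : E → ℝ} (h : BCBound S G M)
    (hM : M ≤ M') : BCBound S G M' := ⟨h.1, fun p hp => (h.2 p hp).trans hM⟩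

theorem L2Into.mono {F : Type} [NormedAddCommGroup F] {rep : F → (ℝ → ℝ) → Prop}
    (h : L2Into rep T c M) (hM : M ≤ M') : L2Into rep T c M' :=
  let ⟨B, h1, h2, h3⟩ := h
  ⟨B, h1, h2, h3.trans hM⟩

theorem L2Bound.mono (h : L2Bound T c M) (hM : M ≤ M') : L2Bound T c M' := ⟨h.1, h.2.trans hM⟩

end Mono

theorem exists_forall_le (l : List ℝ≥0) : ∃ C, ∀ L ∈ l, L ≤ C :=
  ⟨l.toFinset.sup id, fun _ hL => Finset.le_sup (f := id) (List.mem_toFinset.2 hL)⟩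

theorem mul_mul_rpow_le {K K' C : ℝ≥0} {S : ℝ≥0∞} (h : K * K' ^ (1 / 2 : ℝ) ≤ C) :
    K * (K' * S) ^ (1 / 2 : ℝ) ≤ C * S ^ (1 / 2 : ℝ) := by
  rw [ENNReal.mul_rpow_of_nonneg _ _ (by norm_num), ← mul_assoc,
    ← ENNReal.coe_rpow_of_nonneg _ (by norm_num), ← ENNReal.coe_mul]
  gcongr

theorem enorm_toBC_le (B : H1) : ‖toBC B‖ₑ ≤ 2 * ‖B‖ₑ := by
  have h := ENNReal.ofReal_le_ofReal (norm_toBC_le B)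
  rwa [ENNReal.ofReal_mul zero_le_two, ofReal_norm, ofReal_norm, ENNReal.ofReal_ofNat] at h

theorem enorm_le_toBC (B : H1) (y : ℝ) : ‖toBC B y‖ₑ ≤ 2 * ‖B‖ₑ :=
  le_trans (by
    rw [← ofReal_norm, ← ofReal_norm]
    exact ENNReal.ofReal_le_ofReal ((toBC B).norm_coe_le_norm y)) (enorm_toBC_le B)

/-- An element of `H²` is an element of `BC¹`. -/
theorem exists_BC1 {B B' : H1} (h : B.1.snd = B'.1.fst) {M : ℝ≥0∞} (hB : ‖B‖ₑ ≤ M)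
    (hB' : ‖B'‖ₑ ≤ M) : ∃ F : BC1, F.1 = (toBC B, toBC B') ∧ ‖F‖ₑ ≤ 2 * M := by
  refine ⟨⟨(toBC B, toBC B'), hasDerivAt_toBC h⟩, rfl, ?_⟩
  change ‖(toBC B, toBC B')‖ₑ ≤ _
  rw [← ofReal_norm, Prod.norm_def, ENNReal.ofReal_max, ofReal_norm, ofReal_norm]
  exact max_le ((enorm_toBC_le B).trans (by gcongr)) ((enorm_toBC_le B').trans (by gcongr))

theorem sliceComm_opEnd_mul_xInvEnd {T : ℝ≥0∞} (p : ℝ[X]) (b : ℕ) :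
    SliceComm T (opEnd (spaceTime T) p b * xInvEnd (spaceTime T))
      (opEnd plane p b * xInvEnd plane) :=
  (sliceComm_opEnd p b).mul fun _ _ => rfl

section Cases

variable {kt kc : ℕ} {δ : ℝ}

set_option maxHeartbeats 400000 in
theorem exists_init_bounds (hkt : 3 ≤ kt) (hkc : 4 ≤ kc) (hδ : 0 < δ) (hδ' : δ < 1 / 10) :
    ∃ C₀ : ℝ≥0, ∀ C, C₀ ≤ C → ∀ k kb : ℕ, 4 ≤ kb → max (max (kt + 4) (kc + 6)) (kb + 5) ≤ k →
      ∀ v : ℝ × ℝ → ℝ, LocallyIntegrableOn v plane.dom → initNorm k kt kc kb δ v < ⊤ →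
        ∃ v0 v1 : ℝ → ℝ,
          HasExpansion v ![0, 1] ![v0, v1] (3 / 2 + δ) (kc + 7) kc ∧
          (∀ a b : ℕ, a + b ≤ min (kt - 2) (kc - 2) →
            (∃ G, IsWeak plane (fun φ => pdT plane.ex (powT plane a b φ)) v G ∧
              BCBound plane.dom G (C * initNorm k kt kc kb δ v)) ∧
            (∃ G, IsWeak plane (fun φ => pdT plane.ey (powT plane a b φ)) v G ∧
              BCBound plane.dom G (C * initNorm k kt kc kb δ v))) ∧
          (∃ B : BC1, RepBC1 B v0 ∧ ‖B‖ₑ ≤ C * initNorm k kt kc kb δ v) ∧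
          BCBound univ v1 (C * initNorm k kt kc kb δ v) := by
  obtain ⟨K1, h1⟩ := exists_core_gT hδ hδ'
  obtain ⟨K2, h2⟩ := exists_curves hδ hδ'
  obtain ⟨K3, h3⟩ := exists_gradient_bounds hδ hδ' (min (kt - 2) (kc - 2))
  obtain ⟨C₀, hC₀⟩ := exists_forall_le [2 * K2 * K1 ^ (1 / 2 : ℝ), K3 * K1 ^ (1 / 2 : ℝ)]
  refine ⟨C₀, fun C hC k kb hkb hk v hv hfin => ?_⟩
  obtain ⟨β1, β2⟩ := beta_bounds
  have hk1 : kc + 6 ≤ k := (le_max_right _ _).trans ((le_max_left _ _).trans hk)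
  obtain ⟨S, hS⟩ : ∃ S, S = normSq 0 1 k (-1 - δ) v + normSq 0 X kt (-δ) v +
    normSq 0 (qt * X) kt δ v + normSq 0 (qt * X) kc (-δ + 1) v + normSq 0 symb kc (δ + 1) v +
    normSq 1 (qt * X) kb (-δ + 2) v := ⟨_, rfl⟩
  have hN : initNorm k kt kc kb δ v = S ^ (1 / 2 : ℝ) := by rw [hS, initNorm]
  rw [hN] at hfin ⊢
  have hS' : S < ⊤ := (ENNReal.rpow_lt_top_iff_of_pos (by norm_num)).1 hfin
  have n1 : normSq 0 1 k (-1 - δ) v ≤ S := by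
    rw [hS]
    exact le_add_right (le_add_right (le_add_right (le_add_right le_self_add)))
  have n2 : normSq 0 X kt (-δ) v ≤ S := by
    rw [hS]
    exact le_add_right (le_add_right (le_add_right (le_add_right le_add_self)))
  have n5 : normSq 0 symb kc (δ + 1) v ≤ S := by
    rw [hS]
    exact le_add_right le_add_self
  have n6 : normSq 1 (qt * X) kb (-δ + 2) v ≤ S := by
    rw [hS]
    exact le_add_self
  have i0 : intNormSq 1 0 1 k (-(1 / 2) - δ - 1 / 2) (fun p => v p.2) < ⊤ := by
    rw [show -(1 / 2) - δ - 1 / 2 = -1 - δ by ring]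
    exact (intNormSq_comp_snd_le.trans n1).trans_lt hS'
  have i1 : intNormSq 1 0 (X - Polynomial.C 0) kt (1 / 2 - δ - 1 / 2) (fun p => v p.2) < ⊤ := by
    rw [show 1 / 2 - δ - 1 / 2 = -δ by ring, map_zero, sub_zero]
    exact (intNormSq_comp_snd_le.trans n2).trans_lt hS'
  have i5 : intNormSq 1 0 (full roots) kc (3 / 2 + δ - 1 / 2) (fun p => v p.2) < ⊤ := by
    rw [show 3 / 2 + δ - 1 / 2 = δ + 1 by ring, full_roots]
    exact (intNormSq_comp_snd_le.trans n5).trans_lt hS'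
  have i6 : intNormSq 1 1 (qt * X) kb (5 / 2 - δ - 1 / 2) (fun p => v p.2) < ⊤ := by
    rw [show 5 / 2 - δ - 1 / 2 = -δ + 2 by ring]
    exact (intNormSq_comp_snd_le.trans n6).trans_lt hS'
  have s0 : supNormSq 1 0 1 k (-δ - 1) (fun p => v p.2) ≤ S := by
    rw [show -δ - 1 = -1 - δ by ring]
    exact supNormSq_comp_snd_le.trans n1
  have E := expData_gT card_roots hk1 (by omega) i0 i1 i5
    (roots_add_ne 1 (Or.inr (Or.inl ⟨by push_cast; linarith, by push_cast; linarith⟩)))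
    (by linarith) (by linarith) (by linarith) (roots_bad (by linarith) (by linarith))
  have core := h1 1 _ k kc kb kc k kb _ _ _ _ S hkc le_rfl hk1 hkb hk1 (by omega) le_rfl
    (by linarith) E i0 i6 s0 (by rw [intNormDtSq_comp_snd hv]; exact zero_le)
    (supNormSq_comp_snd_le.trans n5) (supNormSq_comp_snd_le.trans n6) hS'.ne
  obtain ⟨B, -, hBn, hB0, -, hB2, hBd⟩ := h2 1 _ kc _ _ kc _ core one_pos
  have hexp := E.hasExpansionT ![0, 1] (fun i j h => by
      fin_cases i <;> fin_cases j <;> simp at h ⊢)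
    (Fin.forall_fin_two.2 ⟨mem_roots.2 (by simp), mem_roots.2 (by simp)⟩)
    (fun γ hγ hb hlt => by
      rcases mem_roots.1 hγ with rfl | rfl | rfl | rfl | rfl | h
      · exact ⟨0, rfl⟩
      · exact ⟨1, rfl⟩
      · linarith
      · linarith
      · linarith
      · exact absurd (mem_badRoots.2 h) hb)
    ![fun t y => toBC (B 0 t) y, fun t y => toBC (B 2 t) y]
    (Fin.forall_fin_two.2 ⟨hB0.mono fun t ht => (toBC_ae_eq _).symm.trans ht,
      hB2.mono fun t ht => (toBC_ae_eq _).symm.trans ht⟩)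
  have := neBot_timeI_one
  obtain ⟨t, ht, hI⟩ :=
    ((HasExpansionT.ae_hasExpansion hv hexp).and (ae_restrict_mem (measurableSet_timeI 1))).exists
  have hK2 : 2 * (K2 * (K1 * S) ^ (1 / 2 : ℝ)) ≤ C * S ^ (1 / 2 : ℝ) := by
    have := mul_mul_rpow_le (S := S) ((hC₀ (2 * K2 * K1 ^ (1 / 2 : ℝ)) (by simp)).trans hC)
    rwa [ENNReal.coe_mul, mul_assoc] at this
  have hK3 := mul_mul_rpow_le (S := S) ((hC₀ (K3 * K1 ^ (1 / 2 : ℝ)) (by simp)).trans hC)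
  refine ⟨toBC (B 0 t), toBC (B 2 t), ?_, fun a b hab => ?_, ?_, ?_⟩
  · convert ht using 1
    ext i
    fin_cases i <;> rfl
  · obtain ⟨g1, g2⟩ := h3 1 _ kc _ _ kc _ core one_pos (by omega) a b hab
    obtain ⟨G, w, hG⟩ := exists_bcBound_of_comp_snd (sliceComm_opEnd_mul_xInvEnd _ _) hv g1
    obtain ⟨G', w', hG'⟩ := exists_bcBound_of_comp_snd (sliceComm_opEnd_mul_xInvEnd _ _) hv g2
    exact ⟨⟨G, (isWeak_iff plane (coe_pdT_ex_powT plane a b) v G).2 w, hG.mono hK3⟩,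
      G', (isWeak_iff plane (coe_pdT_ey_powT plane a b) v G').2 w', hG'.mono hK3⟩
  · obtain ⟨F, hF, hn⟩ := exists_BC1 (hBd t hI) (hBn 0 t hI) (hBn 1 t hI)
    exact ⟨F, fun y => by rw [hF], hn.trans hK2⟩
  · refine ⟨(toBC _).continuous.continuousOn, fun y _ =>
      (enorm_le_toBC _ y).trans (le_trans ?_ hK2)⟩
    gcongr
    exact hBn 2 t hI

section Triple

variable {T : ℝ≥0∞} {m : ℕ} {P : ℝ[X]} {κ : ℕ} {α : ℝ} {v : ℝ × ℝ × ℝ → ℝ} {S : ℝ≥0∞}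

theorem supNormSq_le_of_triSq (h : triSq T m P κ α v ≤ S) : supNormSq T m P κ α v ≤ S :=
  (le_add_right le_self_add).trans h

theorem intNormDtSq_le_of_triSq (h : triSq T m P κ α v ≤ S) :
    intNormDtSq T m P (κ - 2) (α - 1 / 2) v ≤ S :=
  (le_add_right le_add_self).trans h

theorem intNormSq_le_of_triSq (h : triSq T m P κ α v ≤ S) {α' : ℝ} (hα : α' = α + 1 / 2) :
    intNormSq T m P (κ + 2) α' v ≤ S :=
  hα ▸ le_add_self.trans h

end Triple

set_option maxHeartbeats 1000000 in
theorem exists_sol_bounds (hkt : 3 ≤ kt) (hkc : 4 ≤ kc) (hδ : 0 < δ) (hδ' : δ < 1 / 10) :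
    ∃ C₀ : ℝ≥0, ∀ C, C₀ ≤ C → ∀ k kb : ℕ, 4 ≤ kb → max (max (kt + 4) (kc + 6)) (kb + 5) ≤ k →
      ∀ T : ℝ≥0∞, 0 < T →
        ∀ v : ℝ × ℝ × ℝ → ℝ, LocallyIntegrableOn v (spaceTime T).dom →
          solNorm T k kt kc kb δ v < ⊤ →
          ∃ v0 v1 vβ v2 : ℝ → ℝ → ℝ,
            HasExpansionT T v ![0, 1, 1 + β, 2] ![v0, v1, vβ, v2] (2 + δ) (kc + 9) (kc + 2) ∧
            (∀ a b : ℕ, a + b ≤ min (kt - 2) (kc - 2) →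
              (∃ G, IsWeak (spaceTime T)
                  (fun φ => pdT (spaceTime T).ex (powT (spaceTime T) a b φ)) v G ∧
                BCBound {p | p.1 ∈ timeI T ∧ 0 < p.2.1} G (C * solNorm T k kt kc kb δ v)) ∧
              (∃ G, IsWeak (spaceTime T)
                  (fun φ => pdT (spaceTime T).ey (powT (spaceTime T) a b φ)) v G ∧
                BCBound {p | p.1 ∈ timeI T ∧ 0 < p.2.1} G (C * solNorm T k kt kc kb δ v))) ∧
            BCInto RepBC1 T v0 (C * solNorm T k kt kc kb δ v) ∧
            BCBound (timeI T ×ˢ univ) (fun s : ℝ × ℝ => v1 s.1 s.2)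
              (C * solNorm T k kt kc kb δ v) ∧
            L2Into RepH1 T v1 (C * solNorm T k kt kc kb δ v) ∧
            L2Into RepH1 T (fun t => deriv (v0 t)) (C * solNorm T k kt kc kb δ v) ∧
            BCInto RepH1 T v1 (C * solNorm T k kt kc kb δ v) ∧
            BCInto RepH1 T (fun t => deriv (v0 t)) (C * solNorm T k kt kc kb δ v) ∧
            L2Into RepBC0 T vβ (C * solNorm T k kt kc kb δ v) ∧
            L2Into RepH1 T vβ (C * solNorm T k kt kc kb δ v) ∧
            L2Bound T v2 (C * solNorm T k kt kc kb δ v) := by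
  obtain ⟨β1, β2⟩ := beta_bounds
  have m0 : (0 : ℝ) ∈ roots := mem_roots.2 (by simp)
  have m1 : (1 : ℝ) ∈ roots := mem_roots.2 (by simp)
  have m2 : (2 : ℝ) ∈ roots := mem_roots.2 (by simp)
  have mβ : 1 + β ∈ roots := mem_roots.2 (by simp)
  obtain ⟨K1, h1⟩ := exists_core_gT hδ hδ'
  obtain ⟨K2, h2⟩ := exists_curves hδ hδ'
  obtain ⟨K3, h3⟩ := exists_gradient_bounds hδ hδ' (min (kt - 2) (kc - 2))
  obtain ⟨K4, h4⟩ := exists_lintegral_sN_symb_le 0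
  obtain ⟨a10, l10⟩ := exists_lintegral_cfT_gT_le roots m1 0 (ρ := 2 + δ) (-δ)
    (by push_cast; linarith)
  obtain ⟨a11, l11⟩ := exists_lintegral_cfT_gT_le roots m1 1 (ρ := 2 + δ) (-δ)
    (by push_cast; linarith)
  obtain ⟨a01, l01⟩ := exists_lintegral_cfT_gT_le roots m0 1 (ρ := 2 + δ) (-δ)
    (by push_cast; linarith)
  obtain ⟨a02, l02⟩ := exists_lintegral_cfT_gT_le roots m0 2 (ρ := 2 + δ) (-δ)
    (by push_cast; linarith)
  obtain ⟨aβ0, lβ0⟩ := exists_lintegral_cfT_gT_le roots mβ 0 (ρ := 2 + δ) (-δ)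
    (by push_cast; linarith)
  obtain ⟨aβ1, lβ1⟩ := exists_lintegral_cfT_gT_le roots mβ 1 (ρ := 3 - δ) (-δ)
    (by push_cast; linarith)
  obtain ⟨a20, l20⟩ := exists_lintegral_cfT_gT_le roots m2 0 (ρ := 2 + δ) (-δ)
    (by push_cast; linarith)
  obtain ⟨C₀, hC₀⟩ := exists_forall_le [2 * K2 * K1 ^ (1 / 2 : ℝ), K3 * K1 ^ (1 / 2 : ℝ),
    (a10 + a11) ^ (1 / 2 : ℝ), (a01 + a02) ^ (1 / 2 : ℝ), a20 ^ (1 / 2 : ℝ),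
    (aβ0 + aβ1 * (K4 + 1)) ^ (1 / 2 : ℝ), (4 * (aβ0 + aβ1 * (K4 + 1))) ^ (1 / 2 : ℝ)]
  refine ⟨C₀, fun C hC k kb hkb hk T hT v hv hfin => ?_⟩
  have hk1 : kc + 6 ≤ k := (le_max_right _ _).trans ((le_max_left _ _).trans hk)
  obtain ⟨S, hS⟩ : ∃ S, S = triSq T 0 1 k (-δ - 1) v + triSq T 1 1 (kt - 1) (-δ) v +
    triSq T 0 X kt (-δ) v + triSq T 1 X (kt - 1) δ v + triSq T 0 (qt * X) kt δ v +
    triSq T 2 1 (kc - 2) (-δ + 1) v + triSq T 1 X (kc - 1) (-δ + 1) v +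
    triSq T 0 (qt * X) kc (-δ + 1) v + triSq T 2 X (kc - 2) (δ + 1) v +
    triSq T 1 (qt * X) (kc - 1) (δ + 1) v + triSq T 0 symb kc (δ + 1) v +
    triSq T 3 1 (kb - 2) (-δ + 2) v + triSq T 2 X (kb - 1) (-δ + 2) v +
    triSq T 1 (qt * X) kb (-δ + 2) v := ⟨_, rfl⟩
  have hN : solNorm T k kt kc kb δ v = S ^ (1 / 2 : ℝ) := by rw [hS, solNorm]
  rw [hN] at hfin ⊢
  have hS' : S < ⊤ := (ENNReal.rpow_lt_top_iff_of_pos (by norm_num)).1 hfin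
  obtain ⟨n1, n2, n5, n6⟩ : triSq T 0 1 k (-δ - 1) v ≤ S ∧ triSq T 0 X kt (-δ) v ≤ S ∧
      triSq T 0 symb kc (δ + 1) v ≤ S ∧ triSq T 1 (qt * X) kb (-δ + 2) v ≤ S := by
    rw [hS]
    refine ⟨?_, ?_, le_add_right (le_add_right (le_add_right le_add_self)), le_add_self⟩ <;>
    iterate 11 refine le_add_right ?_
    · exact le_add_right le_self_add
    · exact le_add_self
  have i0 : intNormSq T 0 1 (k + 2) (-δ - 1 / 2) v ≤ S := intNormSq_le_of_triSq n1 (by ring)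
  have i1 : intNormSq T 0 (X - Polynomial.C 0) (kt + 2) (1 - δ - 1 / 2) v ≤ S := by
    rw [map_zero, sub_zero]
    exact intNormSq_le_of_triSq n2 (by ring)
  have i5 : intNormSq T 0 (full roots) (kc + 2) (2 + δ - 1 / 2) v ≤ S := by
    rw [full_roots]
    exact intNormSq_le_of_triSq n5 (by ring)
  have i6 : intNormSq T 1 (qt * X) (kb + 2) (3 - δ - 1 / 2) v ≤ S :=
    intNormSq_le_of_triSq n6 (by ring)
  have E := expData_gT card_roots (N := kc + 2) (by omega) (by omega) (i0.trans_lt hS')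
    (i1.trans_lt hS') (i5.trans_lt hS')
    (roots_add_ne 2 (Or.inl ⟨by push_cast; linarith, by push_cast; linarith⟩))
    (by linarith) (by linarith) (by linarith) (roots_bad (by linarith) (by linarith))
  have core := h1 T v k kc kb (kc + 2) (k + 2) (kb + 2) _ _ _ _ S hkc (by omega) hk1 hkb (by omega)
    (by omega) (by linarith) (by linarith) E (i0.trans_lt hS') (i6.trans_lt hS')
    (supNormSq_le_of_triSq n1) (intNormDtSq_le_of_triSq n1) (supNormSq_le_of_triSq n5)
    (supNormSq_le_of_triSq n6) hS'.ne
  obtain ⟨B, hBc, hBn, hB0, hB1, hB2, hBd⟩ := h2 T v _ _ _ kc _ core hT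
  have hJ := E.jets
  -- the coefficients are square integrable
  have hfull : ∀ b ≤ kc + 2, ∫⁻ t in timeO T, sN (2 + δ) (jet (gT T v) (full roots) b) t ≤ S := by
    intro b hb
    have h := lintegral_sN_full_le card_roots hJ (2 + δ) (j := 0) (b := b) (by omega)
    rw [pow_zero, mul_one] at h
    exact h.trans i5
  have hsymb :
      ∫⁻ t in timeO T, sN (3 - δ) (jet (gT T v) (full roots) 1) t ≤ (K4 + 1 : ℝ≥0) * S := by
    have h := h4 T v (kb + 2) (3 - δ - 1 / 2)
      (fun n hn => exists_weakOp_X_pow (i0.trans_lt hS') (by omega)) (by omega)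
    rw [sub_add_cancel, ← full_roots] at h
    exact h.trans (mul_le_mul' (by gcongr; exact le_self_add) i6)
  have hle : S ≤ (K4 + 1 : ℝ≥0) * S := by
    rw [ENNReal.coe_add, add_mul, ENNReal.coe_one, one_mul]
    exact le_add_self
  have hcd := card_roots
  have c10 := l10 T v _ _ S hJ (by omega) (by omega) (by omega) i0 hS'.ne (hfull 0 (by omega))
  have c11 := l11 T v _ _ S hJ (by omega) (by omega) (by omega) i0 hS'.ne (hfull 1 (by omega))
  have c01 := l01 T v _ _ S hJ (by omega) (by omega) (by omega) i0 hS'.ne (hfull 1 (by omega))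
  have c02 := l02 T v _ _ S hJ (by omega) (by omega) (by omega) i0 hS'.ne (hfull 2 (by omega))
  have cβ0 := lβ0 T v _ _ S hJ (by omega) (by omega) (by omega) i0 hS'.ne (hfull 0 (by omega))
  have cβ1 := lβ1 T v _ _ _ hJ (by omega) (by omega) (by omega) (i0.trans hle) (by finiteness) hsymb
  have c20 := l20 T v _ _ S hJ (by omega) (by omega) (by omega) i0 hS'.ne (hfull 0 (by omega))
  rw [← mul_assoc, ← ENNReal.coe_mul] at cβ1
  have mc := hJ.measurable_cfT roots
  obtain ⟨-, H1, -⟩ := l2Into_h1Curve (mc 0 1) (mc 1 1) hS'.ne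
    (E.weakD m1 (b := 0) (by omega) (by push_cast; linarith)) c10 c11
  obtain ⟨-, H0, -⟩ := l2Into_h1Curve (mc 1 0) (mc 2 0) hS'.ne
    (E.weakD m0 (b := 1) (by omega) (by push_cast; linarith)) c01 c02
  obtain ⟨hβ, Hβ, Hβ'⟩ := l2Into_h1Curve (mc 0 (1 + β)) (mc 1 (1 + β)) hS'.ne
    (hJ.weakD_cfT roots mβ (b := 0) (by push_cast; linarith) (by push_cast; linarith) (by omega)
      (by omega) (E.fin_full (by omega)) (E.fin₀ _ mβ 0 (by omega))
      (ne_top_of_le_ne_top (by finiteness) hsymb) (E.fin₀ _ mβ 1 (by omega))) cβ0 cβ1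
  have hmem : ∀ᵐ t ∂volume.restrict (timeO T), t ∈ timeI T :=
    (ae_restrict_mem (isOpen_timeO T).measurableSet).mono fun t ht => timeO_subset T ht
  have hder : ∀ t ∈ timeI T, deriv (toBC (B 0 t)) = toBC (B 1 t) := fun t ht =>
    funext fun y => (hasDerivAt_toBC (hBd t ht) y).deriv
  have hK : ∀ L : ℝ≥0, L ≤ C₀ → L * S ^ (1 / 2 : ℝ) ≤ C * S ^ (1 / 2 : ℝ) := fun L hL => by
    have := hL.trans hC
    gcongr
  have hK2 : 2 * (K2 * (K1 * S) ^ (1 / 2 : ℝ)) ≤ C * S ^ (1 / 2 : ℝ) := by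
    have := mul_mul_rpow_le (S := S) ((hC₀ (2 * K2 * K1 ^ (1 / 2 : ℝ)) (by simp)).trans hC)
    rwa [ENNReal.coe_mul, mul_assoc] at this
  have hK2' : K2 * (K1 * S) ^ (1 / 2 : ℝ) ≤ C * S ^ (1 / 2 : ℝ) :=
    le_trans (by rw [two_mul]; exact le_self_add) hK2
  have hK3 := mul_mul_rpow_le (S := S) ((hC₀ (K3 * K1 ^ (1 / 2 : ℝ)) (by simp)).trans hC)
  refine ⟨fun t y => toBC (B 0 t) y, fun t y => toBC (B 2 t) y,
    fun t y => toBC (h1Curve (cfT roots (gT T v) 0 (1 + β)) (cfT roots (gT T v) 1 (1 + β)) t) y,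
    fun t y => cfT roots (gT T v) 0 2 (t, y), ?_, fun a b hab => ?_, ?_, ?_,
    (H1 _ ?_).mono (hK _ (hC₀ _ (by simp))), (H0 _ ?_).mono (hK _ (hC₀ _ (by simp))), ?_, ?_,
    Hβ'.mono (hK _ (hC₀ _ (by simp))), (Hβ _ ?_).mono (hK _ (hC₀ _ (by simp))),
    (l2Bound_of_lintegral (mc 0 2) c20).mono (hK _ (hC₀ _ (by simp)))⟩
  · refine E.hasExpansionT _ (StrictMono.injective (Fin.strictMono_iff_lt_succ.2 fun i => ?_))
      (fun i => ?_) (fun γ hγ hb hlt => ?_) _ fun i => ?_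
    · fin_cases i <;> simp <;> linarith
    · fin_cases i
      exacts [m0, m1, mβ, m2]
    · rcases mem_roots.1 hγ with rfl | rfl | rfl | rfl | rfl | h
      · exact ⟨0, rfl⟩
      · exact ⟨1, rfl⟩
      · exact ⟨3, rfl⟩
      · linarith
      · exact ⟨2, rfl⟩
      · exact absurd (mem_badRoots.2 h) hb
    · fin_cases i
      · exact hB0.mono fun t ht => (toBC_ae_eq _).symm.trans ht
      · exact hB2.mono fun t ht => (toBC_ae_eq _).symm.trans ht
      · exact hβ.mono fun t ht => (toBC_ae_eq _).symm.trans ht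
      · exact Eventually.of_forall fun t => Eventually.of_forall fun y => rfl
  · obtain ⟨⟨G, w, hG⟩, G', w', hG'⟩ := h3 T v _ _ _ kc _ core hT (by omega) a b hab
    exact ⟨⟨G, (isWeak_iff _ (coe_pdT_ex_powT _ a b) v G).2 w, hG.mono hK3⟩,
      G', (isWeak_iff _ (coe_pdT_ey_powT _ a b) v G').2 w', hG'.mono hK3⟩
  · choose! F hF hn using fun t (ht : t ∈ timeI T) =>
      exists_BC1 (hBd t ht) (hBn 0 t ht) (hBn 1 t ht)
    refine ⟨F, fun t ht y => by rw [hF t ht], ?_, fun t ht => (hn t ht).trans hK2⟩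
    rw [Topology.IsInducing.subtypeVal.continuousOn_iff]
    exact ((continuous_toBC.comp_continuousOn (hBc 0)).prodMk
      (continuous_toBC.comp_continuousOn (hBc 1))).congr hF
  · refine ⟨?_, fun s hs => (enorm_le_toBC _ _).trans (le_trans ?_ hK2)⟩
    · exact (continuous_eval (F := ℝ →ᵇ ℝ)).comp_continuousOn
        (((continuous_toBC.comp_continuousOn (hBc 2)).comp continuousOn_fst
          fun s hs => hs.1).prodMk continuousOn_snd)
    · gcongr
      exact hBn 2 s.1 hs.1
  · exact hB2.mono fun t ht => ht.symm.trans (toBC_ae_eq _)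
  · filter_upwards [hB1, hmem] with t ht hI
    rw [hder t hI]
    exact ht.symm.trans (toBC_ae_eq _)
  · exact ⟨B 2, fun t _ => toBC_ae_eq _, hBc 2, fun t ht => (hBn 2 t ht).trans hK2'⟩
  · refine ⟨B 1, fun t ht => ?_, hBc 1, fun t ht => (hBn 1 t ht).trans hK2'⟩
    change RepH1 (B 1 t) (deriv (toBC (B 0 t)))
    rw [hder t ht]
    exact toBC_ae_eq _
  · exact hβ.mono fun t ht => ht.symm.trans (toBC_ae_eq _)

/-- The roots of `(ζ - 4) (ζ - 3) q̃(ζ - 1) (ζ - 1)`. -/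
def roots₁ : Finset ℝ := roots.map (addRightEmbedding 1)

theorem mem_map_add_one {Γ : Finset ℝ} {γ : ℝ} : γ ∈ Γ.map (addRightEmbedding 1) ↔ γ - 1 ∈ Γ := by
  simp [Finset.mem_map, ← eq_sub_iff_add_eq]

theorem full_roots₁ : full roots₁ = symb.comp (X - C 1) := by
  rw [← full_roots, full, full, Lagrange.nodal, Lagrange.nodal, roots₁, Finset.prod_map,
    Polynomial.prod_comp]
  refine Finset.prod_congr rfl fun γ _ => ?_
  simp only [id, addRightEmbedding_apply, map_add, sub_comp, X_comp, C_comp]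
  ring

theorem exists_rhs_bounds (hkt : 3 ≤ kt) (hδ : 0 < δ) (hδ' : δ < 1 / 10) :
    ∃ C₀ : ℝ≥0, ∀ C, C₀ ≤ C → ∀ k kb : ℕ, 4 ≤ kb → max (max (kt + 4) (kc + 6)) (kb + 5) ≤ k →
      4 ≤ kc → ∀ T : ℝ≥0∞, ∀ f : ℝ × ℝ × ℝ → ℝ, rhsNorm T k kt kc kb δ f < ⊤ →
        ∃ f1 f2 : ℝ → ℝ → ℝ,
          HasExpansionT T f ![1, 2] ![f1, f2] (2 + δ) (kc + 5) (kc - 2) ∧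
          L2Bound T f1 (C * rhsNorm T k kt kc kb δ f) ∧
          L2Bound T f2 (C * rhsNorm T k kt kc kb δ f) := by
  obtain ⟨β1, β2⟩ := beta_bounds
  have m1 : (1 : ℝ) ∈ roots₁ := mem_map_add_one.2 (mem_roots.2 (by simp))
  have m2 : (2 : ℝ) ∈ roots₁ := mem_map_add_one.2 (mem_roots.2 (by norm_num))
  have hcd : roots₁.card = 7 := by rw [roots₁, Finset.card_map, card_roots]
  obtain ⟨a1, l1⟩ := exists_lintegral_cfT_gT_le roots₁ m1 0 (ρ := 2 + δ) (-δ)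
    (by push_cast; linarith)
  obtain ⟨a2, l2⟩ := exists_lintegral_cfT_gT_le roots₁ m2 0 (ρ := 2 + δ) (-δ)
    (by push_cast; linarith)
  obtain ⟨C₀, hC₀⟩ := exists_forall_le [a1 ^ (1 / 2 : ℝ), a2 ^ (1 / 2 : ℝ)]
  refine ⟨C₀, fun C hC k kb hkb hk hkc T f hfin => ?_⟩
  have hk1 : kc + 6 ≤ k := (le_max_right _ _).trans ((le_max_left _ _).trans hk)
  obtain ⟨S, hS⟩ : ∃ S, S = intNormSq T 0 1 (k - 2) (-δ - 1 / 2) f +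
    intNormSq T 0 (X - Polynomial.C 1) (kt - 2) (-δ + 1 / 2) f +
    intNormSq T 0 ((qt * X).comp (X - Polynomial.C 1)) (kt - 2) (δ + 1 / 2) f +
    intNormSq T 0 ((qt * X).comp (X - Polynomial.C 1)) (kc - 2) (-δ + 3 / 2) f +
    intNormSq T 0 (symb.comp (X - Polynomial.C 1)) (kc - 2) (δ + 3 / 2) f +
    intNormSq T 1 ((qt * X).comp (X - Polynomial.C 1)) (kb - 2) (-δ + 5 / 2) f := ⟨_, rfl⟩
  have hN : rhsNorm T k kt kc kb δ f = S ^ (1 / 2 : ℝ) := by rw [hS, rhsNorm]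
  rw [hN] at hfin ⊢
  have hS' : S < ⊤ := (ENNReal.rpow_lt_top_iff_of_pos (by norm_num)).1 hfin
  have i0 : intNormSq T 0 1 (k - 2) (-δ - 1 / 2) f ≤ S := by
    rw [hS]
    exact le_add_right (le_add_right (le_add_right (le_add_right le_self_add)))
  have i1 : intNormSq T 0 (X - Polynomial.C 1) (kt - 2) (1 - δ - 1 / 2) f ≤ S := by
    rw [hS, show 1 - δ - 1 / 2 = -δ + 1 / 2 by ring]
    exact le_add_right (le_add_right (le_add_right (le_add_right le_add_self)))
  have i5 : intNormSq T 0 (full roots₁) (kc - 2) (2 + δ - 1 / 2) f ≤ S := by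
    rw [hS, full_roots₁, show 2 + δ - 1 / 2 = δ + 3 / 2 by ring]
    exact le_add_right le_add_self
  have hbad : ∀ γ ∈ badRoots.map (addRightEmbedding 1), γ ∈ roots₁ ∧ γ < 1 - δ ∧ γ ≠ 1 ∧
      ∃ c, γ ≠ c ∧ ∀ γ' ∈ roots₁, γ' ≠ γ → γ' ≤ 1 - δ → γ' = 1 ∨ γ' = c := by
    intro γ hγ
    obtain ⟨g1, g2, g3, c, g4, g5⟩ :=
      roots_bad (ρ₁ := -δ) (by linarith) (by linarith) _ (mem_map_add_one.1 hγ)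
    refine ⟨mem_map_add_one.2 g1, by linarith, fun h => g3 (by linarith), c + 1,
      fun h => g4 (by linarith), fun γ' k1 k2 k3 => ?_⟩
    rcases g5 _ (mem_map_add_one.1 k1) (fun h => k2 (by linarith)) (by linarith) with h | h
    · exact Or.inl (by linarith)
    · exact Or.inr (by linarith)
  have E := expData_gT hcd (N := kc - 2) (by omega) (by omega) (i0.trans_lt hS')
    (i1.trans_lt hS') (i5.trans_lt hS')
    (fun γ hγ b h => roots_add_ne (ρ := 1 + δ) 1
      (Or.inl ⟨by push_cast; linarith, by push_cast; linarith⟩) _ (mem_map_add_one.1 hγ) b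
      (by linarith))
    (by linarith) (by linarith) (by linarith) hbad
  have hJ := E.jets
  have hfull : ∫⁻ t in timeO T, sN (2 + δ) (jet (gT T f) (full roots₁) 0) t ≤ S := by
    have h := lintegral_sN_full_le hcd hJ (2 + δ) (j := 0) (b := 0) (by omega)
    rw [pow_zero, mul_one] at h
    exact h.trans i5
  have c1 := l1 T f _ _ S hJ (by omega) (by omega) (by omega) i0 hS'.ne hfull
  have c2 := l2 T f _ _ S hJ (by omega) (by omega) (by omega) i0 hS'.ne hfull
  have hK : ∀ L : ℝ≥0, L ≤ C₀ → L * S ^ (1 / 2 : ℝ) ≤ C * S ^ (1 / 2 : ℝ) := fun L hL => by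
    have := hL.trans hC
    gcongr
  refine ⟨fun t y => cfT roots₁ (gT T f) 0 1 (t, y), fun t y => cfT roots₁ (gT T f) 0 2 (t, y), ?_,
    (l2Bound_of_lintegral (hJ.measurable_cfT roots₁ 0 1) c1).mono (hK _ (hC₀ _ (by simp))),
    (l2Bound_of_lintegral (hJ.measurable_cfT roots₁ 0 2) c2).mono (hK _ (hC₀ _ (by simp)))⟩
  rw [show kc + 5 = kc - 2 + 7 by omega]
  refine E.hasExpansionT _ (fun i j h => by fin_cases i <;> fin_cases j <;> simp at h ⊢)
    (Fin.forall_fin_two.2 ⟨m1, m2⟩) (fun γ hγ hb hlt => ?_) _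
    (Fin.forall_fin_two.2 ⟨Eventually.of_forall fun t => Eventually.of_forall fun y => rfl,
      Eventually.of_forall fun t => Eventually.of_forall fun y => rfl⟩)
  rcases mem_roots.1 (mem_map_add_one.1 hγ) with h | h | h | h | h | h
  · exact ⟨0, show (1 : ℝ) = γ by linarith⟩
  · exact ⟨1, show (2 : ℝ) = γ by linarith⟩
  · linarith
  · linarith
  · linarith
  · exact absurd (mem_map_add_one.2 (mem_badRoots.2 h)) hb

end Cases

end

end

end ThinFilm

theorem mainTheorem5 (kt kc : ℕ) (δ : ℝ) (hkt : 3 ≤ kt) (hkc : 4 ≤ kc) (hδ : 0 < δ)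
    (hδ' : δ < 1 / 10) :
    ∃ C : ℝ≥0, ∀ k kb : ℕ, 4 ≤ kb → max (max (kt + 4) (kc + 6)) (kb + 5) ≤ k →
      -- initial data
      (∀ v : ℝ × ℝ → ℝ, LocallyIntegrableOn v plane.dom → initNorm k kt kc kb δ v < ⊤ →
        ∃ v0 v1 : ℝ → ℝ,
          HasExpansion v ![0, 1] ![v0, v1] (3 / 2 + δ) (kc + 7) kc ∧
          (∀ a b : ℕ, a + b ≤ min (kt - 2) (kc - 2) →
            (∃ G, IsWeak plane (fun φ => pdT plane.ex (powT plane a b φ)) v G ∧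
              BCBound plane.dom G (C * initNorm k kt kc kb δ v)) ∧
            (∃ G, IsWeak plane (fun φ => pdT plane.ey (powT plane a b φ)) v G ∧
              BCBound plane.dom G (C * initNorm k kt kc kb δ v))) ∧
          (∃ B : BC1, RepBC1 B v0 ∧ ‖B‖ₑ ≤ C * initNorm k kt kc kb δ v) ∧
          BCBound univ v1 (C * initNorm k kt kc kb δ v)) ∧
      ∀ T : ℝ≥0∞, 0 < T →
        -- solutions
        (∀ v : ℝ × ℝ × ℝ → ℝ, LocallyIntegrableOn v (spaceTime T).dom →
          solNorm T k kt kc kb δ v < ⊤ →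
          ∃ v0 v1 vβ v2 : ℝ → ℝ → ℝ,
            HasExpansionT T v ![0, 1, 1 + β, 2] ![v0, v1, vβ, v2] (2 + δ) (kc + 9) (kc + 2) ∧
            (∀ a b : ℕ, a + b ≤ min (kt - 2) (kc - 2) →
              (∃ G, IsWeak (spaceTime T)
                  (fun φ => pdT (spaceTime T).ex (powT (spaceTime T) a b φ)) v G ∧
                BCBound {p | p.1 ∈ timeI T ∧ 0 < p.2.1} G (C * solNorm T k kt kc kb δ v)) ∧
              (∃ G, IsWeak (spaceTime T)
                  (fun φ => pdT (spaceTime T).ey (powT (spaceTime T) a b φ)) v G ∧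
                BCBound {p | p.1 ∈ timeI T ∧ 0 < p.2.1} G (C * solNorm T k kt kc kb δ v))) ∧
            BCInto RepBC1 T v0 (C * solNorm T k kt kc kb δ v) ∧
            BCBound (timeI T ×ˢ univ) (fun s : ℝ × ℝ => v1 s.1 s.2)
              (C * solNorm T k kt kc kb δ v) ∧
            L2Into RepH1 T v1 (C * solNorm T k kt kc kb δ v) ∧
            L2Into RepH1 T (fun t => deriv (v0 t)) (C * solNorm T k kt kc kb δ v) ∧
            BCInto RepH1 T v1 (C * solNorm T k kt kc kb δ v) ∧
            BCInto RepH1 T (fun t => deriv (v0 t)) (C * solNorm T k kt kc kb δ v) ∧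
            L2Into RepBC0 T vβ (C * solNorm T k kt kc kb δ v) ∧
            L2Into RepH1 T vβ (C * solNorm T k kt kc kb δ v) ∧
            L2Bound T v2 (C * solNorm T k kt kc kb δ v)) ∧
        -- right-hand sides
        (∀ f : ℝ × ℝ × ℝ → ℝ, LocallyIntegrableOn f (spaceTime T).dom →
          rhsNorm T k kt kc kb δ f < ⊤ →
          ∃ f1 f2 : ℝ → ℝ → ℝ,
            HasExpansionT T f ![1, 2] ![f1, f2] (2 + δ) (kc + 5) (kc - 2) ∧
            L2Bound T f1 (C * rhsNorm T k kt kc kb δ f) ∧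
            L2Bound T f2 (C * rhsNorm T k kt kc kb δ f)) := by
  obtain ⟨C₁, h₁⟩ := exists_init_bounds hkt hkc hδ hδ'
  obtain ⟨C₂, h₂⟩ := exists_sol_bounds hkt hkc hδ hδ'
  obtain ⟨C₃, h₃⟩ := exists_rhs_bounds (kc := kc) hkt hδ hδ'
  refine ⟨max C₁ (max C₂ C₃), fun k kb hkb hk => ⟨h₁ _ (le_max_left _ _) k kb hkb hk,
    fun T hT => ⟨h₂ _ (le_max_of_le_right (le_max_left _ _)) k kb hkb hk T hT,
      fun f _ => h₃ _ (le_max_of_le_right (le_max_right _ _)) k kb hkb hk hkc T f⟩⟩⟩
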